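/- **Setting.** Let $\mathcal V$ be a symmetric monoidal category such that the forgetful functor from $\mathcal V$-categories to categories is faithful; $\mathcal V\text{-}\mathbf{Cat}$ carries the tensor product of $\mathcal V$-categories. Let $\mathbb I$ be a $\mathcal V$-enriched strict monoidal category with product $\circledast$ and unit $1$, and let $\mathfrak M$ be a $\mathcal V\text{-}\mathbf{Cat}$-category; $[A,B]$ denotes its hom-$\mathcal V$-categories. *Actions.* An $\mathbb I$-action on $A\in\mathfrak M$ is a $\mathcal V\text{-}\mathbf{Cat}$-functor $\alpha:\mathbf B\mathbb I\times\mathbf B\mathbb I^{op}\to\mathfrak M$ with value $A$ at the only object. Put $L_u=\alpha(u,1)$ and $R_u=\alpha(1,u)$, so that $L_{u\circledast v}=L_uL_v$, $R_{u\circledast v}=R_vR_u$ and $L_uR_v=R_vL_u$ strictly. The action is a *left* (*right*) action if all $R_u$ (all $L_u$), and their 2-cells, are identities. The objects of $\mathbb I\mathfrak M$ are the pairs $A_\alpha$ where $\alpha$ is a left action or a right action. An $\mathbb I$-equivariant morphism $A_\alpha\to B_\beta$ is a 1-cell $f:A\to B$ with invertible 2-cells $\tau(u):R^\beta_u\,f\,L^\alpha_u\cong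 L^\beta_u\,f\,R^\alpha_u$, natural in $u\in\mathbb I$, with $\tau(1)=\mathrm{id}$ and $\tau(u\circledast v)=(L^\beta_u\,\tau(v)\,R^\alpha_u)\circ(R^\beta_v\,\tau(u)\,L^\alpha_v)$; a 2-cell $(f,\tau)\Rightarrow(f',\tau')$ is a 2-cell $f\Rightarrow f'$ compatible with $\tau,\tau'$. They form a $\mathcal V$-category $\mathrm{Fun}_{\mathbb I}(A_\alpha,B_\beta)$. To compose $(f,\tau):A\to B$ and $(g,\tau'):B\to C$, paste their 2-cells along the trivial side of $B$: first $\tau$, then $\tau'$ when $B$ is a left action; first $\tau'$, then $\tau$ when $B$ is a right action. An object of $\mathbb I\mathfrak M$ is *stable* if it is a left action that is 1-equivalent in $\mathbb I\mathfrak M$ to a right action, or a right action that is 1-equivalent in $\mathbb I\mathfrak M$ to a left action. *Coinvariants.* Let $\mathfrak M$ be weakly copowered by $\mathbb I$: each $A$ has an object $\mathbb I\odot A$ with a $\mathcal V$-functor $\iota:\mathbb I\to[A,\mathbb I\odot A]$ such that restriction along $\iota$ is an equivalence of $\mathcal V$-categories from $[\mathbb I\odot A,Z]$ to the $\mathcal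 V$-category of $\mathcal V$-functors $\mathbb I\to[A,Z]$, for all $Z$. The construction is strictly functorial, on 1-cells and 2-cells, in the two-sided multiplications of $\mathbb I$ and in $A$: for $a,b\in\mathbb I$ and $g:A\to B$ there is $(a\circledast-\circledast b)\odot g:\mathbb I\odot A\to\mathbb I\odot B$, for which $\iota$ is pseudonatural, coherently. For $A_\alpha$ in $\mathbb I\mathfrak M$ and $s\in\{l,r\}$ consider the following commuting actions on $\mathbb I\odot A$: $$\lambda_u=\mathrm{id}\odot L_u,\quad \rho_u=(-\circledast u)\odot R_u,\quad \omega_x=(x\circledast-)\odot\mathrm{id}\qquad(s=r),$$ $$\lambda_u=(u\circledast-)\odot L_u,\quad \rho_u=\mathrm{id}\odot R_u,\quad \omega_x=(-\circledast x)\odot\mathrm{id}\qquad(s=l).$$ Let $\mathrm{coInv}_s(A_\alpha)$ be the weak coend of $\lambda,\rho$: the universal object $Z$ with a 1-cell $\pi:\mathbb I\odot A\to Z$ and invertible 2-cells $\sigma(u):\pi\lambda_u\cong\pi\rho_u$, natural in $u$ and compatible with $1$ and $\circledast$, where universal means that postcomposition gives an equivalence of $\mathcal V$-categories from $[Z,Z']$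 to the $\mathcal V$-category of such cowedges with vertex $Z'$, for all $Z'$. It carries an action induced by $\omega$ (that is, $\pi$ is pseudonaturally and coherently equivariant for $\omega$, compatibly with $\sigma$), a left action for $s=r$ and a right action for $s=l$. Assume that $\mathrm{coInv}_s(B_\beta)$ exists for every $s$ and every object $B_\beta$ of $\mathbb I\mathfrak M$. The composite of $\iota(1):A\to\mathbb I\odot A$ and $\pi$, with the 2-cells induced by $\sigma$, is an $\mathbb I$-equivariant morphism $\eta_s:A_\alpha\to\mathrm{coInv}_s(A_\alpha)$. Put $\mathrm{coInv}_{\mathbb I}=\mathrm{coInv}_l\circ\mathrm{coInv}_r$, $\eta=\eta_l\circ\eta_r$, $\mathrm{coInv}^1_{\mathbb I}(A_\alpha)=\mathrm{coInv}_l(A_\alpha)$ and $\mathrm{coInv}^{n}_{\mathbb I}(A_\alpha)=\mathrm{coInv}_{\mathbb I}(\mathrm{coInv}^{n-1}_{\mathbb I}(A_\alpha))$ for $n>1$. Let $\mathrm{coInv}^\infty_{\mathbb I}(A_\alpha)$ be a weak colimit of the sequence of right actions and $\mathbb I$-equivariant morphisms $$\mathrm{coInv}^1_{\mathbb I}(A_\alpha)\xrightarrow{\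 \eta\ }\mathrm{coInv}^2_{\mathbb I}(A_\alpha)\xrightarrow{\ \eta\ }\mathrm{coInv}^3_{\mathbb I}(A_\alpha)\to\cdots,$$ computed in $\mathfrak M$: a right action with a weak cocone of $\mathbb I$-equivariant morphisms whose underlying weak cocone in $\mathfrak M$ is a weak colimit. Let $\eta^\infty:A_\alpha\to\mathrm{coInv}^\infty_{\mathbb I}(A_\alpha)$ be $\eta_l$ followed by the structure morphism of $\mathrm{coInv}^1_{\mathbb I}(A_\alpha)$. **Theorem.** Let $A_\alpha$ be an object of $\mathbb I\mathfrak M$ such that $\mathrm{coInv}^\infty_{\mathbb I}(A_\alpha)$ exists. Then $\mathrm{coInv}^\infty_{\mathbb I}(A_\alpha)$, with $\eta^\infty$, is a costabilization of $A_\alpha$; that is, $\mathrm{coInv}^\infty_{\mathbb I}(A_\alpha)$ is stable, and for every stable object $B_\beta$ of $\mathbb I\mathfrak M$ precomposition with $\eta^\infty$, $$(\eta^\infty)^*:\mathrm{Fun}_{\mathbb I}(\mathrm{coInv}^\infty_{\mathbb I}(A_\alpha),B_\beta)\longrightarrow\mathrm{Fun}_{\mathbb I}(A_\alpha,B_\beta),$$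 is an equivalence of $\mathcal V$-categories. -/

import Mathlib

open CategoryTheory

universe uV vV uI wI uM vM wM uC vC uD vD

set_option linter.unusedSimpArgs false
set_option linter.unusedSectionVars false

namespace CoStab

infixr:70 " ⊛ " => MonoidalCategoryStruct.tensorObj
infixr:70 " ⊛ₘ " => MonoidalCategoryStruct.tensorHom
notation "e[" I "]" => MonoidalCategoryStruct.tensorUnit I

section Enrichment

open MonoidalCategory

/-- A strict monoidal category: the associators and unitors are identities. -/
class StrictMonoidal (I : Type uI) [Category.{wI} I] [MonoidalCategory I] : Prop where
  tensor_assoc (u v w : I) : (u ⊗ v) ⊗ w = u ⊗ (v ⊗ w)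
  one_tensor (u : I) : 𝟙_ I ⊗ u = u
  tensor_one (u : I) : u ⊗ 𝟙_ I = u
  associator_eq (u v w : I) : (α_ u v w).hom = eqToHom (tensor_assoc u v w)
  leftUnitor_eq (u : I) : (λ_ u).hom = eqToHom (one_tensor u)
  rightUnitor_eq (u : I) : (ρ_ u).hom = eqToHom (tensor_one u)

variable (V : Type uV) [Category.{vV} V] [MonoidalCategory V]

/-- The forgetful functor from `V`-categories to categories is faithful: `V`-functors with the same
underlying functor are equal. -/
def ForgetFaithful : Prop :=
  ∀ (C : Type uC) [EnrichedCategory V C] (D : Type uD) [EnrichedCategory V D]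
    (F G : EnrichedFunctor V C D), F.forget = G.forget → F = G

variable {C : Type uC} [Category.{vC} C] [EnrichedOrdinaryCategory V C]
variable {D : Type uD} [Category.{vD} D] [EnrichedOrdinaryCategory V D]

/-- The functor between underlying categories of a `V`-functor. -/
def underlying (F : EnrichedFunctor V C D) : C ⥤ D where
  obj := F.obj
  map {x y} f := (eHomEquiv V).symm (eHomEquiv V f ≫ F.map x y)
  map_id x := by simp [Equiv.symm_apply_eq]
  map_comp f g := by
    rw [Equiv.symm_apply_eq]
    simp [eHomEquiv_comp, tensorHom_comp_tensorHom_assoc]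

variable {V}

/-- The square `σ' ∘ t = t' ∘ σ` of `T`-indexed families of morphisms. -/
def VSquare {p p' q q' : C} (σ : p ≅ p') (σ' : q ≅ q') {T : V}
    (t : T ⟶ (p ⟶[V] q)) (t' : T ⟶ (p' ⟶[V] q')) : Prop :=
  t ≫ eHomWhiskerLeft V p σ'.hom = t' ≫ eHomWhiskerRight V σ.hom q'

variable (V) in
/-- `V`-enriched (strict) monoidal categories: the tensor product is a `V`-functor `I ⊗ I → I` with
the given underlying functor, associative and unital as a `V`-functor. -/
class MonoidalEnriched [BraidedCategory V] (I : Type uI) [Category.{wI} I] [MonoidalCategory I]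
    [EnrichedOrdinaryCategory V I] where
  hom (u u' v v' : I) : (u ⟶[V] u') ⊗ (v ⟶[V] v') ⟶ ((u ⊗ v) ⟶[V] (u' ⊗ v'))
  hom_underlying {u u' v v' : I} (f : u ⟶ u') (g : v ⟶ v') :
    (λ_ (𝟙_ V)).inv ≫ (eHomEquiv V f ⊗ₘ eHomEquiv V g) ≫ hom u u' v v' = eHomEquiv V (f ⊗ₘ g)
  hom_comp (u u' u'' v v' v'' : I) :
    tensorμ (u ⟶[V] u') (v ⟶[V] v') (u' ⟶[V] u'') (v' ⟶[V] v'') ≫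
        (eComp V u u' u'' ⊗ₘ eComp V v v' v'') ≫ hom u u'' v v'' =
      (hom u u' v v' ⊗ₘ hom u' u'' v' v'') ≫ eComp V _ _ _
  hom_assoc (u u' v v' w w' : I) :
    (hom u u' v v' ⊗ₘ 𝟙 (w ⟶[V] w')) ≫ hom _ _ w w' ≫
        eHomWhiskerRight V (α_ u v w).inv _ ≫ eHomWhiskerLeft V _ (α_ u' v' w').hom =
      (α_ _ _ _).hom ≫ (𝟙 (u ⟶[V] u') ⊗ₘ hom v v' w w') ≫ hom u u' _ _
  one_hom (u u' : I) :
    (λ_ (u ⟶[V] u')).inv ≫ (eId V (𝟙_ I) ⊗ₘ 𝟙 (u ⟶[V] u')) ≫ hom _ _ u u' =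
      eHomWhiskerRight V (λ_ u).hom _ ≫ eHomWhiskerLeft V _ (λ_ u').inv
  hom_one (u u' : I) :
    (ρ_ (u ⟶[V] u')).inv ≫ (𝟙 (u ⟶[V] u') ⊗ₘ eId V (𝟙_ I)) ≫ hom u u' _ _ =
      eHomWhiskerRight V (ρ_ u).hom _ ≫ eHomWhiskerLeft V _ (ρ_ u').inv

variable (V) in
/-- `V-Cat`-enriched categories: a strict 2-category whose hom-categories are `V`-categories and
whose composition is given by `V`-functors `[A, B] ⊗ [B, C] → [A, C]`, associative and unital. -/
class VCatCategory [BraidedCategory V] (M : Type uM) [Bicategory.{wM, vM} M] [Bicategory.Strict M]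
    [∀ A B : M, EnrichedOrdinaryCategory V (A ⟶ B)] where
  hcomp {A B C : M} (f f' : A ⟶ B) (g g' : B ⟶ C) :
    (f ⟶[V] f') ⊗ (g ⟶[V] g') ⟶ ((f ≫ g) ⟶[V] (f' ≫ g'))
  hcomp_underlying {A B C : M} {f f' : A ⟶ B} {g g' : B ⟶ C} (φ : f ⟶ f') (ψ : g ⟶ g') :
    (λ_ (𝟙_ V)).inv ≫ (eHomEquiv V φ ⊗ₘ eHomEquiv V ψ) ≫ hcomp f f' g g' =
      eHomEquiv V (Bicategory.whiskerRight φ g ≫ Bicategory.whiskerLeft f' ψ)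
  hcomp_comp {A B C : M} (f f' f'' : A ⟶ B) (g g' g'' : B ⟶ C) :
    tensorμ (f ⟶[V] f') (g ⟶[V] g') (f' ⟶[V] f'') (g' ⟶[V] g'') ≫
        (eComp V f f' f'' ⊗ₘ eComp V g g' g'') ≫ hcomp f f'' g g'' =
      (hcomp f f' g g' ⊗ₘ hcomp f' f'' g' g'') ≫ eComp V _ _ _
  hcomp_assoc {A B C D : M} (f f' : A ⟶ B) (g g' : B ⟶ C) (h h' : C ⟶ D) :
    (hcomp f f' g g' ⊗ₘ 𝟙 (h ⟶[V] h')) ≫ hcomp _ _ h h' ≫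
        eHomWhiskerRight V (Bicategory.associator f g h).inv _ ≫
        eHomWhiskerLeft V _ (Bicategory.associator f' g' h').hom =
      (α_ _ _ _).hom ≫ (𝟙 (f ⟶[V] f') ⊗ₘ hcomp g g' h h') ≫ hcomp f f' _ _
  id_hcomp {A B : M} (f f' : A ⟶ B) :
    (λ_ (f ⟶[V] f')).inv ≫ (eId V (𝟙 A) ⊗ₘ 𝟙 (f ⟶[V] f')) ≫ hcomp _ _ f f' =
      eHomWhiskerRight V (Bicategory.leftUnitor f).hom _ ≫
        eHomWhiskerLeft V _ (Bicategory.leftUnitor f').inv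
  hcomp_id {A B : M} (f f' : A ⟶ B) :
    (ρ_ (f ⟶[V] f')).inv ≫ (𝟙 (f ⟶[V] f') ⊗ₘ eId V (𝟙 B)) ≫ hcomp f f' _ _ =
      eHomWhiskerRight V (Bicategory.rightUnitor f).hom _ ≫
        eHomWhiskerLeft V _ (Bicategory.rightUnitor f').inv

variable [BraidedCategory V] {M : Type uM} [Bicategory.{wM, vM} M] [Bicategory.Strict M]
  [∀ A B : M, EnrichedOrdinaryCategory V (A ⟶ B)] [VCatCategory V M]

/-- The `T`-indexed family `f ◁ t`. -/
def famWhiskerLeft {T : V} {A B C : M} (f : A ⟶ B) {g h : B ⟶ C} (t : T ⟶ (g ⟶[V] h)) :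
    T ⟶ ((f ≫ g) ⟶[V] (f ≫ h)) :=
  (λ_ T).inv ≫ (eId V f ⊗ₘ t) ≫ VCatCategory.hcomp f f g h

/-- The `T`-indexed family `t ▷ h`. -/
def famWhiskerRight {T : V} {A B C : M} {f g : A ⟶ B} (t : T ⟶ (f ⟶[V] g)) (h : B ⟶ C) :
    T ⟶ ((f ≫ h) ⟶[V] (g ≫ h)) :=
  (ρ_ T).inv ≫ (t ⊗ₘ eId V h) ≫ VCatCategory.hcomp f g h h

variable {I : Type uI} [Category.{wI} I] [MonoidalCategory I] [EnrichedOrdinaryCategory V I]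

/-- `F` is the underlying functor of a `V`-functor `I → [A, A]` that is strictly multiplicative,
`F (u ⊗ v) = F v ≫ F u`, also on `V`-valued homs: the restriction of a left action. -/
def IsVLeftAction [MonoidalEnriched V I] {A : M} (F : I ⥤ (A ⟶ A)) : Prop :=
  ∃ (G : EnrichedFunctor V I (A ⟶ A)) (h : ∀ u v, G.obj (u ⊗ v) = G.obj v ≫ G.obj u),
    underlying V G = F ∧ ∀ u u' v v' : I,
      MonoidalEnriched.hom u u' v v' ≫ G.map (u ⊗ v) (u' ⊗ v') ≫
          eHomWhiskerLeft V _ (eqToHom (h u' v')) =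
        (G.map u u' ⊗ₘ G.map v v') ≫ (β_ _ _).hom ≫ VCatCategory.hcomp _ _ _ _ ≫
          eHomWhiskerRight V (eqToHom (h u v)) _

/-- `F` is the underlying functor of a `V`-functor `I → [A, A]` that is strictly multiplicative,
`F (u ⊗ v) = F u ≫ F v`, also on `V`-valued homs: the restriction of a right action. -/
def IsVRightAction [MonoidalEnriched V I] {A : M} (F : I ⥤ (A ⟶ A)) : Prop :=
  ∃ (G : EnrichedFunctor V I (A ⟶ A)) (h : ∀ u v, G.obj (u ⊗ v) = G.obj u ≫ G.obj v),
    underlying V G = F ∧ ∀ u u' v v' : I,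
      MonoidalEnriched.hom u u' v v' ≫ G.map (u ⊗ v) (u' ⊗ v') ≫
          eHomWhiskerLeft V _ (eqToHom (h u' v')) =
        (G.map u u' ⊗ₘ G.map v v') ≫ VCatCategory.hcomp _ _ _ _ ≫
          eHomWhiskerRight V (eqToHom (h u v)) _

variable (V) in
/-- The `V`-functor `u : I → [A, O]` exhibits `O` as a weak copower of `A` by the `V`-category `I`:
for all `Z`, precomposition with `u` is an equivalence of `V`-categories from `[O, Z]` to the
`V`-category of `V`-functors `I → [A, Z]`. A morphism of `V`-functors `F → G` indexed by `T : V` is a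
family of `T ⟶ (F i ⟶[V] G i)` that is `V`-natural in `i`; full faithfulness says that these families
are represented by `(k ⟶[V] k')`. -/
structure IsWeakCopower {A O : M} (u : EnrichedFunctor V I (A ⟶ O)) : Prop where
  ess_surj {Z : M} (H : EnrichedFunctor V I (A ⟶ Z)) :
    ∃ (k : O ⟶ Z) (φ : ∀ i, u.obj i ≫ k ≅ H.obj i),
      ∀ i j : I, VSquare (φ i) (φ j) (famWhiskerRight (u.map i j) k) (H.map i j)
  fully_faithful {Z : M} (k k' : O ⟶ Z) (T : V) (s : ∀ i : I, T ⟶ ((u.obj i ≫ k) ⟶[V] (u.obj i ≫ k')))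
    (hs : ∀ i j : I,
      (β_ T (i ⟶[V] j)).hom ≫ (famWhiskerRight (u.map i j) k ⊗ₘ s j) ≫ eComp V _ _ _ =
        (s i ⊗ₘ famWhiskerRight (u.map i j) k') ≫ eComp V _ _ _) :
    ∃! t : T ⟶ (k ⟶[V] k'), ∀ i, famWhiskerLeft (u.obj i) t = s i

end Enrichment

section Actions
open Bicategory

variable {V : Type uV} [Category.{vV} V] [MonoidalCategory V] [BraidedCategory V]
variable {I : Type uI} [Category.{wI} I] [MonoidalCategory I] [EnrichedOrdinaryCategory V I]
  [MonoidalEnriched V I]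
variable {M : Type uM} [Bicategory.{wM, vM} M] [Bicategory.Strict M]
  [∀ A B : M, EnrichedOrdinaryCategory V (A ⟶ B)] [VCatCategory V M]

/-- A strict biaction of `I` on `A`: a left action `L`, `L (u ⊛ v) = L u ∘ L v`, and a right action `R`,
`R (u ⊛ v) = R v ∘ R u`, that commute strictly with each other, on objects and on morphisms. These are the
strict 2-functors `BI × BI^op → M` with value `A` at the only object, with `L u` the value at `(u, 1)` and
`R u` the value at `(1, u)`. -/
structure IsStrictAction {A : M} (L R : I ⥤ (A ⟶ A)) : Prop where
  L_one : L.obj (e[I]) = 𝟙 A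
  R_one : R.obj (e[I]) = 𝟙 A
  L_mul (u v : I) : L.obj (u ⊛ v) = L.obj v ≫ L.obj u
  R_mul (u v : I) : R.obj (u ⊛ v) = R.obj u ≫ R.obj v
  comm (u v : I) : L.obj u ≫ R.obj v = R.obj v ≫ L.obj u
  L_mul_map {u u' v v' : I} (f : u ⟶ u') (g : v ⟶ v') :
    L.map (f ⊛ₘ g) ≫ eqToHom (L_mul u' v') =
      eqToHom (L_mul u v) ≫ (L.map g ▷ L.obj u) ≫ (L.obj v' ◁ L.map f)
  R_mul_map {u u' v v' : I} (f : u ⟶ u') (g : v ⟶ v') :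
    R.map (f ⊛ₘ g) ≫ eqToHom (R_mul u' v') =
      eqToHom (R_mul u v) ≫ (R.map f ▷ R.obj v) ≫ (R.obj u' ◁ R.map g)
  comm_map {u u' v v' : I} (f : u ⟶ u') (g : v ⟶ v') :
    (L.map f ▷ R.obj v) ≫ (L.obj u' ◁ R.map g) ≫ eqToHom (comm u' v') =
      eqToHom (comm u v) ≫ (R.map g ▷ L.obj u) ≫ (R.obj v' ◁ L.map f)

/-- The action `F` is trivial (mute). -/
structure IsTrivial {A : M} (F : I ⥤ (A ⟶ A)) : Prop where
  obj_eq (u : I) : F.obj u = 𝟙 A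
  map_eq {u v : I} (f : u ⟶ v) : F.map f = eqToHom ((obj_eq u).trans (obj_eq v).symm)

variable (V I M) in
/-- The objects of the 2-category of 𝕀-objects: objects of `M` with a strict `V`-biaction that is mute on
at least one side. A left action has trivial `R`, a right action has trivial `L`. -/
structure IObj where
  carrier : M
  L : I ⥤ (carrier ⟶ carrier)
  R : I ⥤ (carrier ⟶ carrier)
  strict : IsStrictAction L R
  mute : (IsTrivial R ∧ IsVLeftAction (V := V) L) ∨ (IsTrivial L ∧ IsVRightAction (V := V) R)

theorem IObj.trivial_of_not (X : IObj V I M) (h : ¬ IsTrivial X.R) : IsTrivial X.L := by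
  rcases X.mute with h' | h'
  · exact absurd h'.1 h
  · exact h'.1

/-- 𝕀-equivariant morphisms: a 1-cell `hom` with natural invertible 2-cells
`R_Y u ∘ hom ∘ L_X u ≅ L_Y u ∘ hom ∘ R_X u` that are compatible with the unit and the product of `I`. -/
structure Equivariant (X Y : IObj V I M) where
  hom : X.carrier ⟶ Y.carrier
  τ (u : I) : X.L.obj u ≫ hom ≫ Y.R.obj u ≅ X.R.obj u ≫ hom ≫ Y.L.obj u
  natural {u v : I} (f : u ⟶ v) :
    (X.L.map f ▷ (hom ≫ Y.R.obj u)) ≫ (X.L.obj v ◁ hom ◁ Y.R.map f) ≫ (τ v).hom =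
      (τ u).hom ≫ (X.R.map f ▷ (hom ≫ Y.L.obj u)) ≫ (X.R.obj v ◁ hom ◁ Y.L.map f)
  one : (τ (e[I])).hom = eqToHom (by
    simp only [X.strict.L_one, X.strict.R_one, Y.strict.L_one, Y.strict.R_one])
  mul (u v : I) : (τ (u ⊛ v)).hom =
    eqToHom (by simp only [X.strict.L_mul, Y.strict.R_mul, Strict.assoc]) ≫
    (X.L.obj v ◁ (τ u).hom ▷ Y.R.obj v) ≫
    eqToHom (by
      simp only [Strict.assoc, ← Y.strict.comm]
      simp only [← Strict.assoc, ← X.strict.comm]) ≫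
    (X.R.obj u ◁ (τ v).hom ▷ Y.L.obj u) ≫
    eqToHom (by simp only [X.strict.R_mul, Y.strict.L_mul, Strict.assoc])

theorem leftUnitor_hom {A B : M} (f : A ⟶ B) : (λ_ f).hom = eqToHom (Strict.id_comp f) := by
  rw [Strict.leftUnitor_eqToIso]; rfl
theorem leftUnitor_inv {A B : M} (f : A ⟶ B) : (λ_ f).inv = eqToHom (Strict.id_comp f).symm := by
  rw [Strict.leftUnitor_eqToIso]; rfl
theorem rightUnitor_hom {A B : M} (f : A ⟶ B) : (ρ_ f).hom = eqToHom (Strict.comp_id f) := by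
  rw [Strict.rightUnitor_eqToIso]; rfl
theorem rightUnitor_inv {A B : M} (f : A ⟶ B) : (ρ_ f).inv = eqToHom (Strict.comp_id f).symm := by
  rw [Strict.rightUnitor_eqToIso]; rfl
theorem associator_hom {A B C D : M} (f : A ⟶ B) (g : B ⟶ C) (h : C ⟶ D) :
    (α_ f g h).hom = eqToHom (Strict.assoc f g h) := by
  rw [Strict.associator_eqToIso]; rfl
theorem associator_inv {A B C D : M} (f : A ⟶ B) (g : B ⟶ C) (h : C ⟶ D) :
    (α_ f g h).inv = eqToHom (Strict.assoc f g h).symm := by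
  rw [Strict.associator_eqToIso]; rfl


namespace Equivariant
theorem swapR {A B C C' D : M} {f g : A ⟶ B} (η : f ⟶ g) {a : B ⟶ C} {b : C ⟶ D}
    {c : B ⟶ C'} {d : C' ⟶ D} (p : a ≫ b = c ≫ d) :
    η ▷ a ▷ b = eqToHom (by simp only [Strict.assoc, p]) ≫ η ▷ c ▷ d ≫
      eqToHom (by simp only [Strict.assoc, p]) := by
  have h : ∀ {E : M} (x : B ⟶ E) (y : E ⟶ D), η ▷ x ▷ y =
      eqToHom (Strict.assoc _ _ _) ≫ η ▷ (x ≫ y) ≫ eqToHom (Strict.assoc _ _ _).symm := by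
    intro E x y; simp only [Category.assoc, eqToHom_trans, eqToHom_trans_assoc, eqToHom_refl, Category.id_comp, Category.comp_id,
    Bicategory.whiskerLeft_comp, Bicategory.comp_whiskerRight, whiskerLeft_eqToHom, Bicategory.whiskerLeft_id, Bicategory.id_whiskerRight,
    eqToHom_whiskerRight, Bicategory.comp_whiskerLeft, Bicategory.whiskerRight_comp,
    Bicategory.whisker_assoc, Bicategory.id_whiskerLeft, Bicategory.whiskerRight_id,
    leftUnitor_hom, leftUnitor_inv, associator_hom, associator_inv, rightUnitor_hom,
    rightUnitor_inv, Iso.trans_hom, eqToIso.hom, whiskerRightIso_hom, whiskerLeftIso_hom]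
  rw [h, h, whiskerRight_congr p]
  simp only [Category.assoc, eqToHom_trans, eqToHom_trans_assoc, eqToHom_refl, Category.id_comp, Category.comp_id,
    Bicategory.whiskerLeft_comp, Bicategory.comp_whiskerRight, whiskerLeft_eqToHom, Bicategory.whiskerLeft_id, Bicategory.id_whiskerRight,
    eqToHom_whiskerRight, Bicategory.comp_whiskerLeft, Bicategory.whiskerRight_comp,
    Bicategory.whisker_assoc, Bicategory.id_whiskerLeft, Bicategory.whiskerRight_id,
    leftUnitor_hom, leftUnitor_inv, associator_hom, associator_inv, rightUnitor_hom,
    rightUnitor_inv, Iso.trans_hom, eqToIso.hom, whiskerRightIso_hom, whiskerLeftIso_hom]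

theorem swapL {A B C C' D : M} {f g : C ⟶ D} (η : f ⟶ g) {a : A ⟶ B} {b : B ⟶ C}
    {c : A ⟶ C'} {d : C' ⟶ C} (p : a ≫ b = c ≫ d) :
    a ◁ b ◁ η = eqToHom (by simp only [← Strict.assoc, p]) ≫ c ◁ d ◁ η ≫
      eqToHom (by simp only [← Strict.assoc, p]) := by
  have h : ∀ {E : M} (x : A ⟶ E) (y : E ⟶ C), x ◁ y ◁ η =
      eqToHom (Strict.assoc _ _ _).symm ≫ (x ≫ y) ◁ η ≫ eqToHom (Strict.assoc _ _ _) := by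
    intro E x y; simp only [Category.assoc, eqToHom_trans, eqToHom_trans_assoc, eqToHom_refl, Category.id_comp, Category.comp_id,
    Bicategory.whiskerLeft_comp, Bicategory.comp_whiskerRight, whiskerLeft_eqToHom, Bicategory.whiskerLeft_id, Bicategory.id_whiskerRight,
    eqToHom_whiskerRight, Bicategory.comp_whiskerLeft, Bicategory.whiskerRight_comp,
    Bicategory.whisker_assoc, Bicategory.id_whiskerLeft, Bicategory.whiskerRight_id,
    leftUnitor_hom, leftUnitor_inv, associator_hom, associator_inv, rightUnitor_hom,
    rightUnitor_inv, Iso.trans_hom, eqToIso.hom, whiskerRightIso_hom, whiskerLeftIso_hom]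
  rw [h, h, congr_whiskerLeft p]
  simp only [Category.assoc, eqToHom_trans, eqToHom_trans_assoc, eqToHom_refl, Category.id_comp, Category.comp_id,
    Bicategory.whiskerLeft_comp, Bicategory.comp_whiskerRight, whiskerLeft_eqToHom, Bicategory.whiskerLeft_id, Bicategory.id_whiskerRight,
    eqToHom_whiskerRight, Bicategory.comp_whiskerLeft, Bicategory.whiskerRight_comp,
    Bicategory.whisker_assoc, Bicategory.id_whiskerLeft, Bicategory.whiskerRight_id,
    leftUnitor_hom, leftUnitor_inv, associator_hom, associator_inv, rightUnitor_hom,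
    rightUnitor_inv, Iso.trans_hom, eqToIso.hom, whiskerRightIso_hom, whiskerLeftIso_hom]

theorem hom_eq_eqToHom {A B : M} {a b : A ⟶ B} {i : a ≅ b} {h : a = b}
    (e : i.inv = eqToHom h.symm) : i.hom = eqToHom h :=
  (Iso.inv_eq_inv i (eqToIso h)).mp (by rw [e]; simp)

theorem inv_eq_eqToHom {A B : M} {a b : A ⟶ B} {i : a ≅ b} {h : a = b}
    (e : i.hom = eqToHom h) : i.inv = eqToHom h.symm :=
  (Iso.inv_eq_inv i (eqToIso h)).mpr (by rw [e]; simp)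

theorem symm_nat {A B : M} {a a' b b' c d : A ⟶ B} {t : a ≅ b} {t' : a' ≅ b'} {x : a ⟶ c}
    {x' : c ⟶ a'} {y : b ⟶ d} {y' : d ⟶ b'} (h : x ≫ x' ≫ t'.hom = t.hom ≫ y ≫ y') :
    y ≫ y' ≫ t'.symm.hom = t.symm.hom ≫ x ≫ x' := by
  rw [Iso.symm_hom, Iso.symm_hom, Iso.eq_inv_comp, ← reassoc_of% h]; simp

theorem symm_mul {A B : M} {f : A ⟶ B} {lu lv lw ru rv rw : A ⟶ A} {su sv sw mu mv mw : B ⟶ B}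
    (tu : lu ≫ f ≫ su ≅ ru ≫ f ≫ mu) (tv : lv ≫ f ≫ sv ≅ rv ≫ f ≫ mv)
    (tw : lw ≫ f ≫ sw ≅ rw ≫ f ≫ mw) {e₁ : lw ≫ f ≫ sw = lv ≫ (lu ≫ f ≫ su) ≫ sv}
    {e₂ : lv ≫ (ru ≫ f ≫ mu) ≫ sv = ru ≫ (lv ≫ f ≫ sv) ≫ mu}
    {e₃ : ru ≫ (rv ≫ f ≫ mv) ≫ mu = rw ≫ f ≫ mw}
    (h : tw.hom = eqToHom e₁ ≫ (lv ◁ tu.hom ▷ sv) ≫ eqToHom e₂ ≫ (ru ◁ tv.hom ▷ mu) ≫ eqToHom e₃) :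
    tw.symm.hom = eqToHom e₃.symm ≫ (ru ◁ tv.symm.hom ▷ mu) ≫ eqToHom e₂.symm ≫
      (lv ◁ tu.symm.hom ▷ sv) ≫ eqToHom e₁.symm := by
  have : tw = eqToIso e₁ ≪≫ whiskerLeftIso lv (whiskerRightIso tu sv) ≪≫ eqToIso e₂ ≪≫
      whiskerLeftIso ru (whiskerRightIso tv mu) ≪≫ eqToIso e₃ := Iso.ext (by simp [h])
  rw [this]; simp


variable {X Y Z : IObj V I M}

/-- The identity 𝕀-equivariant morphism. -/
def id (X : IObj V I M) : Equivariant X X where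
  hom := 𝟙 X.carrier
  τ u := eqToIso (by simp only [Strict.id_comp, X.strict.comm])
  natural {u v} f := by
    have := X.strict.comm_map f f
    rw [← Category.assoc, comp_eqToHom_iff, Category.assoc] at this
    simp only [Category.assoc, eqToHom_trans, eqToHom_trans_assoc, eqToHom_refl, Category.id_comp, Category.comp_id,
    Bicategory.whiskerLeft_comp, Bicategory.comp_whiskerRight, whiskerLeft_eqToHom, Bicategory.whiskerLeft_id, Bicategory.id_whiskerRight,
    eqToHom_whiskerRight, Bicategory.comp_whiskerLeft, Bicategory.whiskerRight_comp,
    Bicategory.whisker_assoc, Bicategory.id_whiskerLeft, Bicategory.whiskerRight_id,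
    leftUnitor_hom, leftUnitor_inv, associator_hom, associator_inv, rightUnitor_hom,
    rightUnitor_inv, Iso.trans_hom, eqToIso.hom, whiskerRightIso_hom, whiskerLeftIso_hom]
    rw [reassoc_of% this]
    simp
  one := by simp
  mul u v := by simp

/-- Pasting of `tf` and `tg` along a middle 1-cell `s` that is an identity. -/
def pasteIso {A B C : M} {f : A ⟶ B} {g : B ⟶ C} {l r : A ⟶ A} {s m : B ⟶ B} {n k : C ⟶ C}
    (hs : s = 𝟙 B) (tf : l ≫ f ≫ s ≅ r ≫ f ≫ m) (tg : m ≫ g ≫ k ≅ s ≫ g ≫ n) :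
    l ≫ (f ≫ g) ≫ k ≅ r ≫ (f ≫ g) ≫ n :=
  eqToIso (by simp only [hs, Strict.comp_id, Strict.assoc]) ≪≫
  whiskerRightIso tf (g ≫ k) ≪≫
  eqToIso (by simp only [Strict.assoc]) ≪≫
  whiskerLeftIso (r ≫ f) tg ≪≫
  eqToIso (by simp only [hs, Strict.id_comp, Strict.assoc])

theorem paste_mul {A B C : M} {f : A ⟶ B} {g : B ⟶ C} {lu lv lw ru rv rw : A ⟶ A}
    {su sv sw mu mv mw : B ⟶ B} {nu nv nw ku kv kw : C ⟶ C}
    (hsu : su = 𝟙 B) (hsv : sv = 𝟙 B) (hsw : sw = 𝟙 B) (hlw : lw = lv ≫ lu) (hrw : rw = ru ≫ rv)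
    (hmw : mw = mv ≫ mu) (hkw : kw = ku ≫ kv) (hnw : nw = nv ≫ nu)
    (hA : lv ≫ ru = ru ≫ lv) (hC : nu ≫ kv = kv ≫ nu)
    (fu : lu ≫ f ≫ su ≅ ru ≫ f ≫ mu) (gu : mu ≫ g ≫ ku ≅ su ≫ g ≫ nu)
    (fv : lv ≫ f ≫ sv ≅ rv ≫ f ≫ mv) (gv : mv ≫ g ≫ kv ≅ sv ≫ g ≫ nv)
    (fw : lw ≫ f ≫ sw ≅ rw ≫ f ≫ mw) (gw : mw ≫ g ≫ kw ≅ sw ≫ g ≫ nw)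
    (hf : fw.hom = eqToHom (by simp only [hlw, hsw, hsu, hsv, Strict.assoc, Strict.id_comp]) ≫
      (lv ◁ fu.hom ▷ sv) ≫
      eqToHom (by simp only [hsv, Strict.comp_id, ← Strict.assoc, hA]) ≫
      (ru ◁ fv.hom ▷ mu) ≫ eqToHom (by simp only [hrw, hmw, Strict.assoc]))
    (hg : gw.hom = eqToHom (by simp only [hmw, hkw, Strict.assoc]) ≫
      (mv ◁ gu.hom ▷ kv) ≫
      eqToHom (by simp only [hsu, Strict.id_comp, Strict.assoc, hC]) ≫
      (su ◁ gv.hom ▷ nu) ≫ eqToHom (by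
        simp only [hsw, hsu, hsv, hnw, Strict.assoc, Strict.id_comp])) :
    (pasteIso hsw fw gw).hom =
      eqToHom (by simp only [hlw, hkw, Strict.assoc]) ≫
      (lv ◁ (pasteIso hsu fu gu).hom ▷ kv) ≫
      eqToHom (by simp only [Strict.assoc, hC]; simp only [← Strict.assoc, hA]) ≫
      (ru ◁ (pasteIso hsv fv gv).hom ▷ nu) ≫
      eqToHom (by simp only [hrw, hnw, Strict.assoc]) := by
  subst hsu hsv hsw hlw hrw hmw hkw hnw
  have ex := congrArg (fun η => ru ◁ η ▷ kv) (whisker_exchange fv.hom gu.hom)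
  simp only [Category.assoc, eqToHom_trans, eqToHom_trans_assoc, eqToHom_refl, Category.id_comp, Category.comp_id,
    Bicategory.whiskerLeft_comp, Bicategory.comp_whiskerRight, whiskerLeft_eqToHom, Bicategory.whiskerLeft_id, Bicategory.id_whiskerRight,
    eqToHom_whiskerRight, Bicategory.comp_whiskerLeft, Bicategory.whiskerRight_comp,
    Bicategory.whisker_assoc, Bicategory.id_whiskerLeft, Bicategory.whiskerRight_id,
    leftUnitor_hom, leftUnitor_inv, associator_hom, associator_inv, rightUnitor_hom,
    rightUnitor_inv, Iso.trans_hom, eqToIso.hom, whiskerRightIso_hom, whiskerLeftIso_hom, swapR _ hC] at ex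
  simp only [pasteIso, hf, hg, Category.assoc, eqToHom_trans, eqToHom_trans_assoc, eqToHom_refl, Category.id_comp, Category.comp_id,
    Bicategory.whiskerLeft_comp, Bicategory.comp_whiskerRight, whiskerLeft_eqToHom, Bicategory.whiskerLeft_id, Bicategory.id_whiskerRight,
    eqToHom_whiskerRight, Bicategory.comp_whiskerLeft, Bicategory.whiskerRight_comp,
    Bicategory.whisker_assoc, Bicategory.id_whiskerLeft, Bicategory.whiskerRight_id,
    leftUnitor_hom, leftUnitor_inv, associator_hom, associator_inv, rightUnitor_hom,
    rightUnitor_inv, Iso.trans_hom, eqToIso.hom, whiskerRightIso_hom, whiskerLeftIso_hom, swapL _ hA] at ex ⊢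
  try rw [eqToHom_comp_iff] at ex; try simp only [← Category.assoc] at ex
  try rw [comp_eqToHom_iff] at ex
  try simp only [Category.assoc, eqToHom_trans, eqToHom_trans_assoc, eqToHom_refl, Category.id_comp, Category.comp_id] at ex
  rw [reassoc_of% ex]
  simp only [Category.assoc, eqToHom_trans, eqToHom_trans_assoc, eqToHom_refl, Category.id_comp, Category.comp_id,
    Bicategory.whiskerLeft_comp, Bicategory.comp_whiskerRight, whiskerLeft_eqToHom, Bicategory.whiskerLeft_id, Bicategory.id_whiskerRight,
    eqToHom_whiskerRight, Bicategory.comp_whiskerLeft, Bicategory.whiskerRight_comp,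
    Bicategory.whisker_assoc, Bicategory.id_whiskerLeft, Bicategory.whiskerRight_id,
    leftUnitor_hom, leftUnitor_inv, associator_hom, associator_inv, rightUnitor_hom,
    rightUnitor_inv, Iso.trans_hom, eqToIso.hom, whiskerRightIso_hom, whiskerLeftIso_hom]


theorem paste_nat {A B C : M} {f : A ⟶ B} {g : B ⟶ C} {lu lv ru rv : A ⟶ A}
    {su sv mu mv : B ⟶ B} {nu nv ku kv : C ⟶ C}
    (hsu : su = 𝟙 B) (hsv : sv = 𝟙 B)
    (fu : lu ≫ f ≫ su ≅ ru ≫ f ≫ mu) (gu : mu ≫ g ≫ ku ≅ su ≫ g ≫ nu)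
    (fv : lv ≫ f ≫ sv ≅ rv ≫ f ≫ mv) (gv : mv ≫ g ≫ kv ≅ sv ≫ g ≫ nv)
    (l : lu ⟶ lv) (r : ru ⟶ rv) (s : su ⟶ sv) (m : mu ⟶ mv) (k : ku ⟶ kv) (n : nu ⟶ nv)
    (hs : s = eqToHom (hsu.trans hsv.symm))
    (hf : (l ▷ (f ≫ su)) ≫ (lv ◁ f ◁ s) ≫ fv.hom = fu.hom ≫ (r ▷ (f ≫ mu)) ≫ (rv ◁ f ◁ m))
    (hg : (m ▷ (g ≫ ku)) ≫ (mv ◁ g ◁ k) ≫ gv.hom = gu.hom ≫ (s ▷ (g ≫ nu)) ≫ (sv ◁ g ◁ n)) :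
    (l ▷ ((f ≫ g) ≫ ku)) ≫ (lv ◁ (f ≫ g) ◁ k) ≫ (pasteIso hsv fv gv).hom =
      (pasteIso hsu fu gu).hom ≫ (r ▷ ((f ≫ g) ≫ nu)) ≫ (rv ◁ (f ≫ g) ◁ n) := by
  subst hsu hsv
  have ex1 := whisker_exchange fv.hom (g ◁ k)
  have ex2 := whisker_exchange (r ▷ f) gu.hom
  have ex3 := congrArg (· ▷ (g ≫ ku)) hf
  have ex4 := congrArg ((rv ≫ f) ◁ ·) hg
  subst hs
  simp only [pasteIso, Category.assoc, eqToHom_trans, eqToHom_trans_assoc, eqToHom_refl, Category.id_comp, Category.comp_id,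
    Bicategory.whiskerLeft_comp, Bicategory.comp_whiskerRight, whiskerLeft_eqToHom, Bicategory.whiskerLeft_id, Bicategory.id_whiskerRight,
    eqToHom_whiskerRight, Bicategory.comp_whiskerLeft, Bicategory.whiskerRight_comp,
    Bicategory.whisker_assoc, Bicategory.id_whiskerLeft, Bicategory.whiskerRight_id,
    leftUnitor_hom, leftUnitor_inv, associator_hom, associator_inv, rightUnitor_hom,
    rightUnitor_inv, Iso.trans_hom, eqToIso.hom, whiskerRightIso_hom, whiskerLeftIso_hom] at ex1 ex2 ex3 ex4 ⊢
  try rw [eqToHom_comp_iff] at ex1; try simp only [← Category.assoc] at ex1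
  try rw [comp_eqToHom_iff] at ex1
  try simp only [Category.assoc, eqToHom_trans, eqToHom_trans_assoc, eqToHom_refl, Category.id_comp, Category.comp_id] at ex1
  try rw [eqToHom_comp_iff] at ex2; try simp only [← Category.assoc] at ex2
  try rw [comp_eqToHom_iff] at ex2
  try simp only [Category.assoc, eqToHom_trans, eqToHom_trans_assoc, eqToHom_refl, Category.id_comp, Category.comp_id] at ex2
  try rw [eqToHom_comp_iff] at ex3; try simp only [← Category.assoc] at ex3
  try rw [comp_eqToHom_iff] at ex3
  try simp only [Category.assoc, eqToHom_trans, eqToHom_trans_assoc, eqToHom_refl, Category.id_comp, Category.comp_id] at ex3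
  try rw [eqToHom_comp_iff] at ex4; try simp only [← Category.assoc] at ex4
  try rw [comp_eqToHom_iff] at ex4
  try simp only [Category.assoc, eqToHom_trans, eqToHom_trans_assoc, eqToHom_refl, Category.id_comp, Category.comp_id] at ex4
  rw [reassoc_of% ex1]; try simp only [Category.assoc, eqToHom_trans_assoc, eqToHom_refl, Category.id_comp]
  rw [reassoc_of% ex3]; try simp only [Category.assoc, eqToHom_trans_assoc, eqToHom_refl, Category.id_comp]
  rw [reassoc_of% ex4]; try simp only [Category.assoc, eqToHom_trans_assoc, eqToHom_refl, Category.id_comp]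
  rw [reassoc_of% ex2]; try simp only [Category.assoc, eqToHom_trans_assoc, eqToHom_refl, Category.id_comp]
  simp only [Category.assoc, eqToHom_trans, eqToHom_trans_assoc, eqToHom_refl, Category.id_comp, Category.comp_id,
    Bicategory.whiskerLeft_comp, Bicategory.comp_whiskerRight, whiskerLeft_eqToHom, Bicategory.whiskerLeft_id, Bicategory.id_whiskerRight,
    eqToHom_whiskerRight, Bicategory.comp_whiskerLeft, Bicategory.whiskerRight_comp,
    Bicategory.whisker_assoc, Bicategory.id_whiskerLeft, Bicategory.whiskerRight_id,
    leftUnitor_hom, leftUnitor_inv, associator_hom, associator_inv, rightUnitor_hom,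
    rightUnitor_inv, Iso.trans_hom, eqToIso.hom, whiskerRightIso_hom, whiskerLeftIso_hom]

/-- The composite `X → Y → Z`. Since the action on `Y` is trivial on one side, the structure 2-cells
`X.L u ≫ (f ≫ g) ≫ Z.R u ≅ X.R u ≫ (f ≫ g) ≫ Z.L u` are obtained by pasting those of `f` and `g`: first
that of `f` and then that of `g` if `Y.R` is trivial; first that of `g` and then that of `f` if `Y.L`
is trivial. -/
noncomputable def compτ (f : Equivariant X Y) (g : Equivariant Y Z) (u : I) :
    X.L.obj u ≫ (f.hom ≫ g.hom) ≫ Z.R.obj u ≅ X.R.obj u ≫ (f.hom ≫ g.hom) ≫ Z.L.obj u :=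
  open Classical in
  if h : IsTrivial Y.R then pasteIso (h.obj_eq u) (f.τ u) (g.τ u)
  else (pasteIso ((Y.trivial_of_not h).obj_eq u) (f.τ u).symm (g.τ u).symm).symm

/-- The composite of 𝕀-equivariant morphisms. -/
noncomputable def comp (f : Equivariant X Y) (g : Equivariant Y Z) : Equivariant X Z where
  hom := f.hom ≫ g.hom
  τ := compτ f g
  natural {u v} φ := by
    by_cases h : IsTrivial Y.R
    · simp only [compτ, dif_pos h]
      exact paste_nat _ _ _ _ _ _ _ _ _ _ _ _ (h.map_eq φ) (f.natural φ) (g.natural φ)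
    · have h' := Y.trivial_of_not h
      simp only [compτ, dif_neg h]
      exact symm_nat (paste_nat (h'.obj_eq u) (h'.obj_eq v) _ _ _ _ _ _ _ _ _ _ (h'.map_eq φ)
        (symm_nat (f.natural φ)) (symm_nat (g.natural φ)))
  one := by
    by_cases h : IsTrivial Y.R
    · simp only [compτ, dif_pos h]
      simp only [pasteIso, f.one, g.one, Category.assoc, eqToHom_trans, eqToHom_trans_assoc, eqToHom_refl, Category.id_comp, Category.comp_id,
    Bicategory.whiskerLeft_comp, Bicategory.comp_whiskerRight, whiskerLeft_eqToHom, Bicategory.whiskerLeft_id, Bicategory.id_whiskerRight,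
    eqToHom_whiskerRight, Bicategory.comp_whiskerLeft, Bicategory.whiskerRight_comp,
    Bicategory.whisker_assoc, Bicategory.id_whiskerLeft, Bicategory.whiskerRight_id,
    leftUnitor_hom, leftUnitor_inv, associator_hom, associator_inv, rightUnitor_hom,
    rightUnitor_inv, Iso.trans_hom, eqToIso.hom, whiskerRightIso_hom, whiskerLeftIso_hom]
    · have h' := Y.trivial_of_not h
      apply hom_eq_eqToHom
      simp only [compτ, dif_neg h, Iso.symm_inv]
      simp only [pasteIso, Iso.symm_hom, inv_eq_eqToHom f.one, inv_eq_eqToHom g.one, Category.assoc, eqToHom_trans, eqToHom_trans_assoc, eqToHom_refl, Category.id_comp, Category.comp_id,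
    Bicategory.whiskerLeft_comp, Bicategory.comp_whiskerRight, whiskerLeft_eqToHom, Bicategory.whiskerLeft_id, Bicategory.id_whiskerRight,
    eqToHom_whiskerRight, Bicategory.comp_whiskerLeft, Bicategory.whiskerRight_comp,
    Bicategory.whisker_assoc, Bicategory.id_whiskerLeft, Bicategory.whiskerRight_id,
    leftUnitor_hom, leftUnitor_inv, associator_hom, associator_inv, rightUnitor_hom,
    rightUnitor_inv, Iso.trans_hom, eqToIso.hom, whiskerRightIso_hom, whiskerLeftIso_hom]
  mul u v := by
    by_cases h : IsTrivial Y.R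
    · simp only [compτ, dif_pos h]
      exact paste_mul _ _ _ (X.strict.L_mul u v) (X.strict.R_mul u v) (Y.strict.L_mul u v)
        (Z.strict.R_mul u v) (Z.strict.L_mul u v) (X.strict.comm _ _) (Z.strict.comm _ _)
        _ _ _ _ _ _ (f.mul u v) (g.mul u v)
    · have h' := Y.trivial_of_not h
      simp only [compτ, dif_neg h]
      exact symm_mul _ _ _ (paste_mul (h'.obj_eq v) (h'.obj_eq u) (h'.obj_eq (u ⊛ v))
        (X.strict.R_mul u v) (X.strict.L_mul u v) (Y.strict.R_mul u v) (Z.strict.L_mul u v)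
        (Z.strict.R_mul u v) (X.strict.comm _ _).symm (Z.strict.comm _ _).symm
        (f.τ v).symm (g.τ v).symm (f.τ u).symm (g.τ u).symm (f.τ (u ⊛ v)).symm
        (g.τ (u ⊛ v)).symm (symm_mul _ _ _ (f.mul u v)) (symm_mul _ _ _ (g.mul u v)))

/-- A 2-cell between 𝕀-equivariant morphisms. -/
@[ext]
structure Hom₂ (f g : Equivariant X Y) where
  cell : f.hom ⟶ g.hom
  comm (u : I) : (X.L.obj u ◁ cell ▷ Y.R.obj u) ≫ (g.τ u).hom =
    (f.τ u).hom ≫ (X.R.obj u ◁ cell ▷ Y.L.obj u)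

/-- The category of 𝕀-equivariant morphisms `X → Y`. -/
instance : Category (Equivariant X Y) where
  Hom f g := Hom₂ f g
  id f := { cell := 𝟙 _, comm := by simp }
  comp a b :=
    { cell := a.cell ≫ b.cell
      comm := fun u => by
        simp only [comp_whiskerRight, Bicategory.whiskerLeft_comp, Category.assoc, b.comm]
        rw [reassoc_of% (a.comm u)] }
  id_comp a := Hom₂.ext (Category.id_comp _)
  comp_id a := Hom₂.ext (Category.comp_id _)
  assoc a b c := Hom₂.ext (Category.assoc _ _ _)

/-- A `T`-indexed family of 2-cells `f ⟹ g` in `M` that is a `T`-indexed family of 2-cells of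
𝕀-equivariant morphisms. These families, for `T : V`, constitute the `V`-category of 𝕀-equivariant
morphisms `X → Y`. -/
def IsFam (f g : Equivariant X Y) {T : V} (t : T ⟶ (f.hom ⟶[V] g.hom)) : Prop :=
  ∀ u : I, VSquare (f.τ u) (g.τ u)
    (famWhiskerLeft (X.L.obj u) (famWhiskerRight t (Y.R.obj u)))
    (famWhiskerLeft (X.R.obj u) (famWhiskerRight t (Y.L.obj u)))

/-- `X` and `Y` are 1-equivalent in the 2-category of 𝕀-objects. -/
def Equivalent (X Y : IObj V I M) : Prop :=
  ∃ (f : Equivariant X Y) (g : Equivariant Y X),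
    Nonempty (comp f g ≅ id X) ∧ Nonempty (comp g f ≅ id Y)

end Equivariant

/-! ### Weak coends of strict biactions -/

section Coend

variable {E : M} {L R : I ⥤ (E ⟶ E)}

/-- A (weak) cowedge under the action of `I` on `E` given by `L` and `R`. -/
structure Cowedge (h : IsStrictAction L R) (Z : M) where
  leg : E ⟶ Z
  σ (u : I) : L.obj u ≫ leg ≅ R.obj u ≫ leg
  natural {u v : I} (f : u ⟶ v) : (L.map f ▷ leg) ≫ (σ v).hom = (σ u).hom ≫ (R.map f ▷ leg)
  one : (σ (e[I])).hom = eqToHom (by rw [h.L_one, h.R_one])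
  mul (u v : I) : (σ (u ⊛ v)).hom =
    eqToHom (by rw [h.L_mul, Strict.assoc]) ≫ (L.obj v ◁ (σ u).hom) ≫
    eqToHom (by rw [← Strict.assoc, h.comm, Strict.assoc]) ≫ (R.obj u ◁ (σ v).hom) ≫
    eqToHom (by rw [h.R_mul, Strict.assoc])

variable {h : IsStrictAction L R} {Z : M}

/-- The structure 2-cells of the cowedge obtained from `w` by postcomposition with `k`. -/
def Cowedge.push (w : Cowedge h Z) {Z' : M} (k : Z ⟶ Z') (u : I) :
    L.obj u ≫ w.leg ≫ k ≅ R.obj u ≫ w.leg ≫ k :=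
  (α_ _ _ _).symm ≪≫ whiskerRightIso (w.σ u) k ≪≫ α_ _ _ _

variable (V) in
/-- The cowedge `w` exhibits `Z` as a weak coend: for all `Z'`, postcomposition is an equivalence of
`V`-categories from `[Z, Z']` to the `V`-category of cowedges with vertex `Z'`. -/
structure IsWeakCoend (w : Cowedge h Z) : Prop where
  ess_surj {Z' : M} (d : Cowedge h Z') :
    ∃ (k : Z ⟶ Z') (φ : w.leg ≫ k ≅ d.leg), ∀ u : I,
      (w.push k u).hom ≫ (R.obj u ◁ φ.hom) = (L.obj u ◁ φ.hom) ≫ (d.σ u).hom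
  fully_faithful {Z' : M} (k k' : Z ⟶ Z') (T : V) (s : T ⟶ ((w.leg ≫ k) ⟶[V] (w.leg ≫ k')))
    (hs : ∀ u : I, VSquare (w.push k u) (w.push k' u)
      (famWhiskerLeft (L.obj u) s) (famWhiskerLeft (R.obj u) s)) :
    ∃! t : T ⟶ (k ⟶[V] k'), famWhiskerLeft w.leg t = s

end Coend

/-! ### Copowers by `I` -/

variable (V I M) in
/-- Weak copowers by the `V`-category `I`, functorial in a strict way along the two-sided
multiplications of `I`: for `g : A ⟶ B` the 1-cell `map a b g : obj A ⟶ obj B` is `(a ⊗ - ⊗ b) ⊙ g`. -/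
structure Copowering [StrictMonoidal I] where
  /-- The copower `I ⊙ A`. -/
  obj : M → M
  unit (A : M) : EnrichedFunctor V I (A ⟶ obj A)
  universal (A : M) : IsWeakCopower V (unit A)
  map {A B : M} (a b : I) (g : A ⟶ B) : obj A ⟶ obj B
  map₂ {A B : M} {a a' b b' : I} {g g' : A ⟶ B} (p : a ⟶ a') (q : b ⟶ b') (θ : g ⟶ g') :
    map a b g ⟶ map a' b' g'
  map₂_id {A B : M} (a b : I) (g : A ⟶ B) : map₂ (𝟙 a) (𝟙 b) (𝟙 g) = 𝟙 (map a b g)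
  map₂_comp {A B : M} {a a' a'' b b' b'' : I} {g g' g'' : A ⟶ B} (p : a ⟶ a') (p' : a' ⟶ a'')
    (q : b ⟶ b') (q' : b' ⟶ b'') (θ : g ⟶ g') (θ' : g' ⟶ g'') :
    map₂ (p ≫ p') (q ≫ q') (θ ≫ θ') = map₂ p q θ ≫ map₂ p' q' θ'
  map_id (A : M) : map (e[I]) (e[I]) (𝟙 A) = 𝟙 (obj A)
  map_comp {A B C : M} (a b a' b' : I) (g : A ⟶ B) (g' : B ⟶ C) :
    map a b g ≫ map a' b' g' = map (a' ⊛ a) (b ⊛ b') (g ≫ g')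
  map₂_hcomp {A B C : M} {a c b d a' c' b' d' : I} {g k : A ⟶ B} {g' k' : B ⟶ C}
    (p : a ⟶ c) (q : b ⟶ d) (θ : g ⟶ k) (p' : a' ⟶ c') (q' : b' ⟶ d') (θ' : g' ⟶ k') :
    (map₂ p q θ ▷ map a' b' g') ≫ (map c d k ◁ map₂ p' q' θ') =
      eqToHom (map_comp a b a' b' g g') ≫
        map₂ (p' ⊛ₘ p) (q ⊛ₘ q') ((θ ▷ g') ≫ (k ◁ θ')) ≫
        eqToHom (map_comp c d c' d' k k').symm
  /-- `(a ⊗ - ⊗ b) ⊙ g` restricts to `g` and the multiplication `a ⊗ - ⊗ b` along the units. -/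
  nat {A B : M} (a b : I) (g : A ⟶ B) (i : I) :
    (underlying V (unit A)).obj i ≫ map a b g ≅ g ≫ (underlying V (unit B)).obj (a ⊛ i ⊛ b)
  nat_natural {A B : M} {a a' b b' i i' : I} {g g' : A ⟶ B} (p : a ⟶ a') (q : b ⟶ b')
    (θ : g ⟶ g') (f : i ⟶ i') :
    ((underlying V (unit A)).map f ▷ map a b g) ≫ ((underlying V (unit A)).obj i' ◁ map₂ p q θ) ≫
        (nat a' b' g' i').hom =
      (nat a b g i).hom ≫ (θ ▷ (underlying V (unit B)).obj (a ⊛ i ⊛ b)) ≫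
        (g' ◁ (underlying V (unit B)).map (p ⊛ₘ f ⊛ₘ q))
  nat_id (A : M) (i : I) : (nat (e[I]) (e[I]) (𝟙 A) i).hom = eqToHom (by
    rw [map_id, Strict.comp_id, Strict.id_comp, StrictMonoidal.one_tensor,
      StrictMonoidal.tensor_one])
  nat_comp {A B C : M} (a b a' b' : I) (g : A ⟶ B) (g' : B ⟶ C) (i : I) :
    (nat (a' ⊛ a) (b ⊛ b') (g ≫ g') i).hom =
      eqToHom (by rw [← map_comp, Strict.assoc]) ≫ ((nat a b g i).hom ▷ map a' b' g') ≫
        eqToHom (Strict.assoc _ _ _) ≫ (g ◁ (nat a' b' g' (a ⊛ i ⊛ b)).hom) ≫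
        eqToHom (by simp only [Strict.assoc, StrictMonoidal.tensor_assoc])

namespace Copowering

variable [StrictMonoidal I] (P : Copowering V I M)

/-- The functor `u ↦ (α u ⊗ - ⊗ β u) ⊙ F u`. -/
def tri {A B : M} (α β : I ⥤ I) (F : I ⥤ (A ⟶ B)) : I ⥤ (P.obj A ⟶ P.obj B) where
  obj u := P.map (α.obj u) (β.obj u) (F.obj u)
  map f := P.map₂ (α.map f) (β.map f) (F.map f)
  map_id u := by simp only [CategoryTheory.Functor.map_id, P.map₂_id]
  map_comp f g := by simp only [CategoryTheory.Functor.map_comp, P.map₂_comp]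

/-- The functor `I → I` that is constant at the unit object. -/
abbrev constOne : I ⥤ I := (Functor.const I).obj (e[I])

theorem map₂_conj {A B : M} {a a' b b' c c' d d' : I} {g g' k k' : A ⟶ B} {p : a ⟶ a'}
    {q : b ⟶ b'} {θ : g ⟶ g'} {p' : c ⟶ c'} {q' : d ⟶ d'} {θ' : k ⟶ k'} (ha : a = c) (ha' : a' = c')
    (hb : b = d) (hb' : b' = d') (hg : g = k) (hg' : g' = k')
    (hp : p ≫ eqToHom ha' = eqToHom ha ≫ p') (hq : q ≫ eqToHom hb' = eqToHom hb ≫ q')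
    (hθ : θ ≫ eqToHom hg' = eqToHom hg ≫ θ') :
    P.map₂ p q θ = eqToHom (by rw [ha, hb, hg]) ≫ P.map₂ p' q' θ' ≫
      eqToHom (by rw [ha', hb', hg']) := by
  subst ha ha' hb hb' hg hg'
  simp only [eqToHom_refl, Category.comp_id, Category.id_comp] at hp hq hθ ⊢
  rw [hp, hq, hθ]

theorem map_comp_eq {A B C : M} {a b a' b' c d : I} {g : A ⟶ B} {g' : B ⟶ C} {k : A ⟶ C}
    (ha : c = a' ⊛ a) (hb : d = b ⊛ b') (hg : k = g ≫ g') :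
    P.map c d k = P.map a b g ≫ P.map a' b' g' := by
  rw [map_comp, ha, hb, hg]

theorem map₂_law {A B C : M} {a b c d a₁ b₁ c₁ d₁ a₂ b₂ c₂ d₂ : I} {g k : A ⟶ C} {g₁ k₁ : A ⟶ B}
    {g₂ k₂ : B ⟶ C} {p : a ⟶ c} {q : b ⟶ d} {θ : g ⟶ k} {p₁ : a₁ ⟶ c₁} {q₁ : b₁ ⟶ d₁}
    {θ₁ : g₁ ⟶ k₁} {p₂ : a₂ ⟶ c₂} {q₂ : b₂ ⟶ d₂} {θ₂ : g₂ ⟶ k₂}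
    {ha : a = a₂ ⊛ a₁} {hc : c = c₂ ⊛ c₁} {hb : b = b₁ ⊛ b₂} {hd : d = d₁ ⊛ d₂}
    {hg : g = g₁ ≫ g₂} {hk : k = k₁ ≫ k₂}
    (hp : p ≫ eqToHom hc = eqToHom ha ≫ (p₂ ⊛ₘ p₁)) (hq : q ≫ eqToHom hd = eqToHom hb ≫ (q₁ ⊛ₘ q₂))
    (hθ : θ ≫ eqToHom hk = eqToHom hg ≫ (θ₁ ▷ g₂) ≫ (k₁ ◁ θ₂)) :
    P.map₂ p q θ ≫ eqToHom (P.map_comp_eq hc hd hk) =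
      eqToHom (P.map_comp_eq ha hb hg) ≫ (P.map₂ p₁ q₁ θ₁ ▷ P.map a₂ b₂ g₂) ≫
        (P.map c₁ d₁ k₁ ◁ P.map₂ p₂ q₂ θ₂) := by
  rw [P.map₂_conj ha hc hb hd hg hk hp hq hθ, P.map₂_hcomp]
  simp

theorem map₂_comm {A B B' C : M} {a₁ b₁ c₁ d₁ a₂ b₂ c₂ d₂ a₃ b₃ c₃ d₃ a₄ b₄ c₄ d₄ : I}
    {g₁ k₁ : A ⟶ B} {g₂ k₂ : B ⟶ C} {g₃ k₃ : A ⟶ B'} {g₄ k₄ : B' ⟶ C}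
    {p₁ : a₁ ⟶ c₁} {q₁ : b₁ ⟶ d₁} {θ₁ : g₁ ⟶ k₁} {p₂ : a₂ ⟶ c₂} {q₂ : b₂ ⟶ d₂} {θ₂ : g₂ ⟶ k₂}
    {p₃ : a₃ ⟶ c₃} {q₃ : b₃ ⟶ d₃} {θ₃ : g₃ ⟶ k₃} {p₄ : a₄ ⟶ c₄} {q₄ : b₄ ⟶ d₄} {θ₄ : g₄ ⟶ k₄}
    {ha : a₂ ⊛ a₁ = a₄ ⊛ a₃} {hc : c₂ ⊛ c₁ = c₄ ⊛ c₃} {hb : b₁ ⊛ b₂ = b₃ ⊛ b₄}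
    {hd : d₁ ⊛ d₂ = d₃ ⊛ d₄} {hg : g₁ ≫ g₂ = g₃ ≫ g₄} {hk : k₁ ≫ k₂ = k₃ ≫ k₄}
    (hp : (p₂ ⊛ₘ p₁) ≫ eqToHom hc = eqToHom ha ≫ (p₄ ⊛ₘ p₃))
    (hq : (q₁ ⊛ₘ q₂) ≫ eqToHom hd = eqToHom hb ≫ (q₃ ⊛ₘ q₄))
    (hθ : (θ₁ ▷ g₂) ≫ (k₁ ◁ θ₂) ≫ eqToHom hk = eqToHom hg ≫ (θ₃ ▷ g₄) ≫ (k₃ ◁ θ₄)) :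
    (P.map₂ p₁ q₁ θ₁ ▷ P.map a₂ b₂ g₂) ≫ (P.map c₁ d₁ k₁ ◁ P.map₂ p₂ q₂ θ₂) ≫
        eqToHom ((P.map_comp _ _ _ _ _ _).trans (P.map_comp_eq hc hd hk)) =
      eqToHom ((P.map_comp _ _ _ _ _ _).trans (P.map_comp_eq ha hb hg)) ≫
        (P.map₂ p₃ q₃ θ₃ ▷ P.map a₄ b₄ g₄) ≫ (P.map c₃ d₃ k₃ ◁ P.map₂ p₄ q₄ θ₄) := by
  have h := P.map₂_hcomp p₁ q₁ θ₁ p₂ q₂ θ₂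
  rw [reassoc_of% h, P.map₂_conj ha hc hb hd hg hk hp hq ((Category.assoc _ _ _).trans hθ),
    P.map₂_hcomp]
  simp

theorem tensorHom_one {u v : I} (f : u ⟶ v) : (f ⊛ₘ 𝟙 (e[I])) ≫ eqToHom (StrictMonoidal.tensor_one v) =
    eqToHom (StrictMonoidal.tensor_one u) ≫ f := by
  simp [← StrictMonoidal.rightUnitor_eq, MonoidalCategory.tensorHom_id]

theorem one_tensorHom {u v : I} (f : u ⟶ v) : (𝟙 (e[I]) ⊛ₘ f) ≫ eqToHom (StrictMonoidal.one_tensor v) =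
    eqToHom (StrictMonoidal.one_tensor u) ≫ f := by
  simp [← StrictMonoidal.leftUnitor_eq, MonoidalCategory.id_tensorHom]

theorem one_one : e[I] = e[I] ⊛ e[I] := (StrictMonoidal.tensor_one _).symm

theorem one_comm (u : I) : e[I] ⊛ u = u ⊛ e[I] :=
  (StrictMonoidal.one_tensor u).trans (StrictMonoidal.tensor_one u).symm

theorem one_one_hom : 𝟙 (e[I]) ≫ eqToHom one_one = eqToHom one_one ≫ (𝟙 (e[I]) ⊛ₘ 𝟙 (e[I])) := by
  simp

theorem one_comm_hom {u v : I} (f : u ⟶ v) :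
    (𝟙 (e[I]) ⊛ₘ f) ≫ eqToHom (one_comm v) = eqToHom (one_comm u) ≫ (f ⊛ₘ 𝟙 (e[I])) := by
  have h := tensorHom_one f
  rw [comp_eqToHom_iff] at h
  have h' := one_tensorHom f
  rw [comp_eqToHom_iff] at h'
  rw [h, h']; simp

theorem refl_hom {a b : I} (f : a ⟶ b) : f ≫ eqToHom rfl = eqToHom rfl ≫ f := by simp

theorem comm_one_hom {u v : I} (f : u ⟶ v) :
    (f ⊛ₘ 𝟙 (e[I])) ≫ eqToHom (one_comm v).symm = eqToHom (one_comm u).symm ≫ (𝟙 (e[I]) ⊛ₘ f) := by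
  rw [comp_eqToHom_iff, Category.assoc, one_comm_hom]; simp

end Copowering

/-- The two sides of an action. -/
inductive Side
  | l
  | r

namespace Copowering

variable [StrictMonoidal I] (P : Copowering V I M)

/-- The left action on `I ⊙ A` in the biaction `Υ`: for the side `r` it is `id ⊙ L_u`, for the side `l`
it is `(u ⊗ -) ⊙ L_u`. -/
def upsL : (s : Side) → (X : IObj V I M) → I ⥤ (P.obj X.carrier ⟶ P.obj X.carrier)
  | .r, X => P.tri constOne constOne X.L
  | .l, X => P.tri (𝟭 I) constOne X.L

/-- The right action on `I ⊙ A` in the biaction `Υ`: for the side `r` it is `(- ⊗ u) ⊙ R_u`, for the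
side `l` it is `id ⊙ R_u`. -/
def upsR : (s : Side) → (X : IObj V I M) → I ⥤ (P.obj X.carrier ⟶ P.obj X.carrier)
  | .r, X => P.tri constOne (𝟭 I) X.R
  | .l, X => P.tri constOne constOne X.R

/-- The action on `I ⊙ A` that is used neither on the left nor on the right in `Υ`: for the side `r`
it is the left action by `(x ⊗ -) ⊙ id`, for the side `l` it is the right action by `(- ⊗ x) ⊙ id`. -/
def outer : (s : Side) → (X : IObj V I M) → I ⥤ (P.obj X.carrier ⟶ P.obj X.carrier)
  | .r, X => P.tri (𝟭 I) constOne ((Functor.const I).obj (𝟙 X.carrier))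
  | .l, X => P.tri constOne (𝟭 I) ((Functor.const I).obj (𝟙 X.carrier))

theorem ups_strict (s : Side) (X : IObj V I M) : IsStrictAction (P.upsL s X) (P.upsR s X) where
  L_one := by cases s <;> simp [upsL, tri, X.strict.L_one, P.map_id]
  R_one := by cases s <;> simp [upsR, tri, X.strict.R_one, P.map_id]
  L_mul u v := by
    cases s
    · exact P.map_comp_eq rfl one_one (X.strict.L_mul u v)
    · exact P.map_comp_eq one_one one_one (X.strict.L_mul u v)
  R_mul u v := by
    cases s
    · exact P.map_comp_eq one_one one_one (X.strict.R_mul u v)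
    · exact P.map_comp_eq one_one rfl (X.strict.R_mul u v)
  comm u v := by
    cases s
    · exact (P.map_comp _ _ _ _ _ _).trans (P.map_comp_eq (one_comm u) rfl (X.strict.comm u v))
    · exact (P.map_comp _ _ _ _ _ _).trans (P.map_comp_eq rfl (one_comm v) (X.strict.comm u v))
  L_mul_map f g := by
    cases s
    · exact P.map₂_law (refl_hom _) one_one_hom (X.strict.L_mul_map f g)
    · exact P.map₂_law one_one_hom one_one_hom (X.strict.L_mul_map f g)
  R_mul_map f g := by
    cases s
    · exact P.map₂_law one_one_hom one_one_hom (X.strict.R_mul_map f g)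
    · exact P.map₂_law one_one_hom (refl_hom _) (X.strict.R_mul_map f g)
  comm_map f g := by
    cases s
    · exact P.map₂_comm (one_comm_hom f) (refl_hom _) (X.strict.comm_map f g)
    · exact P.map₂_comm (refl_hom _) (one_comm_hom g) (X.strict.comm_map f g)

end Copowering

section Eta
variable {A O Z : M}

def etaIso {l r : A ⟶ A} {j : A ⟶ O} {F H G : O ⟶ O} {ω : O ⟶ Z} {d c : Z ⟶ Z} (hd : d = 𝟙 Z)
    (lam : l ≫ j ≅ j ≫ F) (th : j ≫ H ≅ r ≫ j ≫ G) (σ : F ≫ ω ≅ H ≫ ω) (κ : G ≫ ω ≅ ω ≫ c) :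
    l ≫ (j ≫ ω) ≫ d ≅ r ≫ (j ≫ ω) ≫ c :=
  eqToIso (by simp only [hd, Strict.comp_id, Strict.assoc]) ≪≫
  whiskerRightIso lam ω ≪≫ eqToIso (by simp only [Strict.assoc]) ≪≫
  whiskerLeftIso j σ ≪≫ eqToIso (by simp only [Strict.assoc]) ≪≫
  whiskerRightIso th ω ≪≫ eqToIso (by simp only [Strict.assoc]) ≪≫
  whiskerLeftIso (r ≫ j) κ ≪≫ eqToIso (by simp only [Strict.assoc])

theorem eta_one {l r : A ⟶ A} {j : A ⟶ O} {F H G : O ⟶ O} {ω : O ⟶ Z} {d c : Z ⟶ Z} (hd : d = 𝟙 Z)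
    {lam : l ≫ j ≅ j ≫ F} {th : j ≫ H ≅ r ≫ j ≫ G} {σ : F ≫ ω ≅ H ≫ ω} {κ : G ≫ ω ≅ ω ≫ c}
    {h1 h2 h3 h4} (e1 : lam.hom = eqToHom h1) (e2 : th.hom = eqToHom h2) (e3 : σ.hom = eqToHom h3)
    (e4 : κ.hom = eqToHom h4) (h) : (etaIso hd lam th σ κ).hom = eqToHom h := by
  simp only [etaIso, e1, e2, e3, e4, Category.assoc, eqToHom_trans, eqToHom_trans_assoc, eqToHom_refl, Category.id_comp, Category.comp_id,
    Bicategory.whiskerLeft_comp, Bicategory.comp_whiskerRight, whiskerLeft_eqToHom, Bicategory.whiskerLeft_id, Bicategory.id_whiskerRight,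
    eqToHom_whiskerRight, Bicategory.comp_whiskerLeft, Bicategory.whiskerRight_comp,
    Bicategory.whisker_assoc, Bicategory.id_whiskerLeft, Bicategory.whiskerRight_id,
    leftUnitor_hom, leftUnitor_inv, associator_hom, associator_inv, rightUnitor_hom,
    rightUnitor_inv, Iso.trans_hom, eqToIso.hom, whiskerRightIso_hom, whiskerLeftIso_hom]

theorem eta_nat {lu lv ru rv : A ⟶ A} {j : A ⟶ O} {Fu Fv Hu Hv Gu Gv : O ⟶ O} {ω : O ⟶ Z}
    {du dv cu cv : Z ⟶ Z} (hdu : du = 𝟙 Z) (hdv : dv = 𝟙 Z)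
    {lamu : lu ≫ j ≅ j ≫ Fu} {thu : j ≫ Hu ≅ ru ≫ j ≫ Gu} {σu : Fu ≫ ω ≅ Hu ≫ ω}
    {κu : Gu ≫ ω ≅ ω ≫ cu} {lamv : lv ≫ j ≅ j ≫ Fv} {thv : j ≫ Hv ≅ rv ≫ j ≫ Gv}
    {σv : Fv ≫ ω ≅ Hv ≫ ω} {κv : Gv ≫ ω ≅ ω ≫ cv}
    (l : lu ⟶ lv) (r : ru ⟶ rv) (F : Fu ⟶ Fv) (H : Hu ⟶ Hv) (G : Gu ⟶ Gv) (d : du ⟶ dv)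
    (c : cu ⟶ cv) (hd : d = eqToHom (hdu.trans hdv.symm))
    (ex1 : (l ▷ j) ≫ lamv.hom = lamu.hom ≫ (j ◁ F))
    (ex2 : (F ▷ ω) ≫ σv.hom = σu.hom ≫ (H ▷ ω))
    (ex3 : (j ◁ H) ≫ thv.hom = thu.hom ≫ (r ▷ (j ≫ Gu)) ≫ (rv ◁ j ◁ G))
    (ex4 : (G ▷ ω) ≫ κv.hom = κu.hom ≫ (ω ◁ c)) :
    (l ▷ ((j ≫ ω) ≫ du)) ≫ (lv ◁ (j ≫ ω) ◁ d) ≫ (etaIso hdv lamv thv σv κv).hom =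
      (etaIso hdu lamu thu σu κu).hom ≫ (r ▷ ((j ≫ ω) ≫ cu)) ≫ (rv ◁ (j ≫ ω) ◁ c) := by
  subst hdu hdv
  have ex5 := whisker_exchange (r ▷ j) κu.hom
  replace ex1 := congrArg (· ▷ ω) ex1
  replace ex2 := congrArg (j ◁ ·) ex2
  replace ex3 := congrArg (· ▷ ω) ex3
  replace ex4 := congrArg ((rv ≫ j) ◁ ·) ex4
  subst hd
  simp only [etaIso, Category.assoc, eqToHom_trans, eqToHom_trans_assoc, eqToHom_refl, Category.id_comp, Category.comp_id,
    Bicategory.whiskerLeft_comp, Bicategory.comp_whiskerRight, whiskerLeft_eqToHom, Bicategory.whiskerLeft_id, Bicategory.id_whiskerRight,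
    eqToHom_whiskerRight, Bicategory.comp_whiskerLeft, Bicategory.whiskerRight_comp,
    Bicategory.whisker_assoc, Bicategory.id_whiskerLeft, Bicategory.whiskerRight_id,
    leftUnitor_hom, leftUnitor_inv, associator_hom, associator_inv, rightUnitor_hom,
    rightUnitor_inv, Iso.trans_hom, eqToIso.hom, whiskerRightIso_hom, whiskerLeftIso_hom] at ex1 ex2 ex3 ex4 ex5 ⊢
  try rw [eqToHom_comp_iff] at ex1; try simp only [← Category.assoc] at ex1
  try rw [comp_eqToHom_iff] at ex1
  try simp only [Category.assoc, eqToHom_trans, eqToHom_trans_assoc, eqToHom_refl, Category.id_comp, Category.comp_id] at ex1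
  try rw [eqToHom_comp_iff] at ex2; try simp only [← Category.assoc] at ex2
  try rw [comp_eqToHom_iff] at ex2
  try simp only [Category.assoc, eqToHom_trans, eqToHom_trans_assoc, eqToHom_refl, Category.id_comp, Category.comp_id] at ex2
  try rw [eqToHom_comp_iff] at ex3; try simp only [← Category.assoc] at ex3
  try rw [comp_eqToHom_iff] at ex3
  try simp only [Category.assoc, eqToHom_trans, eqToHom_trans_assoc, eqToHom_refl, Category.id_comp, Category.comp_id] at ex3
  try rw [eqToHom_comp_iff] at ex4; try simp only [← Category.assoc] at ex4
  try rw [comp_eqToHom_iff] at ex4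
  try simp only [Category.assoc, eqToHom_trans, eqToHom_trans_assoc, eqToHom_refl, Category.id_comp, Category.comp_id] at ex4
  replace ex5 := ex5.symm
  try rw [eqToHom_comp_iff] at ex5; try simp only [← Category.assoc] at ex5
  try rw [comp_eqToHom_iff] at ex5
  try simp only [Category.assoc, eqToHom_trans, eqToHom_trans_assoc, eqToHom_refl, Category.id_comp, Category.comp_id] at ex5
  rw [reassoc_of% ex1]; try simp only [Category.assoc, eqToHom_trans_assoc, eqToHom_refl, Category.id_comp]
  rw [reassoc_of% ex2]; try simp only [Category.assoc, eqToHom_trans_assoc, eqToHom_refl, Category.id_comp]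
  rw [reassoc_of% ex3]; try simp only [Category.assoc, eqToHom_trans_assoc, eqToHom_refl, Category.id_comp]
  rw [reassoc_of% ex4]; try simp only [Category.assoc, eqToHom_trans_assoc, eqToHom_refl, Category.id_comp]
  rw [reassoc_of% ex5]; try simp only [Category.assoc, eqToHom_trans_assoc, eqToHom_refl, Category.id_comp]

theorem eta_mul {lu lv lw ru rv rw : A ⟶ A} {j : A ⟶ O} {Fu Fv Fw Hu Hv Hw Gu Gv Gw : O ⟶ O}
    {ω : O ⟶ Z} {du dv dw cu cv cw : Z ⟶ Z} (hdu : du = 𝟙 Z) (hdv : dv = 𝟙 Z) (hdw : dw = 𝟙 Z)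
    {lamu : lu ≫ j ≅ j ≫ Fu} {thu : j ≫ Hu ≅ ru ≫ j ≫ Gu} {σu : Fu ≫ ω ≅ Hu ≫ ω}
    {κu : Gu ≫ ω ≅ ω ≫ cu} {lamv : lv ≫ j ≅ j ≫ Fv} {thv : j ≫ Hv ≅ rv ≫ j ≫ Gv}
    {σv : Fv ≫ ω ≅ Hv ≫ ω} {κv : Gv ≫ ω ≅ ω ≫ cv} {lamw : lw ≫ j ≅ j ≫ Fw}
    {thw : j ≫ Hw ≅ rw ≫ j ≫ Gw} {σw : Fw ≫ ω ≅ Hw ≫ ω} {κw : Gw ≫ ω ≅ ω ≫ cw}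
    (hl : lw = lv ≫ lu) (hr : rw = ru ≫ rv) (hF : Fw = Fv ≫ Fu) (hH : Hw = Hu ≫ Hv)
    (hG : Gw = Gv ≫ Gu) (hc : cw = cv ≫ cu) (hlr : lv ≫ ru = ru ≫ lv) (hFH : Fv ≫ Hu = Hu ≫ Fv)
    (hGH : Gu ≫ Hv = Hv ≫ Gu) (hGF : Gu ≫ Fv = Fv ≫ Gu)
    (elam : lamw.hom = eqToHom (by simp only [hl, Strict.assoc]) ≫ (lv ◁ lamu.hom) ≫
      eqToHom (Strict.assoc _ _ _).symm ≫ (lamv.hom ▷ Fu) ≫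
      eqToHom (by simp only [hF, Strict.assoc]))
    (eth : thw.hom = eqToHom (by simp only [hH, Strict.assoc]) ≫ (thu.hom ▷ Hv) ≫
      eqToHom (by simp only [Strict.assoc, hGH]) ≫ (ru ◁ thv.hom ▷ Gu) ≫
      eqToHom (by simp only [hr, hG, Strict.assoc]))
    (elt : (lv ◁ thu.hom) ≫ eqToHom (by simp only [← Strict.assoc, hlr]) ≫
        (ru ◁ lamv.hom ▷ Gu) =
      eqToHom (Strict.assoc _ _ _).symm ≫ (lamv.hom ▷ Hu) ≫
        eqToHom (by simp only [Strict.assoc, hFH]) ≫ (thu.hom ▷ Fv) ≫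
        eqToHom (by simp only [Strict.assoc, hGF]))
    (eσ : σw.hom = eqToHom (by simp only [hF, Strict.assoc]) ≫ (Fv ◁ σu.hom) ≫
      eqToHom (by simp only [← Strict.assoc, hFH]) ≫ (Hu ◁ σv.hom) ≫
      eqToHom (by simp only [hH, Strict.assoc]))
    (eκ : κw.hom = eqToHom (by simp only [hG, Strict.assoc]) ≫ (Gv ◁ κu.hom) ≫
      eqToHom (Strict.assoc _ _ _).symm ≫ (κv.hom ▷ cu) ≫
      eqToHom (by simp only [hc, Strict.assoc]))
    (eσκ : (Gu ◁ σv.hom) ≫ eqToHom (by simp only [← Strict.assoc, hGH]) ≫ (Hv ◁ κu.hom) =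
      eqToHom (by simp only [← Strict.assoc, hGF]) ≫ (Fv ◁ κu.hom) ≫
        eqToHom (Strict.assoc _ _ _).symm ≫ (σv.hom ▷ cu) ≫ eqToHom (Strict.assoc _ _ _)) :
    (etaIso hdw lamw thw σw κw).hom =
      eqToHom (by simp only [hl, hdu, hdv, hdw, Strict.comp_id, Strict.assoc]) ≫
      (lv ◁ (etaIso hdu lamu thu σu κu).hom ▷ dv) ≫
      eqToHom (by simp only [hdv, Strict.comp_id]; simp only [← Strict.assoc, hlr]) ≫
      (ru ◁ (etaIso hdv lamv thv σv κv).hom ▷ cu) ≫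
      eqToHom (by simp only [hr, hc, Strict.assoc]) := by
  subst hdu hdv hdw hl hr hF hH hG hc
  have ex1 := congrArg (fun η => ru ◁ η) (whisker_exchange lamv.hom κu.hom)
  have ex2 := congrArg (fun η => ru ◁ η) (whisker_exchange thv.hom κu.hom)
  have ex3 := whisker_exchange lamv.hom σu.hom
  have ex4 := whisker_exchange thu.hom σv.hom
  replace elt := congrArg (· ▷ ω) elt
  replace eσκ := congrArg (fun η => ru ◁ j ◁ η) eσκ
  simp only [etaIso, elam, eth, eσ, eκ, Category.assoc, eqToHom_trans, eqToHom_trans_assoc, eqToHom_refl, Category.id_comp, Category.comp_id,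
    Bicategory.whiskerLeft_comp, Bicategory.comp_whiskerRight, whiskerLeft_eqToHom, Bicategory.whiskerLeft_id, Bicategory.id_whiskerRight,
    eqToHom_whiskerRight, Bicategory.comp_whiskerLeft, Bicategory.whiskerRight_comp,
    Bicategory.whisker_assoc, Bicategory.id_whiskerLeft, Bicategory.whiskerRight_id,
    leftUnitor_hom, leftUnitor_inv, associator_hom, associator_inv, rightUnitor_hom,
    rightUnitor_inv, Iso.trans_hom, eqToIso.hom, whiskerRightIso_hom, whiskerLeftIso_hom] at ex1 ex2 ex3 ex4 elt eσκ ⊢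
  simp only [Equivariant.swapL _ hlr, Category.assoc, eqToHom_trans, eqToHom_trans_assoc, eqToHom_refl, Category.id_comp, Category.comp_id,
    Bicategory.whiskerLeft_comp, Bicategory.comp_whiskerRight, whiskerLeft_eqToHom, Bicategory.whiskerLeft_id, Bicategory.id_whiskerRight,
    eqToHom_whiskerRight, Bicategory.comp_whiskerLeft, Bicategory.whiskerRight_comp,
    Bicategory.whisker_assoc, Bicategory.id_whiskerLeft, Bicategory.whiskerRight_id,
    leftUnitor_hom, leftUnitor_inv, associator_hom, associator_inv, rightUnitor_hom,
    rightUnitor_inv, Iso.trans_hom, eqToIso.hom, whiskerRightIso_hom, whiskerLeftIso_hom]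
  replace eσκ := eσκ.symm
  replace ex4 := ex4.symm
  try rw [eqToHom_comp_iff] at ex1; try simp only [← Category.assoc] at ex1
  try rw [comp_eqToHom_iff] at ex1
  try simp only [Category.assoc, eqToHom_trans, eqToHom_trans_assoc, eqToHom_refl, Category.id_comp, Category.comp_id] at ex1
  try rw [eqToHom_comp_iff] at ex2; try simp only [← Category.assoc] at ex2
  try rw [comp_eqToHom_iff] at ex2
  try simp only [Category.assoc, eqToHom_trans, eqToHom_trans_assoc, eqToHom_refl, Category.id_comp, Category.comp_id] at ex2
  try rw [eqToHom_comp_iff] at ex3; try simp only [← Category.assoc] at ex3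
  try rw [comp_eqToHom_iff] at ex3
  try simp only [Category.assoc, eqToHom_trans, eqToHom_trans_assoc, eqToHom_refl, Category.id_comp, Category.comp_id] at ex3
  try rw [eqToHom_comp_iff] at ex4; try simp only [← Category.assoc] at ex4
  try rw [comp_eqToHom_iff] at ex4
  try simp only [Category.assoc, eqToHom_trans, eqToHom_trans_assoc, eqToHom_refl, Category.id_comp, Category.comp_id] at ex4
  try rw [eqToHom_comp_iff] at elt; try simp only [← Category.assoc] at elt
  try rw [comp_eqToHom_iff] at elt
  try simp only [Category.assoc, eqToHom_trans, eqToHom_trans_assoc, eqToHom_refl, Category.id_comp, Category.comp_id] at elt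
  try rw [eqToHom_comp_iff] at eσκ; try simp only [← Category.assoc] at eσκ
  try rw [comp_eqToHom_iff] at eσκ
  try simp only [Category.assoc, eqToHom_trans, eqToHom_trans_assoc, eqToHom_refl, Category.id_comp, Category.comp_id] at eσκ
  rw [reassoc_of% ex1]; try simp only [Category.assoc, eqToHom_trans_assoc, eqToHom_refl, Category.id_comp]
  rw [reassoc_of% eσκ]; try simp only [Category.assoc, eqToHom_trans_assoc, eqToHom_refl, Category.id_comp]
  rw [reassoc_of% ex2]; try simp only [Category.assoc, eqToHom_trans_assoc, eqToHom_refl, Category.id_comp]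
  rw [reassoc_of% elt]; try simp only [Category.assoc, eqToHom_trans_assoc, eqToHom_refl, Category.id_comp]
  rw [reassoc_of% ex3]; try simp only [Category.assoc, eqToHom_trans_assoc, eqToHom_refl, Category.id_comp]
  rw [reassoc_of% ex4]; try simp only [Category.assoc, eqToHom_trans_assoc, eqToHom_refl, Category.id_comp]

end Eta

section EtaAux
variable {A O : M}

/-- Used for the structure 2-cells of `η`. -/
def thIso {r : A ⟶ A} {j p : A ⟶ O} {H G : O ⟶ O} (ν : j ≫ H ≅ r ≫ p) (μ : j ≫ G ≅ p) :
    j ≫ H ≅ r ≫ j ≫ G :=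
  ν ≪≫ whiskerLeftIso r μ.symm

theorem th_nat {ru rv : A ⟶ A} {j pu pv : A ⟶ O} {Hu Hv Gu Gv : O ⟶ O} {νu : j ≫ Hu ≅ ru ≫ pu}
    {μu : j ≫ Gu ≅ pu} {νv : j ≫ Hv ≅ rv ≫ pv} {μv : j ≫ Gv ≅ pv} {H : Hu ⟶ Hv} {G : Gu ⟶ Gv}
    {r : ru ⟶ rv} {π : pu ⟶ pv} (hν : (j ◁ H) ≫ νv.hom = νu.hom ≫ (r ▷ pu) ≫ (rv ◁ π))
    (hμ : (j ◁ G) ≫ μv.hom = μu.hom ≫ π) :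
    (j ◁ H) ≫ (thIso νv μv).hom = (thIso νu μu).hom ≫ (r ▷ (j ≫ Gu)) ≫ (rv ◁ j ◁ G) := by
  have h : π ≫ μv.inv = μu.inv ≫ (j ◁ G) := by
    rw [Iso.comp_inv_eq, Category.assoc, hμ, Iso.inv_hom_id_assoc]
  simp only [thIso, Iso.trans_hom, whiskerLeftIso_hom, Iso.symm_hom, Category.assoc]
  rw [reassoc_of% hν, ← Bicategory.whiskerLeft_comp, h, Bicategory.whiskerLeft_comp,
    whisker_exchange_assoc]

theorem th_mul {ru rv rw : A ⟶ A} {j pu pv pw : A ⟶ O} {Hu Hv Hw Gu Gv Gw : O ⟶ O}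
    {νu : j ≫ Hu ≅ ru ≫ pu} {μu : j ≫ Gu ≅ pu} {νv : j ≫ Hv ≅ rv ≫ pv} {μv : j ≫ Gv ≅ pv}
    {νw : j ≫ Hw ≅ rw ≫ pw} {μw : j ≫ Gw ≅ pw} (ν : pu ≫ Hv ≅ rv ≫ pw) (μ : pv ≫ Gu ≅ pw)
    (hr : rw = ru ≫ rv) (hH : Hw = Hu ≫ Hv) (hG : Gw = Gv ≫ Gu) (hGH : Gu ≫ Hv = Hv ≫ Gu)
    (e₁ : νw.hom = eqToHom (by rw [hH, Strict.assoc]) ≫ (νu.hom ▷ Hv) ≫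
      eqToHom (Strict.assoc _ _ _) ≫ (ru ◁ ν.hom) ≫ eqToHom (by rw [hr, Strict.assoc]))
    (e₂ : μw.hom = eqToHom (by rw [hG, Strict.assoc]) ≫ (μv.hom ▷ Gu) ≫ μ.hom)
    (e₃ : (μu.hom ▷ Hv) ≫ ν.hom = eqToHom (by simp only [Strict.assoc, hGH]) ≫ (νv.hom ▷ Gu) ≫
      eqToHom (Strict.assoc _ _ _) ≫ (rv ◁ μ.hom)) :
    (thIso νw μw).hom = eqToHom (by simp only [hH, Strict.assoc]) ≫ ((thIso νu μu).hom ▷ Hv) ≫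
      eqToHom (by simp only [Strict.assoc, hGH]) ≫ (ru ◁ (thIso νv μv).hom ▷ Gu) ≫
      eqToHom (by simp only [hr, hG, Strict.assoc]) := by
  subst hr hH hG
  have e₄ : (rv ◁ μ.inv) = ν.inv ≫ (μu.inv ▷ Hv) ≫
      eqToHom (by simp only [Strict.assoc, hGH]) ≫ (νv.hom ▷ Gu) ≫
      eqToHom (Strict.assoc _ _ _) := by
    rw [← cancel_epi ν.hom, ← cancel_epi (μu.hom ▷ Hv), reassoc_of% e₃]
    simp [← Bicategory.whiskerLeft_comp_assoc]
  have e₅ : μw = eqToIso (Strict.assoc _ _ _).symm ≪≫ whiskerRightIso μv Gu ≪≫ μ :=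
    Iso.ext (by simp [e₂])
  have e₆ : (ru ≫ rv) ◁ μ.inv = eqToHom (Strict.assoc _ _ _) ≫ (ru ◁ rv ◁ μ.inv) ≫
    eqToHom (Strict.assoc _ _ _).symm := by simp only [Category.assoc, eqToHom_trans, eqToHom_trans_assoc, eqToHom_refl, Category.id_comp, Category.comp_id,
    Bicategory.whiskerLeft_comp, Bicategory.comp_whiskerRight, whiskerLeft_eqToHom, Bicategory.whiskerLeft_id, Bicategory.id_whiskerRight,
    eqToHom_whiskerRight, Bicategory.comp_whiskerLeft, Bicategory.whiskerRight_comp,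
    Bicategory.whisker_assoc, Bicategory.id_whiskerLeft, Bicategory.whiskerRight_id,
    leftUnitor_hom, leftUnitor_inv, associator_hom, associator_inv, rightUnitor_hom,
    rightUnitor_inv, Iso.trans_hom, eqToIso.hom, whiskerRightIso_hom, whiskerLeftIso_hom]
  rw [e₅]
  simp only [thIso, e₁, Iso.trans_hom, whiskerLeftIso_hom, Iso.symm_hom, Iso.trans_inv,
    Bicategory.whiskerLeft_comp, e₆, e₄]
  simp [Category.assoc, eqToHom_trans, eqToHom_trans_assoc, eqToHom_refl, Category.id_comp, Category.comp_id,
    Bicategory.whiskerLeft_comp, Bicategory.comp_whiskerRight, whiskerLeft_eqToHom, Bicategory.whiskerLeft_id, Bicategory.id_whiskerRight,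
    eqToHom_whiskerRight, Bicategory.comp_whiskerLeft, Bicategory.whiskerRight_comp,
    Bicategory.whisker_assoc, Bicategory.id_whiskerLeft, Bicategory.whiskerRight_id,
    leftUnitor_hom, leftUnitor_inv, associator_hom, associator_inv, rightUnitor_hom,
    rightUnitor_inv, Iso.trans_hom, eqToIso.hom, whiskerRightIso_hom, whiskerLeftIso_hom]

theorem lam_th {ru lv : A ⟶ A} {j pu : A ⟶ O} {Hu Gu Fv : O ⟶ O}
    {νu : j ≫ Hu ≅ ru ≫ pu} {μu : j ≫ Gu ≅ pu} {ρv : j ≫ Fv ≅ lv ≫ j} (ρ : pu ≫ Fv ≅ lv ≫ pu)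
    (hlr : lv ≫ ru = ru ≫ lv) (hFH : Fv ≫ Hu = Hu ≫ Fv) (hGF : Gu ≫ Fv = Fv ≫ Gu)
    (f₁ : (ρv.hom ▷ Hu) ≫ eqToHom (Strict.assoc _ _ _) ≫ (lv ◁ νu.hom) =
      eqToHom (by simp only [Strict.assoc, hFH]) ≫ (νu.hom ▷ Fv) ≫ eqToHom (Strict.assoc _ _ _) ≫
        (ru ◁ ρ.hom) ≫ eqToHom (by simp only [← Strict.assoc, hlr]))
    (f₂ : (μu.hom ▷ Fv) ≫ ρ.hom = eqToHom (by simp only [Strict.assoc, hGF]) ≫ (ρv.hom ▷ Gu) ≫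
      eqToHom (Strict.assoc _ _ _) ≫ (lv ◁ μu.hom)) :
    (lv ◁ (thIso νu μu).hom) ≫ eqToHom (by simp only [← Strict.assoc, hlr]) ≫
        (ru ◁ ρv.symm.hom ▷ Gu) =
      eqToHom (Strict.assoc _ _ _).symm ≫ (ρv.symm.hom ▷ Hu) ≫
        eqToHom (by simp only [Strict.assoc, hFH]) ≫ ((thIso νu μu).hom ▷ Fv) ≫
        eqToHom (by simp only [Strict.assoc, hGF]) := by
  have g₂ : (lv ◁ μu.inv) = eqToHom rfl ≫ ρ.inv ≫ (μu.inv ▷ Fv) ≫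
      eqToHom (by simp only [Strict.assoc, hGF]) ≫ (ρv.hom ▷ Gu) ≫
      eqToHom (Strict.assoc _ _ _) := by
    rw [eqToHom_refl, Category.id_comp, ← cancel_epi ρ.hom, ← cancel_epi (μu.hom ▷ Fv),
      reassoc_of% f₂]
    simp [← Bicategory.whiskerLeft_comp]
  rw [← cancel_epi ((ρv.hom ▷ Hu) ≫ eqToHom (Strict.assoc _ _ _))]
  simp only [thIso, Iso.trans_hom, whiskerLeftIso_hom, Iso.symm_hom, Bicategory.whiskerLeft_comp,
    Category.assoc, Equivariant.swapL _ hlr, g₂]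
  rw [reassoc_of% f₁]
  simp [Category.assoc, eqToHom_trans, eqToHom_trans_assoc, eqToHom_refl, Category.id_comp, Category.comp_id,
    Bicategory.whiskerLeft_comp, Bicategory.comp_whiskerRight, whiskerLeft_eqToHom, Bicategory.whiskerLeft_id, Bicategory.id_whiskerRight,
    eqToHom_whiskerRight, Bicategory.comp_whiskerLeft, Bicategory.whiskerRight_comp,
    Bicategory.whisker_assoc, Bicategory.id_whiskerLeft, Bicategory.whiskerRight_id,
    leftUnitor_hom, leftUnitor_inv, associator_hom, associator_inv, rightUnitor_hom,
    rightUnitor_inv, Iso.trans_hom, eqToIso.hom, whiskerRightIso_hom, whiskerLeftIso_hom]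

end EtaAux

namespace Copowering

variable [StrictMonoidal I] (P : Copowering V I M)

/-- The underlying functor of the unit of the copower. -/
abbrev ι (A : M) : I ⥤ (A ⟶ P.obj A) := underlying V (P.unit A)

/-- The 2-cells `nat` with the target index in the form `i'`. -/
def ntr {A B : M} (a b : I) (g : A ⟶ B) {i i' : I} (h : a ⊛ i ⊛ b = i') :
    (P.ι A).obj i ≫ P.map a b g ≅ g ≫ (P.ι B).obj i' :=
  P.nat a b g i ≪≫ eqToIso (by rw [← h])

/-- The 2-cells `nat` for identity 1-cells. -/
def ntrId (A : M) (a b : I) {i i' : I} (h : a ⊛ i ⊛ b = i') :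
    (P.ι A).obj i ≫ P.map a b (𝟙 A) ≅ (P.ι A).obj i' :=
  P.ntr a b (𝟙 A) h ≪≫ eqToIso (Strict.id_comp _)

theorem ntr_natural {A B : M} {a a' b b' i i' k k' : I} {g g' : A ⟶ B} {h : a ⊛ i ⊛ b = k}
    {h' : a' ⊛ i' ⊛ b' = k'} (p : a ⟶ a') (q : b ⟶ b') (θ : g ⟶ g') (f : i ⟶ i') (f' : k ⟶ k')
    (hf : (p ⊛ₘ f ⊛ₘ q) ≫ eqToHom h' = eqToHom h ≫ f') :
    ((P.ι A).map f ▷ P.map a b g) ≫ ((P.ι A).obj i' ◁ P.map₂ p q θ) ≫ (P.ntr a' b' g' h').hom =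
      (P.ntr a b g h).hom ≫ (θ ▷ (P.ι B).obj k) ≫ (g' ◁ (P.ι B).map f') := by
  subst h h'
  have := P.nat_natural p q θ f
  simp only [eqToHom_refl, Category.comp_id, Category.id_comp] at hf
  subst hf
  simpa [ntr, ι] using this

theorem ntr_comp {A B C : M} {a b a' b' a'' b'' i i' i'' : I} {g : A ⟶ B} {g' : B ⟶ C} {g'' : A ⟶ C}
    (h : a ⊛ i ⊛ b = i') (h' : a' ⊛ i' ⊛ b' = i'') (h'' : a'' ⊛ i ⊛ b'' = i'') (ha : a'' = a' ⊛ a)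
    (hb : b'' = b ⊛ b') (hg : g'' = g ≫ g') :
    (P.ntr a'' b'' g'' h'').hom =
      eqToHom (by rw [P.map_comp_eq ha hb hg, Strict.assoc]) ≫
        ((P.ntr a b g h).hom ▷ P.map a' b' g') ≫ eqToHom (Strict.assoc _ _ _) ≫
        (g ◁ (P.ntr a' b' g' h').hom) ≫ eqToHom (by rw [hg, Strict.assoc]) := by
  subst ha hb hg h h'
  simp only [ntr, Iso.trans_hom, nat_comp]
  simp

theorem ntr_swap {A B B' C : M} {a₁ b₁ a₂ b₂ a₃ b₃ a₄ b₄ i j k l : I} {g₁ : A ⟶ B} {g₂ : B ⟶ C}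
    {g₃ : A ⟶ B'} {g₄ : B' ⟶ C} (h₁ : a₁ ⊛ i ⊛ b₁ = j) (h₂ : a₂ ⊛ j ⊛ b₂ = l)
    (h₃ : a₃ ⊛ i ⊛ b₃ = k) (h₄ : a₄ ⊛ k ⊛ b₄ = l) (ha : a₂ ⊛ a₁ = a₄ ⊛ a₃)
    (hb : b₁ ⊛ b₂ = b₃ ⊛ b₄) (hg : g₁ ≫ g₂ = g₃ ≫ g₄) :
    ((P.ntr a₁ b₁ g₁ h₁).hom ▷ P.map a₂ b₂ g₂) ≫ eqToHom (Strict.assoc _ _ _) ≫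
        (g₁ ◁ (P.ntr a₂ b₂ g₂ h₂).hom) =
      eqToHom (by simp only [Strict.assoc, map_comp, ha, hb, hg]) ≫
        ((P.ntr a₃ b₃ g₃ h₃).hom ▷ P.map a₄ b₄ g₄) ≫ eqToHom (Strict.assoc _ _ _) ≫
        (g₃ ◁ (P.ntr a₄ b₄ g₄ h₄).hom) ≫ eqToHom (by simp only [← Strict.assoc, hg]) := by
  have h : (a₂ ⊛ a₁) ⊛ i ⊛ (b₁ ⊛ b₂) = l := by
    rw [← h₂, ← h₁]; simp only [StrictMonoidal.tensor_assoc]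
  have e₁ := P.ntr_comp (g := g₁) (g' := g₂) h₁ h₂ h rfl rfl rfl
  have e₂ := P.ntr_comp h₃ h₄ h ha hb hg
  rw [e₁, eqToHom_comp_iff] at e₂
  simp only [← Category.assoc] at e₂
  rw [comp_eqToHom_iff] at e₂
  simpa using e₂

theorem ntrId_ntr {A B : M} {a₁ b₁ a₂ b₂ i j k l : I} {g : A ⟶ B} (h₁ : a₁ ⊛ i ⊛ b₁ = j)
    (h₂ : a₂ ⊛ j ⊛ b₂ = l) (h₃ : a₂ ⊛ i ⊛ b₂ = k) (h₄ : a₁ ⊛ k ⊛ b₁ = l) (ha : a₂ ⊛ a₁ = a₁ ⊛ a₂)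
    (hb : b₁ ⊛ b₂ = b₂ ⊛ b₁) :
    ((P.ntrId A a₁ b₁ h₁).hom ▷ P.map a₂ b₂ g) ≫ (P.ntr a₂ b₂ g h₂).hom =
      eqToHom (by simp only [Strict.assoc, map_comp, ha, hb, Strict.id_comp, Strict.comp_id]) ≫
        ((P.ntr a₂ b₂ g h₃).hom ▷ P.map a₁ b₁ (𝟙 B)) ≫ eqToHom (Strict.assoc _ _ _) ≫
        (g ◁ (P.ntrId B a₁ b₁ h₄).hom) := by
  have e := P.ntr_swap h₁ h₂ h₃ h₄ ha hb ((Strict.id_comp g).trans (Strict.comp_id g).symm)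
  simp only [Category.assoc, eqToHom_trans, eqToHom_trans_assoc, eqToHom_refl, Category.id_comp, Category.comp_id,
    Bicategory.whiskerLeft_comp, Bicategory.comp_whiskerRight, whiskerLeft_eqToHom, Bicategory.whiskerLeft_id, Bicategory.id_whiskerRight,
    eqToHom_whiskerRight, Bicategory.comp_whiskerLeft, Bicategory.whiskerRight_comp,
    Bicategory.whisker_assoc, Bicategory.id_whiskerLeft, Bicategory.whiskerRight_id,
    leftUnitor_hom, leftUnitor_inv, associator_hom, associator_inv, rightUnitor_hom,
    rightUnitor_inv, Iso.trans_hom, eqToIso.hom, whiskerRightIso_hom, whiskerLeftIso_hom] at e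
  simp only [ntrId, Category.assoc, eqToHom_trans, eqToHom_trans_assoc, eqToHom_refl, Category.id_comp, Category.comp_id,
    Bicategory.whiskerLeft_comp, Bicategory.comp_whiskerRight, whiskerLeft_eqToHom, Bicategory.whiskerLeft_id, Bicategory.id_whiskerRight,
    eqToHom_whiskerRight, Bicategory.comp_whiskerLeft, Bicategory.whiskerRight_comp,
    Bicategory.whisker_assoc, Bicategory.id_whiskerLeft, Bicategory.whiskerRight_id,
    leftUnitor_hom, leftUnitor_inv, associator_hom, associator_inv, rightUnitor_hom,
    rightUnitor_inv, Iso.trans_hom, eqToIso.hom, whiskerRightIso_hom, whiskerLeftIso_hom]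
  simp only [← Category.assoc] at e ⊢
  rw [comp_eqToHom_iff] at e
  rw [e]
  simp

theorem ntrId_comp {A : M} {a b a' b' a'' b'' i i' i'' : I} (h : a ⊛ i ⊛ b = i')
    (h' : a' ⊛ i' ⊛ b' = i'') (h'' : a'' ⊛ i ⊛ b'' = i'') (ha : a'' = a' ⊛ a) (hb : b'' = b ⊛ b') :
    (P.ntrId A a'' b'' h'').hom =
      eqToHom (by rw [P.map_comp_eq ha hb (Strict.comp_id (𝟙 A)).symm, Strict.assoc]) ≫
        ((P.ntrId A a b h).hom ▷ P.map a' b' (𝟙 A)) ≫ (P.ntrId A a' b' h').hom := by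
  simp only [ntrId, P.ntr_comp h h' h'' ha hb (Strict.comp_id (𝟙 A)).symm, Category.assoc, eqToHom_trans, eqToHom_trans_assoc, eqToHom_refl, Category.id_comp, Category.comp_id,
    Bicategory.whiskerLeft_comp, Bicategory.comp_whiskerRight, whiskerLeft_eqToHom, Bicategory.whiskerLeft_id, Bicategory.id_whiskerRight,
    eqToHom_whiskerRight, Bicategory.comp_whiskerLeft, Bicategory.whiskerRight_comp,
    Bicategory.whisker_assoc, Bicategory.id_whiskerLeft, Bicategory.whiskerRight_id,
    leftUnitor_hom, leftUnitor_inv, associator_hom, associator_inv, rightUnitor_hom,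
    rightUnitor_inv, Iso.trans_hom, eqToIso.hom, whiskerRightIso_hom, whiskerLeftIso_hom]

theorem ntrId_natural {A : M} {a a' b b' i k k' : I} {h : a ⊛ i ⊛ b = k}
    {h' : a' ⊛ i ⊛ b' = k'} (p : a ⟶ a') (q : b ⟶ b') (f' : k ⟶ k')
    (hf : (p ⊛ₘ 𝟙 i ⊛ₘ q) ≫ eqToHom h' = eqToHom h ≫ f') :
    ((P.ι A).obj i ◁ P.map₂ p q (𝟙 (𝟙 A))) ≫ (P.ntrId A a' b' h').hom =
      (P.ntrId A a b h).hom ≫ (P.ι A).map f' := by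
  have e := P.ntr_natural p q (𝟙 (𝟙 A)) (𝟙 i) f' hf
  simp only [CategoryTheory.Functor.map_id, Category.assoc, eqToHom_trans, eqToHom_trans_assoc, eqToHom_refl, Category.id_comp, Category.comp_id,
    Bicategory.whiskerLeft_comp, Bicategory.comp_whiskerRight, whiskerLeft_eqToHom, Bicategory.whiskerLeft_id, Bicategory.id_whiskerRight,
    eqToHom_whiskerRight, Bicategory.comp_whiskerLeft, Bicategory.whiskerRight_comp,
    Bicategory.whisker_assoc, Bicategory.id_whiskerLeft, Bicategory.whiskerRight_id,
    leftUnitor_hom, leftUnitor_inv, associator_hom, associator_inv, rightUnitor_hom,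
    rightUnitor_inv, Iso.trans_hom, eqToIso.hom, whiskerRightIso_hom, whiskerLeftIso_hom] at e
  simp only [ntrId, Category.assoc, eqToHom_trans, eqToHom_trans_assoc, eqToHom_refl, Category.id_comp, Category.comp_id,
    Bicategory.whiskerLeft_comp, Bicategory.comp_whiskerRight, whiskerLeft_eqToHom, Bicategory.whiskerLeft_id, Bicategory.id_whiskerRight,
    eqToHom_whiskerRight, Bicategory.comp_whiskerLeft, Bicategory.whiskerRight_comp,
    Bicategory.whisker_assoc, Bicategory.id_whiskerLeft, Bicategory.whiskerRight_id,
    leftUnitor_hom, leftUnitor_inv, associator_hom, associator_inv, rightUnitor_hom,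
    rightUnitor_inv, Iso.trans_hom, eqToIso.hom, whiskerRightIso_hom, whiskerLeftIso_hom]
  rw [reassoc_of% e]
  simp

theorem ntr_id {A : M} {a b i k : I} {g : A ⟶ A} (ha : a = e[I]) (hb : b = e[I]) (hg : g = 𝟙 A)
    (h : a ⊛ i ⊛ b = k) (h') : (P.ntr a b g h).hom = eqToHom h' := by
  subst ha hb hg h
  simp [ntr, P.nat_id]

end Copowering

/-- The action on `Y` that survives in an object with trivial `Side.passive`. -/
def Side.active : (s : Side) → (Y : IObj V I M) → I ⥤ (Y.carrier ⟶ Y.carrier)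
  | .r, Y => Y.L
  | .l, Y => Y.R

/-- The action of `Y` on the given side. -/
def Side.passive : (s : Side) → (Y : IObj V I M) → I ⥤ (Y.carrier ⟶ Y.carrier)
  | .r, Y => Y.R
  | .l, Y => Y.L

/-- The product in `I` that makes `Side.active` contravariantly multiplicative. -/
def Side.mul : Side → I → I → I
  | .r, x, y => x ⊛ y
  | .l, x, y => y ⊛ x

theorem Side.active_mul (s : Side) (Y : IObj V I M) (x y : I) :
    (s.active Y).obj (s.mul x y) = (s.active Y).obj y ≫ (s.active Y).obj x := by
  cases s
  · exact Y.strict.R_mul y x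
  · exact Y.strict.L_mul x y

theorem Side.active_one (s : Side) (Y : IObj V I M) :
    (s.active Y).obj (e[I]) = 𝟙 Y.carrier := by
  cases s
  · exact Y.strict.R_one
  · exact Y.strict.L_one

section CoInvariants

variable [StrictMonoidal I] (P : Copowering V I M)

namespace Copowering

theorem outer_one (s : Side) (X : IObj V I M) : (P.outer s X).obj (e[I]) = 𝟙 _ := by
  cases s <;> exact P.map_id _

theorem outer_mul (s : Side) (X : IObj V I M) (x y : I) :
    (P.outer s X).obj (s.mul x y) = (P.outer s X).obj y ≫ (P.outer s X).obj x := by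
  cases s
  · exact P.map_comp_eq one_one rfl (Strict.id_comp _).symm
  · exact P.map_comp_eq rfl one_one (Strict.id_comp _).symm

theorem outer_upsL (s : Side) (X : IObj V I M) (x u : I) :
    (P.outer s X).obj x ≫ (P.upsL s X).obj u = (P.upsL s X).obj u ≫ (P.outer s X).obj x := by
  have h : ∀ g : X.carrier ⟶ X.carrier, 𝟙 _ ≫ g = g ≫ 𝟙 _ := fun g => by simp [Strict.id_comp, Strict.comp_id]
  cases s
  · exact (P.map_comp _ _ _ _ _ _).trans (P.map_comp_eq (one_comm u).symm (one_comm x).symm (h _))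
  · exact (P.map_comp _ _ _ _ _ _).trans (P.map_comp_eq (one_comm x) rfl (h _))

theorem outer_upsR (s : Side) (X : IObj V I M) (x u : I) :
    (P.outer s X).obj x ≫ (P.upsR s X).obj u = (P.upsR s X).obj u ≫ (P.outer s X).obj x := by
  have h : ∀ g : X.carrier ⟶ X.carrier, 𝟙 _ ≫ g = g ≫ 𝟙 _ := fun g => by simp [Strict.id_comp, Strict.comp_id]
  cases s
  · exact (P.map_comp _ _ _ _ _ _).trans (P.map_comp_eq rfl (one_comm x).symm (h _))
  · exact (P.map_comp _ _ _ _ _ _).trans (P.map_comp_eq (one_comm x) (one_comm u) (h _))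

end Copowering

/-- The coinvariants `coInv_s X`: a weak coend of the biaction `Υ` on `I ⊙ X`, with the strict action of
`I` induced by the remaining action on `I ⊙ X`. -/
structure CoInv (s : Side) (X : IObj V I M) where
  obj : IObj V I M
  trivial : IsTrivial (s.passive obj)
  cowedge : Cowedge (P.ups_strict s X) obj.carrier
  universal : IsWeakCoend V cowedge
  /-- The action on `obj` is induced by the remaining action on the copower. -/
  κ (x : I) : (P.outer s X).obj x ≫ cowedge.leg ≅ cowedge.leg ≫ (s.active obj).obj x
  κ_natural {x y : I} (f : x ⟶ y) :
    ((P.outer s X).map f ▷ cowedge.leg) ≫ (κ y).hom =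
      (κ x).hom ≫ (cowedge.leg ◁ (s.active obj).map f)
  κ_one : (κ (e[I])).hom = eqToHom (by
    rw [P.outer_one, s.active_one, Strict.id_comp, Strict.comp_id])
  κ_mul (x y : I) : (κ (s.mul x y)).hom =
    eqToHom (by rw [P.outer_mul, Strict.assoc]) ≫ ((P.outer s X).obj y ◁ (κ x).hom) ≫
      eqToHom (Strict.assoc _ _ _).symm ≫ ((κ y).hom ▷ (s.active obj).obj x) ≫
      eqToHom (by rw [s.active_mul, Strict.assoc])
  κ_σ (x u : I) :
    ((P.outer s X).obj x ◁ (cowedge.σ u).hom) ≫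
        eqToHom (by rw [← Strict.assoc, P.outer_upsR, Strict.assoc]) ≫
        ((P.upsR s X).obj u ◁ (κ x).hom) =
      eqToHom (by rw [← Strict.assoc, P.outer_upsL, Strict.assoc]) ≫
        ((P.upsL s X).obj u ◁ (κ x).hom) ≫ eqToHom (Strict.assoc _ _ _).symm ≫
        ((cowedge.σ u).hom ▷ (s.active obj).obj x) ≫ eqToHom (Strict.assoc _ _ _)

namespace CoInv

variable {P} {X : IObj V I M}

theorem one_tensor_one (u : I) : e[I] ⊛ u ⊛ e[I] = u := by
  rw [StrictMonoidal.one_tensor, StrictMonoidal.tensor_one]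

theorem one_one_tensor (u : I) : e[I] ⊛ e[I] ⊛ u = u := by
  rw [StrictMonoidal.one_tensor, StrictMonoidal.one_tensor]

theorem tensor_one_one (u : I) : u ⊛ e[I] ⊛ e[I] = u := by
  rw [StrictMonoidal.tensor_one, StrictMonoidal.tensor_one]

variable (P) in
/-- `g ≫ ι 1 ≅ ι 1 ≫ (id ⊙ g)`. -/
def lam {A B : M} (g : A ⟶ B) :
    g ≫ (P.ι B).obj (e[I]) ≅ (P.ι A).obj (e[I]) ≫ P.map (e[I]) (e[I]) g :=
  (P.ntr (e[I]) (e[I]) g (one_one_tensor _)).symm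

variable (P) in
/-- `ι 1 ≫ ((a ⊗ - ⊗ b) ⊙ g) ≅ g ≫ ι w ≅ g ≫ ι 1 ≫ ((a' ⊗ - ⊗ b') ⊙ id)` for `a ⊗ b = w = a' ⊗ b'`. -/
def th {A : M} (a b a' b' : I) {w : I} (h : a ⊛ e[I] ⊛ b = w) (h' : a' ⊛ e[I] ⊛ b' = w) (g : A ⟶ A) :
    (P.ι A).obj (e[I]) ≫ P.map a b g ≅ g ≫ (P.ι A).obj (e[I]) ≫ P.map a' b' (𝟙 A) :=
  thIso (P.ntr a b g h) (P.ntrId A a' b' h')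

theorem lam_nat {A B : M} {g g' : A ⟶ B} (θ : g ⟶ g') :
    (θ ▷ (P.ι B).obj (e[I])) ≫ (lam P g').hom =
      (lam P g).hom ≫ ((P.ι A).obj (e[I]) ◁ P.map₂ (𝟙 (e[I])) (𝟙 (e[I])) θ) := by
  have e := P.ntr_natural (h := one_one_tensor (e[I])) (h' := one_one_tensor (e[I])) (𝟙 (e[I]))
    (𝟙 (e[I])) θ (𝟙 (e[I])) (𝟙 (e[I])) (by simp)
  simp only [CategoryTheory.Functor.map_id, Bicategory.id_whiskerRight, Category.id_comp,
    Bicategory.whiskerLeft_id, Category.comp_id] at e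
  simp only [lam, Iso.symm_hom]
  rw [Iso.eq_inv_comp, ← reassoc_of% e]
  simp

theorem lam_one {A : M} {g : A ⟶ A} (hg : g = 𝟙 A) (h) : (lam P g).hom = eqToHom h :=
  Equivariant.inv_eq_eqToHom (P.ntr_id rfl rfl hg _ h.symm)

theorem lam_mul {A B C : M} {g : A ⟶ B} {g' : B ⟶ C} {g'' : A ⟶ C} (h : g'' = g ≫ g')
    (hF : P.map (e[I]) (e[I]) g'' = P.map (e[I]) (e[I]) g ≫ P.map (e[I]) (e[I]) g') :
    (lam P g'').hom = eqToHom (by rw [h, Strict.assoc]) ≫ (g ◁ (lam P g').hom) ≫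
      eqToHom (Strict.assoc _ _ _).symm ≫ ((lam P g).hom ▷ P.map (e[I]) (e[I]) g') ≫
      eqToHom (by rw [hF, Strict.assoc]) := by
  have e := P.ntr_comp (one_one_tensor (e[I])) (one_one_tensor (e[I])) (one_one_tensor (e[I]))
    Copowering.one_one Copowering.one_one h
  have e' : P.ntr (e[I]) (e[I]) g'' (one_one_tensor (e[I])) =
      eqToIso (by rw [hF, Strict.assoc]) ≪≫ whiskerRightIso (P.ntr (e[I]) (e[I]) g (one_one_tensor (e[I]))) _ ≪≫ eqToIso (Strict.assoc _ _ _) ≪≫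
      whiskerLeftIso g (P.ntr (e[I]) (e[I]) g' (one_one_tensor (e[I]))) ≪≫ eqToIso (by rw [h, Strict.assoc]) :=
    Iso.ext (by simp [e])
  simp only [lam, e']
  simp

theorem th_natural {A : M} {a₁ b₁ a₁' b₁' a₂ b₂ a₂' b₂' w₁ w₂ : I} {h₁ : a₁ ⊛ e[I] ⊛ b₁ = w₁}
    {h₁' : a₁' ⊛ e[I] ⊛ b₁' = w₁} {h₂ : a₂ ⊛ e[I] ⊛ b₂ = w₂} {h₂' : a₂' ⊛ e[I] ⊛ b₂' = w₂}
    (p : a₁ ⟶ a₂) (q : b₁ ⟶ b₂) (p' : a₁' ⟶ a₂') (q' : b₁' ⟶ b₂') (f : w₁ ⟶ w₂)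
    (hf : (p ⊛ₘ 𝟙 (e[I]) ⊛ₘ q) ≫ eqToHom h₂ = eqToHom h₁ ≫ f)
    (hf' : (p' ⊛ₘ 𝟙 (e[I]) ⊛ₘ q') ≫ eqToHom h₂' = eqToHom h₁' ≫ f) {g g' : A ⟶ A} (θ : g ⟶ g') :
    ((P.ι A).obj (e[I]) ◁ P.map₂ p q θ) ≫ (th P a₂ b₂ a₂' b₂' h₂ h₂' g').hom =
      (th P a₁ b₁ a₁' b₁' h₁ h₁' g).hom ≫ (θ ▷ ((P.ι A).obj (e[I]) ≫ P.map a₁' b₁' (𝟙 A))) ≫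
        (g' ◁ (P.ι A).obj (e[I]) ◁ P.map₂ p' q' (𝟙 (𝟙 A))) := by
  refine th_nat (π := (P.ι A).map f) ?_ (P.ntrId_natural p' q' f hf')
  simpa using P.ntr_natural p q θ (𝟙 (e[I])) f hf

theorem th_one {A : M} {a b a' b' w : I} (ha : a = e[I]) (hb : b = e[I]) (ha' : a' = e[I])
    (hb' : b' = e[I]) {g : A ⟶ A} (hg : g = 𝟙 A) (h : a ⊛ e[I] ⊛ b = w)
    (h' : a' ⊛ e[I] ⊛ b' = w) : (th P a b a' b' h h' g).hom = eqToHom (by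
      rw [ha, hb, ha', hb', hg, P.map_id, Strict.comp_id, Strict.id_comp]) := by
  have e₁ := P.ntr_id (A := A) (k := w) ha hb hg h
    (by rw [ha, hb, hg, P.map_id, Strict.comp_id, Strict.id_comp, ← h, ha, hb, one_one_tensor])
  have e₂ := Equivariant.inv_eq_eqToHom (P.ntr_id (A := A) (k := w) ha' hb' rfl h'
    (by rw [ha', hb', P.map_id, Strict.comp_id, Strict.id_comp, ← h, ha, hb, one_one_tensor]))
  simp [th, thIso, Copowering.ntrId, e₁, e₂]

theorem th_mult {A : M} {au bu au' bu' wu av bv av' bv' wv aw bw aw' bw' w : I} {ru rv rw : A ⟶ A}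
    {hu : au ⊛ e[I] ⊛ bu = wu} {hu' : au' ⊛ e[I] ⊛ bu' = wu} {hv : av ⊛ e[I] ⊛ bv = wv}
    {hv' : av' ⊛ e[I] ⊛ bv' = wv} {hw : aw ⊛ e[I] ⊛ bw = w} {hw' : aw' ⊛ e[I] ⊛ bw' = w}
    (h : av ⊛ wu ⊛ bv = w) (h' : au' ⊛ wv ⊛ bu' = w) (ha : aw = av ⊛ au) (hb : bw = bu ⊛ bv)
    (ha' : aw' = au' ⊛ av') (hb' : bw' = bv' ⊛ bu') (hac : av ⊛ au' = au' ⊛ av)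
    (hbc : bu' ⊛ bv = bv ⊛ bu') (hr : rw = ru ≫ rv)
    (hH : P.map aw bw rw = P.map au bu ru ≫ P.map av bv rv)
    (hG : P.map aw' bw' (𝟙 A) = P.map av' bv' (𝟙 A) ≫ P.map au' bu' (𝟙 A))
    (hGH : P.map au' bu' (𝟙 A) ≫ P.map av bv rv = P.map av bv rv ≫ P.map au' bu' (𝟙 A)) :
    (th P aw bw aw' bw' hw hw' rw).hom =
      eqToHom (by simp only [hH, Strict.assoc]) ≫ ((th P au bu au' bu' hu hu' ru).hom ▷ P.map av bv rv) ≫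
        eqToHom (by simp only [Strict.assoc, hGH]) ≫
        (ru ◁ (th P av bv av' bv' hv hv' rv).hom ▷ P.map au' bu' (𝟙 A)) ≫
        eqToHom (by simp only [hr, hG, Strict.assoc]) :=
  th_mul (P.ntr av bv rv h) (P.ntrId A au' bu' h') hr hH hG hGH
    (P.ntr_comp _ _ _ ha hb hr) (P.ntrId_comp _ _ _ ha' hb') (P.ntrId_ntr _ _ _ _ hac hbc)

theorem lam_th_comm {A : M} {a b a' b' w : I} {h : a ⊛ e[I] ⊛ b = w} {h' : a' ⊛ e[I] ⊛ b' = w}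
    {r l : A ⟶ A} (hlr : l ≫ r = r ≫ l)
    (hFH : P.map (e[I]) (e[I]) l ≫ P.map a b r = P.map a b r ≫ P.map (e[I]) (e[I]) l)
    (hGF : P.map a' b' (𝟙 A) ≫ P.map (e[I]) (e[I]) l =
      P.map (e[I]) (e[I]) l ≫ P.map a' b' (𝟙 A)) :
    (l ◁ (th P a b a' b' h h' r).hom) ≫ eqToHom (by simp only [← Strict.assoc, hlr]) ≫
        (r ◁ (lam P l).hom ▷ P.map a' b' (𝟙 A)) =
      eqToHom (Strict.assoc _ _ _).symm ≫ ((lam P l).hom ▷ P.map a b r) ≫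
        eqToHom (by simp only [Strict.assoc, hFH]) ≫
        ((th P a b a' b' h h' r).hom ▷ P.map (e[I]) (e[I]) l) ≫
        eqToHom (by simp only [Strict.assoc, hGF]) :=
  lam_th (P.ntr (e[I]) (e[I]) l (one_tensor_one w)) hlr hFH hGF
    (P.ntr_swap _ h h _ (Copowering.one_comm a).symm (Copowering.one_comm b) hlr)
    (P.ntrId_ntr _ _ _ _ (Copowering.one_comm a') (Copowering.one_comm b').symm)

theorem one_one_tensorHom {u v : I} (f : u ⟶ v) :
    (𝟙 (e[I]) ⊛ₘ 𝟙 (e[I]) ⊛ₘ f) ≫ eqToHom (one_one_tensor v) = eqToHom (one_one_tensor u) ≫ f := by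
  have h := fun {a b : I} (f : a ⟶ b) => (comp_eqToHom_iff _ _ _).mp (Copowering.one_tensorHom f)
  rw [h, h]; simp

theorem tensor_one_oneHom {u v : I} (f : u ⟶ v) :
    (f ⊛ₘ 𝟙 (e[I]) ⊛ₘ 𝟙 (e[I])) ≫ eqToHom (tensor_one_one v) = eqToHom (tensor_one_one u) ≫ f := by
  have h := (comp_eqToHom_iff _ _ _).mp (Copowering.tensorHom_one f)
  have e : ∀ {a : I} (_ : e[I] = a), (f ⊛ₘ 𝟙 a) = eqToHom (by congr 1; exact ‹e[I] = a›.symm) ≫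
      (f ⊛ₘ 𝟙 (e[I])) ≫ eqToHom (by congr 1) := by
    intro a ha; subst ha; simp
  rw [MonoidalCategory.id_tensorHom_id, e Copowering.one_one, h]
  simp

theorem σ_symm_natural (c : CoInv P .l X) {u v : I} (f : u ⟶ v) :
    ((P.upsR .l X).map f ▷ c.cowedge.leg) ≫ (c.cowedge.σ v).symm.hom =
      (c.cowedge.σ u).symm.hom ≫ ((P.upsL .l X).map f ▷ c.cowedge.leg) := by
  simp only [Iso.symm_hom]
  rw [Iso.comp_inv_eq, Category.assoc, c.cowedge.natural f, Iso.inv_hom_id_assoc]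

theorem σ_symm_mul (c : CoInv P .l X) (u v : I) : (c.cowedge.σ (u ⊛ v)).symm.hom =
    eqToHom (by rw [(P.ups_strict .l X).R_mul, Strict.assoc]) ≫
    ((P.upsR .l X).obj u ◁ (c.cowedge.σ v).symm.hom) ≫
    eqToHom (by rw [← Strict.assoc, ← (P.ups_strict .l X).comm, Strict.assoc]) ≫
    ((P.upsL .l X).obj v ◁ (c.cowedge.σ u).symm.hom) ≫
    eqToHom (by rw [(P.ups_strict .l X).L_mul, Strict.assoc]) := by
  have h : c.cowedge.σ (u ⊛ v) = eqToIso (by rw [(P.ups_strict .l X).L_mul, Strict.assoc]) ≪≫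
      whiskerLeftIso _ (c.cowedge.σ u) ≪≫
      eqToIso (by rw [← Strict.assoc, (P.ups_strict .l X).comm, Strict.assoc]) ≪≫
      whiskerLeftIso _ (c.cowedge.σ v) ≪≫
      eqToIso (by rw [(P.ups_strict .l X).R_mul, Strict.assoc]) :=
    Iso.ext (by simp [c.cowedge.mul])
  rw [h]; simp

theorem κ_σ_symm (c : CoInv P .l X) (x u : I) :
    ((P.outer .l X).obj x ◁ (c.cowedge.σ u).symm.hom) ≫
        eqToHom (by rw [← Strict.assoc, P.outer_upsL, Strict.assoc]) ≫
        ((P.upsL .l X).obj u ◁ (c.κ x).hom) =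
      eqToHom (by rw [← Strict.assoc, P.outer_upsR, Strict.assoc]) ≫
        ((P.upsR .l X).obj u ◁ (c.κ x).hom) ≫ eqToHom (Strict.assoc _ _ _).symm ≫
        ((c.cowedge.σ u).symm.hom ▷ (Side.l.active c.obj).obj x) ≫
        eqToHom (Strict.assoc _ _ _) := by
  rw [← cancel_epi ((P.outer .l X).obj x ◁ (c.cowedge.σ u).hom), reassoc_of% (c.κ_σ x u)]
  simp

/-- The unit `η_r : X → coInv_r X`. -/
def ηr (c : CoInv P .r X) : Equivariant X c.obj where
  hom := (P.ι X.carrier).obj (e[I]) ≫ c.cowedge.leg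
  τ u := etaIso (c.trivial.obj_eq u) (lam P (X.L.obj u))
    (th P (e[I]) u u (e[I]) (one_one_tensor u) (tensor_one_one u) (X.R.obj u)) (c.cowedge.σ u) (c.κ u)
  natural {u v} f := eta_nat _ _ (X.L.map f) (X.R.map f) ((P.upsL .r X).map f)
    ((P.upsR .r X).map f) ((P.outer .r X).map f) _ (c.obj.L.map f) (c.trivial.map_eq f)
    (lam_nat _) (c.cowedge.natural f)
    (th_natural _ _ _ _ f (one_one_tensorHom f) (tensor_one_oneHom f) _) (c.κ_natural f)
  one := eta_one _ (lam_one X.strict.L_one (by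
      rw [X.strict.L_one, P.map_id, Strict.comp_id, Strict.id_comp]))
    (th_one rfl rfl rfl rfl X.strict.R_one _ _) c.cowedge.one c.κ_one _
  mul u v := eta_mul (c.trivial.obj_eq u) (c.trivial.obj_eq v) (c.trivial.obj_eq _)
    (X.strict.L_mul u v) (X.strict.R_mul u v) ((P.ups_strict .r X).L_mul u v)
    ((P.ups_strict .r X).R_mul u v) (P.outer_mul .r X u v) (c.obj.strict.L_mul u v)
    (X.strict.comm _ _) ((P.ups_strict .r X).comm _ _) (P.outer_upsR .r X u v)
    (P.outer_upsL .r X u v) (lam_mul (X.strict.L_mul u v) ((P.ups_strict .r X).L_mul u v))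
    (th_mult (StrictMonoidal.one_tensor _) (by rw [StrictMonoidal.tensor_one])
      Copowering.one_one rfl rfl Copowering.one_one (Copowering.one_comm u)
      (Copowering.one_comm v) (X.strict.R_mul u v)
      ((P.ups_strict .r X).R_mul u v) (P.outer_mul .r X u v) (P.outer_upsR .r X u v))
    (lam_th_comm (X.strict.comm _ _) ((P.ups_strict .r X).comm v u) (P.outer_upsL .r X u v)) (c.cowedge.mul u v) (c.κ_mul u v) (c.κ_σ u v)

/-- The unit `η_l : X → coInv_l X`. -/
def ηl (c : CoInv P .l X) : Equivariant X c.obj where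
  hom := (P.ι X.carrier).obj (e[I]) ≫ c.cowedge.leg
  τ u := (etaIso (c.trivial.obj_eq u) (lam P (X.R.obj u))
    (th P u (e[I]) (e[I]) u (tensor_one_one u) (one_one_tensor u) (X.L.obj u))
    (c.cowedge.σ u).symm (c.κ u)).symm
  natural {u v} f := Equivariant.symm_nat (eta_nat _ _ (X.R.map f) (X.L.map f) ((P.upsR .l X).map f)
    ((P.upsL .l X).map f) ((P.outer .l X).map f) _ (c.obj.R.map f) (c.trivial.map_eq f)
    (lam_nat _) (c.σ_symm_natural f)
    (th_natural _ _ _ _ f (tensor_one_oneHom f) (one_one_tensorHom f) _) (c.κ_natural f))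
  one := Equivariant.inv_eq_eqToHom (eta_one _ (lam_one X.strict.R_one (by
      rw [X.strict.R_one, P.map_id, Strict.comp_id, Strict.id_comp]))
    (th_one rfl rfl rfl rfl X.strict.L_one _ _) (Equivariant.inv_eq_eqToHom c.cowedge.one) c.κ_one (by
      change _ ≫ _ ≫ c.obj.L.obj _ = _ ≫ _ ≫ c.obj.R.obj _
      simp only [X.strict.L_one, X.strict.R_one, c.obj.strict.L_one, c.obj.strict.R_one]))
  mul u v := Equivariant.symm_mul _ _ _ (eta_mul (c.trivial.obj_eq v) (c.trivial.obj_eq u)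
    (c.trivial.obj_eq _)
    (X.strict.R_mul u v) (X.strict.L_mul u v) ((P.ups_strict .l X).R_mul u v)
    ((P.ups_strict .l X).L_mul u v) (P.outer_mul .l X v u) (c.obj.strict.R_mul u v)
    (X.strict.comm _ _).symm ((P.ups_strict .l X).comm _ _).symm (P.outer_upsL .l X v u)
    (P.outer_upsR .l X v u) (lam_mul (X.strict.R_mul u v) ((P.ups_strict .l X).R_mul u v))
    (th_mult (by rw [StrictMonoidal.tensor_one]) (StrictMonoidal.one_tensor _)
      rfl Copowering.one_one Copowering.one_one rfl (Copowering.one_comm u).symm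
      (Copowering.one_comm v).symm (X.strict.L_mul u v)
      ((P.ups_strict .l X).L_mul u v) (P.outer_mul .l X v u) (P.outer_upsL .l X v u))
    (lam_th_comm (X.strict.comm _ _).symm ((P.ups_strict .l X).comm _ _).symm
      (P.outer_upsR .l X v u)) (c.σ_symm_mul u v) (c.κ_mul v u)
    (c.κ_σ_symm v u))

end CoInv

end CoInvariants

/-! ### Weak colimits of sequences, `coInv^∞`, and costabilizations -/

/-- A weak cocone under the sequence `X 0 ⟶ X 1 ⟶ ⋯` in `M` with vertex `Z`. -/
structure SeqCocone {X : ℕ → M} (f : ∀ n, X n ⟶ X (n + 1)) (Z : M) where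
  leg (n : ℕ) : X n ⟶ Z
  glue (n : ℕ) : f n ≫ leg (n + 1) ≅ leg n

/-- The structure 2-cells of the weak cocone obtained from `w` by postcomposition with `k`. -/
def SeqCocone.push {X : ℕ → M} {f : ∀ n, X n ⟶ X (n + 1)} {Z : M} (w : SeqCocone f Z) {Z' : M}
    (k : Z ⟶ Z') (n : ℕ) : f n ≫ w.leg (n + 1) ≫ k ≅ w.leg n ≫ k :=
  (α_ _ _ _).symm ≪≫ whiskerRightIso (w.glue n) k

variable (V) in
/-- The weak cocone `w` exhibits `Z` as a weak colimit of the sequence: for all `Z'`, postcomposition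
is an equivalence of `V`-categories from `[Z, Z']` to the `V`-category of weak cocones with vertex
`Z'`. -/
structure IsWeakSeqColimit {X : ℕ → M} {f : ∀ n, X n ⟶ X (n + 1)} {Z : M} (w : SeqCocone f Z) :
    Prop where
  ess_surj {Z' : M} (d : SeqCocone f Z') :
    ∃ (k : Z ⟶ Z') (φ : ∀ n, w.leg n ≫ k ≅ d.leg n), ∀ n,
      (w.push k n).hom ≫ (φ n).hom = (f n ◁ (φ (n + 1)).hom) ≫ (d.glue n).hom
  fully_faithful {Z' : M} (k k' : Z ⟶ Z') (T : V)
    (s : ∀ n, T ⟶ ((w.leg n ≫ k) ⟶[V] (w.leg n ≫ k')))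
    (hs : ∀ n, VSquare (w.push k n) (w.push k' n) (famWhiskerLeft (f n) (s (n + 1))) (s n)) :
    ∃! t : T ⟶ (k ⟶[V] k'), ∀ n, famWhiskerLeft (w.leg n) t = s n

/-- The underlying invertible 2-cell of an isomorphism of 𝕀-equivariant morphisms. -/
def Equivariant.isoCell {X Y : IObj V I M} {f g : Equivariant X Y} (i : f ≅ g) : f.hom ≅ g.hom where
  hom := i.hom.cell
  inv := i.inv.cell
  hom_inv_id := congrArg Equivariant.Hom₂.cell i.hom_inv_id
  inv_hom_id := congrArg Equivariant.Hom₂.cell i.inv_hom_id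

section Infinity

variable [StrictMonoidal I] {P : Copowering V I M}
variable (coInv : ∀ (s : Side) (X : IObj V I M), CoInv P s X)

/-- The iterated coinvariants: `coInv_l A`, and then repeatedly `coInv_l (coInv_r -)`. -/
def coInvSeq (A : IObj V I M) : ℕ → IObj V I M
  | 0 => (coInv .l A).obj
  | n + 1 => (coInv .l (coInv .r (coInvSeq A n)).obj).obj

/-- The morphisms `η_l ∘ η_r` from one iterated object of coinvariants to the next one. -/
noncomputable def coInvMap (A : IObj V I M) (n : ℕ) :
    Equivariant (coInvSeq coInv A n) (coInvSeq coInv A (n + 1)) :=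
  Equivariant.comp (coInv .r (coInvSeq coInv A n)).ηr (coInv .l (coInv .r (coInvSeq coInv A n)).obj).ηl

/-- A weak colimit `coInv^∞ A` of the sequence of iterated coinvariants: an object of `M` with a right
action and compatible 𝕀-equivariant morphisms, whose underlying cocone in `M` is a weak colimit. -/
structure CoInvInfty (A : IObj V I M) where
  obj : IObj V I M
  trivial : IsTrivial obj.L
  leg (n : ℕ) : Equivariant (coInvSeq coInv A n) obj
  glue (n : ℕ) : Equivariant.comp (coInvMap coInv A n) (leg (n + 1)) ≅ leg n
  universal : IsWeakSeqColimit V (f := fun n => (coInvMap coInv A n).hom)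
    { leg := fun n => (leg n).hom
      glue := fun n => Equivariant.isoCell (glue n) }

/-- The morphism `η^∞ : A → coInv^∞ A`. -/
noncomputable def CoInvInfty.η {coInv : ∀ (s : Side) (X : IObj V I M), CoInv P s X} {A : IObj V I M}
    (C : CoInvInfty coInv A) : Equivariant A C.obj :=
  Equivariant.comp (coInv .l A).ηl (C.leg 0)

end Infinity

/-- A left or right action is stable if it is 1-equivalent to an action on the other side. -/
def IsStable (X : IObj V I M) : Prop :=
  (IsTrivial X.R ∧ ∃ Y : IObj V I M, IsTrivial Y.L ∧ Equivariant.Equivalent X Y) ∨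
    (IsTrivial X.L ∧ ∃ Y : IObj V I M, IsTrivial Y.R ∧ Equivariant.Equivalent X Y)

/-- `C` together with `η : A → C` is a costabilization of `A`: `C` is stable, and for every stable `B`
precomposition with `η` is an equivalence from the `V`-category of 𝕀-equivariant morphisms `C → B` to
that of 𝕀-equivariant morphisms `A → B`. -/
structure IsCostabilization (A C : IObj V I M) (η : Equivariant A C) : Prop where
  stable : IsStable C
  ess_surj (B : IObj V I M) (hB : IsStable B) (f : Equivariant A B) :
    ∃ g : Equivariant C B, Nonempty (Equivariant.comp η g ≅ f)
  fully_faithful (B : IObj V I M) (hB : IsStable B) (g g' : Equivariant C B) (T : V)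
    (s : T ⟶ ((η.hom ≫ g.hom) ⟶[V] (η.hom ≫ g'.hom)))
    (hs : Equivariant.IsFam (Equivariant.comp η g) (Equivariant.comp η g') s) :
    ∃! t : T ⟶ (g.hom ⟶[V] g'.hom), Equivariant.IsFam g g' t ∧ famWhiskerLeft η.hom t = s

end Actions
end CoStab

/-! For a side `s`, call "active" the action that survives in `coInv_s X` and "passive" the other
one, which is trivial there. Equivariant morphisms out of `coInv_s X` are studied through their
restrictions along the 1-cells `ι(i)` of the copower followed by `π`. By the universal properties of
the copower and of the coend, an equivariant morphism `coInv_s X → B` amounts to a `V`-functor `i ↦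
H i` from `I` to `[X, B]` with coherent cells `σ : act u ≫ H i ≅ pas u ≫ H (i·u)` and `κ : H (x·i) ≫
pas x ≅ H i ≫ act x`. Such data form `Mid`; the universal property in these terms is `Coin`, and the
extension of a `Mid` to an equivariant morphism is `Coin.exists_extension`. Two consequences carry
the theorem.

Locality. If the passive side of `B` is trivial, then `κ` at `i = 1` reads `H x ≅ H 1 ≫ act x`, so
the whole family is determined by `H 1`, which is an arbitrary equivariant morphism `X → B`. Hence
precomposition with the unit `η_s : X → coInv_s X` is an equivalence on morphisms to such `B`
(`Coin.IsUnit.isLocal`). A stable object is equivalent to a left action and to a right action, so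
`η_l` and `η_r`, and with them all morphisms of the sequence, are local with respect to every stable
object. Locality passes to the first leg of the weak colimit (`ColimSeq.isLocal_leg`), and composing
with `η_l` gives the universal property of `η^∞`.

Stability. If `h : X → B` factors as `a : X → Y` followed by `c : Y → B`, where `Y` has trivial
passive side, then `H i = a ≫ act i ≫ c` is a family as above (`Mid.ofPair`), so `h` extends along
`η_s` although the passive side of `B` need not be trivial. Each morphism of the sequence factors
through the left action `coInv_r (coInv^n A)`, hence so does each leg up to isomorphism. The
resulting families glue over the weak colimit (`ColimSeq.exists_mid`) and give `k : coInv_r (coInv^∞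
A) → coInv^∞ A` with `k ∘ η_r ≅ id`. Then `η_r ∘ k ≅ id` as well, because both sides restrict to
`η_r` along `η_r`, which is local with respect to its own target (`ColimSeq.equivalent`). So
`coInv^∞ A` is equivalent to a left action.

Equivalences of `V`-categories are handled by generalized elements: a morphism of the `V`-category
in question is a family indexed by an arbitrary `T : V`. The faithfulness of the forgetful functor
enters only in `vsquare_of_natural`, where naturality of isomorphisms on underlying functors is
promoted to `V`-naturality. -/

namespace CoStab

/-! ### Generalized elements of hom objects -/

section Families

open MonoidalCategory

variable {V : Type uV} [Category.{vV} V] [MonoidalCategory V]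
variable {C : Type uC} [Category.{vC} C] [EnrichedOrdinaryCategory V C]

theorem eHomEquiv_whiskerLeft {p q q' : C} (φ : p ⟶ q) (ψ : q ⟶ q') :
    eHomEquiv V φ ≫ eHomWhiskerLeft V p ψ = eHomEquiv V (φ ≫ ψ) := by
  rw [eHomWhiskerLeft, eHomEquiv_comp, MonoidalCategory.tensorHom_def, unitors_inv_equal,
    Category.assoc, rightUnitor_inv_naturality_assoc]

theorem eHomEquiv_whiskerRight {p p' q : C} (φ : p ⟶ p') (ψ : p' ⟶ q) :
    eHomEquiv V ψ ≫ eHomWhiskerRight V φ q = eHomEquiv V (φ ≫ ψ) := by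
  rw [eHomWhiskerRight, eHomEquiv_comp, MonoidalCategory.tensorHom_def',
    Category.assoc, leftUnitor_inv_naturality_assoc]

/-- Precomposition of a family of morphisms with a morphism. -/
def pre {p p' q : C} {T : V} (φ : p' ⟶ p) (t : T ⟶ (p ⟶[V] q)) : T ⟶ (p' ⟶[V] q) :=
  t ≫ eHomWhiskerRight V φ q

/-- Postcomposition of a family of morphisms with a morphism. -/
def post {p q q' : C} {T : V} (t : T ⟶ (p ⟶[V] q)) (ψ : q ⟶ q') : T ⟶ (p ⟶[V] q') :=
  t ≫ eHomWhiskerLeft V p ψ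

section
variable {p p' p'' q q' q'' : C} {T S : V}

@[simp] theorem pre_id (t : T ⟶ (p ⟶[V] q)) : pre (𝟙 p) t = t := by simp [pre]
@[simp] theorem post_id (t : T ⟶ (p ⟶[V] q)) : post t (𝟙 q) = t := by simp [post]
@[simp] theorem pre_pre (φ : p' ⟶ p) (φ' : p'' ⟶ p') (t : T ⟶ (p ⟶[V] q)) :
    pre φ' (pre φ t) = pre (φ' ≫ φ) t := by simp [pre, eHomWhiskerRight_comp]
@[simp] theorem post_post (t : T ⟶ (p ⟶[V] q)) (ψ : q ⟶ q') (ψ' : q' ⟶ q'') :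
    post (post t ψ) ψ' = post t (ψ ≫ ψ') := by simp [post, eHomWhiskerLeft_comp]
@[simp] theorem post_pre (φ : p' ⟶ p) (t : T ⟶ (p ⟶[V] q)) (ψ : q ⟶ q') :
    post (pre φ t) ψ = pre φ (post t ψ) := by simp [pre, post, eHom_whisker_exchange]
theorem comp_pre (a : S ⟶ T) (φ : p' ⟶ p) (t : T ⟶ (p ⟶[V] q)) :
    a ≫ pre φ t = pre φ (a ≫ t) := by simp [pre]
theorem comp_post (a : S ⟶ T) (t : T ⟶ (p ⟶[V] q)) (ψ : q ⟶ q') :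
    a ≫ post t ψ = post (a ≫ t) ψ := by simp [post]
theorem post_eHomEquiv (φ : p ⟶ q) (ψ : q ⟶ q') :
    post (eHomEquiv V φ) ψ = eHomEquiv V (φ ≫ ψ) := eHomEquiv_whiskerLeft φ ψ
theorem pre_eHomEquiv (φ : p' ⟶ p) (ψ : p ⟶ q) :
    pre φ (eHomEquiv V ψ) = eHomEquiv V (φ ≫ ψ) := eHomEquiv_whiskerRight φ ψ

/-- Composition of families of morphisms. -/
def fcomp {q r : C} (s : S ⟶ (p ⟶[V] q)) (t : T ⟶ (q ⟶[V] r)) : S ⊗ T ⟶ (p ⟶[V] r) :=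
  (s ⊗ₘ t) ≫ eComp V p q r

theorem fcomp_post {r r' : C} (s : S ⟶ (p ⟶[V] q)) (t : T ⟶ (q ⟶[V] r)) (ψ : r ⟶ r') :
    fcomp s (post t ψ) = post (fcomp s t) ψ := by
  simp [fcomp, post, eComp_eHomWhiskerLeft, MonoidalCategory.tensorHom_def]

theorem pre_fcomp {r : C} (φ : p' ⟶ p) (s : S ⟶ (p ⟶[V] q)) (t : T ⟶ (q ⟶[V] r)) :
    fcomp (pre φ s) t = pre φ (fcomp s t) := by
  simp [fcomp, pre, eComp_eHomWhiskerRight, MonoidalCategory.tensorHom_def']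

theorem fcomp_comp_right {S' : V} {r : C} (s : S ⟶ (p ⟶[V] q)) (a : S' ⟶ T) (t : T ⟶ (q ⟶[V] r)) :
    fcomp s (a ≫ t) = S ◁ a ≫ fcomp s t := by
  simp [fcomp, MonoidalCategory.tensorHom_def']

theorem fcomp_comp_left {S' : V} {r : C} (a : S' ⟶ S) (s : S ⟶ (p ⟶[V] q)) (t : T ⟶ (q ⟶[V] r)) :
    fcomp (a ≫ s) t = a ▷ T ≫ fcomp s t := by
  simp [fcomp, MonoidalCategory.tensorHom_def]

theorem fcomp_assoc {U : V} {r r' : C} (s : S ⟶ (p ⟶[V] q)) (t : T ⟶ (q ⟶[V] r))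
    (u : U ⟶ (r ⟶[V] r')) : fcomp (fcomp s t) u = (α_ S T U).hom ≫ fcomp s (fcomp t u) := by
  simp only [fcomp]
  rw [← Category.comp_id u, ← MonoidalCategory.tensorHom_comp_tensorHom, Category.assoc,
    MonoidalCategory.tensorHom_id, ← e_assoc', associator_naturality_assoc,
    ← MonoidalCategory.id_tensorHom, MonoidalCategory.tensorHom_comp_tensorHom_assoc,
    Category.comp_id, Category.comp_id]

/-- An ordinary morphism is a family indexed by the unit object. With `pre_eq`, this reduces
whiskering of hom objects to `fcomp`, so that associativity of `fcomp` governs everything. -/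
theorem post_eq (t : T ⟶ (p ⟶[V] q)) (ψ : q ⟶ q') :
    post t ψ = (ρ_ T).inv ≫ fcomp t (eHomEquiv V ψ) := by
  simp [post, fcomp, eHomWhiskerLeft, MonoidalCategory.tensorHom_def]

theorem pre_eq (t : T ⟶ (p ⟶[V] q)) (φ : p' ⟶ p) :
    pre φ t = (λ_ T).inv ≫ fcomp (eHomEquiv V φ) t := by
  simp [pre, fcomp, eHomWhiskerRight, MonoidalCategory.tensorHom_def']

/-- Associativity of `fcomp` for three families of which the middle one is indexed by the unit
object; the unitors cancel by the triangle identity. -/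
theorem fcomp_pre {r : C} (s : S ⟶ (p ⟶[V] q)) (ψ : q ⟶ q') (t : T ⟶ (q' ⟶[V] r)) :
    fcomp s (pre ψ t) = fcomp (post s ψ) t := by
  rw [pre_eq, post_eq, fcomp_comp_left, fcomp_comp_right, fcomp_assoc,
    MonoidalCategory.triangle_assoc_comp_right_inv_assoc]

/-- The two sides are invertible, so a commuting square says that one family is the conjugate of the
other. Pasting, cancellation and uniqueness of squares all follow from this form. -/
theorem vsquare_iff {σ : p ≅ p'} {σ' : q ≅ q'} {t : T ⟶ (p ⟶[V] q)} {t' : T ⟶ (p' ⟶[V] q')} :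
    VSquare σ σ' t t' ↔ t' = pre σ.inv (post t σ'.hom) := by
  change post _ _ = pre _ _ ↔ _
  constructor
  · intro h; rw [h]; simp
  · rintro rfl; simp

theorem vsquare_iff' {σ : p ≅ p'} {σ' : q ≅ q'} {t : T ⟶ (p ⟶[V] q)} {t' : T ⟶ (p' ⟶[V] q')} :
    VSquare σ σ' t t' ↔ t = pre σ.hom (post t' σ'.inv) := by
  change post _ _ = pre _ _ ↔ _
  constructor
  · intro h; rw [← post_pre, ← h]; simp
  · rintro rfl; simp

end

namespace VSquare

variable {p p' p'' q q' q'' : C} {σ : p ≅ p'} {σ' : q ≅ q'} {ρ : p' ≅ p''} {ρ' : q' ≅ q''} {T S : V}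
  {t t₁ : T ⟶ (p ⟶[V] q)} {t' t₁' : T ⟶ (p' ⟶[V] q')} {t'' : T ⟶ (p'' ⟶[V] q'')}

theorem trans (h : VSquare σ σ' t t') (h' : VSquare ρ ρ' t' t'') :
    VSquare (σ ≪≫ ρ) (σ' ≪≫ ρ') t t'' := by
  rw [vsquare_iff] at *; subst h h'; simp

theorem refl (t : T ⟶ (p ⟶[V] q)) : VSquare (Iso.refl p) (Iso.refl q) t t := by
  rw [vsquare_iff]; simp

theorem symm (h : VSquare σ σ' t t') : VSquare σ.symm σ'.symm t' t := by
  rw [vsquare_iff] at *; subst h; simp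

theorem conj (σ : p ≅ p') (σ' : q ≅ q') (t : T ⟶ (p ⟶[V] q)) :
    VSquare σ σ' t (pre σ.inv (post t σ'.hom)) := vsquare_iff.2 rfl

theorem conj' (σ : p ≅ p') (σ' : q ≅ q') (t : T ⟶ (p' ⟶[V] q')) :
    VSquare σ σ' (pre σ.hom (post t σ'.inv)) t := vsquare_iff'.2 rfl

theorem unique (h : VSquare σ σ' t t') (h' : VSquare σ σ' t t₁') : t' = t₁' := by
  rw [vsquare_iff] at *; rw [h, h']

theorem unique' (h : VSquare σ σ' t t') (h' : VSquare σ σ' t₁ t') : t = t₁ := by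
  rw [vsquare_iff'] at *; rw [h, h']

/-- The second square of a pasted pair of squares commutes. -/
theorem of_trans (h : VSquare (σ ≪≫ ρ) (σ' ≪≫ ρ') t t'') (h' : VSquare σ σ' t t') :
    VSquare ρ ρ' t' t'' := by
  rw [vsquare_iff] at *; subst h h'; simp

/-- The first square of a pasted pair of squares commutes. -/
theorem of_trans' (h : VSquare (σ ≪≫ ρ) (σ' ≪≫ ρ') t t'') (h' : VSquare ρ ρ' t' t'') :
    VSquare σ σ' t t' := by
  rw [vsquare_iff] at h; rw [vsquare_iff'] at h' ⊢; subst h h'; simp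

theorem congr {σ₁ : p ≅ p'} {σ₁' : q ≅ q'} (h : VSquare σ σ' t t') (e : σ.hom = σ₁.hom)
    (e' : σ'.hom = σ₁'.hom) : VSquare σ₁ σ₁' t t' := by
  rwa [← Iso.ext e, ← Iso.ext e']

theorem comp_left (a : S ⟶ T) (h : VSquare σ σ' t t') : VSquare σ σ' (a ≫ t) (a ≫ t') := by
  rw [vsquare_iff] at *; subst h; rw [comp_pre, comp_post]

/-- For families indexed by the unit object, squares of families are ordinary commuting squares;
this is the passage between the enriched and the ordinary statements. -/
theorem eHomEquiv_iff {φ : p ⟶ q} {φ' : p' ⟶ q'} :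
    VSquare σ σ' (eHomEquiv V φ) (eHomEquiv V φ') ↔ φ ≫ σ'.hom = σ.hom ≫ φ' := by
  change post _ _ = pre _ _ ↔ _
  rw [post_eHomEquiv, pre_eHomEquiv, EmbeddingLike.apply_eq_iff_eq]

/-- The common side `σ'` occurs once as itself and once inverted, and cancels after `fcomp_pre`
moves it across the middle object. -/
theorem fcomp {r r' : C} {τ : r ≅ r'} {u : S ⟶ (q ⟶[V] r)} {u' : S ⟶ (q' ⟶[V] r')}
    (h : VSquare σ σ' t t') (h' : VSquare σ' τ u u') :
    VSquare σ τ (fcomp t u) (fcomp t' u') := by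
  rw [vsquare_iff] at *; subst h h'
  rw [fcomp_pre, fcomp_post, post_pre, post_post, pre_fcomp]
  simp

end VSquare
end Families

/-! ### Horizontal composition of families of 2-cells -/

section Whisker
open MonoidalCategory
variable {V : Type uV} [Category.{vV} V] [MonoidalCategory V] [BraidedCategory V]
variable {M : Type uM} [Bicategory.{wM, vM} M] [Bicategory.Strict M]
  [∀ A B : M, EnrichedOrdinaryCategory V (A ⟶ B)] [VCatCategory V M]
variable {A B C D : M} {T S : V}

/-- Horizontal composition of families. -/
def fhcomp {f f' : A ⟶ B} {g g' : B ⟶ C} (s : S ⟶ (f ⟶[V] f')) (t : T ⟶ (g ⟶[V] g')) :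
    S ⊗ T ⟶ ((f ≫ g) ⟶[V] (f' ≫ g')) :=
  (s ⊗ₘ t) ≫ VCatCategory.hcomp f f' g g'

-- The interchange law of `hcomp` on generalized elements. The exchange and whiskering rules below
-- are its instances in which some of the four index objects are the unit.
open scoped Bicategory in
theorem fhcomp_fcomp {f f' f'' : A ⟶ B} {g g' g'' : B ⟶ C} {S' T' : V} (s : S ⟶ (f ⟶[V] f'))
    (t : T ⟶ (g ⟶[V] g')) (s' : S' ⟶ (f' ⟶[V] f'')) (t' : T' ⟶ (g' ⟶[V] g'')) :
    tensorμ S T S' T' ≫ fhcomp (fcomp s s') (fcomp t t') = fcomp (fhcomp s t) (fhcomp s' t') := by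
  have h := VCatCategory.hcomp_comp (V := V) f f' f'' g g' g''
  simp only [fhcomp, fcomp, ← MonoidalCategory.tensorHom_comp_tensorHom, Category.assoc]
  rw [← h, tensorμ_natural_assoc]

open scoped Bicategory in
theorem fhcomp_eHomEquiv {f f' : A ⟶ B} {g g' : B ⟶ C} (φ : f ⟶ f') (ψ : g ⟶ g') :
    fhcomp (eHomEquiv V φ) (eHomEquiv V ψ) =
      (λ_ (𝟙_ V)).hom ≫ eHomEquiv V (Bicategory.whiskerRight φ g ≫ Bicategory.whiskerLeft f' ψ) := by
  rw [← VCatCategory.hcomp_underlying, Iso.hom_inv_id_assoc]; rfl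

/-- Interchange in which the second column consists of ordinary 2-cells, that is, of families
indexed by the unit object. -/
theorem fhcomp_post {f f' f'' : A ⟶ B} {g g' g'' : B ⟶ C} (s : S ⟶ (f ⟶[V] f'))
    (t : T ⟶ (g ⟶[V] g')) (φ : f' ⟶ f'') (ψ : g' ⟶ g'') :
    fhcomp (post s φ) (post t ψ) =
      post (fhcomp s t) (Bicategory.whiskerRight φ g' ≫ Bicategory.whiskerLeft f'' ψ) := by
  have h := fhcomp_fcomp s t (eHomEquiv V φ) (eHomEquiv V ψ)
  -- Right unitality of the middle-four interchange: two unit objects inserted behind `S` and behind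
  -- `T` may be collected at the end.
  have e : ((ρ_ S).inv ⊗ₘ (ρ_ T).inv) = (ρ_ (S ⊗ T)).inv ≫ (S ⊗ T) ◁ (λ_ (𝟙_ V)).inv ≫
      tensorμ S T (𝟙_ V) (𝟙_ V) := by
    have := tensor_right_unitality S T
    rw [Iso.eq_inv_comp, this]
    simp [MonoidalCategory.tensorHom_comp_tensorHom]
  have : fhcomp (post s φ) (post t ψ) = ((ρ_ S).inv ⊗ₘ (ρ_ T).inv) ≫
      fhcomp (fcomp s (eHomEquiv V φ)) (fcomp t (eHomEquiv V ψ)) := by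
    simp only [post_eq, fhcomp, ← MonoidalCategory.tensorHom_comp_tensorHom, Category.assoc]
  rw [this, e, Category.assoc, Category.assoc, h, fhcomp_eHomEquiv, post_eq,
    fcomp_comp_right, MonoidalCategory.whiskerLeft_inv_hom_assoc]

theorem fhcomp_pre {f f' f'' : A ⟶ B} {g g' g'' : B ⟶ C} (s : S ⟶ (f' ⟶[V] f''))
    (t : T ⟶ (g' ⟶[V] g'')) (φ : f ⟶ f') (ψ : g ⟶ g') :
    fhcomp (pre φ s) (pre ψ t) =
      pre (Bicategory.whiskerRight φ g ≫ Bicategory.whiskerLeft f' ψ) (fhcomp s t) := by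
  have h := fhcomp_fcomp (eHomEquiv V φ) (eHomEquiv V ψ) s t
  have e : ((λ_ S).inv ⊗ₘ (λ_ T).inv) = (λ_ (S ⊗ T)).inv ≫ (λ_ (𝟙_ V)).inv ▷ (S ⊗ T) ≫
      tensorμ (𝟙_ V) (𝟙_ V) S T := by
    have := tensor_left_unitality S T
    rw [Iso.eq_inv_comp, this]
    simp [MonoidalCategory.tensorHom_comp_tensorHom]
  have : fhcomp (pre φ s) (pre ψ t) = ((λ_ S).inv ⊗ₘ (λ_ T).inv) ≫
      fhcomp (fcomp (eHomEquiv V φ) s) (fcomp (eHomEquiv V ψ) t) := by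
    simp only [pre_eq, fhcomp, ← MonoidalCategory.tensorHom_comp_tensorHom, Category.assoc]
  rw [this, e, Category.assoc, Category.assoc, h, fhcomp_eHomEquiv, pre_eq,
    fcomp_comp_left, MonoidalCategory.inv_hom_whiskerRight_assoc]

end Whisker

/-! ### Whiskering of families by 1-cells -/

section Whisker
open MonoidalCategory
variable {V : Type uV} [Category.{vV} V] [MonoidalCategory V] [BraidedCategory V]
variable {M : Type uM} [Bicategory.{wM, vM} M] [Bicategory.Strict M]
  [∀ A B : M, EnrichedOrdinaryCategory V (A ⟶ B)] [VCatCategory V M]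
variable {A B C D : M} {T S U : V}

theorem fhcomp_comp {S' T' : V} {f f' : A ⟶ B} {g g' : B ⟶ C} (a : S' ⟶ S) (b : T' ⟶ T)
    (s : S ⟶ (f ⟶[V] f')) (t : T ⟶ (g ⟶[V] g')) :
    fhcomp (a ≫ s) (b ≫ t) = (a ⊗ₘ b) ≫ fhcomp s t := by
  simp [fhcomp]

theorem famWhiskerLeft_eq (f : A ⟶ B) {g h : B ⟶ C} (t : T ⟶ (g ⟶[V] h)) :
    famWhiskerLeft f t = (λ_ T).inv ≫ fhcomp (eHomEquiv V (𝟙 f)) t := by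
  rw [eHomEquiv_id]; rfl

theorem famWhiskerRight_eq {f g : A ⟶ B} (t : T ⟶ (f ⟶[V] g)) (h : B ⟶ C) :
    famWhiskerRight t h = (ρ_ T).inv ≫ fhcomp t (eHomEquiv V (𝟙 h)) := by
  rw [eHomEquiv_id]; rfl

theorem comp_famWhiskerLeft (a : S ⟶ T) (f : A ⟶ B) {g h : B ⟶ C} (t : T ⟶ (g ⟶[V] h)) :
    a ≫ famWhiskerLeft f t = famWhiskerLeft f (a ≫ t) := by
  rw [famWhiskerLeft_eq, famWhiskerLeft_eq, ← Category.id_comp (eHomEquiv V (𝟙 f)),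
    ← Category.id_comp (eHomEquiv V (𝟙 f)), fhcomp_comp]
  simp

theorem comp_famWhiskerRight (a : S ⟶ T) {f g : A ⟶ B} (t : T ⟶ (f ⟶[V] g)) (h : B ⟶ C) :
    a ≫ famWhiskerRight t h = famWhiskerRight (a ≫ t) h := by
  rw [famWhiskerRight_eq, famWhiskerRight_eq, ← Category.id_comp (eHomEquiv V (𝟙 h)),
    ← Category.id_comp (eHomEquiv V (𝟙 h)), fhcomp_comp]
  simp

theorem famWhiskerLeft_post (f : A ⟶ B) {g h h' : B ⟶ C} (t : T ⟶ (g ⟶[V] h)) (ψ : h ⟶ h') :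
    famWhiskerLeft f (post t ψ) = post (famWhiskerLeft f t) (Bicategory.whiskerLeft f ψ) := by
  rw [famWhiskerLeft_eq, famWhiskerLeft_eq, ← post_id (eHomEquiv V (𝟙 f)), fhcomp_post, comp_post]
  simp

theorem famWhiskerLeft_pre (f : A ⟶ B) {g g' h : B ⟶ C} (t : T ⟶ (g ⟶[V] h)) (ψ : g' ⟶ g) :
    famWhiskerLeft f (pre ψ t) = pre (Bicategory.whiskerLeft f ψ) (famWhiskerLeft f t) := by
  rw [famWhiskerLeft_eq, famWhiskerLeft_eq, ← pre_id (eHomEquiv V (𝟙 f)), fhcomp_pre, comp_pre]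
  simp

theorem famWhiskerRight_post {f g g' : A ⟶ B} (t : T ⟶ (f ⟶[V] g)) (ψ : g ⟶ g') (h : B ⟶ C) :
    famWhiskerRight (post t ψ) h = post (famWhiskerRight t h) (Bicategory.whiskerRight ψ h) := by
  rw [famWhiskerRight_eq, famWhiskerRight_eq, ← post_id (eHomEquiv V (𝟙 h)), fhcomp_post, comp_post]
  simp

theorem famWhiskerRight_pre {f f' g : A ⟶ B} (t : T ⟶ (f ⟶[V] g)) (ψ : f' ⟶ f) (h : B ⟶ C) :
    famWhiskerRight (pre ψ t) h = pre (Bicategory.whiskerRight ψ h) (famWhiskerRight t h) := by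
  rw [famWhiskerRight_eq, famWhiskerRight_eq, ← pre_id (eHomEquiv V (𝟙 h)), fhcomp_pre, comp_pre]
  simp

/-- Both sides are the horizontal composite of `φ` with `t`, computed once by `fhcomp_post` and once
by `fhcomp_pre`. -/
theorem famWhiskerLeft_exchange {f f' : A ⟶ B} {g h : B ⟶ C} (φ : f ⟶ f') (t : T ⟶ (g ⟶[V] h)) :
    post (famWhiskerLeft f t) (Bicategory.whiskerRight φ h) =
      pre (Bicategory.whiskerRight φ g) (famWhiskerLeft f' t) := by
  have h1 := fhcomp_post (eHomEquiv V (𝟙 f)) t φ (𝟙 h)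
  have h2 := fhcomp_pre (eHomEquiv V (𝟙 f')) t φ (𝟙 g)
  simp only [post_eHomEquiv, pre_eHomEquiv, post_id, pre_id, Category.comp_id, Category.id_comp,
    Bicategory.whiskerLeft_id] at h1 h2
  rw [famWhiskerLeft_eq, famWhiskerLeft_eq, ← comp_post, ← comp_pre, ← h1, ← h2]

theorem famWhiskerRight_exchange {f f' : A ⟶ B} {g h : B ⟶ C} (t : T ⟶ (f ⟶[V] f')) (ψ : g ⟶ h) :
    post (famWhiskerRight t g) (Bicategory.whiskerLeft f' ψ) =
      pre (Bicategory.whiskerLeft f ψ) (famWhiskerRight t h) := by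
  have h1 := fhcomp_post t (eHomEquiv V (𝟙 g)) (𝟙 f') ψ
  have h2 := fhcomp_pre t (eHomEquiv V (𝟙 h)) (𝟙 f) ψ
  simp only [post_eHomEquiv, pre_eHomEquiv, post_id, pre_id, Category.comp_id, Category.id_comp,
    Bicategory.id_whiskerRight] at h1 h2
  rw [famWhiskerRight_eq, famWhiskerRight_eq, ← comp_post, ← comp_pre, ← h1, ← h2]

theorem famWhiskerLeft_eHomEquiv (f : A ⟶ B) {g h : B ⟶ C} (ψ : g ⟶ h) :
    famWhiskerLeft f (eHomEquiv V ψ) = eHomEquiv V (Bicategory.whiskerLeft f ψ) := by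
  rw [famWhiskerLeft_eq, fhcomp_eHomEquiv]
  simp

theorem famWhiskerRight_eHomEquiv {f g : A ⟶ B} (ψ : f ⟶ g) (h : B ⟶ C) :
    famWhiskerRight (eHomEquiv V ψ) h = eHomEquiv V (Bicategory.whiskerRight ψ h) := by
  rw [famWhiskerRight_eq, fhcomp_eHomEquiv, ← unitors_inv_equal]
  simp

/-- One of the two ways to write a horizontal composite as a vertical one; `fhcomp_eq_braiding` is
the other. Comparing them yields the `V`-naturality of whiskered families. -/
theorem fhcomp_eq_fcomp {f f' : A ⟶ B} {g g' : B ⟶ C} (s : S ⟶ (f ⟶[V] f'))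
    (t : T ⟶ (g ⟶[V] g')) :
    fcomp (famWhiskerRight s g) (famWhiskerLeft f' t) = fhcomp s t := by
  have h := fhcomp_fcomp s (eHomEquiv V (𝟙 g)) (eHomEquiv V (𝟙 f')) t
  have e1 : fcomp s (eHomEquiv V (𝟙 f')) = (ρ_ S).hom ≫ s := by
    have := post_eq s (𝟙 f')
    rw [post_id] at this
    exact ((Iso.eq_inv_comp _).1 this).symm
  have e2 : fcomp (eHomEquiv V (𝟙 g)) t = (λ_ T).hom ≫ t := by
    have := pre_eq t (𝟙 g)
    rw [pre_id] at this
    exact ((Iso.eq_inv_comp _).1 this).symm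
  rw [e1, e2, fhcomp_comp] at h
  rw [famWhiskerLeft_eq, famWhiskerRight_eq, fcomp_comp_left, fcomp_comp_right, ← h]
  -- The interchange swaps two unit objects only, so no braiding of `S` and `T` remains.
  have e3 : (ρ_ S).inv ▷ T ≫ (S ⊗ 𝟙_ V) ◁ (λ_ T).inv ≫ tensorμ S (𝟙_ V) (𝟙_ V) T ≫
      ((ρ_ S).hom ⊗ₘ (λ_ T).hom) = 𝟙 _ := by
    simp only [tensorμ, braiding_tensorUnit_left]
    monoidal
  rw [reassoc_of% e3]

/-- In this order the interchange swaps `T` past `S`, whence the braiding. -/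
theorem fhcomp_eq_braiding {f f' : A ⟶ B} {g g' : B ⟶ C} (s : S ⟶ (f ⟶[V] f'))
    (t : T ⟶ (g ⟶[V] g')) :
    fcomp (famWhiskerLeft f t) (famWhiskerRight s g') = (β_ T S).hom ≫ fhcomp s t := by
  have h := fhcomp_fcomp (eHomEquiv V (𝟙 f)) t s (eHomEquiv V (𝟙 g'))
  have e1 : fcomp t (eHomEquiv V (𝟙 g')) = (ρ_ T).hom ≫ t := by
    have := post_eq t (𝟙 g')
    rw [post_id] at this
    exact ((Iso.eq_inv_comp _).1 this).symm
  have e2 : fcomp (eHomEquiv V (𝟙 f)) s = (λ_ S).hom ≫ s := by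
    have := pre_eq s (𝟙 f)
    rw [pre_id] at this
    exact ((Iso.eq_inv_comp _).1 this).symm
  rw [e1, e2, fhcomp_comp] at h
  rw [famWhiskerLeft_eq, famWhiskerRight_eq, fcomp_comp_left, fcomp_comp_right, ← h]
  have e3 : (λ_ T).inv ▷ S ≫ (𝟙_ V ⊗ T) ◁ (ρ_ S).inv ≫ tensorμ (𝟙_ V) T S (𝟙_ V) ≫
      ((λ_ S).hom ⊗ₘ (ρ_ T).hom) = (β_ T S).hom := by
    simp only [tensorμ]
    monoidal
  rw [reassoc_of% e3]

theorem famWhiskerLeft_fcomp (f : A ⟶ B) {g g' g'' : B ⟶ C} (s : S ⟶ (g ⟶[V] g'))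
    (t : T ⟶ (g' ⟶[V] g'')) :
    famWhiskerLeft f (fcomp s t) = fcomp (famWhiskerLeft f s) (famWhiskerLeft f t) := by
  have h := fhcomp_fcomp (eHomEquiv V (𝟙 f)) s (eHomEquiv V (𝟙 f)) t
  have e1 : fcomp (eHomEquiv V (𝟙 f)) (eHomEquiv V (𝟙 f)) = (λ_ _).hom ≫ eHomEquiv V (𝟙 f) := by
    have := pre_eq (eHomEquiv V (𝟙 f)) (𝟙 f)
    rw [pre_id] at this
    exact ((Iso.eq_inv_comp _).1 this).symm
  rw [e1, ← Category.id_comp (fcomp s t), fhcomp_comp] at h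
  rw [famWhiskerLeft_eq, famWhiskerLeft_eq, famWhiskerLeft_eq, fcomp_comp_left, fcomp_comp_right,
    ← h]
  have e3 : (λ_ S).inv ▷ T ≫ (𝟙_ V ⊗ S) ◁ (λ_ T).inv ≫ tensorμ (𝟙_ V) S (𝟙_ V) T ≫
      ((λ_ (𝟙_ V)).hom ⊗ₘ 𝟙 (S ⊗ T)) = (λ_ (S ⊗ T)).inv := by
    simp only [tensorμ, braiding_tensorUnit_right]
    monoidal
  rw [reassoc_of% e3]

theorem famWhiskerRight_fcomp {f f' f'' : A ⟶ B} (s : S ⟶ (f ⟶[V] f'))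
    (t : T ⟶ (f' ⟶[V] f'')) (g : B ⟶ C) :
    famWhiskerRight (fcomp s t) g = fcomp (famWhiskerRight s g) (famWhiskerRight t g) := by
  have h := fhcomp_fcomp s (eHomEquiv V (𝟙 g)) t (eHomEquiv V (𝟙 g))
  have e1 : fcomp (eHomEquiv V (𝟙 g)) (eHomEquiv V (𝟙 g)) = (λ_ _).hom ≫ eHomEquiv V (𝟙 g) := by
    have := pre_eq (eHomEquiv V (𝟙 g)) (𝟙 g)
    rw [pre_id] at this
    exact ((Iso.eq_inv_comp _).1 this).symm
  rw [e1, ← Category.id_comp (fcomp s t), fhcomp_comp] at h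
  rw [famWhiskerRight_eq, famWhiskerRight_eq, famWhiskerRight_eq, fcomp_comp_left, fcomp_comp_right,
    ← h]
  have e3 : (ρ_ S).inv ▷ T ≫ (S ⊗ 𝟙_ V) ◁ (ρ_ T).inv ≫ tensorμ S (𝟙_ V) T (𝟙_ V) ≫
      (𝟙 (S ⊗ T) ⊗ₘ (λ_ (𝟙_ V)).hom) = (ρ_ (S ⊗ T)).inv := by
    simp only [tensorμ, braiding_tensorUnit_left]
    monoidal
  rw [reassoc_of% e3]

/-- The axiom `hcomp_assoc` on generalized elements. Taking two of the three families to be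
identities gives the rules `assocL`, `assocR` and `assocM`. -/
theorem fhcomp_assoc {f f' : A ⟶ B} {g g' : B ⟶ C} {h h' : C ⟶ D} (s : S ⟶ (f ⟶[V] f'))
    (t : T ⟶ (g ⟶[V] g')) (u : U ⟶ (h ⟶[V] h')) :
    VSquare (Bicategory.associator f g h) (Bicategory.associator f' g' h')
      (fhcomp (fhcomp s t) u) ((MonoidalCategory.associator S T U).hom ≫ fhcomp s (fhcomp t u)) := by
  rw [vsquare_iff, post, pre]
  have H := VCatCategory.hcomp_assoc (V := V) f f' g g' h h'
  have H' := congrArg (fun z => ((s ⊗ₘ t) ⊗ₘ u) ≫ z) H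
  simp only [MonoidalCategory.tensorHom_comp_tensorHom_assoc, Category.comp_id,
    MonoidalCategory.associator_naturality_assoc] at H'
  rw [Category.assoc, eHom_whisker_exchange]
  simpa [fhcomp] using H'.symm

theorem VSquare.assocL (f : A ⟶ B) (g : B ⟶ C) {h h' : C ⟶ D} (t : T ⟶ (h ⟶[V] h')) :
    VSquare (Bicategory.associator f g h) (Bicategory.associator f g h') (famWhiskerLeft (f ≫ g) t)
      (famWhiskerLeft f (famWhiskerLeft g t)) := by
  have H := (fhcomp_assoc (eHomEquiv V (𝟙 f)) (eHomEquiv V (𝟙 g)) t).comp_left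
    ((λ_ T).inv ≫ (λ_ (𝟙_ V)).inv ▷ T)
  convert H using 1
  · have := fhcomp_eHomEquiv (V := V) (𝟙 f) (𝟙 g)
    rw [famWhiskerLeft_eq, this, ← Category.id_comp t, fhcomp_comp]
    simp
  · have e : fhcomp (eHomEquiv V (𝟙 f)) (famWhiskerLeft g t) = (𝟙_ V) ◁ (λ_ T).inv ≫
        fhcomp (eHomEquiv V (𝟙 f)) (fhcomp (eHomEquiv V (𝟙 g)) t) := by
      rw [famWhiskerLeft_eq, ← Category.id_comp (eHomEquiv V (𝟙 f)), fhcomp_comp]; simp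
    rw [famWhiskerLeft_eq, e]
    simp [← Category.assoc]; congr 1; monoidal

theorem VSquare.assocR {f f' : A ⟶ B} (t : T ⟶ (f ⟶[V] f')) (g : B ⟶ C) (h : C ⟶ D) :
    VSquare (Bicategory.associator f g h) (Bicategory.associator f' g h)
      (famWhiskerRight (famWhiskerRight t g) h) (famWhiskerRight t (g ≫ h)) := by
  have H := (fhcomp_assoc t (eHomEquiv V (𝟙 g)) (eHomEquiv V (𝟙 h))).comp_left
    ((ρ_ T).inv ≫ (ρ_ T).inv ▷ (𝟙_ V))
  convert H using 1
  · have e : fhcomp (famWhiskerRight t g) (eHomEquiv V (𝟙 h)) = (ρ_ T).inv ▷ (𝟙_ V) ≫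
        fhcomp (fhcomp t (eHomEquiv V (𝟙 g))) (eHomEquiv V (𝟙 h)) := by
      rw [famWhiskerRight_eq, ← Category.id_comp (eHomEquiv V (𝟙 h)), fhcomp_comp]; simp
    rw [famWhiskerRight_eq, e]
    simp
  · have := fhcomp_eHomEquiv (V := V) (𝟙 g) (𝟙 h)
    rw [famWhiskerRight_eq, this, ← Category.id_comp t, fhcomp_comp]
    simp [← Category.assoc]; congr 1; monoidal

theorem VSquare.assocM (f : A ⟶ B) {g g' : B ⟶ C} (t : T ⟶ (g ⟶[V] g')) (h : C ⟶ D) :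
    VSquare (Bicategory.associator f g h) (Bicategory.associator f g' h)
      (famWhiskerRight (famWhiskerLeft f t) h) (famWhiskerLeft f (famWhiskerRight t h)) := by
  have H := (fhcomp_assoc (eHomEquiv V (𝟙 f)) t (eHomEquiv V (𝟙 h))).comp_left
    ((ρ_ T).inv ≫ (λ_ T).inv ▷ (𝟙_ V))
  convert H using 1
  · have e : fhcomp (famWhiskerLeft f t) (eHomEquiv V (𝟙 h)) = (λ_ T).inv ▷ (𝟙_ V) ≫
        fhcomp (fhcomp (eHomEquiv V (𝟙 f)) t) (eHomEquiv V (𝟙 h)) := by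
      rw [famWhiskerLeft_eq, ← Category.id_comp (eHomEquiv V (𝟙 h)), fhcomp_comp]; simp
    rw [famWhiskerRight_eq, e]
    simp
  · have e : fhcomp (eHomEquiv V (𝟙 f)) (famWhiskerRight t h) = (𝟙_ V) ◁ (ρ_ T).inv ≫
        fhcomp (eHomEquiv V (𝟙 f)) (fhcomp t (eHomEquiv V (𝟙 h))) := by
      rw [famWhiskerRight_eq, ← Category.id_comp (eHomEquiv V (𝟙 f)), fhcomp_comp]; simp
    rw [famWhiskerLeft_eq, e]
    simp [← Category.assoc]

theorem VSquare.unitL {f f' : A ⟶ B} (t : T ⟶ (f ⟶[V] f')) :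
    VSquare (Bicategory.leftUnitor f) (Bicategory.leftUnitor f') (famWhiskerLeft (𝟙 A) t) t := by
  rw [vsquare_iff']
  have h := VCatCategory.id_hcomp (V := V) f f'
  have h' := congrArg (t ≫ ·) h
  rw [← post_pre]
  simp only [post, pre, Category.assoc]
  rw [← h', famWhiskerLeft, ← Category.id_comp (eId V (𝟙 A)), ← Category.comp_id t,
    ← MonoidalCategory.tensorHom_comp_tensorHom]
  simp

theorem VSquare.unitR {f f' : A ⟶ B} (t : T ⟶ (f ⟶[V] f')) :
    VSquare (Bicategory.rightUnitor f) (Bicategory.rightUnitor f') (famWhiskerRight t (𝟙 B)) t := by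
  rw [vsquare_iff']
  have h := VCatCategory.hcomp_id (V := V) f f'
  have h' := congrArg (t ≫ ·) h
  rw [← post_pre]
  simp only [post, pre, Category.assoc]
  rw [← h', famWhiskerRight, ← Category.id_comp (eId V (𝟙 B)), ← Category.comp_id t,
    ← MonoidalCategory.tensorHom_comp_tensorHom]
  simp

namespace VSquare

theorem whiskerLeft {p p' q q' : B ⟶ C} {σ : p ≅ p'} {σ' : q ≅ q'}
    {t : T ⟶ (p ⟶[V] q)} {t' : T ⟶ (p' ⟶[V] q')} (h : VSquare σ σ' t t') (f : A ⟶ B) :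
    VSquare (Bicategory.whiskerLeftIso f σ) (Bicategory.whiskerLeftIso f σ')
      (famWhiskerLeft f t) (famWhiskerLeft f t') := by
  rw [vsquare_iff] at *; subst h
  rw [famWhiskerLeft_pre, famWhiskerLeft_post]; rfl

theorem whiskerRight {p p' q q' : A ⟶ B} {σ : p ≅ p'} {σ' : q ≅ q'}
    {t : T ⟶ (p ⟶[V] q)} {t' : T ⟶ (p' ⟶[V] q')} (h : VSquare σ σ' t t') (f : B ⟶ C) :
    VSquare (Bicategory.whiskerRightIso σ f) (Bicategory.whiskerRightIso σ' f)
      (famWhiskerRight t f) (famWhiskerRight t' f) := by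
  rw [vsquare_iff] at *; subst h
  rw [famWhiskerRight_pre, famWhiskerRight_post]; rfl

theorem exchangeLeft {f f' : A ⟶ B} {g h : B ⟶ C} (φ : f ≅ f') (t : T ⟶ (g ⟶[V] h)) :
    VSquare (Bicategory.whiskerRightIso φ g) (Bicategory.whiskerRightIso φ h)
      (famWhiskerLeft f t) (famWhiskerLeft f' t) :=
  famWhiskerLeft_exchange φ.hom t

theorem exchangeRight {f f' : A ⟶ B} {g h : B ⟶ C} (t : T ⟶ (f ⟶[V] f')) (ψ : g ≅ h) :
    VSquare (Bicategory.whiskerLeftIso f ψ) (Bicategory.whiskerLeftIso f' ψ)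
      (famWhiskerRight t g) (famWhiskerRight t h) :=
  famWhiskerRight_exchange t ψ.hom

end VSquare

end Whisker

theorem conj_eq {C : Type uC} [Category.{vC} C] {a b a' b' : C} {x y : a ⟶ b} (h : x = y)
    (p : a' = a) (q : b = b') : eqToHom p ≫ x ≫ eqToHom q = eqToHom p ≫ y ≫ eqToHom q := by rw [h]

/-! ### Equality of families up to equality of endpoints -/

section FEq
variable {V : Type uV} [Category.{vV} V] [MonoidalCategory V] 
variable {C : Type uC} [Category.{vC} C] [EnrichedOrdinaryCategory V C] {T : V}

/-- Equality of families of morphisms up to equality of their domains and codomains. -/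
def FEq {p q p' q' : C} (t : T ⟶ (p ⟶[V] q)) (t' : T ⟶ (p' ⟶[V] q')) : Prop :=
  ∃ (h : p = p') (h' : q = q'), VSquare (eqToIso h) (eqToIso h') t t'

namespace FEq
variable {p q p' q' p'' q'' : C} {t : T ⟶ (p ⟶[V] q)} {t' : T ⟶ (p' ⟶[V] q')}
  {t'' : T ⟶ (p'' ⟶[V] q'')}

theorem rfl' (t : T ⟶ (p ⟶[V] q)) : FEq t t := ⟨rfl, rfl, VSquare.refl t⟩
theorem of_eq {t t' : T ⟶ (p ⟶[V] q)} (h : t = t') : FEq t t' := h ▸ rfl' t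
theorem symm (h : FEq t t') : FEq t' t := by
  obtain ⟨rfl, rfl, h⟩ := h; exact ⟨rfl, rfl, h.symm⟩
theorem trans (h : FEq t t') (h' : FEq t' t'') : FEq t t'' := by
  obtain ⟨rfl, rfl, h⟩ := h; obtain ⟨rfl, rfl, h'⟩ := h'
  exact ⟨rfl, rfl, (h.trans h').congr (by simp) (by simp)⟩
-- By proof irrelevance the sides may be built from any equalities at hand. Thus the `eqToIso`
-- pieces in a pasting of squares are filled by a calculation with `FEq`.
theorem vsquare (H : FEq t t') (h : p = p') (h' : q = q') :
    VSquare (eqToIso h) (eqToIso h') t t' := H.2.2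
theorem eq {t t' : T ⟶ (p ⟶[V] q)} (h : FEq t t') : t = t' := by
  obtain ⟨_, _, h⟩ := h; exact (VSquare.refl t).unique h |>.symm ▸ rfl
theorem of_vsquare {σ : p ≅ p'} {σ' : q ≅ q'} (h : VSquare σ σ' t t') {e e'}
    (h1 : σ.hom = eqToHom e) (h2 : σ'.hom = eqToHom e') : FEq t t' :=
  ⟨e, e', h.congr h1 h2⟩
end FEq
end FEq

/-! ### Strict associativity and unit laws for whiskered families -/

section
open Bicategory
variable {V : Type uV} [Category.{vV} V] [MonoidalCategory V] [BraidedCategory V]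
variable {M : Type uM} [Bicategory.{wM, vM} M] [Bicategory.Strict M]
  [∀ A B : M, EnrichedOrdinaryCategory V (A ⟶ B)] [VCatCategory V M]
variable {A B C D : M} {T : V}

namespace FEq

theorem assocL (f : A ⟶ B) (g : B ⟶ C) {h h' : C ⟶ D} (t : T ⟶ (h ⟶[V] h')) :
    FEq (famWhiskerLeft (f ≫ g) t) (famWhiskerLeft f (famWhiskerLeft g t)) :=
  of_vsquare (VSquare.assocL f g t) (associator_hom _ _ _) (associator_hom _ _ _)
theorem assocR {f f' : A ⟶ B} (t : T ⟶ (f ⟶[V] f')) (g : B ⟶ C) (h : C ⟶ D) :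
    FEq (famWhiskerRight (famWhiskerRight t g) h) (famWhiskerRight t (g ≫ h)) :=
  of_vsquare (VSquare.assocR t g h) (associator_hom _ _ _) (associator_hom _ _ _)
theorem assocM (f : A ⟶ B) {g g' : B ⟶ C} (t : T ⟶ (g ⟶[V] g')) (h : C ⟶ D) :
    FEq (famWhiskerRight (famWhiskerLeft f t) h) (famWhiskerLeft f (famWhiskerRight t h)) :=
  of_vsquare (VSquare.assocM f t h) (associator_hom _ _ _) (associator_hom _ _ _)
theorem unitL {f f' : A ⟶ B} (t : T ⟶ (f ⟶[V] f')) : FEq (famWhiskerLeft (𝟙 A) t) t :=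
  of_vsquare (VSquare.unitL t) (leftUnitor_hom _) (leftUnitor_hom _)
theorem unitR {f f' : A ⟶ B} (t : T ⟶ (f ⟶[V] f')) : FEq (famWhiskerRight t (𝟙 B)) t :=
  of_vsquare (VSquare.unitR t) (rightUnitor_hom _) (rightUnitor_hom _)
theorem left {f f' : A ⟶ B} (e : f = f') {g h g' h' : B ⟶ C} {t : T ⟶ (g ⟶[V] h)}
    {t' : T ⟶ (g' ⟶[V] h')} (H : FEq t t') : FEq (famWhiskerLeft f t) (famWhiskerLeft f' t') := by
  subst e; obtain ⟨rfl, rfl, H⟩ := H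
  exact ⟨rfl, rfl, (H.whiskerLeft f).congr (by simp) (by simp)⟩
theorem right {f f' : B ⟶ C} {g h g' h' : A ⟶ B} {t : T ⟶ (g ⟶[V] h)}
    {t' : T ⟶ (g' ⟶[V] h')} (H : FEq t t') (e : f = f') :
    FEq (famWhiskerRight t f) (famWhiskerRight t' f') := by
  subst e; obtain ⟨rfl, rfl, H⟩ := H
  exact ⟨rfl, rfl, (H.whiskerRight f).congr (by simp) (by simp)⟩
end FEq
end

/-! ### Uniform treatment of left and right actions -/

section Sides
open Bicategory
variable {V : Type uV} [Category.{vV} V] [MonoidalCategory V] [BraidedCategory V]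
variable {I : Type uI} [Category.{wI} I] [MonoidalCategory I] [EnrichedOrdinaryCategory V I]
  [MonoidalEnriched V I]
variable {M : Type uM} [Bicategory.{wM, vM} M] [Bicategory.Strict M]
  [∀ A B : M, EnrichedOrdinaryCategory V (A ⟶ B)] [VCatCategory V M]

attribute [local simp] leftUnitor_hom leftUnitor_inv rightUnitor_hom rightUnitor_inv associator_hom
  associator_inv

/-- The functoriality of `Side.mul`. -/
def Side.mulMap : (s : Side) → {x x' y y' : I} → (x ⟶ x') → (y ⟶ y') → (s.mul x y ⟶ s.mul x' y')
  | .r, _, _, _, _, f, g => f ⊛ₘ g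
  | .l, _, _, _, _, f, g => g ⊛ₘ f

variable {X Y Z W : IObj V I M} (s : Side)

theorem Side.passive_mul (Y : IObj V I M) (x y : I) :
    (s.passive Y).obj (s.mul x y) = (s.passive Y).obj x ≫ (s.passive Y).obj y := by
  cases s
  · exact Y.strict.L_mul y x
  · exact Y.strict.R_mul x y

theorem Side.passive_one (Y : IObj V I M) : (s.passive Y).obj (e[I]) = 𝟙 Y.carrier := by
  cases s
  · exact Y.strict.L_one
  · exact Y.strict.R_one

theorem Side.comm (Y : IObj V I M) (x y : I) : (s.active Y).obj x ≫ (s.passive Y).obj y =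
    (s.passive Y).obj y ≫ (s.active Y).obj x := by
  cases s
  · exact (Y.strict.comm y x).symm
  · exact Y.strict.comm x y

theorem Side.active_mul_map (Y : IObj V I M) {x x' y y' : I} (f : x ⟶ x') (g : y ⟶ y') :
    (s.active Y).map (s.mulMap f g) ≫ eqToHom (s.active_mul Y x' y') =
      eqToHom (s.active_mul Y x y) ≫ ((s.active Y).map g ▷ (s.active Y).obj x) ≫
        ((s.active Y).obj y' ◁ (s.active Y).map f) := by
  cases s
  · exact Y.strict.R_mul_map g f
  · exact Y.strict.L_mul_map f g

theorem exists_passive_trivial (Y : IObj V I M) : ∃ s : Side, IsTrivial (s.passive Y) := by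
  rcases Y.mute with h | h
  · exact ⟨.r, h.1⟩
  · exact ⟨.l, h.1⟩

namespace Equivariant

/-- The structure 2-cells of an equivariant morphism, in the direction determined by the side. -/
def ts (f : Equivariant X Y) : (s : Side) → (u : I) →
    ((s.active X).obj u ≫ f.hom ≫ (s.passive Y).obj u ≅
      (s.passive X).obj u ≫ f.hom ≫ (s.active Y).obj u)
  | .r, u => f.τ u
  | .l, u => (f.τ u).symm

theorem ts_natural (f : Equivariant X Y) {u v : I} (φ : u ⟶ v) :
    ((s.active X).map φ ▷ (f.hom ≫ (s.passive Y).obj u)) ≫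
        ((s.active X).obj v ◁ f.hom ◁ (s.passive Y).map φ) ≫ (f.ts s v).hom =
      (f.ts s u).hom ≫ ((s.passive X).map φ ▷ (f.hom ≫ (s.active Y).obj u)) ≫
        ((s.passive X).obj v ◁ f.hom ◁ (s.active Y).map φ) := by
  cases s
  · exact symm_nat (f.natural φ)
  · exact f.natural φ

theorem ts_one (f : Equivariant X Y) : (f.ts s (e[I])).hom = eqToHom (by
    rw [s.active_one, s.active_one, s.passive_one, s.passive_one]) := by
  cases s
  · exact inv_eq_eqToHom f.one
  · exact f.one

theorem ts_mul (f : Equivariant X Y) (u v : I) : (f.ts s (s.mul u v)).hom =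
    eqToHom (by simp only [s.active_mul, s.passive_mul, Strict.assoc]) ≫
    ((s.active X).obj v ◁ (f.ts s u).hom ▷ (s.passive Y).obj v) ≫
    eqToHom (by
      simp only [Strict.assoc, s.comm]
      simp only [← Strict.assoc, s.comm]) ≫
    ((s.passive X).obj u ◁ (f.ts s v).hom ▷ (s.active Y).obj u) ≫
    eqToHom (by simp only [s.passive_mul, s.active_mul, Strict.assoc]) := by
  cases s
  · exact symm_mul _ _ _ (f.mul v u)
  · exact f.mul u v

/-- When both actions on the middle object are trivial, the two prescribed orders of pasting are
both possible, and they agree by interchange of the two cells. -/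
theorem pasteIso_symm {A B C : M} {f : A ⟶ B} {g : B ⟶ C} {l r : A ⟶ A} {s m : B ⟶ B} {n k : C ⟶ C}
    (hs : s = 𝟙 B) (hm : m = 𝟙 B) (tf : l ≫ f ≫ s ≅ r ≫ f ≫ m) (tg : m ≫ g ≫ k ≅ s ≫ g ≫ n) :
    (pasteIso hm tf.symm tg.symm).symm = pasteIso hs tf tg := by
  subst hs hm
  ext
  refine Eq.trans ?_ ((conj_eq (whisker_exchange tf.hom tg.hom)
    (by simp only [Strict.assoc, Strict.comp_id, Strict.id_comp])
    (by simp only [Strict.assoc, Strict.id_comp])).trans ?_) <;>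
  simp [pasteIso]

/-- The definition of `comp` distinguishes cases by the triviality of `Y.R`. In terms of `ts` one
formula covers every middle object whose passive side is trivial. -/
theorem comp_ts (f : Equivariant X Y) (g : Equivariant Y Z) (hY : IsTrivial (s.passive Y)) (u : I) :
    (comp f g).ts s u = pasteIso (hY.obj_eq u) (f.ts s u) (g.ts s u) := by
  cases s
  -- If both actions on `Y` are trivial, `comp` uses the order for left actions, and `pasteIso_symm`
  -- reconciles it with the order for right actions.
  · by_cases h : IsTrivial Y.R
    · have e : (comp f g).τ u = pasteIso (h.obj_eq u) (f.τ u) (g.τ u) := dif_pos h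
      have := pasteIso_symm (h.obj_eq u) (hY.obj_eq u) (f.τ u) (g.τ u)
      exact congrArg Iso.symm (e.trans this.symm)
    · have e : (comp f g).τ u = (pasteIso ((Y.trivial_of_not h).obj_eq u) (f.τ u).symm
        (g.τ u).symm).symm := dif_neg h
      exact congrArg Iso.symm e
  · exact dif_pos hY

theorem isFam_iff (f g : Equivariant X Y) {T : V} (t : T ⟶ (f.hom ⟶[V] g.hom)) :
    IsFam f g t ↔ ∀ u : I, VSquare (f.ts s u) (g.ts s u)
      (famWhiskerLeft ((s.active X).obj u) (famWhiskerRight t ((s.passive Y).obj u)))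
      (famWhiskerLeft ((s.passive X).obj u) (famWhiskerRight t ((s.active Y).obj u))) := by
  cases s
  · exact ⟨fun h u => (h u).symm, fun h u => (h u).symm⟩
  · rfl

/-- The action cell of a composite is a pasting of two cells. Past the cell of `h` the family moves
by exchange, past the cells of `f` and `g` by hypothesis; the rest is strict associativity and the
triviality of the middle action. -/
theorem IsFam.comp_left {f g : Equivariant Y Z} {T : V} {t : T ⟶ (f.hom ⟶[V] g.hom)}
    (ht : IsFam f g t) (h : Equivariant X Y) :
    IsFam (comp h f) (comp h g) (famWhiskerLeft h.hom t) := by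
  obtain ⟨s, hY⟩ := exists_passive_trivial Y
  rw [isFam_iff s] at ht
  refine (isFam_iff s _ _ _).2 fun u => VSquare.congr
    (σ := pasteIso (hY.obj_eq u) (h.ts s u) (f.ts s u))
    (σ' := pasteIso (hY.obj_eq u) (h.ts s u) (g.ts s u)) ?_
    (congrArg Iso.hom (comp_ts s h f hY u).symm) (congrArg Iso.hom (comp_ts s h g hY u).symm)
  refine VSquare.trans (FEq.vsquare (t' := famWhiskerLeft (_ ≫ h.hom ≫ (s.passive Y).obj u)
      (famWhiskerRight t _)) ?_ _ _) <|
    (VSquare.exchangeLeft (h.ts s u) _).trans <|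
    (FEq.vsquare (t' := famWhiskerLeft (_ ≫ h.hom) (famWhiskerLeft _ (famWhiskerRight t _))) ?_ _ _).trans <|
    ((ht u).whiskerLeft _).trans <| FEq.vsquare ?_ _ _
  · refine ((FEq.assocM _ _ _).left rfl).trans <| (FEq.assocL _ _ _).symm.trans <|
      FEq.left (by rw [hY.obj_eq, Strict.comp_id]) (FEq.rfl' _)
  · exact ((FEq.left (Strict.assoc _ _ _).symm (FEq.rfl' _))).trans (FEq.assocL _ _ _)
  · refine (FEq.left rfl (FEq.left (hY.obj_eq u) (FEq.rfl' _))).trans <|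
      (FEq.left rfl (FEq.unitL _)).trans <| (FEq.assocL _ _ _).trans (FEq.left rfl (FEq.assocM _ _ _).symm)

/-- Dual to `IsFam.comp_left`: the hypothesis handles the first cell of the pasting and exchange the
second. -/
theorem IsFam.comp_right {f g : Equivariant X Y} {T : V} {t : T ⟶ (f.hom ⟶[V] g.hom)}
    (ht : IsFam f g t) (h : Equivariant Y Z) :
    IsFam (comp f h) (comp g h) (famWhiskerRight t h.hom) := by
  obtain ⟨s, hY⟩ := exists_passive_trivial Y
  rw [isFam_iff s] at ht
  refine (isFam_iff s _ _ _).2 fun u => VSquare.congr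
    (σ := pasteIso (hY.obj_eq u) (f.ts s u) (h.ts s u))
    (σ' := pasteIso (hY.obj_eq u) (g.ts s u) (h.ts s u)) ?_
    (congrArg Iso.hom (comp_ts s f h hY u).symm) (congrArg Iso.hom (comp_ts s g h hY u).symm)
  refine VSquare.trans (FEq.vsquare (t' := famWhiskerRight (famWhiskerLeft _
      (famWhiskerRight t ((s.passive Y).obj u))) _) ?_ _ _) <|
    ((ht u).whiskerRight _).trans <|
    (FEq.vsquare (t' := famWhiskerRight (famWhiskerLeft _ t) _) ?_ _ _).trans <|
    (VSquare.exchangeRight _ (h.ts s u)).trans <| FEq.vsquare ?_ _ _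
  · refine FEq.symm ((FEq.assocM _ _ _).trans <| FEq.left rfl ?_)
    refine ((FEq.right (FEq.rfl' _) (hY.obj_eq u)).trans (FEq.unitR _)).right rfl |>.trans
      (FEq.assocR _ _ _).symm
  · exact ((FEq.assocM _ _ _).symm.right rfl).trans (FEq.assocR _ _ _)
  · refine (FEq.assocM _ _ _).trans <| FEq.left rfl <|
      (FEq.right (FEq.rfl' _) (by rw [hY.obj_eq, Strict.id_comp])).trans (FEq.assocR _ _ _).symm

end Equivariant
end Sides

/-! ### Isomorphisms of equivariant morphisms; local morphisms -/

section EquivariantIso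
open Bicategory
variable {V : Type uV} [Category.{vV} V] [MonoidalCategory V] [BraidedCategory V]
variable {I : Type uI} [Category.{wI} I] [MonoidalCategory I] [EnrichedOrdinaryCategory V I]
  [MonoidalEnriched V I]
variable {M : Type uM} [Bicategory.{wM, vM} M] [Bicategory.Strict M]
  [∀ A B : M, EnrichedOrdinaryCategory V (A ⟶ B)] [VCatCategory V M]

attribute [local simp] leftUnitor_hom leftUnitor_inv rightUnitor_hom rightUnitor_inv associator_hom
  associator_inv

namespace Equivariant

variable {X Y Z W : IObj V I M} {T : V}

/-- The invertible 2-cell `i` is an isomorphism of 𝕀-equivariant morphisms. -/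
def IsIso₂ (f g : Equivariant X Y) (i : f.hom ≅ g.hom) : Prop :=
  IsFam f g (eHomEquiv V i.hom)

theorem isIso₂_iff (s : Side) {f g : Equivariant X Y} {i : f.hom ≅ g.hom} : IsIso₂ f g i ↔
    ∀ u, ((s.active X).obj u ◁ i.hom ▷ (s.passive Y).obj u) ≫ (g.ts s u).hom =
      (f.ts s u).hom ≫ ((s.passive X).obj u ◁ i.hom ▷ (s.active Y).obj u) := by
  rw [IsIso₂, isFam_iff s]
  simp only [famWhiskerRight_eHomEquiv, famWhiskerLeft_eHomEquiv, VSquare.eHomEquiv_iff]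

namespace IsIso₂
variable {f g h : Equivariant X Y} {i : f.hom ≅ g.hom} {j : g.hom ≅ h.hom}

theorem refl (f : Equivariant X Y) : IsIso₂ f f (Iso.refl _) := by
  rw [isIso₂_iff .r]; intro u; simp

theorem trans (hi : IsIso₂ f g i) (hj : IsIso₂ g h j) : IsIso₂ f h (i ≪≫ j) := by
  rw [isIso₂_iff .r] at *
  intro u
  simp only [Iso.trans_hom, comp_whiskerRight, Bicategory.whiskerLeft_comp, Category.assoc, hj u]
  rw [reassoc_of% (hi u)]

theorem symm (hi : IsIso₂ f g i) : IsIso₂ g f i.symm := by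
  rw [isIso₂_iff .r] at *
  intro u
  have := hi u
  rw [← cancel_epi ((Side.r.active X).obj u ◁ i.hom ▷ (Side.r.passive Y).obj u), reassoc_of% this]
  simp [← Bicategory.whiskerLeft_comp_assoc, ← Bicategory.whiskerLeft_comp,
    ← Bicategory.comp_whiskerRight]

theorem comp_left {f g : Equivariant Y Z} {i : f.hom ≅ g.hom} (hi : IsIso₂ f g i)
    (h : Equivariant X Y) : IsIso₂ (comp h f) (comp h g) (whiskerLeftIso h.hom i) := by
  have := IsFam.comp_left hi h
  rwa [famWhiskerLeft_eHomEquiv] at this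

theorem comp_right {f g : Equivariant X Y} {i : f.hom ≅ g.hom} (hi : IsIso₂ f g i)
    (h : Equivariant Y Z) : IsIso₂ (comp f h) (comp g h) (whiskerRightIso i h.hom) := by
  have := IsFam.comp_right hi h
  rwa [famWhiskerRight_eHomEquiv] at this

/-- The two middle objects are trivial on the same side, so both bracketings paste the three cells
in the same order. -/
theorem paste_assoc {A B C D : M} {f : A ⟶ B} {g : B ⟶ C} {h : C ⟶ D} {l r : A ⟶ A} {s m : B ⟶ B}
    {n k : C ⟶ C} {p q : D ⟶ D} (hs : s = 𝟙 B) (hn : n = 𝟙 C) (tf : l ≫ f ≫ s ≅ r ≫ f ≫ m)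
    (tg : m ≫ g ≫ n ≅ s ≫ g ≫ k) (th : k ≫ h ≫ p ≅ n ≫ h ≫ q) :
    (l ◁ eqToHom (Strict.assoc f g h) ▷ p) ≫ (pasteIso hs tf (pasteIso hn tg th)).hom =
      (pasteIso hn (pasteIso hs tf tg) th).hom ≫ (r ◁ eqToHom (Strict.assoc f g h) ▷ q) := by
  subst hs hn
  simp only [pasteIso, Category.assoc, eqToHom_trans, eqToHom_trans_assoc, eqToHom_refl,
    Category.id_comp, Category.comp_id, Bicategory.whiskerLeft_comp, Bicategory.comp_whiskerRight,
    whiskerLeft_eqToHom, eqToHom_whiskerRight, Bicategory.comp_whiskerLeft,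
    Bicategory.whiskerRight_comp, Bicategory.whisker_assoc, associator_hom, associator_inv,
    Bicategory.id_whiskerLeft, Bicategory.whiskerRight_id, leftUnitor_hom, leftUnitor_inv,
    rightUnitor_hom, rightUnitor_inv, Iso.trans_hom, eqToIso.hom, whiskerRightIso_hom, whiskerLeftIso_hom]

/-- The middle objects are trivial on opposite sides. The bracketings then differ in the order of
the cells of `f` and `h`, which are independent, so interchange identifies them. -/
theorem paste_assoc' {A B C D : M} {f : A ⟶ B} {g : B ⟶ C} {h : C ⟶ D} {l r : A ⟶ A} {s m : B ⟶ B}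
    {n k : C ⟶ C} {p q : D ⟶ D} (hs : s = 𝟙 B) (hn : n = 𝟙 C) (tf : l ≫ f ≫ s ≅ r ≫ f ≫ m)
    (tg : m ≫ g ≫ k ≅ s ≫ g ≫ n) (th : n ≫ h ≫ p ≅ k ≫ h ≫ q) :
    (l ◁ eqToHom (Strict.assoc f g h) ▷ p) ≫ (pasteIso hs tf (pasteIso hn tg.symm th.symm).symm).hom =
      (pasteIso hn (pasteIso hs tf tg).symm th.symm).symm.hom ≫
        (r ◁ eqToHom (Strict.assoc f g h) ▷ q) := by
  subst hs hn
  have ex := whisker_exchange (tf.hom ▷ g) th.hom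
  simp at ex
  rw [eqToHom_comp_iff] at ex; simp only [← Category.assoc] at ex
  rw [comp_eqToHom_iff] at ex; simp at ex
  simp [pasteIso, reassoc_of% ex]

theorem comp_ts' (s : Side) (f : Equivariant X Y) (g : Equivariant Y Z)
    (hY : IsTrivial (s.active Y)) (u : I) : (comp f g).ts s u =
      (pasteIso (hY.obj_eq u) (f.ts s u).symm (g.ts s u).symm).symm := by
  cases s
  · exact congrArg Iso.symm (comp_ts .r f g hY u)
  · exact congrArg Iso.symm (comp_ts .l f g hY u)

/-- Although composition depends on which sides of the middle objects are trivial, it is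
associative: the two mixed cases reduce to `paste_assoc'`, the others to `paste_assoc`. -/
theorem assoc (f : Equivariant X Y) (g : Equivariant Y Z) (h : Equivariant Z W) :
    IsIso₂ (comp (comp f g) h) (comp f (comp g h)) (eqToIso (Strict.assoc _ _ _)) := by
  obtain ⟨s, hY⟩ := exists_passive_trivial Y
  have hZ : IsTrivial (s.passive Z) ∨ IsTrivial (s.active Z) := by
    obtain ⟨s', hZ⟩ := exists_passive_trivial Z
    cases s <;> cases s' <;> first | exact Or.inl hZ | exact Or.inr hZ
  rw [isIso₂_iff s]
  intro u
  have e₁ := comp_ts s f g hY u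
  have e₂ := comp_ts s f (comp g h) hY u
  rcases hZ with hZ | hZ
  · have e₃ := comp_ts s g h hZ u
    have e₄ := comp_ts s (comp f g) h hZ u
    rw [e₃] at e₂
    rw [e₁] at e₄
    refine Eq.trans ?_ (Eq.trans (paste_assoc (hY.obj_eq u) (hZ.obj_eq u) (f.ts s u) (g.ts s u)
      (h.ts s u)) ?_)
    · exact congrArg (fun z => _ ≫ Iso.hom z) e₂
    · exact congrArg (fun z => Iso.hom z ≫ _) e₄.symm
  · have e₃ := comp_ts' s g h hZ u
    have e₄ := comp_ts' s (comp f g) h hZ u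
    rw [e₃] at e₂
    rw [e₁] at e₄
    refine Eq.trans ?_ (Eq.trans (paste_assoc' (hY.obj_eq u) (hZ.obj_eq u) (f.ts s u) (g.ts s u)
      (h.ts s u)) ?_)
    · exact congrArg (fun z => _ ≫ Iso.hom z) e₂
    · exact congrArg (fun z => Iso.hom z ≫ _) e₄.symm

theorem paste_id {A B : M} {f : A ⟶ B} {l r : A ⟶ A} {s m : B ⟶ B} (hl : r = 𝟙 A)
    (t : l ≫ f ≫ s ≅ r ≫ f ≫ m) (e : l ≫ 𝟙 A ≫ r ≅ r ≫ 𝟙 A ≫ l) (h) (he : e = eqToIso h) :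
    (l ◁ eqToHom (Strict.id_comp f) ▷ s) ≫ t.hom =
      (pasteIso hl e t).hom ≫ (r ◁ eqToHom (Strict.id_comp f) ▷ m) := by
  subst hl he
  simp [pasteIso]

theorem paste_id' {A B : M} {f : A ⟶ B} {l r : A ⟶ A} {s m : B ⟶ B} (hs : s = 𝟙 B)
    (t : l ≫ f ≫ s ≅ r ≫ f ≫ m) (e : m ≫ 𝟙 B ≫ s ≅ s ≫ 𝟙 B ≫ m) (h) (he : e = eqToIso h) :
    (l ◁ eqToHom (Strict.comp_id f) ▷ s) ≫ t.hom =
      (pasteIso hs t e).hom ≫ (r ◁ eqToHom (Strict.comp_id f) ▷ m) := by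
  subst hs he
  simp [pasteIso]

theorem id_ts (X : IObj V I M) (s : Side) (u : I) (h) : (Equivariant.id X).ts s u = eqToIso h := by
  cases s <;> rfl

theorem id_comp (f : Equivariant X Y) :
    IsIso₂ (comp (Equivariant.id X) f) f (eqToIso (Strict.id_comp _)) := by
  obtain ⟨s, hX⟩ := exists_passive_trivial X
  rw [isIso₂_iff s]
  intro u
  refine Eq.trans ?_ (congrArg (fun z => Iso.hom z ≫ _) (comp_ts s (Equivariant.id X) f hX u).symm)
  exact paste_id (hX.obj_eq u) (f.ts s u) _ (by rw [hX.obj_eq]; simp [Equivariant.id, Strict.id_comp, Strict.comp_id]) (id_ts X s u _)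

theorem comp_id (f : Equivariant X Y) :
    IsIso₂ (comp f (Equivariant.id Y)) f (eqToIso (Strict.comp_id _)) := by
  obtain ⟨s, hX⟩ := exists_passive_trivial Y
  rw [isIso₂_iff s]
  intro u
  refine Eq.trans ?_ (congrArg (fun z => Iso.hom z ≫ _) (comp_ts s f (Equivariant.id Y) hX u).symm)
  exact paste_id' (hX.obj_eq u) (f.ts s u) _ (by rw [hX.obj_eq]; simp [Equivariant.id, Strict.id_comp, Strict.comp_id]) (id_ts Y s u _)

theorem nonempty_iso (h : IsIso₂ f g i) : Nonempty (f ≅ g) :=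
  ⟨{ hom := ⟨i.hom, (isIso₂_iff .r).1 h⟩
     inv := ⟨i.inv, (isIso₂_iff .r).1 h.symm⟩
     hom_inv_id := Hom₂.ext i.hom_inv_id
     inv_hom_id := Hom₂.ext i.inv_hom_id }⟩

theorem of_iso (i : f ≅ g) : IsIso₂ f g (isoCell i) := (isIso₂_iff .r).2 i.hom.comm

end IsIso₂

/-- The square for `t'` is that for `t` with whiskered conjugation squares pasted to its two ends;
equivariance of `i` and `j` identifies the outer sides. -/
theorem IsFam.conj {f f' g g' : Equivariant X Y} {t : T ⟶ (f.hom ⟶[V] g.hom)}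
    {t' : T ⟶ (f'.hom ⟶[V] g'.hom)} (ht : IsFam f g t) {i : f.hom ≅ f'.hom} {j : g.hom ≅ g'.hom}
    (hi : IsIso₂ f f' i) (hj : IsIso₂ g g' j) (h : VSquare i j t t') : IsFam f' g' t' := by
  rw [isIso₂_iff .r] at hi hj
  rw [isFam_iff .r] at ht ⊢
  intro u
  refine VSquare.congr
    (((h.whiskerRight ((Side.r.passive Y).obj u)).whiskerLeft ((Side.r.active X).obj u)).symm.trans
      ((ht u).trans ((h.whiskerRight ((Side.r.active Y).obj u)).whiskerLeft
        ((Side.r.passive X).obj u)))) ?_ ?_ <;>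
  simp only [Iso.trans_hom, Iso.symm_hom, Iso.inv_comp_eq, whiskerLeftIso_hom, whiskerRightIso_hom,
    hi, hj]

/-- Precomposition with `η` is an equivalence from equivariant morphisms `Y → B` to equivariant
morphisms `X → B`. -/
structure IsLocal (η : Equivariant X Y) (B : IObj V I M) : Prop where
  ess_surj (f : Equivariant X B) :
    ∃ (g : Equivariant Y B) (i : η.hom ≫ g.hom ≅ f.hom), IsIso₂ (comp η g) f i
  fully_faithful (g g' : Equivariant Y B) (T : V)
    (s : T ⟶ ((η.hom ≫ g.hom) ⟶[V] (η.hom ≫ g'.hom))) (hs : IsFam (comp η g) (comp η g') s) :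
    ∃! t : T ⟶ (g.hom ⟶[V] g'.hom), IsFam g g' t ∧ famWhiskerLeft η.hom t = s

namespace IsLocal

/-- Isomorphisms lift along a local morphism. -/
theorem exists_iso {η : Equivariant X Y} {B : IObj V I M} (h : IsLocal η B) {g g' : Equivariant Y B}
    {i : η.hom ≫ g.hom ≅ η.hom ≫ g'.hom} (hi : IsIso₂ (comp η g) (comp η g') i) :
    ∃ j : g.hom ≅ g'.hom, IsIso₂ g g' j ∧ η.hom ◁ j.hom = i.hom := by
  -- Full faithfulness for families indexed by the unit object lifts single 2-cells.
  have key : ∀ {g g' : Equivariant Y B} {i : η.hom ≫ g.hom ≅ η.hom ≫ g'.hom},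
      IsIso₂ (comp η g) (comp η g') i →
      ∃ j : g.hom ⟶ g'.hom, IsFam g g' (eHomEquiv V j) ∧ η.hom ◁ j = i.hom := by
    intro g g' i hi
    obtain ⟨t, ⟨ht, ht'⟩, -⟩ := h.fully_faithful g g' _ (eHomEquiv V i.hom) hi
    obtain ⟨j, rfl⟩ := (eHomEquiv V).surjective t
    exact ⟨j, ht, (eHomEquiv V).injective ((famWhiskerLeft_eHomEquiv _ _).symm.trans ht')⟩
  -- Used to see that the lifts of `i` and of its inverse are inverse to each other.
  have faithful : ∀ {g : Equivariant Y B} {a : g.hom ⟶ g.hom}, IsFam g g (eHomEquiv V a) →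
      η.hom ◁ a = 𝟙 _ → a = 𝟙 _ := by
    intro g a ha e
    have hid : IsFam g g (eHomEquiv V (𝟙 g.hom)) := IsIso₂.refl g
    obtain ⟨t, -, ht⟩ := h.fully_faithful g g _ _ (hid.comp_left η)
    refine (eHomEquiv V).injective ((ht _ ⟨ha, ?_⟩).trans (ht _ ⟨hid, rfl⟩).symm)
    rw [famWhiskerLeft_eHomEquiv, famWhiskerLeft_eHomEquiv, e, Bicategory.whiskerLeft_id]
  have fc : ∀ {g g' g'' : Equivariant Y B} {a : g.hom ⟶ g'.hom} {b : g'.hom ⟶ g''.hom},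
      IsFam g g' (eHomEquiv V a) → IsFam g' g'' (eHomEquiv V b) →
      IsFam g g'' (eHomEquiv V (a ≫ b)) := by
    intro g g' g'' a b ha hb u
    have ha := ha u
    have hb := hb u
    simp only [famWhiskerRight_eHomEquiv, famWhiskerLeft_eHomEquiv, VSquare.eHomEquiv_iff] at ha hb ⊢
    simp only [comp_whiskerRight, Bicategory.whiskerLeft_comp, Category.assoc, hb]
    rw [reassoc_of% ha]
  obtain ⟨a, ha, ea⟩ := key hi
  obtain ⟨b, hb, eb⟩ := key hi.symm
  exact ⟨⟨a, b, faithful (fc ha hb)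
      ((Bicategory.whiskerLeft_comp _ _ _).trans ((congrArg₂ (· ≫ ·) ea eb).trans i.hom_inv_id)),
    faithful (fc hb ha)
      ((Bicategory.whiskerLeft_comp _ _ _).trans ((congrArg₂ (· ≫ ·) eb ea).trans i.inv_hom_id))⟩, ha, ea⟩

theorem comp {η : Equivariant X Y} {θ : Equivariant Y Z} {B : IObj V I M} (h : IsLocal η B)
    (h' : IsLocal θ B) : IsLocal (comp η θ) B where
  ess_surj f := by
    obtain ⟨g, i, hi⟩ := h.ess_surj f
    obtain ⟨k, j, hj⟩ := h'.ess_surj g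
    exact ⟨k, _, ((IsIso₂.assoc η θ k).trans (hj.comp_left η)).trans hi⟩
  fully_faithful g g' T s hs := by
    have hs' : IsFam (Equivariant.comp η (Equivariant.comp θ g))
        (Equivariant.comp η (Equivariant.comp θ g')) _ :=
      hs.conj (IsIso₂.assoc η θ g) (IsIso₂.assoc η θ g') (VSquare.conj _ _ s)
    obtain ⟨t₁, ⟨ht₁, e₁⟩, u₁⟩ := h.fully_faithful _ _ T _ hs'
    obtain ⟨t, ⟨ht, e⟩, u⟩ := h'.fully_faithful _ _ T t₁ ht₁
    have key : ∀ t : T ⟶ (g.hom ⟶[V] g'.hom), VSquare (eqToIso (Strict.assoc η.hom θ.hom g.hom))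
        (eqToIso (Strict.assoc η.hom θ.hom g'.hom)) (famWhiskerLeft (η.hom ≫ θ.hom) t)
        (famWhiskerLeft η.hom (famWhiskerLeft θ.hom t)) := fun t =>
      (FEq.assocL _ _ _).vsquare _ _
    refine ⟨t, ⟨ht, ?_⟩, fun t' ht' => u t' ⟨ht'.1, u₁ _ ⟨ht'.1.comp_left θ, ?_⟩⟩⟩
    · have := key t
      have e' : famWhiskerLeft η.hom (famWhiskerLeft θ.hom t) = _ :=
        (congrArg (famWhiskerLeft η.hom) e).trans e₁
      rw [e'] at this
      exact this.unique' (VSquare.conj _ _ s)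
    · have := key t'
      have e' : famWhiskerLeft (η.hom ≫ θ.hom) t' = s := ht'.2
      rw [e'] at this
      exact this.unique (VSquare.conj _ _ s)

/-- A morphism to `B` is transported to `B'` along `e`, extended there, and transported back along
`e'`; the isomorphism `e ≫ e' ≅ id` compares the result with the original. -/
theorem of_equivalent {η : Equivariant X Y} {B B' : IObj V I M} (h : IsLocal η B')
    (hB : Equivalent B B') : IsLocal η B := by
  obtain ⟨e, e', ⟨i⟩, -⟩ := hB
  obtain ⟨j, hi⟩ : ∃ j : e.hom ≫ e'.hom ≅ 𝟙 B.carrier,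
    IsIso₂ (Equivariant.comp e e') (Equivariant.id B) j := ⟨isoCell i, IsIso₂.of_iso i⟩
  have iso : ∀ {Z : IObj V I M} (f : Equivariant Z B), IsIso₂ (Equivariant.comp (Equivariant.comp f e) e') f
      (eqToIso (Strict.assoc _ _ _) ≪≫ whiskerLeftIso f.hom j ≪≫
        eqToIso (Strict.comp_id _)) := fun f =>
    (IsIso₂.assoc f e e').trans ((hi.comp_left f).trans (IsIso₂.comp_id f))
  -- Whiskering with `e` and then `e'` is conjugate to doing nothing. This gives existence as well
  -- as uniqueness of lifted families.
  have sq : ∀ {Z : M} {f f' : Z ⟶ B.carrier} {T : V} (t : T ⟶ (f ⟶[V] f')),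
      VSquare (eqToIso (Strict.assoc f e.hom e'.hom) ≪≫ whiskerLeftIso f j ≪≫
          eqToIso (Strict.comp_id _)) (eqToIso (Strict.assoc f' e.hom e'.hom) ≪≫
          whiskerLeftIso f' j ≪≫ eqToIso (Strict.comp_id _))
        (famWhiskerRight (famWhiskerRight t e.hom) e'.hom) t := fun t =>
    ((FEq.assocR _ _ _).vsquare _ _).trans
      ((VSquare.exchangeRight t j).trans ((FEq.unitR _).vsquare _ _))
  have raw : ∀ {W Y' : M} (a : W ⟶ Y') (g : Y' ⟶ B.carrier),
      (whiskerRightIso (eqToIso (Strict.assoc a g e.hom)) e'.hom ≪≫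
        eqToIso (Strict.assoc a (g ≫ e.hom) e'.hom) ≪≫
        whiskerLeftIso a (eqToIso (Strict.assoc g e.hom e'.hom) ≪≫ whiskerLeftIso g j ≪≫
          eqToIso (Strict.comp_id g))).hom =
      (eqToIso (Strict.assoc (a ≫ g) e.hom e'.hom) ≪≫ whiskerLeftIso (a ≫ g) j ≪≫
        eqToIso (Strict.comp_id (a ≫ g))).hom := by
    intros; simp
  refine ⟨fun f => ?_, fun g g' T s hs => ?_⟩
  · obtain ⟨g, k, hk⟩ := h.ess_surj (Equivariant.comp f e)
    exact ⟨Equivariant.comp g e', _,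
      ((IsIso₂.assoc η g e').symm.trans (hk.comp_right e')).trans (iso f)⟩
  · have hs' : IsFam (Equivariant.comp η (Equivariant.comp g e))
        (Equivariant.comp η (Equivariant.comp g' e)) _ :=
      (hs.comp_right e).conj (IsIso₂.assoc η g e) (IsIso₂.assoc η g' e) (VSquare.conj _ _ _)
    obtain ⟨t, ⟨ht, et⟩, ut⟩ := h.fully_faithful _ _ T _ hs'
    have hc := VSquare.conj (eqToIso (Strict.assoc η.hom g.hom e.hom))
      (eqToIso (Strict.assoc η.hom g'.hom e.hom)) (famWhiskerRight s e.hom)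
    refine ⟨_, ⟨(ht.comp_right e').conj (iso g) (iso g') (VSquare.conj _ _ _), ?_⟩, ?_⟩
    · refine VSquare.unique ?_ (sq s)
      have hc' : VSquare (eqToIso (Strict.assoc η.hom g.hom e.hom))
          (eqToIso (Strict.assoc η.hom g'.hom e.hom)) (famWhiskerRight s e.hom)
          (famWhiskerLeft (g := g.hom ≫ e.hom) (h := g'.hom ≫ e.hom) η.hom t) :=
        (congrArg (VSquare _ _ (famWhiskerRight s e.hom)) et).mpr hc
      refine VSquare.congr ((hc'.whiskerRight e'.hom).trans
        (((FEq.assocM _ _ _).vsquare (Strict.assoc _ _ _) (Strict.assoc _ _ _)).trans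
        ((VSquare.conj _ _ (famWhiskerRight t e'.hom)).whiskerLeft η.hom))) ?_ ?_
      · exact raw _ _
      · exact raw _ _
    · rintro t' ⟨ht', e'⟩
      refine VSquare.unique (sq t') ?_
      -- Uniqueness over `B'` determines `t' ▷ e`, and `sq` recovers `t'` from it.
      have : famWhiskerRight t' e.hom = t := by
        refine ut _ ⟨ht'.comp_right e, VSquare.unique ?_ hc⟩
        rw [← e']
        exact (FEq.assocM _ _ _).vsquare _ _
      rw [this]
      exact VSquare.conj _ _ _

end IsLocal

end Equivariant
end EquivariantIso

/-! ### From ordinary naturality to `V`-naturality -/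

section VNatural
open MonoidalCategory

variable {V : Type uV} [Category.{vV} V] [MonoidalCategory V] [SymmetricCategory V]
variable {I : Type uI} [Category.{wI} I] [EnrichedOrdinaryCategory V I]

section
variable {D : Type uD} [Category.{vD} D] [EnrichedOrdinaryCategory V D]

theorem underlying_map (F : EnrichedFunctor V I D) {i j : I} (f : i ⟶ j) :
    eHomEquiv V ((underlying V F).map f) = eHomEquiv V f ≫ F.map i j :=
  (eHomEquiv V).apply_symm_apply _

/-- The `V`-functor isomorphic to `F` with given values on objects. -/
def conjFunctor (F : EnrichedFunctor V I D) (G : I → D) (φ : ∀ i, F.obj i ≅ G i) :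
    EnrichedFunctor V I D where
  obj := G
  map i j := pre (φ i).inv (post (F.map i j) (φ j).hom)
  map_id i := by
    rw [comp_pre, comp_post, F.map_id, ← eHomEquiv_id, ← eHomEquiv_id, post_eHomEquiv,
      pre_eHomEquiv]
    simp
  map_comp i j k := by
    have h : fcomp (pre (φ i).inv (post (F.map i j) (φ j).hom))
        (pre (φ j).inv (post (F.map j k) (φ k).hom)) =
        pre (φ i).inv (post (fcomp (F.map i j) (F.map j k)) (φ k).hom) := by
      rw [fcomp_pre, post_pre, post_post, pre_fcomp, Iso.hom_inv_id, post_id, fcomp_post]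
    rw [comp_pre, comp_post, F.map_comp]
    exact h.symm

theorem conjFunctor_vsquare (F : EnrichedFunctor V I D) (G : I → D) (φ : ∀ i, F.obj i ≅ G i)
    (i j : I) : VSquare (φ i) (φ j) (F.map i j) ((conjFunctor F G φ).map i j) :=
  VSquare.conj _ _ _

/-- The hypothesis `hV` speaks of functors between the categories `ForgetEnrichment`, whereas
`underlying` lives on the given ordinary categories; `eHomEquiv` translates between their morphisms.
-/
theorem enrichedFunctor_ext_of_underlying (hV : ForgetFaithful.{uV, vV, uI, uD} V)
    {F G : EnrichedFunctor V I D} (h : underlying V F = underlying V G) : F = G := by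
  refine hV I D F G ?_
  obtain ⟨o, m, h₁, h₂⟩ := F
  obtain ⟨o', m', h₁', h₂'⟩ := G
  obtain rfl : o = o' := funext fun i => congrArg (fun H : I ⥤ D => H.obj i) h
  refine CategoryTheory.Functor.hext (fun i => rfl) fun i j f => heq_of_eq ?_
  let f' : ForgetEnrichment.to V i ⟶ ForgetEnrichment.to V j :=
    (eHomEquiv V).symm (ForgetEnrichment.homTo V f)
  have e : HEq ((underlying V ⟨o, m, h₁, h₂⟩).map f') ((underlying V ⟨o, m', h₁', h₂'⟩).map f') :=
    congr_arg_heq (fun H : I ⥤ D => H.map f') h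
  replace e := eq_of_heq e
  have e' := (underlying_map ⟨o, m, h₁, h₂⟩ f').symm.trans
    ((congrArg (eHomEquiv V) e).trans (underlying_map ⟨o, m', h₁', h₂'⟩ f'))
  have hf : eHomEquiv V f' = ForgetEnrichment.homTo V f := Equiv.apply_symm_apply _ _
  rw [hf] at e'
  exact congrArg (ForgetEnrichment.homOf V) e'

/-- Conjugating `F` by `φ` gives a `V`-functor with the objects of `G`. Ordinary naturality of `φ`
says that it has the underlying functor of `G`, hence it equals `G` by faithfulness of the forgetful
functor. This is what makes the ordinary data in the definitions of actions and cowedges sufficient.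
-/
theorem vsquare_of_natural (hV : ForgetFaithful.{uV, vV, uI, uD} V) {F G : EnrichedFunctor V I D}
    (φ : ∀ i, F.obj i ≅ G.obj i)
    (h : ∀ {i j : I} (f : i ⟶ j), (underlying V F).map f ≫ (φ j).hom =
      (φ i).hom ≫ (underlying V G).map f) (i j : I) :
    VSquare (φ i) (φ j) (F.map i j) (G.map i j) := by
  have e : conjFunctor F G.obj φ = G := by
    refine enrichedFunctor_ext_of_underlying hV ?_
    refine CategoryTheory.Functor.hext (fun i => rfl) fun i j f => heq_of_eq ?_
    refine (eHomEquiv V).injective ?_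
    have e₂ : eHomEquiv V f ≫ (conjFunctor F G.obj φ).map i j =
        eHomEquiv V ((φ i).inv ≫ (underlying V F).map f ≫ (φ j).hom) :=
      (comp_pre _ _ _).trans ((congrArg (pre _) ((comp_post _ _ _).trans
        ((congrArg (post · _) (underlying_map F f).symm).trans (post_eHomEquiv _ _)))).trans
        (pre_eHomEquiv _ _))
    exact ((underlying_map _ f).trans e₂).trans (congrArg _ ((Iso.inv_comp_eq _).2 (h f)))
  -- Equality of the `V`-functors has to be turned into equality of their actions on hom objects,
  -- whose types depend on the object parts; here the object parts agree definitionally.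
  have e' : ∀ o m h₁ h₂, (⟨o, m, h₁, h₂⟩ : EnrichedFunctor V I D) = G → ∀ p : o = G.obj,
      p ▸ m = G.map := by
    rintro o m h₁ h₂ rfl p
    rfl
  have e₁ := conjFunctor_vsquare F G.obj φ i j
  rwa [show (conjFunctor F G.obj φ).map = G.map from e' _ _ _ _ e rfl] at e₁

/-- The family `s` of morphisms `F i → G i`, indexed by `T`, is `V`-natural. -/
def VNat {T : V} (F G : EnrichedFunctor V I D) (s : ∀ i, T ⟶ (F.obj i ⟶[V] G.obj i)) : Prop :=
  ∀ i j, (β_ T (i ⟶[V] j)).hom ≫ fcomp (F.map i j) (s j) = fcomp (s i) (G.map i j)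

theorem VNat.of_vsquare {F G : EnrichedFunctor V I D} {φ : ∀ i, F.obj i ≅ G.obj i}
    (h : ∀ i j, VSquare (φ i) (φ j) (F.map i j) (G.map i j)) :
    VNat F G fun i => eHomEquiv V (φ i).hom := by
  intro i j
  have h' : post (F.map i j) (φ j).hom = pre (φ i).hom (G.map i j) := h i j
  rw [post_eq, pre_eq, Iso.inv_comp_eq] at h'
  rw [h', braiding_tensorUnit_left]
  simp

theorem VNat.conj {T : V} {F G F' G' : EnrichedFunctor V I D}
    {s : ∀ i, T ⟶ (F.obj i ⟶[V] G.obj i)} (hs : VNat F G s)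
    {s' : ∀ i, T ⟶ (F'.obj i ⟶[V] G'.obj i)} {φ : ∀ i, F.obj i ≅ F'.obj i}
    {ψ : ∀ i, G.obj i ≅ G'.obj i} (hφ : ∀ i j, VSquare (φ i) (φ j) (F.map i j) (F'.map i j))
    (hψ : ∀ i j, VSquare (ψ i) (ψ j) (G.map i j) (G'.map i j))
    (h : ∀ i, VSquare (φ i) (ψ i) (s i) (s' i)) : VNat F' G' s' := by
  intro i j
  have e₁ := ((hφ i j).fcomp (h j)).comp_left (β_ T (i ⟶[V] j)).hom
  rw [hs i j] at e₁
  exact e₁.unique ((h i).fcomp (hψ i j))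

end

variable {M : Type uM} [Bicategory.{wM, vM} M] [Bicategory.Strict M]
  [∀ A B : M, EnrichedOrdinaryCategory V (A ⟶ B)] [VCatCategory V M] {A B C : M}

/-- Postcomposition of a `V`-functor `I → [A, B]` with a 1-cell. -/
def enrR (F : EnrichedFunctor V I (A ⟶ B)) (k : B ⟶ C) :
    EnrichedFunctor V I (A ⟶ C) where
  obj i := F.obj i ≫ k
  map i j := famWhiskerRight (F.map i j) k
  map_id i := by
    rw [comp_famWhiskerRight, F.map_id, ← eHomEquiv_id, famWhiskerRight_eHomEquiv,
      Bicategory.id_whiskerRight, eHomEquiv_id]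
  map_comp i j l := by
    rw [comp_famWhiskerRight, F.map_comp]
    exact famWhiskerRight_fcomp _ _ _

/-- Precomposition of a `V`-functor `I → [B, C]` with a 1-cell. -/
def enrL (k : A ⟶ B) (F : EnrichedFunctor V I (B ⟶ C)) :
    EnrichedFunctor V I (A ⟶ C) where
  obj i := k ≫ F.obj i
  map i j := famWhiskerLeft k (F.map i j)
  map_id i := by
    rw [comp_famWhiskerLeft, F.map_id, ← eHomEquiv_id, famWhiskerLeft_eHomEquiv,
      Bicategory.whiskerLeft_id, eHomEquiv_id]
  map_comp i j l := by
    rw [comp_famWhiskerLeft, F.map_comp]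
    exact famWhiskerLeft_fcomp _ _ _

/-- Postcomposition of a functor `I → [A, B]` with a 1-cell. -/
def funR (F : I ⥤ (A ⟶ B)) (k : B ⟶ C) : I ⥤ (A ⟶ C) where
  obj i := F.obj i ≫ k
  map f := Bicategory.whiskerRight (F.map f) k

/-- Precomposition of a functor `I → [B, C]` with a 1-cell. -/
def funL (k : A ⟶ B) (F : I ⥤ (B ⟶ C)) : I ⥤ (A ⟶ C) where
  obj i := k ≫ F.obj i
  map f := Bicategory.whiskerLeft k (F.map f)

/-- Both sides are horizontal composites of `F.map i j` with `t`, read in the two orders. -/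
theorem VNat.whiskerL_exchange {T : V} (F : EnrichedFunctor V I (A ⟶ B)) {k k' : B ⟶ C}
    (t : T ⟶ (k ⟶[V] k')) :
    VNat (enrR F k) (enrR F k') fun i => famWhiskerLeft (F.obj i) t := by
  intro i j
  exact (congrArg (_ ≫ ·) (fhcomp_eq_fcomp _ _)).trans (fhcomp_eq_braiding _ _).symm

/-- Here the braiding occurs twice and has to cancel, which uses the symmetry of `V`. -/
theorem VNat.whiskerR_exchange {T : V} (F : EnrichedFunctor V I (B ⟶ C)) {k k' : A ⟶ B}
    (t : T ⟶ (k ⟶[V] k')) :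
    VNat (enrL k F) (enrL k' F) fun i => famWhiskerRight t (F.obj i) := by
  intro i j
  refine (congrArg (_ ≫ ·) (fhcomp_eq_braiding _ _)).trans ?_
  rw [SymmetricCategory.symmetry_assoc]
  exact (fhcomp_eq_fcomp _ _).symm

end VNatural

/-! ### Jointly faithful families of 1-cells -/

section Joint
open Bicategory
variable {V : Type uV} [Category.{vV} V] [MonoidalCategory V] [SymmetricCategory V]
variable {M : Type uM} [Bicategory.{wM, vM} M] [Bicategory.Strict M]
  [∀ A B : M, EnrichedOrdinaryCategory V (A ⟶ B)] [VCatCategory V M]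

variable (V) in
/-- Families of 2-cells between 1-cells with source `O` are determined by their restrictions along
the `e i`. -/
def JointlyFaithful {J : Type*} {A : J → M} {O : M} (e : ∀ i, A i ⟶ O) : Prop :=
  ∀ ⦃Z : M⦄ ⦃k k' : O ⟶ Z⦄ ⦃T : V⦄ ⦃t t' : T ⟶ (k ⟶[V] k')⦄,
    (∀ i, famWhiskerLeft (e i) t = famWhiskerLeft (e i) t') → t = t'

namespace JointlyFaithful
variable {J : Type*} {A : J → M} {O Z : M} {e : ∀ i, A i ⟶ O}

theorem cell (h : JointlyFaithful V e) {k k' : O ⟶ Z} {φ ψ : k ⟶ k'}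
    (H : ∀ i, e i ◁ φ = e i ◁ ψ) : φ = ψ :=
  (eHomEquiv V).injective <| h fun i => by
    rw [famWhiskerLeft_eHomEquiv, famWhiskerLeft_eHomEquiv, H]

theorem vsquare (h : JointlyFaithful V e) {p p' q q' : O ⟶ Z} {σ : p ≅ p'} {σ' : q ≅ q'} {T : V}
    {t : T ⟶ (p ⟶[V] q)} {t' : T ⟶ (p' ⟶[V] q')}
    (H : ∀ i, VSquare (whiskerLeftIso (e i) σ) (whiskerLeftIso (e i) σ') (famWhiskerLeft (e i) t)
      (famWhiskerLeft (e i) t')) : VSquare σ σ' t t' :=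
  vsquare_iff.2 <| h fun i => (H i).unique ((VSquare.conj σ σ' t).whiskerLeft (e i))

/-- The lifts of `i` and of its inverse are mutually inverse, since their composites restrict to
identities along every `e n`. -/
theorem exists_iso (h : JointlyFaithful V e) {k k' : O ⟶ Z} (i : ∀ n, e n ≫ k ≅ e n ≫ k')
    (h₁ : ∃ φ : k ⟶ k', ∀ n, e n ◁ φ = (i n).hom) (h₂ : ∃ φ : k' ⟶ k, ∀ n, e n ◁ φ = (i n).inv) :
    ∃ φ : k ≅ k', ∀ n, e n ◁ φ.hom = (i n).hom := by
  obtain ⟨φ, hφ⟩ := h₁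
  obtain ⟨ψ, hψ⟩ := h₂
  exact ⟨⟨φ, ψ, h.cell fun n => by simp [hφ, hψ], h.cell fun n => by simp [hφ, hψ]⟩, hφ⟩

theorem comp (h : JointlyFaithful V e) {B : M} {π : O ⟶ B}
    (hπ : JointlyFaithful V fun _ : Unit => π) : JointlyFaithful V fun i => e i ≫ π := by
  intro Z k k' T t t' H
  refine hπ fun _ => h fun i => ?_
  have e₁ := (FEq.assocL (e i) π t).vsquare (Strict.assoc _ _ _) (Strict.assoc _ _ _)
  rw [H i] at e₁
  exact e₁.unique ((FEq.assocL (e i) π t').vsquare (Strict.assoc _ _ _) (Strict.assoc _ _ _))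

end JointlyFaithful
end Joint

/-! ### Families indexed by `I` with structure cells -/

section Mid
open Bicategory

variable {V : Type uV} [Category.{vV} V] [MonoidalCategory V] [SymmetricCategory V]
variable {I : Type uI} [Category.{wI} I] [MonoidalCategory I] [EnrichedOrdinaryCategory V I]
  [MonoidalEnriched V I]
variable {M : Type uM} [Bicategory.{wM, vM} M] [Bicategory.Strict M]
  [∀ A B : M, EnrichedOrdinaryCategory V (A ⟶ B)] [VCatCategory V M]

attribute [local simp] leftUnitor_hom leftUnitor_inv rightUnitor_hom rightUnitor_inv associator_hom
  associator_inv

section VStr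
open MonoidalCategory
variable {D : Type uD} [Category.{vD} D] [EnrichedOrdinaryCategory V D]

variable (V) in
/-- A `V`-functor with underlying functor `H`. -/
structure VStr (H : I ⥤ D) where
  map (i j : I) : (i ⟶[V] j) ⟶ (H.obj i ⟶[V] H.obj j)
  map_id (i : I) : eId V i ≫ map i i = eId V (H.obj i)
  map_comp (i j k : I) : eComp V i j k ≫ map i k = (map i j ⊗ₘ map j k) ≫ eComp V _ _ _
  map_eq {i j : I} (f : i ⟶ j) : eHomEquiv V f ≫ map i j = eHomEquiv V (H.map f)

namespace VStr
variable {H K : I ⥤ D} {A B C : M}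

/-- The `V`-functor. -/
@[reducible] def enr (h : VStr V H) : EnrichedFunctor V I D :=
  ⟨H.obj, h.map, h.map_id, h.map_comp⟩

/-- The `V`-structure on the underlying functor of a `V`-functor. -/
def ofEnr (G : EnrichedFunctor V I D) : VStr V (underlying V G) :=
  ⟨G.map, G.map_id, G.map_comp, fun f => (underlying_map G f).symm⟩

theorem nonempty_of_eq {G : EnrichedFunctor V I D} (e : underlying V G = H) : Nonempty (VStr V H) := by
  subst e
  exact ⟨ofEnr G⟩

theorem vsquare (hV : ForgetFaithful.{uV, vV, uI, uD} V) (h : VStr V H) (k : VStr V K)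
    (φ : ∀ i, H.obj i ≅ K.obj i)
    (e : ∀ {i j : I} (f : i ⟶ j), H.map f ≫ (φ j).hom = (φ i).hom ≫ K.map f) (i j : I) :
    VSquare (φ i) (φ j) (h.map i j) (k.map i j) := by
  refine vsquare_of_natural hV (F := h.enr) (G := k.enr) φ (fun {i j} f => ?_) i j
  have e₁ : (underlying V h.enr).map f = H.map f :=
    (eHomEquiv V).injective ((underlying_map h.enr f).trans (h.map_eq f))
  have e₂ : (underlying V k.enr).map f = K.map f :=
    (eHomEquiv V).injective ((underlying_map k.enr f).trans (k.map_eq f))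
  exact (congrArg (· ≫ (φ j).hom) e₁).trans ((e f).trans (congrArg ((φ i).hom ≫ ·) e₂.symm))

theorem natural (h : VStr V H) (k : VStr V K) (φ : ∀ i, H.obj i ≅ K.obj i)
    (e : ∀ i j, VSquare (φ i) (φ j) (h.map i j) (k.map i j)) {i j : I} (f : i ⟶ j) :
    H.map f ≫ (φ j).hom = (φ i).hom ≫ K.map f := by
  have := (e i j).comp_left (eHomEquiv V f)
  rw [h.map_eq, k.map_eq] at this
  exact VSquare.eHomEquiv_iff.1 this

/-- Postcomposition with a 1-cell. -/
def funR {F : I ⥤ (A ⟶ B)} (h : VStr V F) (k : B ⟶ C) : VStr V (funR F k) where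
  map i j := famWhiskerRight (h.map i j) k
  map_id := (enrR h.enr k).map_id
  map_comp := (enrR h.enr k).map_comp
  map_eq f := (comp_famWhiskerRight _ _ _).trans
    ((congrArg (famWhiskerRight · k) (h.map_eq f)).trans (famWhiskerRight_eHomEquiv _ _))

/-- Precomposition with a 1-cell. -/
def funL {F : I ⥤ (B ⟶ C)} (k : A ⟶ B) (h : VStr V F) : VStr V (funL k F) where
  map i j := famWhiskerLeft k (h.map i j)
  map_id := (enrL k h.enr).map_id
  map_comp := (enrL k h.enr).map_comp
  map_eq f := (comp_famWhiskerLeft _ _ _).trans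
    ((congrArg (famWhiskerLeft k ·) (h.map_eq f)).trans (famWhiskerLeft_eHomEquiv _ _))

end VStr

/-- `V`-natural families of morphisms `H i ⟶ K i`. -/
def VStr.Nat {H K : I ⥤ D} (h : VStr V H) (k : VStr V K) {T : V}
    (s : ∀ i, T ⟶ (H.obj i ⟶[V] K.obj i)) : Prop := VNat h.enr k.enr s

/-- The field `mute` gives a `V`-structure on the action opposite to a trivial one. If that is not
the active action, then both actions are trivial, hence equal as functors, and the structure can be
transferred. -/
theorem exists_vStr_active (s : Side) (Y : IObj V I M) : IsTrivial (s.passive Y) →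
    Nonempty (VStr V (s.active Y)) := by
  intro hY
  have triv : ∀ {A : M} {F G : I ⥤ (A ⟶ A)}, IsTrivial F → IsTrivial G → F = G := by
    intro A F G hF hG
    refine CategoryTheory.Functor.ext (fun i => (hF.obj_eq i).trans (hG.obj_eq i).symm) fun i j f => ?_
    rw [hF.map_eq, hG.map_eq]
    simp
  cases s
  · rcases Y.mute with ⟨h₁, G, -, e, -⟩ | ⟨h₁, G, -, e, -⟩
    · exact VStr.nonempty_of_eq (e.trans (triv (G := Y.R) hY h₁))
    · exact VStr.nonempty_of_eq e
  · rcases Y.mute with ⟨h₁, G, -, e, -⟩ | ⟨h₁, G, -, e, -⟩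
    · exact VStr.nonempty_of_eq e
    · exact VStr.nonempty_of_eq (e.trans (triv (G := Y.L) hY h₁))

end VStr

variable {X Y B : IObj V I M}

/-- Structure cells `act u ≫ H i ≅ pas u ≫ H (i ⊛ u)`. -/
abbrev SigCells (s : Side) (X : IObj V I M) {Z : M} (H : I ⥤ (X.carrier ⟶ Z)) :=
  ∀ i u k : I, s.mul i u = k →
    ((s.active X).obj u ≫ H.obj i ≅ (s.passive X).obj u ≫ H.obj k)

/-- Naturality and coherence of `SigCells`. -/
structure IsSig (s : Side) {Z : M} {H : I ⥤ (X.carrier ⟶ Z)} (σ : SigCells s X H) : Prop where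
  natural {i i' u u' k k' : I} (h : s.mul i u = k) (h' : s.mul i' u' = k') (φ : i ⟶ i')
    (ψ : u ⟶ u') (χ : k ⟶ k') (e : s.mulMap φ ψ ≫ eqToHom h' = eqToHom h ≫ χ) :
    ((s.active X).map ψ ▷ H.obj i) ≫ ((s.active X).obj u' ◁ H.map φ) ≫ (σ i' u' k' h').hom =
      (σ i u k h).hom ≫ ((s.passive X).map ψ ▷ H.obj k) ≫ ((s.passive X).obj u' ◁ H.map χ)
  one (i : I) (h : s.mul i (e[I]) = i) : (σ i (e[I]) i h).hom = eqToHom (by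
    rw [s.active_one, s.passive_one])
  mul {i u v k l : I} (h : s.mul i u = k) (h' : s.mul k v = l) (h'' : s.mul i (s.mul u v) = l) :
    (σ i (s.mul u v) l h'').hom = eqToHom (by rw [s.active_mul, Strict.assoc]) ≫
      ((s.active X).obj v ◁ (σ i u k h).hom) ≫
      eqToHom (by rw [← Strict.assoc, s.comm, Strict.assoc]) ≫
      ((s.passive X).obj u ◁ (σ k v l h').hom) ≫ eqToHom (by rw [s.passive_mul, Strict.assoc])

/-- Structure cells `H (x ⊛ i) ≫ pas x ≅ H i ≫ act x`. -/
abbrev KapCells (s : Side) (B : IObj V I M) {A : M} (H : I ⥤ (A ⟶ B.carrier)) :=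
  ∀ x i k : I, s.mul x i = k →
    (H.obj k ≫ (s.passive B).obj x ≅ H.obj i ≫ (s.active B).obj x)

/-- Naturality and coherence of `KapCells`. -/
structure IsKap (s : Side) {A : M} {H : I ⥤ (A ⟶ B.carrier)} (κ : KapCells s B H) : Prop where
  natural {x x' i i' k k' : I} (h : s.mul x i = k) (h' : s.mul x' i' = k') (ψ : x ⟶ x')
    (φ : i ⟶ i') (χ : k ⟶ k') (e : s.mulMap ψ φ ≫ eqToHom h' = eqToHom h ≫ χ) :
    (H.map χ ▷ (s.passive B).obj x) ≫ (H.obj k' ◁ (s.passive B).map ψ) ≫ (κ x' i' k' h').hom =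
      (κ x i k h).hom ≫ (H.map φ ▷ (s.active B).obj x) ≫ (H.obj i' ◁ (s.active B).map ψ)
  one (i : I) (h : s.mul (e[I]) i = i) : (κ (e[I]) i i h).hom = eqToHom (by
    rw [s.active_one, s.passive_one])
  mul {x y i k l : I} (h : s.mul y i = k) (h' : s.mul x k = l) (h'' : s.mul (s.mul x y) i = l) :
    (κ (s.mul x y) i l h'').hom = eqToHom (by rw [s.passive_mul, Strict.assoc]) ≫
      ((κ x k l h').hom ▷ (s.passive B).obj y) ≫
      eqToHom (by rw [Strict.assoc, s.comm, Strict.assoc]) ≫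
      ((κ y i k h).hom ▷ (s.active B).obj x) ≫ eqToHom (by rw [s.active_mul, Strict.assoc])

/-- A family `H : I → [X, B]` with structure cells that make it what a morphism from the
coinvariants of `X` to `B` restricts to. -/
structure Mid (s : Side) (X B : IObj V I M) where
  H : I ⥤ (X.carrier ⟶ B.carrier)
  vs : VStr V H
  σ : SigCells s X H
  isSig : IsSig s σ
  κ : KapCells s B H
  isKap : IsKap s κ
  comm {i u x k j l : I} (h : s.mul i u = k) (hj : s.mul x i = j) (hl : s.mul x k = l)
    (h' : s.mul j u = l) :
    ((σ j u l h').hom ▷ (s.passive B).obj x) ≫ eqToHom (Strict.assoc _ _ _) ≫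
        ((s.passive X).obj u ◁ (κ x k l hl).hom) =
      eqToHom (Strict.assoc _ _ _) ≫ ((s.active X).obj u ◁ (κ x i j hj).hom) ≫
        eqToHom (Strict.assoc _ _ _).symm ≫ ((σ i u k h).hom ▷ (s.active B).obj x) ≫
        eqToHom (Strict.assoc _ _ _)

/-- The cell `σ ▷ k`, reassociated. -/
def cellPush {A A' A'' B C : M} {a : A ⟶ A'} {f : A' ⟶ B} {b : A ⟶ A''} {g : A'' ⟶ B}
    (σ : a ≫ f ≅ b ≫ g) (k : B ⟶ C) : a ≫ f ≫ k ≅ b ≫ g ≫ k :=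
  (α_ _ _ _).symm ≪≫ whiskerRightIso σ k ≪≫ α_ _ _ _

/-- The universal property of the coinvariants in terms of the restrictions `H i`. -/
structure Coin (s : Side) (X O : IObj V I M) extends Mid s X O where
  trivial : IsTrivial (s.passive O)
  ess_surj {Z : M} {K : I ⥤ (X.carrier ⟶ Z)} (hK : VStr V K) {ρ : SigCells s X K}
    (hρ : IsSig s ρ) : ∃ (k : O.carrier ⟶ Z) (ψ : ∀ i, H.obj i ≫ k ≅ K.obj i),
      (∀ {i j : I} (f : i ⟶ j), (H.map f ▷ k) ≫ (ψ j).hom = (ψ i).hom ≫ K.map f) ∧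
      ∀ i u l (h : s.mul i u = l), (cellPush (σ i u l h) k).hom ≫ ((s.passive X).obj u ◁ (ψ l).hom) =
        ((s.active X).obj u ◁ (ψ i).hom) ≫ (ρ i u l h).hom
  faithful : JointlyFaithful V fun i => H.obj i
  full {Z : M} (k k' : O.carrier ⟶ Z) (T : V)
    (t : ∀ i, T ⟶ ((H.obj i ≫ k) ⟶[V] (H.obj i ≫ k')))
    (ht : (vs.funR k).Nat (vs.funR k') t)
    (ht' : ∀ i u l (h : s.mul i u = l), VSquare (cellPush (σ i u l h) k) (cellPush (σ i u l h) k')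
      (famWhiskerLeft ((s.active X).obj u) (t i)) (famWhiskerLeft ((s.passive X).obj u) (t l))) :
    ∃ t' : T ⟶ (k ⟶[V] k'), ∀ i, famWhiskerLeft (H.obj i) t' = t i

end Mid

/-! ### Commuting squares of ordinary morphisms, up to equality of endpoints -/

section CSq
variable {C : Type uC} [Category.{vC} C]

/-- The square `x ≫ σ' = σ ≫ x'`. -/
def CSq {p p' q q' : C} (σ : p ≅ p') (σ' : q ≅ q') (x : p ⟶ q) (x' : p' ⟶ q') : Prop :=
  x ≫ σ'.hom = σ.hom ≫ x'

/-- `x` and `x'` are equal up to `eqToHom`. -/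
def CEq {p q p' q' : C} (x : p ⟶ q) (x' : p' ⟶ q') : Prop :=
  ∃ (h : p = p') (h' : q = q'), CSq (eqToIso h) (eqToIso h') x x'

namespace CSq
variable {p p' p'' q q' q'' r r' : C} {σ : p ≅ p'} {σ' : q ≅ q'} {ρ : p' ≅ p''} {ρ' : q' ≅ q''}
  {x x₁ : p ⟶ q} {x' x₁' : p' ⟶ q'} {x'' : p'' ⟶ q''}

theorem trans (h : CSq σ σ' x x') (h' : CSq ρ ρ' x' x'') : CSq (σ ≪≫ ρ) (σ' ≪≫ ρ') x x'' := by
  unfold CSq at *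
  simp [← h', reassoc_of% h]

theorem symm (h : CSq σ σ' x x') : CSq σ.symm σ'.symm x' x := by
  unfold CSq at *
  rw [Iso.symm_hom, Iso.symm_hom, Iso.eq_inv_comp, ← reassoc_of% h]
  simp

theorem refl (x : p ⟶ q) : CSq (Iso.refl p) (Iso.refl q) x x := by simp [CSq]

theorem unique (h : CSq σ σ' x x') (h' : CSq σ σ' x x₁') : x' = x₁' := by
  unfold CSq at *
  rwa [h, cancel_epi] at h'

theorem unique' (h : CSq σ σ' x x') (h' : CSq σ σ' x₁ x') : x = x₁ := by
  unfold CSq at *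
  rwa [← h, cancel_mono, eq_comm] at h'

theorem congr {σ₁ : p ≅ p'} {σ₁' : q ≅ q'} (h : CSq σ σ' x x') (e : σ.hom = σ₁.hom)
    (e' : σ'.hom = σ₁'.hom) : CSq σ₁ σ₁' x x' := by
  unfold CSq at *
  rw [← e, ← e', h]

theorem comp {τ : r ≅ r'} {y : q ⟶ r} {y' : q' ⟶ r'} (h : CSq σ σ' x x') (h' : CSq σ' τ y y') :
    CSq σ τ (x ≫ y) (x' ≫ y') := by
  unfold CSq at *
  rw [Category.assoc, h', reassoc_of% h]

theorem of_trans (h : CSq (σ ≪≫ ρ) (σ' ≪≫ ρ') x x'') (h' : CSq σ σ' x x') : CSq ρ ρ' x' x'' := by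
  have := h'.symm.trans h
  exact this.congr (by simp) (by simp)

theorem inv {x : p ≅ q} {x' : p' ≅ q'} (h : CSq σ σ' x.hom x'.hom) : CSq σ' σ x.inv x'.inv := by
  unfold CSq at *
  rw [Iso.inv_comp_eq, ← Category.assoc, Iso.eq_comp_inv, h]

theorem ofCEq (h : CEq x x') (h₁ : p = p') (h₂ : q = q') : CSq (eqToIso h₁) (eqToIso h₂) x x' :=
  h.2.2

end CSq

namespace CEq
variable {p q r p' q' r' p'' q'' : C} {x : p ⟶ q} {x' : p' ⟶ q'} {x'' : p'' ⟶ q''}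

theorem rfl' (x : p ⟶ q) : CEq x x := ⟨rfl, rfl, CSq.refl x⟩
theorem of_eq {x x' : p ⟶ q} (h : x = x') : CEq x x' := h ▸ rfl' x
theorem symm (h : CEq x x') : CEq x' x := by
  obtain ⟨rfl, rfl, h⟩ := h
  exact ⟨rfl, rfl, h.symm⟩
theorem eq {x x' : p ⟶ q} (h : CEq x x') : x = x' := by
  obtain ⟨_, _, h⟩ := h
  simpa [CSq] using h

end CEq
end CSq

section CSqBicategory
open Bicategory
variable {M : Type uM} [Bicategory.{wM, vM} M] [Bicategory.Strict M] {A B C D : M}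

attribute [local simp] leftUnitor_hom leftUnitor_inv rightUnitor_hom rightUnitor_inv associator_hom
  associator_inv

namespace CSq

theorem whiskerLeft {p p' q q' : B ⟶ C} {σ : p ≅ p'} {σ' : q ≅ q'} {x : p ⟶ q} {x' : p' ⟶ q'}
    (h : CSq σ σ' x x') (f : A ⟶ B) :
    CSq (whiskerLeftIso f σ) (whiskerLeftIso f σ') (f ◁ x) (f ◁ x') := by
  have := congrArg (f ◁ ·) h
  simpa [CSq] using this

theorem whiskerRight {p p' q q' : A ⟶ B} {σ : p ≅ p'} {σ' : q ≅ q'} {x : p ⟶ q} {x' : p' ⟶ q'}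
    (h : CSq σ σ' x x') (f : B ⟶ C) :
    CSq (whiskerRightIso σ f) (whiskerRightIso σ' f) (x ▷ f) (x' ▷ f) := by
  have := congrArg (· ▷ f) h
  simpa [CSq] using this

theorem exchangeLeft {f f' : A ⟶ B} {g h : B ⟶ C} (φ : f ≅ f') (x : g ⟶ h) :
    CSq (whiskerRightIso φ g) (whiskerRightIso φ h) (f ◁ x) (f' ◁ x) :=
  whisker_exchange φ.hom x

theorem exchangeRight {f f' : A ⟶ B} {g h : B ⟶ C} (x : f ⟶ f') (ψ : g ≅ h) :
    CSq (whiskerLeftIso f ψ) (whiskerLeftIso f' ψ) (x ▷ g) (x ▷ h) :=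
  (whisker_exchange x ψ.hom).symm

end CSq

namespace CEq

theorem assocL (f : A ⟶ B) (g : B ⟶ C) {h h' : C ⟶ D} (x : h ⟶ h') :
    CEq ((f ≫ g) ◁ x) (f ◁ g ◁ x) :=
  ⟨Strict.assoc _ _ _, Strict.assoc _ _ _, by simp [CSq]⟩
theorem assocM (f : A ⟶ B) {g g' : B ⟶ C} (x : g ⟶ g') (h : C ⟶ D) :
    CEq ((f ◁ x) ▷ h) (f ◁ x ▷ h) :=
  ⟨Strict.assoc _ _ _, Strict.assoc _ _ _, by simp [CSq]⟩
theorem unitR {e : B ⟶ B} (he : e = 𝟙 B) {f f' : A ⟶ B} (x : f ⟶ f') : CEq (x ▷ e) x := by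
  subst he
  exact ⟨Strict.comp_id _, Strict.comp_id _, by simp [CSq]⟩

end CEq
end CSqBicategory

/-! ### Extension of families to equivariant morphisms on the coinvariants -/

section Extension
open Bicategory

variable {V : Type uV} [Category.{vV} V] [MonoidalCategory V] [SymmetricCategory V]
variable {I : Type uI} [Category.{wI} I] [MonoidalCategory I] [EnrichedOrdinaryCategory V I]
  [MonoidalEnriched V I]
variable {M : Type uM} [Bicategory.{wM, vM} M] [Bicategory.Strict M]
  [∀ A B : M, EnrichedOrdinaryCategory V (A ⟶ B)] [VCatCategory V M]

attribute [local simp] leftUnitor_hom leftUnitor_inv rightUnitor_hom rightUnitor_inv associator_hom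
  associator_inv

/-- An equivariant morphism is given by its structure cells `ts s`. -/
theorem Equivariant.exists_ts_eq {X Y : IObj V I M} {s : Side} {f : X.carrier ⟶ Y.carrier}
    {t : ∀ u, (s.active X).obj u ≫ f ≫ (s.passive Y).obj u ≅
      (s.passive X).obj u ≫ f ≫ (s.active Y).obj u}
    (natural : ∀ {u v : I} (φ : u ⟶ v), ((s.active X).map φ ▷ (f ≫ (s.passive Y).obj u)) ≫
        ((s.active X).obj v ◁ f ◁ (s.passive Y).map φ) ≫ (t v).hom =
      (t u).hom ≫ ((s.passive X).map φ ▷ (f ≫ (s.active Y).obj u)) ≫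
        ((s.passive X).obj v ◁ f ◁ (s.active Y).map φ))
    (one : (t (e[I])).hom = eqToHom (by
      rw [s.active_one, s.active_one, s.passive_one, s.passive_one]))
    (mul : ∀ u v : I, (t (s.mul u v)).hom =
      eqToHom (by simp only [s.active_mul, s.passive_mul, Strict.assoc]) ≫
      ((s.active X).obj v ◁ (t u).hom ▷ (s.passive Y).obj v) ≫
      eqToHom (by
        simp only [Strict.assoc, s.comm]
        simp only [← Strict.assoc, s.comm]) ≫
      ((s.passive X).obj u ◁ (t v).hom ▷ (s.active Y).obj u) ≫
      eqToHom (by simp only [s.passive_mul, s.active_mul, Strict.assoc])) :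
    ∃ k : Equivariant X Y, k.hom = f ∧ ∀ u, HEq (k.ts s u) (t u) := by
  cases s
  · exact ⟨⟨f, fun u => (t u).symm, fun φ => symm_nat (natural φ), inv_eq_eqToHom one,
      fun u v => symm_mul _ _ _ (mul v u)⟩, rfl, fun u => HEq.rfl⟩
  · exact ⟨⟨f, t, natural, one, mul⟩, rfl, fun u => HEq.rfl⟩

section Raw
variable {A O B : M} {k : O ⟶ B}

/-- The composite `Ji ≫ a ≫ k ≫ q ≅ Jj ≫ k ≫ q ≅ Hj ≫ q`. -/
def extL {Ji Jj : A ⟶ O} {Hj : A ⟶ B} {a p : O ⟶ O} (hp : p = 𝟙 O) (κ : Jj ≫ p ≅ Ji ≫ a)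
    (ψ : Jj ≫ k ≅ Hj) (q : B ⟶ B) : Ji ≫ a ≫ k ≫ q ≅ Hj ≫ q :=
  eqToIso (Strict.assoc _ _ _).symm ≪≫ whiskerRightIso κ.symm (k ≫ q) ≪≫
    eqToIso (by rw [hp, Strict.comp_id, Strict.assoc]) ≪≫ whiskerRightIso ψ q

/-- The composite `Ji ≫ p ≫ k ≫ b ≅ Ji ≫ k ≫ b ≅ Hi ≫ b` for an identity `p`. -/
def extR {Ji : A ⟶ O} {Hi : A ⟶ B} {p : O ⟶ O} (hp : p = 𝟙 O) (ψ : Ji ≫ k ≅ Hi) (b : B ⟶ B) :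
    Ji ≫ p ≫ k ≫ b ≅ Hi ≫ b :=
  eqToIso (by rw [hp, Strict.id_comp, Strict.assoc]) ≪≫ whiskerRightIso ψ b

/-- Via `extL` and `extR`, the restriction along `Ji` of an action cell of `k` is compared with a
cell `κ` of the target family. Naturality of the comparisons in the index and in the acting object
lets laws for `κ` be turned into laws for the action cells. -/
theorem extL_natural {Ji Jj Ji' Jj' : A ⟶ O} {Hj Hj' : A ⟶ B} {a p a' p' : O ⟶ O} {hp : p = 𝟙 O}
    {hp' : p' = 𝟙 O} {κ : Jj ≫ p ≅ Ji ≫ a} {κ' : Jj' ≫ p' ≅ Ji' ≫ a'} {ψ : Jj ≫ k ≅ Hj}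
    {ψ' : Jj' ≫ k ≅ Hj'} {q q' : B ⟶ B} {y : Ji ⟶ Ji'} {y' : Jj ⟶ Jj'} {z : Hj ⟶ Hj'} {α : a ⟶ a'}
    {π : p ⟶ p'} (hπ : π = eqToHom (hp.trans hp'.symm)) (β : q ⟶ q') (hψ : (y' ▷ k) ≫ ψ'.hom = ψ.hom ≫ z)
    (hκ : (y' ▷ p) ≫ (Jj' ◁ π) ≫ κ'.hom = κ.hom ≫ (y ▷ a) ≫ (Ji' ◁ α)) :
    CSq (extL hp κ ψ q) (extL hp' κ' ψ' q')
      ((y ▷ (a ≫ k ≫ q)) ≫ (Ji' ◁ α ▷ (k ≫ q)) ≫ (Ji' ◁ a' ◁ k ◁ β)) ((z ▷ q) ≫ (Hj' ◁ β)) := by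
  subst hp hp' hπ
  have h₁ : CSq κ κ' (y' ▷ 𝟙 O) ((y ▷ a) ≫ (Ji' ◁ α)) := by
    unfold CSq; rw [← hκ]; simp
  have h₂ : CSq ψ ψ' (y' ▷ k) z := hψ
  have h₃ := (h₁.symm.whiskerRight (k ≫ q)).comp (CSq.exchangeLeft κ'.symm (k ◁ β))
  have h₄ := (h₂.whiskerRight q).comp (CSq.exchangeLeft ψ' β)
  refine CSq.congr (CSq.trans (CSq.ofCEq ?_ (by simp only [Strict.assoc]) (by simp only [Strict.assoc])) <|
    h₃.trans <| CSq.trans (CSq.ofCEq (x' := (y' ▷ k ▷ q) ≫ ((Jj' ≫ k) ◁ β)) ?_ ?_ ?_) h₄) ?_ ?_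
  any_goals simp only [Strict.assoc, Strict.id_comp]
  · exact ⟨by simp only [Strict.assoc], by simp only [Strict.assoc], by simp [CSq]⟩
  · exact ⟨by simp only [Strict.assoc, Strict.id_comp],
      by simp only [Strict.assoc, Strict.id_comp], by simp [CSq]⟩
  · simp [extL]
  · simp [extL]

theorem extR_natural {Ji Ji' : A ⟶ O} {Hi Hi' : A ⟶ B} {p p' : O ⟶ O} {hp : p = 𝟙 O}
    {hp' : p' = 𝟙 O} {ψ : Ji ≫ k ≅ Hi} {ψ' : Ji' ≫ k ≅ Hi'} {b b' : B ⟶ B} {y : Ji ⟶ Ji'}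
    {x : Hi ⟶ Hi'} {π : p ⟶ p'} (hπ : π = eqToHom (hp.trans hp'.symm)) (β : b ⟶ b')
    (hψ : (y ▷ k) ≫ ψ'.hom = ψ.hom ≫ x) :
    CSq (extR hp ψ b) (extR hp' ψ' b')
      ((y ▷ (p ≫ k ≫ b)) ≫ (Ji' ◁ π ▷ (k ≫ b)) ≫ (Ji' ◁ p' ◁ k ◁ β)) ((x ▷ b) ≫ (Hi' ◁ β)) := by
  subst hp hp' hπ
  have h₂ : CSq ψ ψ' (y ▷ k) x := hψ
  have h₄ := (h₂.whiskerRight b).comp (CSq.exchangeLeft ψ' β)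
  refine CSq.congr (CSq.trans (CSq.ofCEq ?_ (by simp only [Strict.assoc, Strict.id_comp])
    (by simp only [Strict.assoc, Strict.id_comp])) h₄) ?_ ?_
  · exact ⟨by simp only [Strict.assoc, Strict.id_comp],
      by simp only [Strict.assoc, Strict.id_comp], by simp [CSq]⟩
  · simp [extR]
  · simp [extR]

/-- The comparison is built from `κ` and `ψ`. It respects the cells `σ` because `σ` commutes with
`κ` in the source family and `ψ` carries `σ` to `ρ`. -/
theorem extL_sig {X : M} {l r : X ⟶ A} {Ji Jj Ju Jv : A ⟶ O} {Hj Hv : A ⟶ B} {a p : O ⟶ O}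
    {hp : p = 𝟙 O} {κ : Jj ≫ p ≅ Ji ≫ a} {κ' : Jv ≫ p ≅ Ju ≫ a} {ψ : Jj ≫ k ≅ Hj} {ψ' : Jv ≫ k ≅ Hv}
    {q : B ⟶ B} {σ : l ≫ Ji ≅ r ≫ Ju} {σ' : l ≫ Jj ≅ r ≫ Jv} {ρ : l ≫ Hj ≅ r ≫ Hv}
    (hκ : (σ'.hom ▷ p) ≫ eqToHom (Strict.assoc _ _ _) ≫ (r ◁ κ'.hom) =
      eqToHom (Strict.assoc _ _ _) ≫ (l ◁ κ.hom) ≫ eqToHom (Strict.assoc _ _ _).symm ≫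
        (σ.hom ▷ a) ≫ eqToHom (Strict.assoc _ _ _))
    (hψ : (cellPush σ' k).hom ≫ (r ◁ ψ'.hom) = (l ◁ ψ.hom) ≫ ρ.hom) :
    CSq (whiskerLeftIso l (extL hp κ ψ q)) (whiskerLeftIso r (extL hp κ' ψ' q))
      (cellPush σ (a ≫ k ≫ q)).hom (cellPush ρ q).hom := by
  subst hp
  have h₁ : CSq (whiskerLeftIso l κ) (whiskerLeftIso r κ') (cellPush σ' (𝟙 O)).hom (cellPush σ a).hom := by
    have := congrArg (eqToHom (Strict.assoc _ _ _).symm ≫ ·) hκ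
    simpa [CSq, cellPush] using this
  have h₂ : CSq (whiskerLeftIso l ψ) (whiskerLeftIso r ψ') (cellPush σ' k).hom ρ.hom := hψ
  refine CSq.congr (CSq.trans (CSq.ofCEq ?_ (by simp only [Strict.assoc]) (by simp only [Strict.assoc])) <|
    (h₁.symm.whiskerRight (k ≫ q)).trans <|
    CSq.trans (CSq.ofCEq (x' := (cellPush σ' k).hom ▷ q) ?_ ?_ ?_) <| (h₂.whiskerRight q).trans <|
    CSq.ofCEq ?_ (Strict.assoc _ _ _) (Strict.assoc _ _ _)) ?_ ?_
  any_goals simp only [Strict.assoc, Strict.id_comp]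
  · exact ⟨by simp only [Strict.assoc], by simp only [Strict.assoc], by simp [CSq, cellPush]⟩
  · exact ⟨by simp only [Strict.assoc, Strict.id_comp],
      by simp only [Strict.assoc, Strict.id_comp], by simp [CSq, cellPush]⟩
  · exact ⟨by simp only [Strict.assoc], by simp only [Strict.assoc], by simp [CSq, cellPush]⟩
  · simp [extL]
  · simp [extL]

theorem extR_sig {X : M} {l r : X ⟶ A} {Ji Ju : A ⟶ O} {Hi Hu : A ⟶ B} {p : O ⟶ O}
    {hp : p = 𝟙 O} {ψ : Ji ≫ k ≅ Hi} {ψ' : Ju ≫ k ≅ Hu}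
    {b : B ⟶ B} {σ : l ≫ Ji ≅ r ≫ Ju} {ρ : l ≫ Hi ≅ r ≫ Hu}
    (hψ : (cellPush σ k).hom ≫ (r ◁ ψ'.hom) = (l ◁ ψ.hom) ≫ ρ.hom) :
    CSq (whiskerLeftIso l (extR hp ψ b)) (whiskerLeftIso r (extR hp ψ' b))
      (cellPush σ (p ≫ k ≫ b)).hom (cellPush ρ b).hom := by
  subst hp
  have h₂ : CSq (whiskerLeftIso l ψ) (whiskerLeftIso r ψ') (cellPush σ k).hom ρ.hom := hψ
  refine CSq.congr (CSq.trans (CSq.ofCEq ?_ (by simp only [Strict.assoc, Strict.id_comp])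
    (by simp only [Strict.assoc, Strict.id_comp])) <| (h₂.whiskerRight b).trans <|
    CSq.ofCEq ?_ (Strict.assoc _ _ _) (Strict.assoc _ _ _)) ?_ ?_
  · exact ⟨by simp only [Strict.assoc, Strict.id_comp],
      by simp only [Strict.assoc, Strict.id_comp], by simp [CSq, cellPush]⟩
  · exact ⟨by simp only [Strict.assoc], by simp only [Strict.assoc], by simp [CSq, cellPush]⟩
  · simp [extR]
  · simp [extR]

/-- The cell `τ` is determined on `Ji` by the two cells `κ` and `κ'`, and these are identities at
the unit object. -/
theorem ext_one {Ji : A ⟶ O} {Hi : A ⟶ B} {a p : O ⟶ O} {hp : p = 𝟙 O} (ha : a = 𝟙 O)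
    {κ : Ji ≫ p ≅ Ji ≫ a} {ψ : Ji ≫ k ≅ Hi} {q b : B ⟶ B} (hq : q = 𝟙 B) (hb : b = 𝟙 B)
    {κ' : Hi ≫ q ≅ Hi ≫ b} {τ : a ≫ k ≫ q ⟶ p ≫ k ≫ b} {h h'} (hκ : κ.hom = eqToHom h)
    (hκ' : κ'.hom = eqToHom h') (hτ : CSq (extL hp κ ψ q) (extR hp ψ b) (Ji ◁ τ) κ'.hom) (h'') :
    Ji ◁ τ = Ji ◁ eqToHom h'' := by
  subst hp ha hq hb
  refine hτ.unique' ?_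
  have : κ.inv = eqToHom h.symm := Equivariant.inv_eq_eqToHom hκ
  simp [CSq, extL, extR, hκ', this]

/-- The multiplicativity of `τ` on `Ji` is forced by that of `κ` and `κ'`: the comparison squares
for `x` at the index of `Jk` and for `y` at the index of `Ji` paste to one with the same outer sides
as that for the product. -/
theorem ext_mul {Ji Jk Jl : A ⟶ O} {Hi Hk Hl : A ⟶ B} {ax ay az px py pz : O ⟶ O}
    {hpx : px = 𝟙 O} {hpy : py = 𝟙 O} {hpz : pz = 𝟙 O} (haz : az = ay ≫ ax)
    {κx : Jl ≫ px ≅ Jk ≫ ax} {κy : Jk ≫ py ≅ Ji ≫ ay} {κz : Jl ≫ pz ≅ Ji ≫ az}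
    {ψi : Ji ≫ k ≅ Hi} {ψk : Jk ≫ k ≅ Hk} {ψl : Jl ≫ k ≅ Hl} {qx qy qz bx byy bz : B ⟶ B}
    (hq : qz = qx ≫ qy) (hb : bz = byy ≫ bx) (hC : bx ≫ qy = qy ≫ bx)
    {κx' : Hl ≫ qx ≅ Hk ≫ bx} {κy' : Hk ≫ qy ≅ Hi ≫ byy} {κz' : Hl ≫ qz ≅ Hi ≫ bz}
    {τx : ax ≫ k ≫ qx ⟶ px ≫ k ≫ bx} {τy : ay ≫ k ≫ qy ⟶ py ≫ k ≫ byy}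
    {τz : az ≫ k ≫ qz ⟶ pz ≫ k ≫ bz}
    {h₁ h₂ h₃} (hκ : κz.hom = eqToHom h₁ ≫ (κx.hom ▷ py) ≫ eqToHom h₂ ≫ (κy.hom ▷ ax) ≫ eqToHom h₃)
    {h₁' h₂' h₃'}
    (hκ' : κz'.hom = eqToHom h₁' ≫ (κx'.hom ▷ qy) ≫ eqToHom h₂' ≫ (κy'.hom ▷ bx) ≫ eqToHom h₃')
    (hx : CSq (extL hpx κx ψl qx) (extR hpx ψk bx) (Jk ◁ τx) κx'.hom)
    (hy : CSq (extL hpy κy ψk qy) (extR hpy ψi byy) (Ji ◁ τy) κy'.hom)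
    (hz : CSq (extL hpz κz ψl qz) (extR hpz ψi bz) (Ji ◁ τz) κz'.hom) (e₁ e₂ e₃) :
    Ji ◁ τz = Ji ◁ (eqToHom e₁ ≫ (ay ◁ τx ▷ qy) ≫ eqToHom e₂ ≫ (px ◁ τy ▷ bx) ≫ eqToHom e₃) := by
  subst hpx hpy hpz haz hq hb
  have hκ₀ : κz = eqToIso h₁ ≪≫ whiskerRightIso κx (𝟙 O) ≪≫ eqToIso h₂ ≪≫ whiskerRightIso κy ax ≪≫
    eqToIso h₃ := Iso.ext (by simp [hκ])
  subst hκ₀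
  refine hz.unique' ?_
  rw [hκ']
  have H₁ := ((CSq.exchangeLeft κy.symm τx).whiskerRight qy).trans <|
    CSq.trans (CSq.ofCEq (x' := (Jk ◁ τx) ▷ qy)
      ⟨by simp only [Strict.comp_id], by simp only [Strict.comp_id], by simp [CSq]⟩
      (by simp only [Strict.comp_id]) (by simp only [Strict.comp_id])) (hx.whiskerRight qy)
  have H₂ := hy.whiskerRight bx
  have E₁ : CEq (Ji ◁ ay ◁ τx ▷ qy) (((Ji ≫ ay) ◁ τx) ▷ qy) :=
    ⟨by simp only [Strict.assoc], by simp only [Strict.assoc], by simp [CSq]⟩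
  have E₂ : CEq (Ji ◁ (𝟙 O) ◁ τy ▷ bx) ((Ji ◁ τy) ▷ bx) :=
    ⟨by simp only [Strict.assoc, Strict.id_comp], by simp only [Strict.assoc, Strict.id_comp],
      by simp [CSq]⟩
  simp only [Bicategory.whiskerLeft_comp, whiskerLeft_eqToHom]
  have F₁ := ((CSq.ofCEq E₁ (by simp only [Strict.assoc]) (by simp only [Strict.assoc])).trans H₁).trans
    (CSq.ofCEq (CEq.rfl' _) rfl rfl)
  have F₂ := ((CSq.ofCEq E₂ (by simp only [Strict.assoc, Strict.id_comp])
    (by simp only [Strict.assoc, Strict.id_comp])).trans H₂)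
  refine CSq.comp ?_ (F₁.comp (CSq.comp ?_ (F₂.comp ?_)))
  · simp [CSq, extL]
  -- Between the two squares the comparison at the middle index `Jk` must move past the commuting
  -- 1-cells `bx` and `qy`.
  · have := Equivariant.swapR ψk.hom hC
    have h := Equivariant.swapR (κy.inv ▷ k) hC
    simp [CSq, extL, extR, this, h]
  · simp [CSq, extR]

end Raw

section
variable [StrictMonoidal I] {s : Side} {X O B : IObj V I M} {Z : M}

theorem Side.mul_assoc (s : Side) (x y z : I) : s.mul (s.mul x y) z = s.mul x (s.mul y z) := by
  cases s
  · exact (StrictMonoidal.tensor_assoc _ _ _).symm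
  · exact StrictMonoidal.tensor_assoc _ _ _

theorem Side.one_mul (s : Side) (x : I) : s.mul (e[I]) x = x := by
  cases s
  · exact StrictMonoidal.tensor_one _
  · exact StrictMonoidal.one_tensor _

theorem Side.mul_one (s : Side) (x : I) : s.mul x (e[I]) = x := by
  cases s
  · exact StrictMonoidal.one_tensor _
  · exact StrictMonoidal.tensor_one _

/-- Compatible isomorphisms of the restrictions along the `H i` lift. -/
theorem Coin.exists_iso (hV : ForgetFaithful.{uV, vV, uI, vM} V) (c : Coin s X O)
    {k k' : O.carrier ⟶ Z} (φ : ∀ i, c.H.obj i ≫ k ≅ c.H.obj i ≫ k')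
    (hφ : ∀ {i j : I} (f : i ⟶ j), CSq (φ i) (φ j) (c.H.map f ▷ k) (c.H.map f ▷ k'))
    (hσ : ∀ i u l (h : s.mul i u = l), CSq (whiskerLeftIso ((s.active X).obj u) (φ i))
      (whiskerLeftIso ((s.passive X).obj u) (φ l)) (cellPush (c.σ i u l h) k).hom
      (cellPush (c.σ i u l h) k').hom) :
    ∃ ψ : k ≅ k', ∀ i, c.H.obj i ◁ ψ.hom = (φ i).hom := by
  have key : ∀ {k k' : O.carrier ⟶ Z} (φ : ∀ i, c.H.obj i ≫ k ≅ c.H.obj i ≫ k')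
    (_ : ∀ {i j : I} (f : i ⟶ j), CSq (φ i) (φ j) (c.H.map f ▷ k) (c.H.map f ▷ k'))
    (_ : ∀ i u l (h : s.mul i u = l), CSq (whiskerLeftIso ((s.active X).obj u) (φ i))
      (whiskerLeftIso ((s.passive X).obj u) (φ l)) (cellPush (c.σ i u l h) k).hom
      (cellPush (c.σ i u l h) k').hom), ∃ ψ : k ⟶ k', ∀ i, c.H.obj i ◁ ψ = (φ i).hom := by
    intro k k' φ hφ hσ
    -- `hV` promotes the naturality of `φ` to the `V`-naturality that `full` asks for.
    obtain ⟨t, ht⟩ := c.full k k' _ (fun i => eHomEquiv V (φ i).hom)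
      (VNat.of_vsquare (VStr.vsquare hV (c.vs.funR k) (c.vs.funR k') φ fun f => hφ f)) (by
        intro i u l h
        rw [famWhiskerLeft_eHomEquiv, famWhiskerLeft_eHomEquiv, VSquare.eHomEquiv_iff]
        exact Eq.symm (hσ i u l h))
    obtain ⟨ψ, rfl⟩ := (eHomEquiv V).surjective t
    exact ⟨ψ, fun i => (eHomEquiv V).injective ((famWhiskerLeft_eHomEquiv _ _).symm.trans (ht i))⟩
  exact c.faithful.exists_iso φ (key φ hφ hσ)
    (key (fun i => (φ i).symm) (fun f => (hφ f).symm) fun i u l h => (hσ i u l h).symm)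

/-- A family of the form `Mid` extends to an equivariant morphism on the coinvariants. -/
theorem Coin.exists_extension (hV : ForgetFaithful.{uV, vV, uI, vM} V) (c : Coin s X O)
    (m : Mid s X B) : ∃ (k : Equivariant O B) (ψ : ∀ i, c.H.obj i ≫ k.hom ≅ m.H.obj i),
      (∀ {i j : I} (f : i ⟶ j), (c.H.map f ▷ k.hom) ≫ (ψ j).hom = (ψ i).hom ≫ m.H.map f) ∧
      (∀ i u l (h : s.mul i u = l), (cellPush (c.σ i u l h) k.hom).hom ≫
        ((s.passive X).obj u ◁ (ψ l).hom) = ((s.active X).obj u ◁ (ψ i).hom) ≫ (m.σ i u l h).hom) ∧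
      ∀ x i j (h : s.mul x i = j), CSq
        (extL (c.trivial.obj_eq x) (c.κ x i j h) (ψ j) ((s.passive B).obj x))
        (extR (c.trivial.obj_eq x) (ψ i) ((s.active B).obj x)) (c.H.obj i ◁ (k.ts s x).hom)
        (m.κ x i j h).hom := by
  obtain ⟨k, ψ, hψ, hψσ⟩ := c.ess_surj m.vs m.isSig
  -- The underlying 1-cell `k` uses `H` and `σ` only. Its action cell at `x` is forced on each
  -- restriction by `κ`; it exists because these prescriptions are natural in the index and respect
  -- `σ`.
  have hτ : ∀ x : I, ∃ τ : (s.active O).obj x ≫ k ≫ (s.passive B).obj x ≅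
      (s.passive O).obj x ≫ k ≫ (s.active B).obj x, ∀ i j (h : s.mul x i = j), CSq
        (extL (c.trivial.obj_eq x) (c.κ x i j h) (ψ j) ((s.passive B).obj x))
        (extR (c.trivial.obj_eq x) (ψ i) ((s.active B).obj x)) (c.H.obj i ◁ τ.hom)
        (m.κ x i j h).hom := by
    intro x
    obtain ⟨τ, hτ⟩ := c.exists_iso hV (fun i => extL (c.trivial.obj_eq x) (c.κ x i _ rfl) (ψ _)
      ((s.passive B).obj x) ≪≫ m.κ x i _ rfl ≪≫
      (extR (c.trivial.obj_eq x) (ψ i) ((s.active B).obj x)).symm) (fun {i j} f => by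
        have h₁ := extL_natural (hp := c.trivial.obj_eq x) (hp' := c.trivial.obj_eq x)
          (c.trivial.map_eq (𝟙 x)) ((s.passive B).map (𝟙 x))
          (hψ (s.mulMap (𝟙 x) f)) (c.isKap.natural rfl rfl (𝟙 x) f (s.mulMap (𝟙 x) f) (by simp))
        have h₂ := extR_natural (hp := c.trivial.obj_eq x) (hp' := c.trivial.obj_eq x)
          (c.trivial.map_eq (𝟙 x)) ((s.active B).map (𝟙 x)) (hψ f)
        have h₃ := m.isKap.natural rfl rfl (𝟙 x) f (s.mulMap (𝟙 x) f) (by simp)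
        simp only [CategoryTheory.Functor.map_id, Bicategory.id_whiskerRight, Bicategory.whiskerLeft_id,
          Category.comp_id] at h₁ h₂ h₃
        exact h₁.trans (CSq.trans (ρ := (extR (c.trivial.obj_eq x) (ψ i) ((s.active B).obj x)).symm)
          (ρ' := (extR (c.trivial.obj_eq x) (ψ j) ((s.active B).obj x)).symm)
          (by simpa [CSq] using h₃) h₂.symm))
      -- Compatibility with `σ` is where the condition `comm` on both families is needed.
      (fun i u l h => by
        have a : s.mul (s.mul x i) u = s.mul x l := by rw [s.mul_assoc, h]
        have h₁ := extL_sig (hp := c.trivial.obj_eq x) (q := (s.passive B).obj x)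
          (c.comm h rfl rfl a) (hψσ _ _ _ a)
        have h₂ := extR_sig (hp := c.trivial.obj_eq x) (b := (s.active B).obj x) (hψσ _ _ _ h)
        have h₃ : CSq (whiskerLeftIso _ (m.κ x i _ rfl)) (whiskerLeftIso _ (m.κ x l _ rfl))
            (cellPush (m.σ _ _ _ a) ((s.passive B).obj x)).hom
            (cellPush (m.σ _ _ _ h) ((s.active B).obj x)).hom := by
          have := congrArg (eqToHom (Strict.assoc _ _ _).symm ≫ ·) (m.comm h rfl rfl a)
          simpa [CSq, cellPush] using this
        exact (h₁.trans (h₃.trans h₂.symm)).congr (by simp) (by simp))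
    refine ⟨τ, ?_⟩
    rintro i _ rfl
    rw [hτ]
    simp [CSq]
  choose τ hτ using hτ
  refine (Equivariant.exists_ts_eq (X := O) (Y := B) (f := k) (t := τ) ?_ ?_ ?_).elim ?_
  -- The laws of an equivariant morphism are tested on the restrictions along all `H i`, where they
  -- become the laws of `κ`.
  · intro x y φ
    refine c.faithful.cell fun i => ?_
    have h₁ := extL_natural (hp := c.trivial.obj_eq x) (hp' := c.trivial.obj_eq y)
      (c.trivial.map_eq φ) ((s.passive B).map φ)
      (hψ (s.mulMap φ (𝟙 i))) (c.isKap.natural rfl rfl φ (𝟙 i) (s.mulMap φ (𝟙 i)) (by simp))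
    have h₂ := extR_natural (hp := c.trivial.obj_eq x) (hp' := c.trivial.obj_eq y)
      (c.trivial.map_eq φ) ((s.active B).map φ) (hψ (𝟙 i))
    have h₃ := m.isKap.natural rfl rfl φ (𝟙 i) (s.mulMap φ (𝟙 i)) (by simp)
    have h₄ := h₁.comp (hτ y i _ rfl)
    simp only [Category.assoc] at h₄
    rw [h₃] at h₄
    have h₅ := h₄.unique' ((hτ x i _ rfl).comp h₂)
    simpa using h₅
  · refine c.faithful.cell fun i => ?_
    have h := s.one_mul i
    exact ext_one (s.active_one O) (s.passive_one B) (s.active_one B) (c.isKap.one i h)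
      (m.isKap.one i h) (hτ (e[I]) i i h) _
  · intro x y
    refine c.faithful.cell fun i => ?_
    have h := s.mul_assoc x y i
    exact ext_mul (s.active_mul O x y) (s.passive_mul B x y) (s.active_mul B x y) (s.comm B x y)
      (c.isKap.mul rfl rfl h) (m.isKap.mul rfl rfl h) (hτ x _ _ rfl) (hτ y i _ rfl) (hτ _ i _ h) _ _ _
  · rintro k ⟨rfl, hk⟩
    refine ⟨k, ψ, hψ, hψσ, fun x i j h => ?_⟩
    rw [eq_of_heq (hk x)]
    exact hτ x i j h

end
end Extension

/-! ### Restricting cowedges and induced actions along 1-cells -/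

section CoinvariantsRaw
open Bicategory
variable {M : Type uM} [Bicategory.{wM, vM} M] [Bicategory.Strict M]

attribute [local simp] leftUnitor_hom leftUnitor_inv rightUnitor_hom rightUnitor_inv associator_hom
  associator_inv

variable {A O Z : M} {π : O ⟶ Z}

/-- The composite `j ≫ F ≫ π ≅ a ≫ j' ≫ π ≅ a ≫ h`. -/
def pushIso {j j' : A ⟶ O} {F : O ⟶ O} {a : A ⟶ A} {h : A ⟶ Z} (n : j ≫ F ≅ a ≫ j')
    (φ : j' ≫ π ≅ h) : j ≫ F ≫ π ≅ a ≫ h :=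
  cellPush n π ≪≫ whiskerLeftIso a φ

theorem pushIso_natural {j j₁ j' j₁' : A ⟶ O} {F F' : O ⟶ O} {a a' : A ⟶ A} {h h' : A ⟶ Z}
    {n : j ≫ F ≅ a ≫ j'} {n' : j₁ ≫ F' ≅ a' ≫ j₁'} {φ : j' ≫ π ≅ h} {φ' : j₁' ≫ π ≅ h'}
    {y : j ⟶ j₁} {f : F ⟶ F'} {α : a ⟶ a'} {y' : j' ⟶ j₁'} {z : h ⟶ h'}
    (hn : (y ▷ F) ≫ (j₁ ◁ f) ≫ n'.hom = n.hom ≫ (α ▷ j') ≫ (a' ◁ y'))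
    (hφ : (y' ▷ π) ≫ φ'.hom = φ.hom ≫ z) :
    CSq (pushIso n φ) (pushIso n' φ') ((y ▷ (F ≫ π)) ≫ (j₁ ◁ f ▷ π)) ((α ▷ h) ≫ (a' ◁ z)) := by
  have h₁ : CSq n n' ((y ▷ F) ≫ (j₁ ◁ f)) ((α ▷ j') ≫ (a' ◁ y')) := by
    unfold CSq; rw [← hn]; simp
  have h₂ : CSq φ φ' (y' ▷ π) z := hφ
  refine CSq.congr (CSq.trans (CSq.ofCEq ?_ (Strict.assoc _ _ _).symm (Strict.assoc _ _ _).symm) <|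
    (h₁.whiskerRight π).trans <| CSq.trans (CSq.ofCEq ?_ (Strict.assoc _ _ _) (Strict.assoc _ _ _)) <|
    (CSq.exchangeRight α φ).comp (h₂.whiskerLeft a')) ?_ ?_
  · exact ⟨(Strict.assoc _ _ _).symm, (Strict.assoc _ _ _).symm, by simp [CSq]⟩
  · exact ⟨(Strict.assoc _ _ _), (Strict.assoc _ _ _), by simp [CSq]⟩
  · simp [pushIso, cellPush]
  · simp [pushIso, cellPush]

theorem push_one {j : A ⟶ O} {F G : O ⟶ O} {a p : A ⟶ A} {h : A ⟶ Z} {n : j ≫ F ≅ a ≫ j}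
    {m : j ≫ G ≅ p ≫ j} {φ : j ≫ π ≅ h} (hF : F = 𝟙 O) (hG : G = 𝟙 O) (ha : a = 𝟙 A) (hp : p = 𝟙 A)
    {h₁ h₂} (hn : n.hom = eqToHom h₁) (hm : m.hom = eqToHom h₂) (h₃ h₄) :
    CSq (pushIso n φ) (pushIso m φ) (j ◁ eqToHom h₃) (eqToHom h₄) := by
  subst hF hG ha hp
  simp [CSq, pushIso, cellPush, hn, hm]

/-- Cells `σ` on `O` and `ρ` on `A` that correspond under restriction have corresponding products,
provided the cells `n`, `m` that restrict the two actions are multiplicative and commute. The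
1-cells to `Z` may vary with the index, so that this serves for the coinvariants as well as for
gluing over a colimit. -/
theorem push_mul {πi πk πl : O ⟶ Z} {ji jk jl : A ⟶ O} {Fu Fv Fw Gu Gv Gw : O ⟶ O} {au av aw pu pv pw : A ⟶ A}
    {hi hk hl : A ⟶ Z} {nu : ji ≫ Fu ≅ au ≫ ji} {nv : ji ≫ Fv ≅ av ≫ ji} {nv' : jk ≫ Fv ≅ av ≫ jk}
    {nw : ji ≫ Fw ≅ aw ≫ ji} {mu : ji ≫ Gu ≅ pu ≫ jk} {mv : jk ≫ Gv ≅ pv ≫ jl}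
    {mw : ji ≫ Gw ≅ pw ≫ jl} {φi : ji ≫ πi ≅ hi} {φk : jk ≫ πk ≅ hk} {φl : jl ≫ πl ≅ hl}
    {σu : Fu ≫ πi ⟶ Gu ≫ πk} {σv : Fv ≫ πk ⟶ Gv ≫ πl} {ρu : au ≫ hi ⟶ pu ≫ hk}
    {ρv : av ≫ hk ⟶ pv ≫ hl} (hF : Fw = Fv ≫ Fu) (hG : Gw = Gu ≫ Gv) (ha : aw = av ≫ au)
    (hp : pw = pu ≫ pv) (hFG : Fv ≫ Gu = Gu ≫ Fv) (hap : av ≫ pu = pu ≫ av)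
    (hn : nw.hom = eqToHom (by rw [hF, Strict.assoc]) ≫ (nv.hom ▷ Fu) ≫
      eqToHom (Strict.assoc _ _ _) ≫ (av ◁ nu.hom) ≫ eqToHom (by rw [ha, Strict.assoc]))
    (hm : mw.hom = eqToHom (by rw [hG, Strict.assoc]) ≫ (mu.hom ▷ Gv) ≫
      eqToHom (Strict.assoc _ _ _) ≫ (pu ◁ mv.hom) ≫ eqToHom (by rw [hp, Strict.assoc]))
    (hnm : (nv.hom ▷ Gu) ≫ eqToHom (Strict.assoc _ _ _) ≫ (av ◁ mu.hom) =
      eqToHom (by simp only [Strict.assoc, hFG]) ≫ (mu.hom ▷ Fv) ≫ eqToHom (Strict.assoc _ _ _) ≫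
        (pu ◁ nv'.hom) ≫ eqToHom (by simp only [← Strict.assoc, hap]))
    (hu : CSq (pushIso nu φi) (pushIso mu φk) (ji ◁ σu) ρu)
    (hv : CSq (pushIso nv' φk) (pushIso mv φl) (jk ◁ σv) ρv) (e₁ e₂ e₃ e₄ e₅ e₆) :
    CSq (pushIso nw φi) (pushIso mw φl)
      (ji ◁ (eqToHom e₁ ≫ (Fv ◁ σu) ≫ eqToHom e₂ ≫ (Gu ◁ σv) ≫ eqToHom e₃))
      (eqToHom e₄ ≫ (av ◁ ρu) ≫ eqToHom e₅ ≫ (pu ◁ ρv) ≫ eqToHom e₆) := by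
  subst hF hG ha hp
  have F₁ := (CSq.ofCEq (CEq.assocL ji Fv σu).symm (Strict.assoc _ _ _).symm
    (Strict.assoc _ _ _).symm).trans <| (CSq.exchangeLeft nv σu).trans <|
    (CSq.ofCEq (CEq.assocL av ji σu) (Strict.assoc _ _ _) (Strict.assoc _ _ _)).trans
    (hu.whiskerLeft av)
  have F₂ := (CSq.ofCEq (CEq.assocL ji Gu σv).symm (Strict.assoc _ _ _).symm
    (Strict.assoc _ _ _).symm).trans <| (CSq.exchangeLeft mu σv).trans <|
    (CSq.ofCEq (CEq.assocL pu jk σv) (Strict.assoc _ _ _) (Strict.assoc _ _ _)).trans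
    (hv.whiskerLeft pu)
  simp only [Bicategory.whiskerLeft_comp, whiskerLeft_eqToHom]
  refine CSq.comp ?_ (F₁.comp (CSq.comp ?_ (F₂.comp ?_)))
  · simp [CSq, pushIso, cellPush, hn]
  · have h₁ := congrArg (· ▷ πk) hnm
    have h₂ := Equivariant.swapL φk.hom hap
    simp at h₁ h₂
    simp only [← Category.assoc] at h₁
    rw [comp_eqToHom_iff] at h₁
    simp only [Category.assoc, eqToHom_trans] at h₁
    simp [CSq, pushIso, cellPush, reassoc_of% h₁, h₂]
  · simp [CSq, pushIso, cellPush, hm]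

/-- The composite `ji ≫ W ≫ π ≅ (jk ≫ π) ≫ q` for an identity `q`. -/
def kapIso {ji jk : A ⟶ O} {W : O ⟶ O} {q : Z ⟶ Z} (n : ji ≫ W ≅ jk) (hq : q = 𝟙 Z) :
    ji ≫ W ≫ π ≅ (jk ≫ π) ≫ q :=
  eqToIso (Strict.assoc _ _ _).symm ≪≫ whiskerRightIso n π ≪≫ eqToIso (by rw [hq, Strict.comp_id])

theorem kapIso_natural {ji jk ji' jk' : A ⟶ O} {W W' : O ⟶ O} {q q' : Z ⟶ Z} {n : ji ≫ W ≅ jk}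
    {n' : ji' ≫ W' ≅ jk'} {hq : q = 𝟙 Z} {hq' : q' = 𝟙 Z} {y : ji ⟶ ji'} {w : W ⟶ W'} {x : jk ⟶ jk'}
    {β : q ⟶ q'} (hβ : β = eqToHom (hq.trans hq'.symm))
    (hn : (y ▷ W) ≫ (ji' ◁ w) ≫ n'.hom = n.hom ≫ x) :
    CSq (kapIso (π := π) n hq) (kapIso n' hq') ((y ▷ (W ≫ π)) ≫ (ji' ◁ w ▷ π))
      ((x ▷ π ▷ q) ≫ ((jk' ≫ π) ◁ β)) := by
  subst hq hq' hβ
  have h := congrArg (· ▷ π) hn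
  simp at h
  simp [CSq, kapIso, reassoc_of% h]

/-- The analogue of `push_mul` for the induced action: `κ` for a product is pasted from its factors,
and exchange moves the first factor to the index reached by `ny`. -/
theorem kap_mul {ji jk jl : A ⟶ O} {Wx Wy Wz : O ⟶ O} {qx qy qz bx byy bz : Z ⟶ Z}
    {ny : ji ≫ Wy ≅ jk} {nx : jk ≫ Wx ≅ jl} {nz : ji ≫ Wz ≅ jl} {hx : qx = 𝟙 Z} {hy : qy = 𝟙 Z}
    {hz : qz = 𝟙 Z} {κx : Wx ≫ π ⟶ π ≫ bx} {κy : Wy ≫ π ⟶ π ≫ byy} {θx : (jl ≫ π) ≫ qx ⟶ (jk ≫ π) ≫ bx}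
    {θy : (jk ≫ π) ≫ qy ⟶ (ji ≫ π) ≫ byy} (hW : Wz = Wy ≫ Wx) (hb : bz = byy ≫ bx)
    (hn : nz.hom = eqToHom (by rw [hW, Strict.assoc]) ≫ (ny.hom ▷ Wx) ≫ nx.hom)
    (Hx : CSq (kapIso nx hx) (eqToIso (Strict.assoc _ _ _).symm) (jk ◁ κx) θx)
    (Hy : CSq (kapIso ny hy) (eqToIso (Strict.assoc _ _ _).symm) (ji ◁ κy) θy) (e₁ e₂ e₃ e₄ e₅ e₆) :
    CSq (kapIso (π := π) nz hz) (eqToIso (Strict.assoc ji π bz).symm)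
      (ji ◁ (eqToHom e₁ ≫ (Wy ◁ κx) ≫ eqToHom e₂ ≫ (κy ▷ bx) ≫ eqToHom e₃))
      (eqToHom e₄ ≫ (θx ▷ qy) ≫ eqToHom e₅ ≫ (θy ▷ bx) ≫ eqToHom e₆) := by
  subst hx hy hz hW hb
  have F₁ := (CSq.ofCEq (CEq.assocL ji Wy κx).symm (Strict.assoc _ _ _).symm
    (Strict.assoc _ _ _).symm).trans <| (CSq.exchangeLeft ny κx).trans <|
    Hx.trans (CSq.ofCEq (CEq.unitR rfl θx).symm (Strict.comp_id _).symm (Strict.comp_id _).symm)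
  have F₂ := (CSq.ofCEq (CEq.assocM ji κy bx).symm (Strict.assoc _ _ _).symm
    (Strict.assoc _ _ _).symm).trans (Hy.whiskerRight bx)
  simp only [Bicategory.whiskerLeft_comp, whiskerLeft_eqToHom]
  refine CSq.comp ?_ (F₁.comp (CSq.comp ?_ (F₂.comp ?_)))
  · simp [CSq, kapIso, hn]
  · simp [CSq, kapIso]
  · simp [CSq, kapIso]

/-- The compatibility of `κ` with `σ` on `O`, whiskered with `ji` and moved through the restriction
squares of all four cells, becomes the condition `comm` of `Mid`. -/
theorem push_kap {ji jj jk jl : A ⟶ O} {F G W : O ⟶ O} {a p : A ⟶ A} {b q : Z ⟶ Z}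
    {nai : ji ≫ F ≅ a ≫ ji} {naj : jj ≫ F ≅ a ≫ jj} {npi : ji ≫ G ≅ p ≫ jk} {npj : jj ≫ G ≅ p ≫ jl}
    {noi : ji ≫ W ≅ jj} {nok : jk ≫ W ≅ jl} {σ : F ≫ π ≅ G ≫ π} {κ : W ≫ π ≅ π ≫ b} (hq : q = 𝟙 Z)
    {σi : a ≫ ji ≫ π ≅ p ≫ jk ≫ π} {σj : a ≫ jj ≫ π ≅ p ≫ jl ≫ π} {κi : (jj ≫ π) ≫ q ≅ (ji ≫ π) ≫ b}
    {κk : (jl ≫ π) ≫ q ≅ (jk ≫ π) ≫ b} (hWF : W ≫ F = F ≫ W) (hWG : W ≫ G = G ≫ W)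
    (hF : (noi.hom ▷ F) ≫ naj.hom = eqToHom (by simp only [Strict.assoc, hWF]) ≫ (nai.hom ▷ W) ≫
      eqToHom (Strict.assoc _ _ _) ≫ (a ◁ noi.hom))
    (hG : (noi.hom ▷ G) ≫ npj.hom = eqToHom (by simp only [Strict.assoc, hWG]) ≫ (npi.hom ▷ W) ≫
      eqToHom (Strict.assoc _ _ _) ≫ (p ◁ nok.hom))
    (hσκ : (W ◁ σ.hom) ≫ eqToHom (by rw [← Strict.assoc, hWG, Strict.assoc]) ≫ (G ◁ κ.hom) =
      eqToHom (by rw [← Strict.assoc, hWF, Strict.assoc]) ≫ (F ◁ κ.hom) ≫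
        eqToHom (Strict.assoc _ _ _).symm ≫ (σ.hom ▷ b) ≫ eqToHom (Strict.assoc _ _ _))
    (Hi : CSq (pushIso nai (Iso.refl _)) (pushIso npi (Iso.refl _)) (ji ◁ σ.hom) σi.hom)
    (Hj : CSq (pushIso naj (Iso.refl _)) (pushIso npj (Iso.refl _)) (jj ◁ σ.hom) σj.hom)
    (Ki : CSq (kapIso noi hq) (eqToIso (Strict.assoc _ _ _).symm) (ji ◁ κ.hom) κi.hom)
    (Kk : CSq (kapIso nok hq) (eqToIso (Strict.assoc _ _ _).symm) (jk ◁ κ.hom) κk.hom) :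
    (σj.hom ▷ q) ≫ eqToHom (Strict.assoc _ _ _) ≫ (p ◁ κk.hom) =
      eqToHom (Strict.assoc _ _ _) ≫ (a ◁ κi.hom) ≫ eqToHom (Strict.assoc _ _ _).symm ≫
        (σi.hom ▷ b) ≫ eqToHom (Strict.assoc _ _ _) := by
  subst hq
  have F₁ := (CSq.ofCEq (CEq.assocL ji W σ.hom).symm (Strict.assoc _ _ _).symm
    (Strict.assoc _ _ _).symm).trans <| (CSq.exchangeLeft noi σ.hom).trans <|
    Hj.trans (CSq.ofCEq (CEq.unitR rfl σj.hom).symm (Strict.comp_id _).symm (Strict.comp_id _).symm)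
  have F₂ := (CSq.ofCEq (CEq.assocL ji G κ.hom).symm (Strict.assoc _ _ _).symm
    (Strict.assoc _ _ _).symm).trans <| (CSq.exchangeLeft npi κ.hom).trans <|
    (CSq.ofCEq (CEq.assocL p jk κ.hom) (Strict.assoc _ _ _) (Strict.assoc _ _ _)).trans
    (Kk.whiskerLeft p)
  have F₃ := (CSq.ofCEq (CEq.assocL ji F κ.hom).symm (Strict.assoc _ _ _).symm
    (Strict.assoc _ _ _).symm).trans <| (CSq.exchangeLeft nai κ.hom).trans <|
    (CSq.ofCEq (CEq.assocL a ji κ.hom) (Strict.assoc _ _ _) (Strict.assoc _ _ _)).trans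
    (Ki.whiskerLeft a)
  have F₄ := (CSq.ofCEq (CEq.assocM ji σ.hom b).symm (Strict.assoc _ _ _).symm
    (Strict.assoc _ _ _).symm).trans (Hi.whiskerRight b)
  have hF' := congrArg (· ▷ π) hF
  have hG' := congrArg (· ▷ π) hG
  simp at hF' hG'
  have e := congrArg (ji ◁ ·) hσκ
  simp only [Bicategory.whiskerLeft_comp, whiskerLeft_eqToHom] at e
  have L := F₁.comp (CSq.comp (x := eqToHom (by
      simp only [← Strict.assoc]; rw [Strict.assoc ji, hWG, ← Strict.assoc]))
    (x' := eqToHom (Strict.assoc _ _ _)) (by simp [CSq, pushIso, cellPush, kapIso, reassoc_of% hG']) F₂)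
  rw [e] at L
  refine L.unique (CSq.comp (σ' := _) ?_ (F₃.comp (CSq.comp (σ' := _) ?_ (F₄.comp ?_))))
  · simp [CSq, pushIso, cellPush, kapIso, reassoc_of% hF']
  · simp [CSq, pushIso, cellPush, kapIso]
  · simp [CSq, pushIso, cellPush, kapIso]

end CoinvariantsRaw

/-! ### Restriction of the three actions on the copower along its unit -/

section CopowerCells
open Bicategory
variable {V : Type uV} [Category.{vV} V] [MonoidalCategory V] [SymmetricCategory V]
variable {I : Type uI} [Category.{wI} I] [MonoidalCategory I] [EnrichedOrdinaryCategory V I]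
  [MonoidalEnriched V I]
variable {M : Type uM} [Bicategory.{wM, vM} M] [Bicategory.Strict M]
  [∀ A B : M, EnrichedOrdinaryCategory V (A ⟶ B)] [VCatCategory V M]

attribute [local simp] leftUnitor_hom leftUnitor_inv rightUnitor_hom rightUnitor_inv associator_hom
  associator_inv
variable [StrictMonoidal I] (P : Copowering V I M) (s : Side) (X : IObj V I M)

namespace Copowering

theorem tensorHom_conj {a a' b b' c c' d d' : I} {f : a ⟶ a'} {g : b ⟶ b'} {f' : c ⟶ c'} {g' : d ⟶ d'}
    {p : a = c} {p' : a' = c'} {q : b = d} {q' : b' = d'} (hf : f ≫ eqToHom p' = eqToHom p ≫ f')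
    (hg : g ≫ eqToHom q' = eqToHom q ≫ g') : (f ⊛ₘ g) ≫ eqToHom (by rw [p', q']) =
      eqToHom (by rw [p, q]) ≫ (f' ⊛ₘ g') := by
  subst p p' q q'
  simp only [eqToHom_refl, Category.id_comp, Category.comp_id] at hf hg ⊢
  rw [hf, hg]

theorem conj_trans {C : Type uC} [Category.{vC} C] {a a' b b' c c' : C} {f : a ⟶ a'} {g : b ⟶ b'}
    {h : c ⟶ c'} {p : a = b} {p' : a' = b'} {q : b = c} {q' : b' = c'}
    (hf : f ≫ eqToHom p' = eqToHom p ≫ g) (hg : g ≫ eqToHom q' = eqToHom q ≫ h) :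
    f ≫ eqToHom (p'.trans q') = eqToHom (p.trans q) ≫ h := by
  subst p p' q q'
  simp_all

/-- The part of the biaction on `I ⊙ X` that is induced by the active side of `X`. -/
def upsA : I ⥤ (P.obj X.carrier ⟶ P.obj X.carrier) :=
  match s with
  | .r => P.upsL .r X
  | .l => P.upsR .l X

/-- The part of the biaction on `I ⊙ X` that involves the passive side of `X`. -/
def upsP : I ⥤ (P.obj X.carrier ⟶ P.obj X.carrier) :=
  match s with
  | .r => P.upsR .r X
  | .l => P.upsL .l X

theorem upsA_one : (P.upsA s X).obj (e[I]) = 𝟙 _ := by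
  cases s
  · exact (P.ups_strict .l X).R_one
  · exact (P.ups_strict .r X).L_one

theorem upsP_one : (P.upsP s X).obj (e[I]) = 𝟙 _ := by
  cases s
  · exact (P.ups_strict .l X).L_one
  · exact (P.ups_strict .r X).R_one

theorem upsA_mul (u v : I) : (P.upsA s X).obj (s.mul u v) =
    (P.upsA s X).obj v ≫ (P.upsA s X).obj u := by
  cases s
  · exact (P.ups_strict .l X).R_mul v u
  · exact (P.ups_strict .r X).L_mul u v

theorem upsP_mul (u v : I) : (P.upsP s X).obj (s.mul u v) =
    (P.upsP s X).obj u ≫ (P.upsP s X).obj v := by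
  cases s
  · exact (P.ups_strict .l X).L_mul v u
  · exact (P.ups_strict .r X).R_mul u v

theorem upsA_upsP (u v : I) : (P.upsA s X).obj u ≫ (P.upsP s X).obj v =
    (P.upsP s X).obj v ≫ (P.upsA s X).obj u := by
  cases s
  · exact ((P.ups_strict .l X).comm v u).symm
  · exact (P.ups_strict .r X).comm u v

theorem outer_upsA (x u : I) : (P.outer s X).obj x ≫ (P.upsA s X).obj u =
    (P.upsA s X).obj u ≫ (P.outer s X).obj x := by
  cases s
  · exact P.outer_upsR .l X x u
  · exact P.outer_upsL .r X x u

theorem outer_upsP (x u : I) : (P.outer s X).obj x ≫ (P.upsP s X).obj u =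
    (P.upsP s X).obj u ≫ (P.outer s X).obj x := by
  cases s
  · exact P.outer_upsL .l X x u
  · exact P.outer_upsR .r X x u

/-- `upsA` restricts to the active side of `X` along the unit. -/
def cellA (i u : I) : (P.ι X.carrier).obj i ≫ (P.upsA s X).obj u ≅
    (s.active X).obj u ≫ (P.ι X.carrier).obj i :=
  match s with
  | .r => P.ntr (e[I]) (e[I]) (X.L.obj u) (CoInv.one_tensor_one i)
  | .l => P.ntr (e[I]) (e[I]) (X.R.obj u) (CoInv.one_tensor_one i)

theorem index_r {i u k : I} (h : i ⊛ u = k) : e[I] ⊛ i ⊛ u = k :=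
  (StrictMonoidal.one_tensor _).trans h
theorem index_l {i u k : I} (h : i ⊛ u = k) : i ⊛ u ⊛ e[I] = k := by
  rw [StrictMonoidal.tensor_one, h]

/-- `upsP` restricts to the passive side of `X` and the multiplication along the unit. -/
def cellP (i u k : I) (h : s.mul i u = k) : (P.ι X.carrier).obj i ≫ (P.upsP s X).obj u ≅
    (s.passive X).obj u ≫ (P.ι X.carrier).obj k :=
  match s, h with
  | .r, h => P.ntr (e[I]) u (X.R.obj u) (index_r h)
  | .l, h => P.ntr u (e[I]) (X.L.obj u) (index_l h)

/-- `outer` restricts to the multiplication along the unit. -/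
def cellO (i x k : I) (h : s.mul x i = k) : (P.ι X.carrier).obj i ≫ (P.outer s X).obj x ≅
    (P.ι X.carrier).obj k :=
  match s, h with
  | .r, h => P.ntrId X.carrier x (e[I]) (index_l h)
  | .l, h => P.ntrId X.carrier (e[I]) x (index_r h)

theorem conj_index_r {i i' u u' k k' : I} {h : i ⊛ u = k} {h' : i' ⊛ u' = k'} {φ : i ⟶ i'}
    {ψ : u ⟶ u'} {χ : k ⟶ k'} (e : (φ ⊛ₘ ψ) ≫ eqToHom h' = eqToHom h ≫ χ) :
    (𝟙 (e[I]) ⊛ₘ φ ⊛ₘ ψ) ≫ eqToHom (index_r h') = eqToHom (index_r h) ≫ χ :=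
  conj_trans (one_tensorHom _) e

theorem conj_index_l {i i' u u' k k' : I} {h : i ⊛ u = k} {h' : i' ⊛ u' = k'} {φ : i ⟶ i'}
    {ψ : u ⟶ u'} {χ : k ⟶ k'} (e : (φ ⊛ₘ ψ) ≫ eqToHom h' = eqToHom h ≫ χ) :
    (φ ⊛ₘ ψ ⊛ₘ 𝟙 (e[I])) ≫ eqToHom (index_l h') = eqToHom (index_l h) ≫ χ :=
  conj_trans (tensorHom_conj (refl_hom φ) (tensorHom_one ψ)) e

theorem cellA_natural {i i' u u' : I} (φ : i ⟶ i') (ψ : u ⟶ u') :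
    ((P.ι X.carrier).map φ ▷ (P.upsA s X).obj u) ≫ ((P.ι X.carrier).obj i' ◁ (P.upsA s X).map ψ) ≫
        (P.cellA s X i' u').hom =
      (P.cellA s X i u).hom ≫ ((s.active X).map ψ ▷ (P.ι X.carrier).obj i) ≫
        ((s.active X).obj u' ◁ (P.ι X.carrier).map φ) := by
  cases s
  · exact P.ntr_natural (h := CoInv.one_tensor_one i) (h' := CoInv.one_tensor_one i') (𝟙 _) (𝟙 _) _ φ φ (conj_index_r (tensorHom_one φ))
  · exact P.ntr_natural (h := CoInv.one_tensor_one i) (h' := CoInv.one_tensor_one i') (𝟙 _) (𝟙 _) _ φ φ (conj_index_r (tensorHom_one φ))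

theorem cellA_one (i : I) : (P.cellA s X i (e[I])).hom = eqToHom (by
    rw [P.upsA_one, s.active_one, Strict.comp_id, Strict.id_comp]) := by
  cases s
  · exact P.ntr_id rfl rfl (Side.l.active_one X) (CoInv.one_tensor_one i) _
  · exact P.ntr_id rfl rfl (Side.r.active_one X) (CoInv.one_tensor_one i) _

theorem cellA_mul (i u v : I) : (P.cellA s X i (s.mul u v)).hom =
    eqToHom (by rw [P.upsA_mul, Strict.assoc]) ≫ ((P.cellA s X i v).hom ▷ (P.upsA s X).obj u) ≫
      eqToHom (Strict.assoc _ _ _) ≫ ((s.active X).obj v ◁ (P.cellA s X i u).hom) ≫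
      eqToHom (by rw [s.active_mul, Strict.assoc]) := by
  cases s
  · exact P.ntr_comp (CoInv.one_tensor_one i) (CoInv.one_tensor_one i) (CoInv.one_tensor_one i) one_one one_one (Side.l.active_mul X u v)
  · exact P.ntr_comp (CoInv.one_tensor_one i) (CoInv.one_tensor_one i) (CoInv.one_tensor_one i) one_one one_one (Side.r.active_mul X u v)

theorem cellP_natural {i i' u u' k k' : I} (h : s.mul i u = k) (h' : s.mul i' u' = k') (φ : i ⟶ i')
    (ψ : u ⟶ u') (χ : k ⟶ k') (e : s.mulMap φ ψ ≫ eqToHom h' = eqToHom h ≫ χ) :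
    ((P.ι X.carrier).map φ ▷ (P.upsP s X).obj u) ≫ ((P.ι X.carrier).obj i' ◁ (P.upsP s X).map ψ) ≫
        (P.cellP s X i' u' k' h').hom =
      (P.cellP s X i u k h).hom ≫ ((s.passive X).map ψ ▷ (P.ι X.carrier).obj k) ≫
        ((s.passive X).obj u' ◁ (P.ι X.carrier).map χ) := by
  cases s
  · exact P.ntr_natural (h := index_l h) (h' := index_l h') _ (𝟙 _) _ φ χ (conj_index_l e)
  · exact P.ntr_natural (h := index_r h) (h' := index_r h') (𝟙 _) _ _ φ χ (conj_index_r e)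

theorem cellP_one (i : I) (h : s.mul i (e[I]) = i) : (P.cellP s X i (e[I]) i h).hom = eqToHom (by
    rw [P.upsP_one, s.passive_one, Strict.comp_id, Strict.id_comp]) := by
  cases s
  · exact P.ntr_id rfl rfl (Side.l.passive_one X) (index_l h) _
  · exact P.ntr_id rfl rfl (Side.r.passive_one X) (index_r h) _

theorem cellP_mul {i u v k l : I} (h : s.mul i u = k) (h' : s.mul k v = l)
    (h'' : s.mul i (s.mul u v) = l) : (P.cellP s X i (s.mul u v) l h'').hom =
    eqToHom (by rw [P.upsP_mul, Strict.assoc]) ≫ ((P.cellP s X i u k h).hom ▷ (P.upsP s X).obj v) ≫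
      eqToHom (Strict.assoc _ _ _) ≫ ((s.passive X).obj u ◁ (P.cellP s X k v l h').hom) ≫
      eqToHom (by rw [s.passive_mul, Strict.assoc]) := by
  cases s
  · exact P.ntr_comp (index_l h) (index_l h') (index_l h'') rfl one_one (Side.l.passive_mul X u v)
  · exact P.ntr_comp (index_r h) (index_r h') (index_r h'') one_one rfl (Side.r.passive_mul X u v)

theorem cellO_natural {i i' x x' k k' : I} (h : s.mul x i = k) (h' : s.mul x' i' = k') (φ : i ⟶ i')
    (ψ : x ⟶ x') (χ : k ⟶ k') (e : s.mulMap ψ φ ≫ eqToHom h' = eqToHom h ≫ χ) :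
    ((P.ι X.carrier).map φ ▷ (P.outer s X).obj x) ≫
        ((P.ι X.carrier).obj i' ◁ (P.outer s X).map ψ) ≫ (P.cellO s X i' x' k' h').hom =
      (P.cellO s X i x k h).hom ≫ (P.ι X.carrier).map χ := by
  cases s
  · have := P.ntr_natural (h := index_r h) (h' := index_r h') (𝟙 _) ψ (𝟙 (𝟙 X.carrier)) φ χ (conj_index_r e)
    have t := this =≫ eqToHom (Strict.id_comp _)
    simp only [Category.assoc] at t
    refine t.trans ?_
    simp [cellO, ntrId]
    exact (Category.assoc _ _ _).symm
  · have := P.ntr_natural (h := index_l h) (h' := index_l h') ψ (𝟙 _) (𝟙 (𝟙 X.carrier)) φ χ (conj_index_l e)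
    have t := this =≫ eqToHom (Strict.id_comp _)
    simp only [Category.assoc] at t
    refine t.trans ?_
    simp [cellO, ntrId]
    exact (Category.assoc _ _ _).symm

theorem cellO_one (i : I) (h : s.mul (e[I]) i = i) : (P.cellO s X i (e[I]) i h).hom = eqToHom (by
    rw [P.outer_one, Strict.comp_id]) := by
  cases s
  · simp only [cellO, ntrId, Iso.trans_hom]
    rw [P.ntr_id rfl rfl rfl (index_r h) (by rw [P.map_id, Strict.comp_id, Strict.id_comp])]
    exact eqToHom_trans _ (Strict.id_comp _)
  · simp only [cellO, ntrId, Iso.trans_hom]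
    rw [P.ntr_id rfl rfl rfl (index_l h) (by rw [P.map_id, Strict.comp_id, Strict.id_comp])]
    exact eqToHom_trans _ (Strict.id_comp _)

theorem cellO_mul {i x y k l : I} (h : s.mul y i = k) (h' : s.mul x k = l)
    (h'' : s.mul (s.mul x y) i = l) : (P.cellO s X i (s.mul x y) l h'').hom =
    eqToHom (by rw [P.outer_mul, Strict.assoc]) ≫ ((P.cellO s X i y k h).hom ▷ (P.outer s X).obj x) ≫
      (P.cellO s X k x l h').hom := by
  cases s
  · exact P.ntrId_comp (index_r h) (index_r h') (index_r h'') one_one rfl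
  · exact P.ntrId_comp (index_l h) (index_l h') (index_l h'') rfl one_one

/-- Commuting two-sided multiplications have equal composites on the copower, and by `ntr_comp` both
orders of restriction give the cell of that composite. The two lemmas that follow hold for the same
reason. -/
theorem cellA_cellP (i u v k : I) (h : s.mul i u = k) :
    ((P.cellA s X i v).hom ▷ (P.upsP s X).obj u) ≫ eqToHom (Strict.assoc _ _ _) ≫
        ((s.active X).obj v ◁ (P.cellP s X i u k h).hom) =
      eqToHom (by simp only [Strict.assoc, P.upsA_upsP]) ≫
        ((P.cellP s X i u k h).hom ▷ (P.upsA s X).obj v) ≫ eqToHom (Strict.assoc _ _ _) ≫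
        ((s.passive X).obj u ◁ (P.cellA s X k v).hom) ≫
        eqToHom (by simp only [← Strict.assoc, s.comm]) := by
  cases s
  · exact P.ntr_swap (CoInv.one_tensor_one i) (index_l h) (index_l h) (CoInv.one_tensor_one k) (one_comm u).symm rfl (Side.l.comm X v u)
  · exact P.ntr_swap (CoInv.one_tensor_one i) (index_r h) (index_r h) (CoInv.one_tensor_one k) rfl (one_comm u) (Side.r.comm X v u)

theorem cellO_cellA (i u x j : I) (h : s.mul x i = j) :
    ((P.cellO s X i x j h).hom ▷ (P.upsA s X).obj u) ≫ (P.cellA s X j u).hom =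
      eqToHom (by simp only [Strict.assoc, P.outer_upsA]) ≫
        ((P.cellA s X i u).hom ▷ (P.outer s X).obj x) ≫ eqToHom (Strict.assoc _ _ _) ≫
        ((s.active X).obj u ◁ (P.cellO s X i x j h).hom) := by
  cases s
  · exact P.ntrId_ntr (index_r h) (CoInv.one_tensor_one j) (CoInv.one_tensor_one i) (index_r h) rfl (one_comm x).symm
  · exact P.ntrId_ntr (index_l h) (CoInv.one_tensor_one j) (CoInv.one_tensor_one i) (index_l h) (one_comm x) rfl

theorem cellO_cellP {i u x j k l : I} (h : s.mul x i = j) (hk : s.mul i u = k) (hl : s.mul x k = l)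
    (hl' : s.mul j u = l) :
    ((P.cellO s X i x j h).hom ▷ (P.upsP s X).obj u) ≫ (P.cellP s X j u l hl').hom =
      eqToHom (by simp only [Strict.assoc, P.outer_upsP]) ≫
        ((P.cellP s X i u k hk).hom ▷ (P.outer s X).obj x) ≫ eqToHom (Strict.assoc _ _ _) ≫
        ((s.passive X).obj u ◁ (P.cellO s X k x l hl).hom) := by
  cases s
  · exact P.ntrId_ntr (index_r h) (index_l hl') (index_l hk) (index_r hl) (one_comm u).symm (one_comm x).symm
  · exact P.ntrId_ntr (index_l h) (index_r hl') (index_r hk) (index_l hl) (one_comm x) (one_comm u)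

end Copowering
end CopowerCells

/-! ### Universal property of the coend, from the active to the passive side -/

section CoInvUniform
open Bicategory
variable {V : Type uV} [Category.{vV} V] [MonoidalCategory V] [SymmetricCategory V]
variable {I : Type uI} [Category.{wI} I] [MonoidalCategory I] [EnrichedOrdinaryCategory V I]
  [MonoidalEnriched V I]
variable {M : Type uM} [Bicategory.{wM, vM} M] [Bicategory.Strict M]
  [∀ A B : M, EnrichedOrdinaryCategory V (A ⟶ B)] [VCatCategory V M]

attribute [local simp] leftUnitor_hom leftUnitor_inv rightUnitor_hom rightUnitor_inv associator_hom
  associator_inv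
variable [StrictMonoidal I] {P : Copowering V I M} {s : Side} {X : IObj V I M}

namespace CoInv

/-- The structure cells of the cowedge, from the active to the passive side. -/
def sg : {s : Side} → (c : CoInv P s X) → (u : I) →
    ((P.upsA s X).obj u ≫ c.cowedge.leg ≅ (P.upsP s X).obj u ≫ c.cowedge.leg)
  | .r, c, u => c.cowedge.σ u
  | .l, c, u => (c.cowedge.σ u).symm

variable (c : CoInv P s X)

/-- Inverting the cells reverses the order of the factors, which matches the reversal of the product
in `Side.mul` for the side `l`. -/
theorem symm_hom_mul {O Z : M} {Fu Fv Gu Gv Fw Gw : O ⟶ O} {k : O ⟶ Z} {du : Fu ≫ k ≅ Gu ≫ k}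
    {dv : Fv ≫ k ≅ Gv ≫ k} {dw : Fw ≫ k ≅ Gw ≫ k} {e₁ e₂ e₃} (h : dw.hom = eqToHom e₁ ≫
      (Fv ◁ du.hom) ≫ eqToHom e₂ ≫ (Gu ◁ dv.hom) ≫ eqToHom e₃) : dw.symm.hom =
      eqToHom e₃.symm ≫ (Gu ◁ dv.symm.hom) ≫ eqToHom e₂.symm ≫ (Fv ◁ du.symm.hom) ≫
        eqToHom e₁.symm := by
  rw [Iso.symm_hom, ← cancel_epi dw.hom, Iso.hom_inv_id, h]
  simp

theorem cellPush_symm {A A' A'' B C : M} {a : A ⟶ A'} {f : A' ⟶ B} {b : A ⟶ A''} {g : A'' ⟶ B}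
    (σ : a ≫ f ≅ b ≫ g) (k : B ⟶ C) : cellPush σ.symm k = (cellPush σ k).symm :=
  Iso.ext (by simp [cellPush])

theorem sg_natural {u v : I} (f : u ⟶ v) : ((P.upsA s X).map f ▷ c.cowedge.leg) ≫ (c.sg v).hom =
    (c.sg u).hom ≫ ((P.upsP s X).map f ▷ c.cowedge.leg) := by
  cases s
  · exact c.σ_symm_natural f
  · exact c.cowedge.natural f

theorem sg_one : (c.sg (e[I])).hom = eqToHom (by rw [P.upsA_one, P.upsP_one]) := by
  cases s
  · exact Equivariant.inv_eq_eqToHom c.cowedge.one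
  · exact c.cowedge.one

theorem sg_mul (u v : I) : (c.sg (s.mul u v)).hom =
    eqToHom (by rw [P.upsA_mul, Strict.assoc]) ≫ ((P.upsA s X).obj v ◁ (c.sg u).hom) ≫
    eqToHom (by rw [← Strict.assoc, P.upsA_upsP, Strict.assoc]) ≫
    ((P.upsP s X).obj u ◁ (c.sg v).hom) ≫
    eqToHom (by rw [P.upsP_mul, Strict.assoc]) := by
  cases s
  · exact c.σ_symm_mul v u
  · exact c.cowedge.mul u v

theorem κ_sg (x u : I) :
    ((P.outer s X).obj x ◁ (c.sg u).hom) ≫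
        eqToHom (by rw [← Strict.assoc, P.outer_upsP, Strict.assoc]) ≫
        ((P.upsP s X).obj u ◁ (c.κ x).hom) =
      eqToHom (by rw [← Strict.assoc, P.outer_upsA, Strict.assoc]) ≫
        ((P.upsA s X).obj u ◁ (c.κ x).hom) ≫ eqToHom (Strict.assoc _ _ _).symm ≫
        ((c.sg u).hom ▷ (s.active c.obj).obj x) ≫ eqToHom (Strict.assoc _ _ _) := by
  cases s
  · exact c.κ_σ_symm x u
  · exact c.κ_σ x u

/-- A cowedge has cells from the left to the right action. For the side `r` this is the direction of
`d`; for `l` the active side is the right one, and the inverse cells form the cowedge. -/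
theorem exists_desc {Z : M} {k : P.obj X.carrier ⟶ Z}
    (d : ∀ u, (P.upsA s X).obj u ≫ k ≅ (P.upsP s X).obj u ≫ k)
    (natural : ∀ {u v : I} (f : u ⟶ v), ((P.upsA s X).map f ▷ k) ≫ (d v).hom =
      (d u).hom ≫ ((P.upsP s X).map f ▷ k))
    (one : (d (e[I])).hom = eqToHom (by rw [P.upsA_one, P.upsP_one]))
    (mul : ∀ u v : I, (d (s.mul u v)).hom =
      eqToHom (by rw [P.upsA_mul, Strict.assoc]) ≫ ((P.upsA s X).obj v ◁ (d u).hom) ≫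
      eqToHom (by rw [← Strict.assoc, P.upsA_upsP, Strict.assoc]) ≫
      ((P.upsP s X).obj u ◁ (d v).hom) ≫ eqToHom (by rw [P.upsP_mul, Strict.assoc])) :
    ∃ (k' : c.obj.carrier ⟶ Z) (φ : c.cowedge.leg ≫ k' ≅ k), ∀ u,
      (cellPush (c.sg u) k').hom ≫ ((P.upsP s X).obj u ◁ φ.hom) =
        ((P.upsA s X).obj u ◁ φ.hom) ≫ (d u).hom := by
  cases s
  · obtain ⟨k', φ, h⟩ := c.universal.ess_surj
      { leg := k, σ := fun u => (d u).symm,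
        natural := fun f => CSq.symm (natural f)
        one := Equivariant.inv_eq_eqToHom one
        mul := fun u v => symm_hom_mul (mul v u) }
    refine ⟨k', φ, fun u => ?_⟩
    have h' : CSq (cellPush (c.cowedge.σ u) k') (d u).symm ((P.upsP .l X).obj u ◁ φ.hom)
      ((P.upsA .l X).obj u ◁ φ.hom) := Eq.symm (h u)
    exact (congrArg (fun i => Iso.hom i ≫ ((P.upsP .l X).obj u ◁ φ.hom))
      (cellPush_symm (c.cowedge.σ u) k')).trans (Eq.symm h'.symm)
  · obtain ⟨k', φ, h⟩ := c.universal.ess_surj ⟨k, d, natural, one, mul⟩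
    exact ⟨k', φ, h⟩

theorem exists_unique_desc {Z : M} (k k' : c.obj.carrier ⟶ Z) (T : V)
    (t : T ⟶ ((c.cowedge.leg ≫ k) ⟶[V] (c.cowedge.leg ≫ k')))
    (ht : ∀ u, VSquare (cellPush (c.sg u) k) (cellPush (c.sg u) k')
      (famWhiskerLeft ((P.upsA s X).obj u) t) (famWhiskerLeft ((P.upsP s X).obj u) t)) :
    ∃! t' : T ⟶ (k ⟶[V] k'), famWhiskerLeft c.cowedge.leg t' = t := by
  refine c.universal.fully_faithful k k' T t fun u => ?_
  cases s
  · have h := (ht u).symm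
    exact ((congrArg₂ (fun i j => VSquare i j (famWhiskerLeft ((P.upsP .l X).obj u) t)
      (famWhiskerLeft ((P.upsA .l X).obj u) t)) (cellPush_symm (c.cowedge.σ u).symm k)
      (cellPush_symm (c.cowedge.σ u).symm k')).mpr h :)
  · exact ht u

end CoInv
end CoInvUniform

open Bicategory
-- The coinvariants as a family indexed by `I`
section CoInvRestricted
open Bicategory
variable {V : Type uV} [Category.{vV} V] [MonoidalCategory V] [SymmetricCategory V]
variable {I : Type uI} [Category.{wI} I] [MonoidalCategory I] [EnrichedOrdinaryCategory V I]
  [MonoidalEnriched V I]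
variable {M : Type uM} [Bicategory.{wM, vM} M] [Bicategory.Strict M]
  [∀ A B : M, EnrichedOrdinaryCategory V (A ⟶ B)] [VCatCategory V M]

attribute [local simp] leftUnitor_hom leftUnitor_inv rightUnitor_hom rightUnitor_inv associator_hom
  associator_inv
variable [StrictMonoidal I] {P : Copowering V I M} {s : Side} {X : IObj V I M}

/-- The whiskerings of any `t` with the 1-cells `ι i` form a `V`-natural family, so the uniqueness
part of the weak copower applies to `t` and `t'` alike. -/
theorem Copowering.jointlyFaithful (P : Copowering V I M) (A : M) :
    JointlyFaithful V fun i => (P.ι A).obj i := by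
  intro Z k k' T t t' h
  obtain ⟨u, -, hu⟩ := (P.universal A).fully_faithful k k' T
    (fun i => famWhiskerLeft ((P.unit A).obj i) t) (VNat.whiskerL_exchange (P.unit A) t)
  exact (hu t fun _ => rfl).trans (hu t' fun i => (h i).symm).symm

/-- Naturality of `φ` becomes `V`-naturality by `hV`, so `φ` and its inverse both lift through the
weak copower; joint faithfulness makes the lifts inverse to each other. -/
theorem Copowering.exists_iso (hV : ForgetFaithful.{uV, vV, uI, vM} V) (P : Copowering V I M) {A Z : M}
    {k k' : P.obj A ⟶ Z} (φ : ∀ i, (P.ι A).obj i ≫ k ≅ (P.ι A).obj i ≫ k')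
    (hφ : ∀ {i j : I} (f : i ⟶ j), CSq (φ i) (φ j) ((P.ι A).map f ▷ k) ((P.ι A).map f ▷ k')) :
    ∃ ψ : k ≅ k', ∀ i, (P.ι A).obj i ◁ ψ.hom = (φ i).hom := by
  have key : ∀ {k k' : P.obj A ⟶ Z} (φ : ∀ i, (P.ι A).obj i ≫ k ≅ (P.ι A).obj i ≫ k')
    (_ : ∀ {i j : I} (f : i ⟶ j), CSq (φ i) (φ j) ((P.ι A).map f ▷ k) ((P.ι A).map f ▷ k')),
    ∃ ψ : k ⟶ k', ∀ i, (P.ι A).obj i ◁ ψ = (φ i).hom := by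
    intro k k' φ hφ
    obtain ⟨t, ht, -⟩ := (P.universal A).fully_faithful k k' _ (fun i => eHomEquiv V (φ i).hom)
      (VNat.of_vsquare (F := enrR (P.unit A) k) (G := enrR (P.unit A) k') (VStr.vsquare hV ((VStr.ofEnr (P.unit A)).funR k)
        ((VStr.ofEnr (P.unit A)).funR k') φ fun f => hφ f))
    obtain ⟨ψ, rfl⟩ := (eHomEquiv V).surjective t
    exact ⟨ψ, fun i => (eHomEquiv V).injective ((famWhiskerLeft_eHomEquiv _ _).symm.trans (ht i))⟩
  exact (P.jointlyFaithful A).exists_iso φ (key φ hφ)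
    (key (fun i => (φ i).symm) fun f => (hφ f).symm)

theorem VSquare.pushIso {A O Z : M} {j j' : A ⟶ O} {F : O ⟶ O} {a : A ⟶ A} (n : j ≫ F ≅ a ≫ j')
    {k k' : O ⟶ Z} {T : V} (t : T ⟶ (k ⟶[V] k')) :
    VSquare (CoStab.pushIso n (Iso.refl (j' ≫ k))) (CoStab.pushIso n (Iso.refl (j' ≫ k')))
      (famWhiskerLeft j (famWhiskerLeft F t)) (famWhiskerLeft a (famWhiskerLeft j' t)) :=
  ((VSquare.assocL j F t).symm.trans ((VSquare.exchangeLeft n t).trans (VSquare.assocL a j' t))).congr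
    (by simp [CoStab.pushIso, cellPush]) (by simp [CoStab.pushIso, cellPush])

namespace CoInv
variable (c : CoInv P s X)

/-- The restriction of `sg` along the unit of the copower. -/
def sig (i u k : I) (h : s.mul i u = k) :
    (s.active X).obj u ≫ (P.ι X.carrier).obj i ≫ c.cowedge.leg ≅
      (s.passive X).obj u ≫ (P.ι X.carrier).obj k ≫ c.cowedge.leg :=
  (pushIso (P.cellA s X i u) (Iso.refl _)).symm ≪≫ whiskerLeftIso _ (c.sg u) ≪≫
    pushIso (P.cellP s X i u k h) (Iso.refl _)

/-- The restriction of `κ` along the unit of the copower. -/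
def kap (x i k : I) (h : s.mul x i = k) :
    ((P.ι X.carrier).obj k ≫ c.cowedge.leg) ≫ (s.passive c.obj).obj x ≅
      ((P.ι X.carrier).obj i ≫ c.cowedge.leg) ≫ (s.active c.obj).obj x :=
  (kapIso (P.cellO s X i x k h) (c.trivial.obj_eq x)).symm ≪≫ whiskerLeftIso _ (c.κ x) ≪≫
    eqToIso (Strict.assoc _ _ _).symm

theorem sig_csq (i u k : I) (h : s.mul i u = k) : CSq (pushIso (P.cellA s X i u) (Iso.refl _))
    (pushIso (P.cellP s X i u k h) (Iso.refl _)) ((P.ι X.carrier).obj i ◁ (c.sg u).hom)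
    (c.sig i u k h).hom := by
  simp [CSq, sig]

theorem kap_csq (x i k : I) (h : s.mul x i = k) : CSq (kapIso (P.cellO s X i x k h)
    (c.trivial.obj_eq x)) (eqToIso (Strict.assoc _ _ _).symm) ((P.ι X.carrier).obj i ◁ (c.κ x).hom)
    (c.kap x i k h).hom := by
  simp [CSq, kap]

/-- Every law is the corresponding law of the cowedge, whiskered with `ι i` and conjugated by the
cells that restrict the two actions. -/
theorem isSig : IsSig (X := X) s (H := funR (P.ι X.carrier) c.cowedge.leg) c.sig where
  natural {i i' u u' k k'} h h' φ ψ χ e := by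
    have h₁ := pushIso_natural (π := c.cowedge.leg) (φ := Iso.refl _) (φ' := Iso.refl _)
      (z := (P.ι X.carrier).map φ ▷ c.cowedge.leg) (P.cellA_natural s X φ ψ) (by simp)
    have h₂ := pushIso_natural (π := c.cowedge.leg) (φ := Iso.refl _) (φ' := Iso.refl _)
      (z := (P.ι X.carrier).map χ ▷ c.cowedge.leg) (P.cellP_natural s X h h' φ ψ χ e) (by simp)
    have h₃ := h₁.comp (c.sig_csq i' u' k' h')
    have h₄ := (c.sig_csq i u k h).comp h₂
    have e₁ := congrArg ((P.ι X.carrier).obj i' ◁ ·) (c.sg_natural ψ)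
    simp only [Bicategory.whiskerLeft_comp] at e₁
    simp only [Category.assoc, e₁] at h₃
    rw [← whisker_exchange_assoc] at h₃
    exact h₃.unique h₄
  one i h := (c.sig_csq i (e[I]) i h).unique (by
    rw [c.sg_one]
    exact push_one (P.upsA_one s X) (P.upsP_one s X) (s.active_one X) (s.passive_one X)
      (P.cellA_one s X i) (P.cellP_one s X i h) _ _)
  mul {i u v k l} h h' h'' := (c.sig_csq i _ l h'').unique (by
    rw [c.sg_mul]
    exact push_mul (P.upsA_mul s X u v) (P.upsP_mul s X u v) (s.active_mul X u v)
      (s.passive_mul X u v) (P.upsA_upsP s X v u) (s.comm X v u) (P.cellA_mul s X i u v)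
      (P.cellP_mul s X h h' h'') (P.cellA_cellP s X i u v k h) (c.sig_csq i u k h)
      (c.sig_csq k v l h') _ _ _ _ _ _)

theorem isKap : IsKap (B := c.obj) s (H := funR (P.ι X.carrier) c.cowedge.leg) c.kap where
  natural {x x' i i' k k'} h h' ψ φ χ e := by
    have h₁ := kapIso_natural (π := c.cowedge.leg) (hq := c.trivial.obj_eq x)
      (hq' := c.trivial.obj_eq x') (c.trivial.map_eq ψ)
      (P.cellO_natural s X h h' φ ψ χ e)
    have h₃ := h₁.comp (c.kap_csq x' i' k' h')
    have h₂ : CSq (eqToIso (Strict.assoc _ _ _).symm) (eqToIso (Strict.assoc _ _ _).symm)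
        ((P.ι X.carrier).map φ ▷ (c.cowedge.leg ≫ (s.active c.obj).obj x) ≫
          ((P.ι X.carrier).obj i' ◁ c.cowedge.leg ◁ (s.active c.obj).map ψ))
        (((P.ι X.carrier).map φ ▷ c.cowedge.leg ▷ (s.active c.obj).obj x) ≫
          (((P.ι X.carrier).obj i' ≫ c.cowedge.leg) ◁ (s.active c.obj).map ψ)) := by
      simp [CSq]
    have h₄ := (c.kap_csq x i k h).comp h₂
    have e₁ := congrArg ((P.ι X.carrier).obj i' ◁ ·) (c.κ_natural ψ)
    simp only [Bicategory.whiskerLeft_comp] at e₁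
    simp only [Category.assoc, e₁] at h₃
    rw [← whisker_exchange_assoc] at h₃
    exact h₃.unique h₄
  one i h := (c.kap_csq (e[I]) i i h).unique (by
    have := P.cellO_one s X i h
    rw [c.κ_one]
    simp [CSq, kapIso, this]
    exact (eqToHom_trans _ _).symm)
  mul {x y i k l} h h' h'' := (c.kap_csq _ i l h'').unique (by
    rw [c.κ_mul]
    exact kap_mul (P.outer_mul s X x y) (s.active_mul c.obj x y) (P.cellO_mul s X h h' h'')
      (c.kap_csq x k l h') (c.kap_csq y i k h) _ _ _ _ _ _)

/-- The restriction of the structure of the coinvariants along the unit of the copower. -/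
def mid : Mid s X c.obj where
  H := funR (P.ι X.carrier) c.cowedge.leg
  vs := (VStr.ofEnr (P.unit X.carrier)).funR c.cowedge.leg
  σ := c.sig
  isSig := c.isSig
  κ := c.kap
  isKap := c.isKap
  comm {i u x k j l} h hj hl h' := push_kap (c.trivial.obj_eq x) (P.outer_upsA s X x u)
    (P.outer_upsP s X x u) (P.cellO_cellA s X i u x j hj) (P.cellO_cellP s X hj h hl h')
    (c.κ_sg x u) (c.sig_csq i u k h) (c.sig_csq j u l h') (c.kap_csq x i j hj) (c.kap_csq x k l hl)

end CoInv
end CoInvRestricted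

open Bicategory
-- The coinvariants have the universal property `Coin`
section CoInvCoin
open Bicategory
variable {V : Type uV} [Category.{vV} V] [MonoidalCategory V] [SymmetricCategory V]
variable {I : Type uI} [Category.{wI} I] [MonoidalCategory I] [EnrichedOrdinaryCategory V I]
  [MonoidalEnriched V I]
variable {M : Type uM} [Bicategory.{wM, vM} M] [Bicategory.Strict M]
  [∀ A B : M, EnrichedOrdinaryCategory V (A ⟶ B)] [VCatCategory V M]

attribute [local simp] leftUnitor_hom leftUnitor_inv rightUnitor_hom rightUnitor_inv associator_hom
  associator_inv
variable [StrictMonoidal I] {P : Copowering V I M} {s : Side} {X : IObj V I M}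

/-- Interchange of `n` with `ξ`: restricting first along `j` and then comparing `π ≫ k` with `k₀`
gives the same as the opposite order. -/
theorem pushIso_comp {A O Z Z' : M} {j j' : A ⟶ O} {F : O ⟶ O} {a : A ⟶ A} (n : j ≫ F ≅ a ≫ j')
    {π : O ⟶ Z} {k : Z ⟶ Z'} {k₀ : O ⟶ Z'} {h : A ⟶ Z'} (ξ : π ≫ k ≅ k₀) (φ : j' ≫ k₀ ≅ h) :
    (j ◁ F ◁ ξ.hom) ≫ (pushIso n φ).hom = eqToHom (by simp only [Strict.assoc]) ≫
      ((pushIso n (Iso.refl (j' ≫ π))).hom ▷ k) ≫ eqToHom (Strict.assoc _ _ _) ≫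
      (a ◁ ((α_ j' π k).hom ≫ (j' ◁ ξ.hom) ≫ φ.hom)) := by
  have e := whisker_exchange n.hom ξ.hom
  simp at e
  rw [eqToHom_comp_iff] at e
  simp at e
  simp [pushIso, cellPush, reassoc_of% e]

namespace CoInv
variable (c : CoInv P s X)

/-- A whiskered family automatically respects the cells of the cowedge, by exchange, so the
uniqueness part of the coend applies. -/
theorem faithful_leg : JointlyFaithful V fun _ : Unit => c.cowedge.leg := by
  intro Z k k' T t t' h
  obtain ⟨u, -, hu⟩ := c.exists_unique_desc k k' T (famWhiskerLeft c.cowedge.leg t) fun u =>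
    (((VSquare.assocL _ _ t).symm.trans (VSquare.exchangeLeft (c.sg u) t)).trans
      (VSquare.assocL _ _ t)).congr (by simp [cellPush]) (by simp [cellPush])
  exact (hu t rfl).trans (hu t' (h ()).symm).symm

theorem faithful : JointlyFaithful V fun i => (P.ι X.carrier).obj i ≫ c.cowedge.leg :=
  (P.jointlyFaithful X.carrier).comp c.faithful_leg

/-- The two universal properties are applied in turn: the `V`-functor `K` extends to `k₀ : I ⊙ X →
Z`, the cells `ρ` make `k₀` the leg of a cowedge, and this descends to the coend. -/
theorem exists_ext (hV : ForgetFaithful.{uV, vV, uI, vM} V) {Z : M} {K : I ⥤ (X.carrier ⟶ Z)}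
    (hK : VStr V K) {ρ : SigCells s X K} (hρ : IsSig s ρ) :
    ∃ (k : c.obj.carrier ⟶ Z) (ψ : ∀ i, ((P.ι X.carrier).obj i ≫ c.cowedge.leg) ≫ k ≅ K.obj i),
      (∀ {i j : I} (f : i ⟶ j), ((P.ι X.carrier).map f ▷ c.cowedge.leg ▷ k) ≫ (ψ j).hom =
        (ψ i).hom ≫ K.map f) ∧
      ∀ i u l (h : s.mul i u = l), (cellPush (c.sig i u l h) k).hom ≫
        ((s.passive X).obj u ◁ (ψ l).hom) = ((s.active X).obj u ◁ (ψ i).hom) ≫ (ρ i u l h).hom := by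
  obtain ⟨k₀, φ, hφ⟩ := (P.universal X.carrier).ess_surj hK.enr
  obtain ⟨φ, hφ'⟩ : ∃ φ : ∀ i, (P.ι X.carrier).obj i ≫ k₀ ≅ K.obj i, ∀ (i j : I) (f : i ⟶ j),
      ((P.ι X.carrier).map f ▷ k₀) ≫ (φ j).hom = (φ i).hom ≫ K.map f := ⟨φ, fun i j f =>
    VStr.natural ((VStr.ofEnr (P.unit X.carrier)).funR k₀) hK φ hφ f⟩
  -- On `ι i` the cell of the cowedge at `u` has to be `ρ` at `(i, u)`; naturality of `ρ` in `i`
  -- lets these cells lift together.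
  have hd : ∀ u : I, ∃ d : (P.upsA s X).obj u ≫ k₀ ≅ (P.upsP s X).obj u ≫ k₀, ∀ i l
      (h : s.mul i u = l), CSq (pushIso (P.cellA s X i u) (φ i)) (pushIso (P.cellP s X i u l h) (φ l))
        ((P.ι X.carrier).obj i ◁ d.hom) (ρ i u l h).hom := by
    intro u
    obtain ⟨d, hd⟩ := P.exists_iso hV (fun i => pushIso (P.cellA s X i u) (φ i) ≪≫ ρ i u _ rfl ≪≫
      (pushIso (P.cellP s X i u _ rfl) (φ _)).symm) (fun {i j} f => by
        have h₁ := pushIso_natural (P.cellA_natural s X f (𝟙 u)) (hφ' _ _ f)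
        have h₂ := pushIso_natural (P.cellP_natural s X rfl rfl f (𝟙 u) (s.mulMap f (𝟙 u)) (by simp))
          (hφ' _ _ (s.mulMap f (𝟙 u)))
        have h₃ := hρ.natural rfl rfl f (𝟙 u) (s.mulMap f (𝟙 u)) (by simp)
        simp only [CategoryTheory.Functor.map_id, Bicategory.id_whiskerRight,
          Bicategory.whiskerLeft_id, Category.comp_id, Category.id_comp] at h₁ h₂ h₃
        exact h₁.trans (CSq.trans (x' := (s.passive X).obj u ◁ K.map (s.mulMap f (𝟙 u))) h₃ h₂.symm))
    refine ⟨d, ?_⟩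
    rintro i _ rfl
    rw [hd]
    simp [CSq]
  choose d hd using hd
  refine (c.exists_desc d ?_ ?_ ?_).elim ?_
  -- The cowedge axioms hold because they hold on every `ι i`, where they are the axioms of `IsSig`.
  · intro u v f
    refine (P.jointlyFaithful X.carrier).cell fun i => ?_
    have h₁ := pushIso_natural (P.cellA_natural s X (𝟙 i) f) (hφ' _ _ (𝟙 i))
    have h₂ := pushIso_natural (P.cellP_natural s X rfl rfl (𝟙 i) f (s.mulMap (𝟙 i) f) (by simp))
      (hφ' _ _ (s.mulMap (𝟙 i) f))
    have h₃ := h₁.comp (hd v i _ rfl)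
    have h₄ := (hd u i _ rfl).comp h₂
    have h₅ := hρ.natural rfl rfl (𝟙 i) f (s.mulMap (𝟙 i) f) (by simp)
    simp only [CategoryTheory.Functor.map_id, Bicategory.id_whiskerRight,
      Bicategory.whiskerLeft_id, Category.comp_id, Category.id_comp] at h₃ h₄ h₅
    rw [h₅] at h₃
    rw [Bicategory.whiskerLeft_comp, Bicategory.whiskerLeft_comp]
    exact h₃.unique' h₄
  · refine (P.jointlyFaithful X.carrier).cell fun i => ?_
    have h : s.mul i (e[I]) = i := s.mul_one i
    have h₁ := hd (e[I]) i i h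
    rw [hρ.one] at h₁
    exact h₁.unique' (push_one (P.upsA_one s X) (P.upsP_one s X) (s.active_one X) (s.passive_one X)
      (P.cellA_one s X i) (P.cellP_one s X i h) _ _)
  · intro u v
    refine (P.jointlyFaithful X.carrier).cell fun i => ?_
    have h := s.mul_assoc i u v
    have h₁ := hd (s.mul u v) i (s.mul (s.mul i u) v) h.symm
    rw [hρ.mul (k := s.mul i u) rfl rfl] at h₁
    refine h₁.unique' ?_
    exact push_mul (P.upsA_mul s X u v) (P.upsP_mul s X u v) (s.active_mul X u v)
      (s.passive_mul X u v) (P.upsA_upsP s X v u) (s.comm X v u) (P.cellA_mul s X i u v)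
      (P.cellP_mul s X rfl rfl h.symm) (P.cellA_cellP s X i u v _ rfl) (hd u i _ rfl)
      (hd v _ _ rfl) _ _ _ _ _ _
  · rintro k ⟨ξ, hξ⟩
    refine ⟨k, fun i => α_ _ _ _ ≪≫ whiskerLeftIso _ ξ ≪≫ φ i, ?_, ?_⟩
    · intro i j f
      have e := whisker_exchange_assoc ((P.ι X.carrier).map f) ξ.hom (φ j).hom
      simp
      rw [← hφ' _ _ f, e]
      simp
    -- The compatibility of `ξ` with the cowedges, restricted along `ι i`, gives a pasted square
    -- whose first part is the one that defines `sig`; cancelling it leaves the claim.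
    · intro i u l h
      have h₁ : CSq (whiskerLeftIso ((P.upsA s X).obj u) ξ) (whiskerLeftIso ((P.upsP s X).obj u) ξ)
          (cellPush (c.sg u) k).hom (d u).hom := hξ u
      have h₂ := (h₁.whiskerLeft ((P.ι X.carrier).obj i)).trans (hd u i l h)
      have h₃ := (c.sig_csq i u l h).whiskerRight k
      have h₄ : CEq ((P.ι X.carrier).obj i ◁ (cellPush (c.sg u) k).hom)
          (((P.ι X.carrier).obj i ◁ (c.sg u).hom) ▷ k) :=
        ⟨by simp only [Strict.assoc], by simp only [Strict.assoc], by simp [CSq, cellPush]⟩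
      have h₅ : CEq ((c.sig i u l h).hom ▷ k) (cellPush (c.sig i u l h) k).hom :=
        ⟨by simp only [Strict.assoc], by simp only [Strict.assoc], by simp [CSq, cellPush]⟩
      have h₆ := ((CSq.ofCEq h₄ (by simp only [Strict.assoc]) (by simp only [Strict.assoc])).trans
        h₃).trans (CSq.ofCEq h₅ (by simp only [Strict.assoc]) (by simp only [Strict.assoc]))
      refine (CSq.of_trans (σ := _) (σ' := _) (ρ := whiskerLeftIso _ _)
        (ρ' := whiskerLeftIso _ _) (h₂.congr ?_ ?_) h₆)
      · exact (pushIso_comp _ ξ _).trans (by simp)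
      · exact (pushIso_comp _ ξ _).trans (by simp)

/-- The same two stages for families: `V`-naturality lifts `t` to the copower, and compatibility
with `σ`, tested on the 1-cells `ι i`, lifts it further to the coend. -/
theorem exists_fam {Z : M} (k k' : c.obj.carrier ⟶ Z) (T : V)
    (t : ∀ i, T ⟶ ((((P.ι X.carrier).obj i ≫ c.cowedge.leg) ≫ k) ⟶[V]
      (((P.ι X.carrier).obj i ≫ c.cowedge.leg) ≫ k')))
    (ht : (((VStr.ofEnr (P.unit X.carrier)).funR c.cowedge.leg).funR k).Nat
      (((VStr.ofEnr (P.unit X.carrier)).funR c.cowedge.leg).funR k') t)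
    (ht' : ∀ i u l (h : s.mul i u = l), VSquare (cellPush (c.sig i u l h) k)
      (cellPush (c.sig i u l h) k') (famWhiskerLeft ((s.active X).obj u) (t i))
      (famWhiskerLeft ((s.passive X).obj u) (t l))) :
    ∃ t' : T ⟶ (k ⟶[V] k'), ∀ i,
      famWhiskerLeft ((P.ι X.carrier).obj i ≫ c.cowedge.leg) t' = t i := by
  have hs : ∀ i, ∃ s' : T ⟶ (((P.ι X.carrier).obj i ≫ c.cowedge.leg ≫ k) ⟶[V]
      ((P.ι X.carrier).obj i ≫ c.cowedge.leg ≫ k')), VSquare (α_ _ _ _) (α_ _ _ _) (t i) s' :=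
    fun i => ⟨_, VSquare.conj _ _ _⟩
  choose s' hs using hs
  obtain ⟨t₁, h₁, -⟩ := (P.universal X.carrier).fully_faithful (c.cowedge.leg ≫ k)
    (c.cowedge.leg ≫ k') T s' (VNat.conj (F := enrR (enrR (P.unit X.carrier) c.cowedge.leg) k)
      (G := enrR (enrR (P.unit X.carrier) c.cowedge.leg) k')
      (F' := enrR (P.unit X.carrier) (c.cowedge.leg ≫ k))
      (G' := enrR (P.unit X.carrier) (c.cowedge.leg ≫ k')) ht
      (fun i j => VSquare.assocR _ _ _) (fun i j => VSquare.assocR _ _ _) hs)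
  replace h₁ : ∀ i, famWhiskerLeft ((P.ι X.carrier).obj i) t₁ = s' i := h₁
  obtain ⟨t', h₂, -⟩ := c.exists_unique_desc k k' T t₁ fun u =>
    (P.jointlyFaithful X.carrier).vsquare fun i => by
      have e₁ := VSquare.pushIso (P.cellA s X i u) t₁
      have e₂ := VSquare.pushIso (P.cellP s X i u _ rfl) t₁
      rw [h₁] at e₁ e₂
      have e₃ := ht' i u _ rfl
      have a₁ := (hs i).whiskerLeft ((s.active X).obj u)
      have a₂ := (hs (s.mul i u)).whiskerLeft ((s.passive X).obj u)
      refine (((e₁.trans a₁.symm).trans e₃).trans (a₂.trans e₂.symm)).congr ?_ ?_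
      · simp [cellPush, pushIso, sig]
      · simp [cellPush, pushIso, sig]
  refine ⟨t', fun i => ?_⟩
  have e := VSquare.assocL ((P.ι X.carrier).obj i) c.cowedge.leg t'
  rw [h₂, h₁] at e
  exact e.unique' (hs i)

/-- The universal property of the coinvariants. -/
def coin (hV : ForgetFaithful.{uV, vV, uI, vM} V) : Coin s X c.obj where
  toMid := c.mid
  trivial := c.trivial
  ess_surj hK _ hρ := c.exists_ext hV hK hρ
  faithful := c.faithful
  full := c.exists_fam

end CoInv
end CoInvCoin

open Bicategory
-- The action cells of the unit `η_s`
section Unit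
open Bicategory
variable {V : Type uV} [Category.{vV} V] [MonoidalCategory V] [SymmetricCategory V]
variable {I : Type uI} [Category.{wI} I] [MonoidalCategory I] [EnrichedOrdinaryCategory V I]
  [MonoidalEnriched V I]
variable {M : Type uM} [Bicategory.{wM, vM} M] [Bicategory.Strict M]
  [∀ A B : M, EnrichedOrdinaryCategory V (A ⟶ B)] [VCatCategory V M]

attribute [local simp] leftUnitor_hom leftUnitor_inv rightUnitor_hom rightUnitor_inv associator_hom
  associator_inv
variable [StrictMonoidal I] {P : Copowering V I M} {s : Side} {X : IObj V I M}

/-- The structure cell of `η` splits at the 1-cell `r ≫ p ≫ ω` into a part that involves only `σ`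
and a part that involves only `κ`. -/
theorem etaIso_eq {A O Z : M} {l r : A ⟶ A} {j p : A ⟶ O} {F H G : O ⟶ O} {ω : O ⟶ Z}
    {d c : Z ⟶ Z} (hd : d = 𝟙 Z) (n : j ≫ F ≅ l ≫ j) (ν : j ≫ H ≅ r ≫ p) (μ : j ≫ G ≅ p)
    (σ : F ≫ ω ≅ H ≫ ω) (κ : G ≫ ω ≅ ω ≫ c) :
    (etaIso hd n.symm (thIso ν μ) σ κ).hom =
      eqToHom (by rw [hd, Strict.comp_id]) ≫
      ((pushIso n (Iso.refl _)).symm ≪≫ whiskerLeftIso j σ ≪≫ pushIso ν (Iso.refl _)).hom ≫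
      eqToHom (by rw [hd, Strict.comp_id]) ≫
      (r ◁ ((kapIso μ hd).symm ≪≫ whiskerLeftIso j κ ≪≫ eqToIso (Strict.assoc _ _ _).symm).hom) := by
  subst hd
  simp [etaIso, thIso, pushIso, kapIso, cellPush]

namespace CoInv

/-- The unit `X → coInv_s X`. -/
def unit : {s : Side} → (c : CoInv P s X) → Equivariant X c.obj
  | .r, c => c.ηr
  | .l, c => c.ηl

variable (c : CoInv P s X)

theorem unit_hom : c.unit.hom = (P.ι X.carrier).obj (e[I]) ≫ c.cowedge.leg := by
  cases s <;> rfl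

/-- The cell leads from the index `1` to the index `u = 1·u` by `σ`, and back from `u = u·1` to `1`
by `κ`. -/
theorem unit_ts (u : I) (h : s.mul (e[I]) u = u) (h' : s.mul u (e[I]) = u) (e₁ e₂ e₃) :
    (c.unit.ts s u).hom = eqToHom e₁ ≫ (c.sig (e[I]) u u h).hom ≫ eqToHom e₂ ≫
      ((s.passive X).obj u ◁ (c.kap u (e[I]) u h').hom) ≫ eqToHom e₃ := by
  cases s
  · exact (etaIso_eq (c.trivial.obj_eq u) _ _ _ _ _).trans (congrArg (fun x => _ ≫
      (c.sig (e[I]) u u h).hom ≫ _ ≫ x) (Category.comp_id _).symm)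
  · exact (etaIso_eq (c.trivial.obj_eq u) _ _ _ _ _).trans (congrArg (fun x => _ ≫
      (c.sig (e[I]) u u h).hom ≫ _ ≫ x) (Category.comp_id _).symm)

end CoInv
end Unit

open Bicategory
-- The family of a composite through an action with trivial passive side
section PairRaw
open Bicategory
variable {M : Type uM} [Bicategory.{wM, vM} M] [Bicategory.Strict M]

attribute [local simp] leftUnitor_hom leftUnitor_inv rightUnitor_hom rightUnitor_inv associator_hom
  associator_inv

variable {X Y B : M} {a : X ⟶ Y} {c : Y ⟶ B}

/-- The action cell `t` of `a`, whiskered with `ai ≫ c`. -/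
def pairSig {x y : X ⟶ X} {p au ai ak : Y ⟶ Y} (hp : p = 𝟙 Y) (hk : ak = au ≫ ai)
    (t : x ≫ a ≫ p ≅ y ≫ a ≫ au) : x ≫ a ≫ ai ≫ c ≅ y ≫ a ≫ ak ≫ c :=
  eqToIso (by simp only [hp, Strict.comp_id, Strict.assoc]) ≪≫ whiskerRightIso t (ai ≫ c) ≪≫
    eqToIso (by simp only [hk, Strict.assoc])

/-- For the family `a ≫ act i ≫ c` the cell `σ` is the action cell of `a`, and multiplicativity of
the action on `Y` absorbs the new factor `act u` into the index. Naturality combines that of the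
cell with an interchange with `φ ▷ c`. -/
theorem pairSig_natural {x y x' y' : X ⟶ X} {p au ai ak p' au' ai' ak' : Y ⟶ Y} {hp : p = 𝟙 Y}
    {hp' : p' = 𝟙 Y} {hk : ak = au ≫ ai} {hk' : ak' = au' ≫ ai'} {t : x ≫ a ≫ p ≅ y ≫ a ≫ au}
    {t' : x' ≫ a ≫ p' ≅ y' ≫ a ≫ au'} {ξ : x ⟶ x'} {υ : y ⟶ y'} {ψ : au ⟶ au'} {φ : ai ⟶ ai'}
    {χ : ak ⟶ ak'} {π : p ⟶ p'} (hπ : π = eqToHom (hp.trans hp'.symm))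
    (hχ : χ ≫ eqToHom hk' = eqToHom hk ≫ (ψ ▷ ai) ≫ (au' ◁ φ))
    (ht : (ξ ▷ (a ≫ p)) ≫ (x' ◁ a ◁ π) ≫ t'.hom = t.hom ≫ (υ ▷ (a ≫ au)) ≫ (y' ◁ a ◁ ψ)) :
    (ξ ▷ (a ≫ ai ≫ c)) ≫ (x' ◁ a ◁ φ ▷ c) ≫ (pairSig (c := c) hp' hk' t').hom =
      (pairSig hp hk t).hom ≫ (υ ▷ (a ≫ ak ≫ c)) ≫ (y' ◁ a ◁ χ ▷ c) := by
  subst hp hp' hk hk' hπ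
  simp only [eqToHom_refl, Category.comp_id, Category.id_comp] at hχ
  subst hχ
  rw [eqToHom_refl, Bicategory.whiskerLeft_id, Bicategory.whiskerLeft_id, Category.id_comp] at ht
  have h₁ := congrArg (fun η => η ▷ (ai ≫ c)) ht
  have h₂ := whisker_exchange t'.hom (φ ▷ c)
  simp at h₂
  simp only [Category.assoc, eqToHom_trans, eqToHom_trans_assoc, eqToHom_refl, Category.id_comp, Category.comp_id,
    Bicategory.whiskerLeft_comp, Bicategory.comp_whiskerRight, whiskerLeft_eqToHom, Bicategory.whiskerLeft_id, Bicategory.id_whiskerRight,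
    eqToHom_whiskerRight, Bicategory.comp_whiskerLeft, Bicategory.whiskerRight_comp,
    Bicategory.whisker_assoc, Bicategory.id_whiskerLeft, Bicategory.whiskerRight_id,
    leftUnitor_hom, leftUnitor_inv, associator_hom, associator_inv, rightUnitor_hom,
    rightUnitor_inv] at h₁
  rw [eqToHom_comp_iff] at h₂
  simp only [← Category.assoc] at h₁ h₂
  rw [comp_eqToHom_iff] at h₁ h₂
  simp only [Category.assoc, eqToHom_trans, eqToHom_trans_assoc] at h₁ h₂
  simp [pairSig]
  rw [reassoc_of% h₂]
  simp
  rw [eqToHom_comp_iff] at h₁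
  simp only [Category.assoc, eqToHom_trans_assoc] at h₁
  simp [reassoc_of% h₁]

theorem pairSig_mul {xu xv xw yu yv yw : X ⟶ X} {pu pv pw au av aw ai ak al : Y ⟶ Y}
    {hpu : pu = 𝟙 Y} {hpv : pv = 𝟙 Y} {hpw : pw = 𝟙 Y} {hk : ak = au ≫ ai} {hl : al = av ≫ ak}
    {hw : al = aw ≫ ai} {tu : xu ≫ a ≫ pu ≅ yu ≫ a ≫ au} {tv : xv ≫ a ≫ pv ≅ yv ≫ a ≫ av}
    {tw : xw ≫ a ≫ pw ≅ yw ≫ a ≫ aw} (hx : xw = xv ≫ xu) (hy : yw = yu ≫ yv)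
    (ha : aw = av ≫ au) {e₁ e₂ e₃}
    (ht : tw.hom = eqToHom e₁ ≫ (xv ◁ tu.hom ▷ pv) ≫ eqToHom e₂ ≫ (yu ◁ tv.hom ▷ au) ≫
      eqToHom e₃) (e₄ e₅ e₆) :
    (pairSig (c := c) hpw hw tw).hom = eqToHom e₄ ≫ (xv ◁ (pairSig (c := c) hpu hk tu).hom) ≫
      eqToHom e₅ ≫ (yu ◁ (pairSig (c := c) hpv hl tv).hom) ≫ eqToHom e₆ := by
  subst hpu hpv hpw hk hl hx hy ha
  simp [pairSig, ht]

/-- The action cell `t` of `c`, whiskered with `a ≫ ai`. -/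
def pairKap {q b : B ⟶ B} {p ax ai ak : Y ⟶ Y} (hp : p = 𝟙 Y) (hk : ak = ai ≫ ax)
    (t : ax ≫ c ≫ q ≅ p ≫ c ≫ b) : (a ≫ ak ≫ c) ≫ q ≅ (a ≫ ai ≫ c) ≫ b :=
  eqToIso (by simp only [hk, Strict.assoc]) ≪≫ whiskerLeftIso a (whiskerLeftIso ai t) ≪≫
    eqToIso (by simp only [hp, Strict.id_comp, Strict.assoc])

theorem pairKap_natural {q b q' b' : B ⟶ B} {p ax ai ak p' ax' ai' ak' : Y ⟶ Y} {hp : p = 𝟙 Y}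
    {hp' : p' = 𝟙 Y} {hk : ak = ai ≫ ax} {hk' : ak' = ai' ≫ ax'} {t : ax ≫ c ≫ q ≅ p ≫ c ≫ b}
    {t' : ax' ≫ c ≫ q' ≅ p' ≫ c ≫ b'} {θ : q ⟶ q'} {β : b ⟶ b'} {ψ : ax ⟶ ax'} {φ : ai ⟶ ai'}
    {χ : ak ⟶ ak'} {π : p ⟶ p'} (hπ : π = eqToHom (hp.trans hp'.symm))
    (hχ : χ ≫ eqToHom hk' = eqToHom hk ≫ (φ ▷ ax) ≫ (ai' ◁ ψ))
    (ht : (ψ ▷ (c ≫ q)) ≫ (ax' ◁ c ◁ θ) ≫ t'.hom = t.hom ≫ (π ▷ (c ≫ b)) ≫ (p' ◁ c ◁ β)) :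
    ((a ◁ χ ▷ c) ▷ q) ≫ ((a ≫ ak' ≫ c) ◁ θ) ≫ (pairKap (a := a) hp' hk' t').hom =
      (pairKap hp hk t).hom ≫ ((a ◁ φ ▷ c) ▷ b) ≫ ((a ≫ ai' ≫ c) ◁ β) := by
  subst hp hp' hk hk' hπ
  simp only [eqToHom_refl, Category.comp_id, Category.id_comp] at hχ
  subst hχ
  have h₁ := congrArg (fun η => a ◁ ai' ◁ η) ht
  have h₂ := congrArg (a ◁ ·) (whisker_exchange φ t.hom)
  replace h₂ := h₂.symm
  simp at h₁ h₂
  rw [eqToHom_comp_iff] at h₁ h₂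
  simp [pairKap, reassoc_of% h₁, reassoc_of% h₂]

theorem pairKap_mul {qx qy qw bx by' bw : B ⟶ B} {px py pw ax ay aw ai ak al : Y ⟶ Y}
    {hpx : px = 𝟙 Y} {hpy : py = 𝟙 Y} {hpw : pw = 𝟙 Y} {hk : ak = ai ≫ ay} {hl : al = ak ≫ ax}
    {hw : al = ai ≫ aw} {tx : ax ≫ c ≫ qx ≅ px ≫ c ≫ bx} {ty : ay ≫ c ≫ qy ≅ py ≫ c ≫ by'}
    {tw : aw ≫ c ≫ qw ≅ pw ≫ c ≫ bw} (hq : qw = qx ≫ qy) (hb : bw = by' ≫ bx)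
    (ha : aw = ay ≫ ax) {e₁ e₂ e₃}
    (ht : tw.hom = eqToHom e₁ ≫ (ay ◁ tx.hom ▷ qy) ≫ eqToHom e₂ ≫ (px ◁ ty.hom ▷ bx) ≫
      eqToHom e₃) (e₄ e₅ e₆) :
    (pairKap (a := a) hpw hw tw).hom = eqToHom e₄ ≫ ((pairKap (a := a) hpx hl tx).hom ▷ qy) ≫
      eqToHom e₅ ≫ ((pairKap (a := a) hpy hk ty).hom ▷ bx) ≫ eqToHom e₆ := by
  subst hpx hpy hpw hk hl hq hb ha
  simp [pairKap, ht]

/-- The cell `σ` acts at the left end of `a ≫ act i ≫ c` and `κ` at the right end, so they commute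
by interchange. -/
theorem pair_comm {x y : X ⟶ X} {q b : B ⟶ B} {pu px au ax ai aj ak al : Y ⟶ Y} (hpu : pu = 𝟙 Y)
    (hpx : px = 𝟙 Y) (hk : ak = au ≫ ai) (hj : aj = ai ≫ ax) (hl : al = au ≫ aj)
    (hl' : al = ak ≫ ax) (t : x ≫ a ≫ pu ≅ y ≫ a ≫ au) (t' : ax ≫ c ≫ q ≅ px ≫ c ≫ b) :
    ((pairSig (c := c) hpu hl t).hom ▷ q) ≫ eqToHom (Strict.assoc _ _ _) ≫
        (y ◁ (pairKap (a := a) hpx hl' t').hom) =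
      eqToHom (Strict.assoc _ _ _) ≫ (x ◁ (pairKap (a := a) hpx hj t').hom) ≫
        eqToHom (Strict.assoc _ _ _).symm ≫ ((pairSig (c := c) hpu hk t).hom ▷ b) ≫
        eqToHom (Strict.assoc _ _ _) := by
  subst hpu hpx hk hj hl
  have h := (whisker_exchange t.hom (ai ◁ t'.hom)).symm
  simp at h
  rw [eqToHom_comp_iff] at h
  simp only [← Category.assoc] at h
  rw [comp_eqToHom_iff] at h
  simp at h
  simp [pairSig, pairKap, reassoc_of% h]

end PairRaw

section Pair
open Bicategory
variable {V : Type uV} [Category.{vV} V] [MonoidalCategory V] [SymmetricCategory V]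
variable {I : Type uI} [Category.{wI} I] [MonoidalCategory I] [EnrichedOrdinaryCategory V I]
  [MonoidalEnriched V I]
variable {M : Type uM} [Bicategory.{wM, vM} M] [Bicategory.Strict M]
  [∀ A B : M, EnrichedOrdinaryCategory V (A ⟶ B)] [VCatCategory V M]
variable {X Y B : IObj V I M}

/-- The family `a ≫ act i ≫ c` for equivariant morphisms `a : X → Y` and `c : Y → B`. -/
noncomputable def Mid.ofPair (s : Side) (a : Equivariant X Y) (c : Equivariant Y B)
    (hY : IsTrivial (s.passive Y)) : Mid s X B where
  H := funL a.hom (funR (s.active Y) c.hom)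
  vs := ((exists_vStr_active s Y hY).some.funR c.hom).funL a.hom
  σ i u k h := pairSig (hY.obj_eq u) (by rw [← h, s.active_mul]) (a.ts s u)
  isSig :=
    { natural := by
        rintro i i' u u' _ _ rfl rfl φ ψ χ e
        have e' : χ = s.mulMap φ ψ := by simpa using e.symm
        subst e'
        exact pairSig_natural (hY.map_eq ψ) (s.active_mul_map Y φ ψ) (a.ts_natural s ψ)
      one := fun i h => by
        have := a.ts_one (s := s)
        simp only [pairSig, Iso.trans_hom, whiskerRightIso_hom, this, eqToHom_whiskerRight,
          eqToIso.hom, eqToHom_trans]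
        rfl
      mul := fun {i u v k l} h h' h'' => pairSig_mul (s.active_mul X u v) (s.passive_mul X u v)
        (s.active_mul Y u v) (a.ts_mul s u v) _ _ _ }
  κ x i k h := pairKap (hY.obj_eq x) (by rw [← h, s.active_mul]) (c.ts s x)
  isKap :=
    { natural := by
        rintro x x' i i' _ _ rfl rfl ψ φ χ e
        have e' : χ = s.mulMap ψ φ := by simpa using e.symm
        subst e'
        exact pairKap_natural (hY.map_eq ψ) (s.active_mul_map Y ψ φ) (c.ts_natural s ψ)
      one := fun i h => by
        have := c.ts_one (s := s)
        simp only [pairKap, Iso.trans_hom, whiskerLeftIso_hom, this, whiskerLeft_eqToHom,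
          eqToIso.hom, eqToHom_trans]
        rfl
      mul := fun {x y i k l} h h' h'' => pairKap_mul (s.passive_mul B x y) (s.active_mul B x y)
        (s.active_mul Y x y) (c.ts_mul s x y) _ _ _ }
  comm {i u x k j l} h hj hl h' := pair_comm (hY.obj_eq u) (hY.obj_eq x) _ _ _ _ _ _

end Pair

open Bicategory

/-! ### Restriction to the unit object of `I` -/

section OneRaw
open Bicategory
variable {M : Type uM} [Bicategory.{wM, vM} M] [Bicategory.Strict M]

attribute [local simp] leftUnitor_hom leftUnitor_inv rightUnitor_hom rightUnitor_inv associator_hom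
  associator_inv

variable {A O B : M} {l r : A ⟶ A}

/-- The composite `l ≫ j ≫ p ≅ r ≫ ju ≫ p ≅ r ≫ j ≫ a`. -/
def oneIso {j ju : A ⟶ O} {a p : O ⟶ O} (σ : l ≫ j ≅ r ≫ ju) (κ : ju ≫ p ≅ j ≫ a) :
    l ≫ j ≫ p ≅ r ≫ j ≫ a :=
  eqToIso (Strict.assoc _ _ _).symm ≪≫ whiskerRightIso σ p ≪≫ eqToIso (Strict.assoc _ _ _) ≪≫
    whiskerLeftIso r κ

/-- The `σ`-halves of the two action cells are matched by `hσ` and the `κ`-halves by `hκ`; the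
auxiliary comparison at the index of `ju` cancels between them. -/
theorem oneIso_paste {j ju : A ⟶ O} {f fu : A ⟶ B} {k : O ⟶ B} {a p : O ⟶ O} {q b : B ⟶ B}
    (hp : p = 𝟙 O) {σ : l ≫ j ≅ r ≫ ju} {κ : ju ≫ p ≅ j ≫ a} {σ' : l ≫ f ≅ r ≫ fu}
    {κ' : fu ≫ q ≅ f ≫ b} {ψ : j ≫ k ≅ f} {ψu : ju ≫ k ≅ fu} {τ : a ≫ k ≫ q ≅ p ≫ k ≫ b}
    (hσ : (cellPush σ k).hom ≫ (r ◁ ψu.hom) = (l ◁ ψ.hom) ≫ σ'.hom)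
    (hκ : CSq (extL hp κ ψu q) (extR hp ψ b) (j ◁ τ.hom) κ'.hom) :
    (l ◁ ψ.hom ▷ q) ≫ (oneIso σ' κ').hom =
      (Equivariant.pasteIso hp (oneIso σ κ) τ).hom ≫ (r ◁ ψ.hom ▷ b) := by
  subst hp
  have h₁ := congrArg (r ◁ ·) hκ
  have h₂ := congrArg (· ▷ q) hσ
  simp [extL, extR, cellPush] at h₁ h₂
  simp only [← Category.assoc] at h₂
  rw [comp_eqToHom_iff] at h₂
  simp at h₂
  rw [eqToHom_comp_iff] at h₂
  simp at h₂
  simp [Equivariant.pasteIso, oneIso, h₁, reassoc_of% h₂]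

theorem oneIso_paste' {j ju j' : A ⟶ O} {f fu : A ⟶ B} {k : O ⟶ B} {a p : O ⟶ O} {q b : B ⟶ B}
    (hp : p = 𝟙 O) (hj : j' = j) {σ : l ≫ j ≅ r ≫ ju} {κ : ju ≫ p ≅ j ≫ a} {t : l ≫ j' ≫ p ≅ r ≫ j' ≫ a}
    (ht : CEq t.hom (oneIso σ κ).hom) {σ' : l ≫ f ≅ r ≫ fu}
    {κ' : fu ≫ q ≅ f ≫ b} {ψ : j ≫ k ≅ f} {ψu : ju ≫ k ≅ fu} {τ : a ≫ k ≫ q ≅ p ≫ k ≫ b}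
    (hσ : (cellPush σ k).hom ≫ (r ◁ ψu.hom) = (l ◁ ψ.hom) ≫ σ'.hom)
    (hκ : CSq (extL hp κ ψu q) (extR hp ψ b) (j ◁ τ.hom) κ'.hom) :
    (l ◁ (eqToIso (congrArg (· ≫ k) hj) ≪≫ ψ).hom ▷ q) ≫ (oneIso σ' κ').hom =
      (Equivariant.pasteIso hp t τ).hom ≫ (r ◁ (eqToIso (congrArg (· ≫ k) hj) ≪≫ ψ).hom ▷ b) := by
  subst hj
  have : t = oneIso σ κ := Iso.ext ht.eq
  subst this
  simpa using oneIso_paste hp hσ hκ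

/-- The family of `f` followed by an identity has `f` as its value at the unit object, and there its
cells compose to the action cell of `f`. -/
theorem oneIso_pair {f : A ⟶ B} {q a₁ b : B ⟶ B} (hq : q = 𝟙 B) (ha₁ : a₁ = 𝟙 B)
    {hk : b = b ≫ a₁} {hk' : b = a₁ ≫ b} {t : l ≫ f ≫ q ≅ r ≫ f ≫ b}
    {t' : b ≫ 𝟙 B ≫ q ≅ q ≫ 𝟙 B ≫ b} {h} (ht' : t' = eqToIso h) (e : f ≫ a₁ ≫ 𝟙 B = f) :
    (l ◁ eqToHom e ▷ q) ≫ t.hom =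
      (oneIso (pairSig hq hk t) (pairKap hq hk' t')).hom ≫ (r ◁ eqToHom e ▷ b) := by
  subst hq ha₁ ht'
  simp [oneIso, pairSig, pairKap]

theorem oneIso_ceq {j ju j' : A ⟶ O} {a p : O ⟶ O} (hp : p = 𝟙 O) (hj : j' = j)
    {σ : l ≫ j ≅ r ≫ ju} {κ : ju ≫ p ≅ j ≫ a} {t : l ≫ j' ≫ p ≅ r ≫ j' ≫ a} {e₁ e₂ e₃}
    (ht : t.hom = eqToHom e₁ ≫ σ.hom ≫ eqToHom e₂ ≫ (r ◁ κ.hom) ≫ eqToHom e₃) :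
    CEq t.hom (oneIso σ κ).hom := by
  subst hp hj
  exact CEq.of_eq (by simp [ht, oneIso])

theorem cell_trans {x y z : A ⟶ B} {q b : B ⟶ B} {i : x ⟶ y} {e : y ⟶ z} {T : l ≫ x ≫ q ⟶ r ≫ x ≫ b}
    {S : l ≫ y ≫ q ⟶ r ≫ y ≫ b} {R : l ≫ z ≫ q ⟶ r ≫ z ≫ b}
    (h₁ : (l ◁ i ▷ q) ≫ S = T ≫ (r ◁ i ▷ b)) (h₂ : (l ◁ e ▷ q) ≫ R = S ≫ (r ◁ e ▷ b)) :
    (l ◁ (i ≫ e) ▷ q) ≫ R = T ≫ (r ◁ (i ≫ e) ▷ b) := by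
  simp only [comp_whiskerRight, Bicategory.whiskerLeft_comp, Category.assoc, h₂]
  rw [reassoc_of% h₁]

end OneRaw

/-! ### Essential surjectivity of restriction along the unit -/

section Local
open Bicategory Equivariant
variable {V : Type uV} [Category.{vV} V] [MonoidalCategory V] [SymmetricCategory V]
variable {I : Type uI} [Category.{wI} I] [MonoidalCategory I] [EnrichedOrdinaryCategory V I]
  [MonoidalEnriched V I]
variable {M : Type uM} [Bicategory.{wM, vM} M] [Bicategory.Strict M]
  [∀ A B : M, EnrichedOrdinaryCategory V (A ⟶ B)] [VCatCategory V M]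
variable [StrictMonoidal I] {s : Side} {X O B : IObj V I M}

/-- The action cells of the restriction of `m` along the unit. -/
def Mid.oneTs (m : Mid s X B) (u : I) : (s.active X).obj u ≫ m.H.obj (e[I]) ≫ (s.passive B).obj u ≅
    (s.passive X).obj u ≫ m.H.obj (e[I]) ≫ (s.active B).obj u :=
  oneIso (m.σ (e[I]) u u (s.one_mul u)) (m.κ u (e[I]) u (s.mul_one u))

/-- `η` is the unit of the coinvariants `c`. -/
structure Coin.IsUnit (c : Coin s X O) (η : Equivariant X O) : Prop where
  hom_eq : η.hom = c.H.obj (e[I])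
  ts_eq (u : I) : CEq (η.ts s u).hom (c.toMid.oneTs u).hom

theorem CoInv.isUnit {P : Copowering V I M} (hV : ForgetFaithful.{uV, vV, uI, vM} V)
    (c : CoInv P s X) : (c.coin hV).IsUnit c.unit where
  hom_eq := c.unit_hom
  ts_eq u := oneIso_ceq (c.trivial.obj_eq u) c.unit_hom (c.unit_ts u (s.one_mul u) (s.mul_one u)
    (by rw [c.trivial.obj_eq, Strict.comp_id, c.unit_hom])
    (congrArg _ (by rw [c.trivial.obj_eq, Strict.comp_id]))
    (by rw [c.unit_hom]))

/-- Nothing is assumed about `B`: any value `m.H 1` of a `Mid` extends along `η`. Locality uses this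
with values in `B` of trivial passive side, and stability with a target of the opposite kind. -/
theorem Coin.IsUnit.exists_extension (hV : ForgetFaithful.{uV, vV, uI, vM} V) {c : Coin s X O}
    {η : Equivariant X O} (h : c.IsUnit η) (m : Mid s X B) :
    ∃ (k : Equivariant O B) (i : η.hom ≫ k.hom ≅ m.H.obj (e[I])), ∀ u,
      ((s.active X).obj u ◁ i.hom ▷ (s.passive B).obj u) ≫ (m.oneTs u).hom =
        ((comp η k).ts s u).hom ≫ ((s.passive X).obj u ◁ i.hom ▷ (s.active B).obj u) := by
  obtain ⟨k, ψ, -, hσ, hκ⟩ := c.exists_extension hV m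
  refine ⟨k, eqToIso (congrArg (· ≫ k.hom) h.hom_eq) ≪≫ ψ _, fun u => ?_⟩
  rw [comp_ts s η k c.trivial u]
  exact oneIso_paste' (c.trivial.obj_eq u) h.hom_eq (h.ts_eq u) (hσ _ u u (s.one_mul u))
    (hκ u _ u (s.mul_one u))

/-- Every morphism to `B` factors through `B` itself, whose passive side is trivial, so the family
`f ≫ act i` extends it. -/
theorem Coin.IsUnit.ess_surj (hV : ForgetFaithful.{uV, vV, uI, vM} V) {c : Coin s X O}
    {η : Equivariant X O} (h : c.IsUnit η) (hB : IsTrivial (s.passive B)) (f : Equivariant X B) :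
    ∃ (k : Equivariant O B) (i : η.hom ≫ k.hom ≅ f.hom), IsIso₂ (comp η k) f i := by
  obtain ⟨k, i, hi⟩ := h.exists_extension hV (Mid.ofPair s f (Equivariant.id B) hB)
  have e : (Mid.ofPair s f (Equivariant.id B) hB).H.obj (e[I]) = f.hom := by
    change f.hom ≫ (s.active B).obj (e[I]) ≫ 𝟙 _ = f.hom
    rw [s.active_one, Strict.comp_id, Strict.comp_id]
  refine ⟨k, i ≪≫ eqToIso e, (isIso₂_iff s).2 fun u => ?_⟩
  have h₁ := oneIso_pair (hB.obj_eq u) (s.active_one B) (t := f.ts s u)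
    (hk := by rw [s.active_one, Strict.comp_id]) (hk' := by rw [s.active_one, Strict.id_comp])
    (IsIso₂.id_ts B s u (by rw [hB.obj_eq]; simp [Equivariant.id, Strict.id_comp, Strict.comp_id])) e
  exact cell_trans (hi u) h₁

end Local

open Bicategory

theorem CSq.conj_hom {C : Type uC} [Category.{vC} C] {p p' q q' : C} {σ : p ≅ p'} {σ' : q ≅ q'}
    {x : p ⟶ q} {x' : p' ≅ q'} (h : CSq σ σ' x x'.hom) : (σ ≪≫ x' ≪≫ σ'.symm).hom = x := by
  unfold CSq at h
  simp [← reassoc_of% h]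

/-! ### The isomorphism `H i ≫ g ≅ (H 1 ≫ g) ≫ act i` -/

section XiRaw
open Bicategory
variable {M : Type uM} [Bicategory.{wM, vM} M] [Bicategory.Strict M]

attribute [local simp] leftUnitor_hom leftUnitor_inv rightUnitor_hom rightUnitor_inv associator_hom
  associator_inv

variable {A O B : M} {k : O ⟶ B}

/-- The composite `ju ≫ k ≅ j ≫ a ≫ k ≅ (j ≫ k) ≫ b`. -/
def xiIso {j ju : A ⟶ O} {a p : O ⟶ O} {q b : B ⟶ B} (hp : p = 𝟙 O) (hq : q = 𝟙 B)
    (κ : ju ≫ p ≅ j ≫ a) (τ : a ≫ k ≫ q ≅ p ≫ k ≫ b) : ju ≫ k ≅ (j ≫ k) ≫ b :=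
  eqToIso (by rw [hp, Strict.comp_id]) ≪≫ whiskerRightIso κ k ≪≫
    eqToIso (by rw [hq, Strict.comp_id, Strict.assoc]) ≪≫ whiskerLeftIso j τ ≪≫
    eqToIso (by rw [hp, Strict.id_comp, Strict.assoc])

theorem xiIso_natural {j ju ju' : A ⟶ O} {a p a' p' : O ⟶ O} {q b q' b' : B ⟶ B} {hp : p = 𝟙 O}
    {hq : q = 𝟙 B} {hp' : p' = 𝟙 O} {hq' : q' = 𝟙 B} {κ : ju ≫ p ≅ j ≫ a} {κ' : ju' ≫ p' ≅ j ≫ a'}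
    {τ : a ≫ k ≫ q ≅ p ≫ k ≫ b} {τ' : a' ≫ k ≫ q' ≅ p' ≫ k ≫ b'} {y : ju ⟶ ju'} {α : a ⟶ a'}
    {β : b ⟶ b'} {π : p ⟶ p'} {θ : q ⟶ q'} (hπ : π = eqToHom (hp.trans hp'.symm))
    (hθ : θ = eqToHom (hq.trans hq'.symm))
    (hκ : (y ▷ p) ≫ (ju' ◁ π) ≫ κ'.hom = κ.hom ≫ (j ◁ α))
    (hτ : (α ▷ (k ≫ q)) ≫ (a' ◁ k ◁ θ) ≫ τ'.hom = τ.hom ≫ (π ▷ (k ≫ b)) ≫ (p' ◁ k ◁ β)) :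
    CSq (xiIso hp hq κ τ) (xiIso hp' hq' κ' τ') (y ▷ k) ((j ≫ k) ◁ β) := by
  subst hp hq hp' hq' hπ hθ
  have h₁ := congrArg (· ▷ k) hκ
  have h₂ := congrArg (j ◁ ·) hτ
  simp only [Category.assoc, eqToHom_trans, eqToHom_trans_assoc, eqToHom_refl, Category.id_comp,
    Category.comp_id, Bicategory.whiskerLeft_comp, Bicategory.comp_whiskerRight, whiskerLeft_eqToHom,
    Bicategory.whiskerLeft_id, Bicategory.id_whiskerRight, eqToHom_whiskerRight,
    Bicategory.comp_whiskerLeft, Bicategory.whiskerRight_comp, Bicategory.whisker_assoc,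
    Bicategory.id_whiskerLeft, Bicategory.whiskerRight_id, leftUnitor_hom, leftUnitor_inv,
    associator_hom, associator_inv, rightUnitor_hom, rightUnitor_inv] at h₁ h₂
  simp [CSq, xiIso]
  rw [eqToHom_comp_iff] at h₁
  rw [eqToHom_comp_iff] at h₂
  rw [reassoc_of% h₁]
  simp only [Category.assoc, eqToHom_trans, eqToHom_trans_assoc, eqToHom_refl, Category.id_comp, Category.comp_id]
  rw [reassoc_of% h₂]
  simp only [Category.assoc, eqToHom_trans, eqToHom_trans_assoc, eqToHom_refl, Category.id_comp, Category.comp_id]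

/-- Under these isomorphisms the action cell of `k`, restricted by means of `κ`, turns into the
strict equality `act (x·i) = act i ≫ act x` on the target. The multiplicativity of both `κ` and the
action cells enters here. -/
theorem xiIso_kap {j ji jl : A ⟶ O} {ax px ai pi' al pl : O ⟶ O} {qx bx qi bi ql bl : B ⟶ B}
    {hpx : px = 𝟙 O} {hpi : pi' = 𝟙 O} {hpl : pl = 𝟙 O} {hqi : qi = 𝟙 B} {hql : ql = 𝟙 B}
    (hqx : qx = 𝟙 B) (ha : al = ai ≫ ax) (hb : bl = bi ≫ bx)
    {κ : jl ≫ px ≅ ji ≫ ax} {κi : ji ≫ pi' ≅ j ≫ ai} {κl : jl ≫ pl ≅ j ≫ al}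
    {τx : ax ≫ k ≫ qx ≅ px ≫ k ≫ bx} {τi : ai ≫ k ≫ qi ≅ pi' ≫ k ≫ bi}
    {τl : al ≫ k ≫ ql ≅ pl ≫ k ≫ bl} {h₁ h₂ h₃}
    (hκ : κl.hom = eqToHom h₁ ≫ (κ.hom ▷ pi') ≫ eqToHom h₂ ≫ (κi.hom ▷ ax) ≫ eqToHom h₃) {e₁ e₂ e₃}
    (hτ : τl.hom = eqToHom e₁ ≫ (ai ◁ τx.hom ▷ qi) ≫ eqToHom e₂ ≫ (px ◁ τi.hom ▷ bx) ≫ eqToHom e₃) (h) :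
    CSq (extL hpx κ (xiIso hpl hql κl τl) qx) (extR hpx (xiIso hpi hqi κi τi) bx) (ji ◁ τx.hom)
      (eqToHom h) := by
  have hp' : pl = px ≫ pi' := by rw [hpx, hpi, hpl, Strict.comp_id]
  subst hpx hpi hpl hqx hqi hql ha hb
  have h := whisker_exchange κi.hom τx.hom
  simp only [Category.assoc, eqToHom_trans, eqToHom_trans_assoc, eqToHom_refl, Category.id_comp,
    Category.comp_id, Bicategory.whiskerLeft_comp, Bicategory.comp_whiskerRight, whiskerLeft_eqToHom,
    Bicategory.whiskerLeft_id, Bicategory.id_whiskerRight, eqToHom_whiskerRight,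
    Bicategory.comp_whiskerLeft, Bicategory.whiskerRight_comp, Bicategory.whisker_assoc,
    Bicategory.id_whiskerLeft, Bicategory.whiskerRight_id, leftUnitor_hom, leftUnitor_inv,
    associator_hom, associator_inv, rightUnitor_hom, rightUnitor_inv] at h
  simp only [CSq, extL, extR, xiIso, hκ, hτ, Iso.trans_hom, Iso.symm_hom, eqToIso.hom, whiskerLeftIso_hom, whiskerRightIso_hom, Category.assoc, eqToHom_trans, eqToHom_trans_assoc, eqToHom_refl, Category.id_comp,
    Category.comp_id, Bicategory.whiskerLeft_comp, Bicategory.comp_whiskerRight, whiskerLeft_eqToHom,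
    Bicategory.whiskerLeft_id, Bicategory.id_whiskerRight, eqToHom_whiskerRight,
    Bicategory.comp_whiskerLeft, Bicategory.whiskerRight_comp, Bicategory.whisker_assoc,
    Bicategory.id_whiskerLeft, Bicategory.whiskerRight_id, leftUnitor_hom, leftUnitor_inv,
    associator_hom, associator_inv, rightUnitor_hom, rightUnitor_inv]
  rw [eqToHom_comp_iff] at h
  simp only [← Category.assoc] at h
  rw [comp_eqToHom_iff] at h
  simp only [Category.assoc, eqToHom_trans, eqToHom_trans_assoc, eqToHom_refl, Category.id_comp, Category.comp_id] at h
  simp only [inv_hom_whiskerRight_assoc, Category.assoc, eqToHom_trans, eqToHom_trans_assoc, eqToHom_refl, Category.id_comp, Category.comp_id]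
  rw [reassoc_of% h]
  simp only [Category.assoc, eqToHom_trans, eqToHom_trans_assoc, eqToHom_refl, Category.id_comp, Category.comp_id]

/-- The cell `t ▷ bi`, reassociated. -/
def actIso {f : A ⟶ B} {l r : A ⟶ A} {q b bi bl : B ⟶ B} (hq : q = 𝟙 B) (hb : bl = b ≫ bi)
    (t : l ≫ f ≫ q ≅ r ≫ f ≫ b) : l ≫ f ≫ bi ≅ r ≫ f ≫ bl :=
  eqToIso (by simp only [hq, Strict.comp_id, Strict.assoc]) ≪≫ whiskerRightIso t bi ≪≫
    eqToIso (by simp only [hb, Strict.assoc])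

/-- Under these isomorphisms the cell `σ` at index `i` turns into the action cell of the restriction
to the unit object, whiskered with `act i`. The reasons are the condition `comm` and the
multiplicativity of `κ` and of the action cells. -/
theorem xiIso_sig {l r : A ⟶ A} {j ju ji jl : A ⟶ O} {a p ai pi' al pl : O ⟶ O}
    {q b qi bi ql bl : B ⟶ B}
    {hp : p = 𝟙 O} {hpi : pi' = 𝟙 O} {hpl : pl = 𝟙 O} {hq : q = 𝟙 B} {hqi : qi = 𝟙 B} {hql : ql = 𝟙 B}
    (ha : al = a ≫ ai) {hb : bl = b ≫ bi}
    {σ : l ≫ ji ≅ r ≫ jl} {σu : l ≫ j ≅ r ≫ ju}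
    {κ : jl ≫ pi' ≅ ju ≫ ai} {κi : ji ≫ pi' ≅ j ≫ ai} {κu : ju ≫ p ≅ j ≫ a}
    {κl : jl ≫ pl ≅ j ≫ al}
    {τ : a ≫ k ≫ q ≅ p ≫ k ≫ b} {τi : ai ≫ k ≫ qi ≅ pi' ≫ k ≫ bi}
    {τl : al ≫ k ≫ ql ≅ pl ≫ k ≫ bl}
    (hσ : (σ.hom ▷ pi') ≫ eqToHom (Strict.assoc _ _ _) ≫ (r ◁ κ.hom) =
      eqToHom (Strict.assoc _ _ _) ≫ (l ◁ κi.hom) ≫ eqToHom (Strict.assoc _ _ _).symm ≫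
        (σu.hom ▷ ai) ≫ eqToHom (Strict.assoc _ _ _)) {h₁ h₂ h₃}
    (hκ : κl.hom = eqToHom h₁ ≫ (κ.hom ▷ p) ≫ eqToHom h₂ ≫ (κu.hom ▷ ai) ≫ eqToHom h₃) {e₁ e₂ e₃}
    (hτ : τl.hom = eqToHom e₁ ≫ (a ◁ τi.hom ▷ q) ≫ eqToHom e₂ ≫ (pi' ◁ τ.hom ▷ bi) ≫ eqToHom e₃) :
    CSq (whiskerLeftIso l (xiIso hpi hqi κi τi)) (whiskerLeftIso r (xiIso hpl hql κl τl))
      (cellPush σ k).hom (actIso hq hb (Equivariant.pasteIso hp (oneIso σu κu) τ)).hom := by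
  subst hp hpi hpl hq hqi hql ha hb
  have h₁ := congrArg (· ▷ k) hσ
  have h₂ := whisker_exchange (oneIso σu κu).hom τi.hom
  simp [oneIso] at h₁ h₂
  simp [CSq, cellPush, xiIso, actIso, Equivariant.pasteIso, hκ, hτ, oneIso]
  replace h₂ := h₂.symm
  rw [eqToHom_comp_iff] at h₁
  simp only [← Category.assoc] at h₁
  rw [comp_eqToHom_iff] at h₁
  simp only [Category.assoc, eqToHom_trans, eqToHom_trans_assoc, eqToHom_refl, Category.id_comp, Category.comp_id] at h₁
  rw [eqToHom_comp_iff] at h₂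
  simp only [← Category.assoc] at h₂
  rw [comp_eqToHom_iff] at h₂
  simp only [Category.assoc, eqToHom_trans, eqToHom_trans_assoc, eqToHom_refl, Category.id_comp, Category.comp_id] at h₂
  rw [reassoc_of% h₁]
  simp only [Category.assoc, eqToHom_trans, eqToHom_trans_assoc, eqToHom_refl, Category.id_comp, Category.comp_id]
  rw [reassoc_of% h₂]
  simp only [Category.assoc, eqToHom_trans, eqToHom_trans_assoc, eqToHom_refl, Category.id_comp, Category.comp_id]

end XiRaw

/-! ### The comparison isomorphisms on families of 2-cells -/

section XiFam
open Bicategory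
variable {V : Type uV} [Category.{vV} V] [MonoidalCategory V] [BraidedCategory V]
variable {M : Type uM} [Bicategory.{wM, vM} M] [Bicategory.Strict M]
  [∀ A B : M, EnrichedOrdinaryCategory V (A ⟶ B)] [VCatCategory V M]
variable {A O B : M} {T : V}

namespace VSquare

theorem xiIso {k k' : O ⟶ B} {j ju : A ⟶ O} {a p : O ⟶ O} {q b : B ⟶ B} (hp : p = 𝟙 O)
    (hq : q = 𝟙 B) (κ : ju ≫ p ≅ j ≫ a) {τ : a ≫ k ≫ q ≅ p ≫ k ≫ b} {τ' : a ≫ k' ≫ q ≅ p ≫ k' ≫ b}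
    {t : T ⟶ (k ⟶[V] k')} (ht : VSquare τ τ' (famWhiskerLeft a (famWhiskerRight t q))
      (famWhiskerLeft p (famWhiskerRight t b))) :
    VSquare (xiIso hp hq κ τ) (xiIso hp hq κ τ') (famWhiskerLeft ju t)
      (famWhiskerRight (famWhiskerLeft j t) b) := by
  refine VSquare.trans (FEq.vsquare (t' := famWhiskerLeft (ju ≫ p) t) ?_ _ _) <|
    (VSquare.exchangeLeft κ t).trans <| VSquare.trans (FEq.vsquare ?_ _ _) <|
    (ht.whiskerLeft j).trans <| FEq.vsquare ?_ _ _
  · exact FEq.left (by rw [hp, Strict.comp_id]) (FEq.rfl' _)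
  · exact (FEq.assocL _ _ _).trans
      (FEq.left rfl (FEq.left rfl ((FEq.right (FEq.rfl' _) hq).trans (FEq.unitR _)).symm))
  · exact (FEq.left rfl ((FEq.left hp (FEq.rfl' _)).trans (FEq.unitL _))).trans
      (FEq.assocM _ _ _).symm

theorem actIso {f f' : A ⟶ B} {l r : A ⟶ A} {q b bi bl : B ⟶ B} (hq : q = 𝟙 B) (hb : bl = b ≫ bi)
    {τ : l ≫ f ≫ q ≅ r ≫ f ≫ b} {τ' : l ≫ f' ≫ q ≅ r ≫ f' ≫ b} {t : T ⟶ (f ⟶[V] f')}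
    (ht : VSquare τ τ' (famWhiskerLeft l (famWhiskerRight t q))
      (famWhiskerLeft r (famWhiskerRight t b))) :
    VSquare (actIso hq hb τ) (actIso hq hb τ') (famWhiskerLeft l (famWhiskerRight t bi))
      (famWhiskerLeft r (famWhiskerRight t bl)) := by
  refine VSquare.trans (FEq.vsquare ?_ _ _) <| (ht.whiskerRight bi).trans <| FEq.vsquare ?_ _ _
  · exact ((FEq.assocM _ _ _).trans (FEq.left rfl
      (((FEq.right (FEq.rfl' _) hq).trans (FEq.unitR _)).right rfl))).symm
  · exact (FEq.assocM _ _ _).trans (FEq.left rfl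
      ((FEq.assocR _ _ _).trans (FEq.right (FEq.rfl' _) hb.symm)))

theorem extL {k k' : O ⟶ B} {Ji Jj : A ⟶ O} {Hj Hj' : A ⟶ B} {a p : O ⟶ O} (hp : p = 𝟙 O)
    (κ : Jj ≫ p ≅ Ji ≫ a) {ψ : Jj ≫ k ≅ Hj} {ψ' : Jj ≫ k' ≅ Hj'} (q : B ⟶ B) {t : T ⟶ (k ⟶[V] k')}
    {x : T ⟶ (Hj ⟶[V] Hj')} (h : VSquare ψ ψ' (famWhiskerLeft Jj t) x) :
    VSquare (extL hp κ ψ q) (extL hp κ ψ' q)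
      (famWhiskerLeft Ji (famWhiskerLeft a (famWhiskerRight t q))) (famWhiskerRight x q) := by
  refine VSquare.trans (FEq.vsquare (t' := famWhiskerLeft (Ji ≫ a) (famWhiskerRight t q)) ?_ _ _) <|
    (VSquare.exchangeLeft κ.symm _).trans <| VSquare.trans (FEq.vsquare ?_ _ _) (h.whiskerRight q)
  · exact (FEq.assocL _ _ _).symm
  · exact (FEq.left (by rw [hp, Strict.comp_id]) (FEq.rfl' _)).trans (FEq.assocM _ _ _).symm

theorem extR {k k' : O ⟶ B} {Ji : A ⟶ O} {Hi Hi' : A ⟶ B} {p : O ⟶ O} (hp : p = 𝟙 O)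
    {ψ : Ji ≫ k ≅ Hi} {ψ' : Ji ≫ k' ≅ Hi'} (b : B ⟶ B) {t : T ⟶ (k ⟶[V] k')}
    {x : T ⟶ (Hi ⟶[V] Hi')} (h : VSquare ψ ψ' (famWhiskerLeft Ji t) x) :
    VSquare (extR hp ψ b) (extR hp ψ' b)
      (famWhiskerLeft Ji (famWhiskerLeft p (famWhiskerRight t b))) (famWhiskerRight x b) := by
  refine VSquare.trans (FEq.vsquare ?_ _ _) (h.whiskerRight b)
  exact (FEq.left rfl ((FEq.left hp (FEq.rfl' _)).trans (FEq.unitL _))).trans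
    (FEq.assocM _ _ _).symm

end VSquare
end XiFam

/-! ### Full faithfulness of restriction along the unit -/

section LocalFull
open Bicategory Equivariant
variable {V : Type uV} [Category.{vV} V] [MonoidalCategory V] [SymmetricCategory V]
variable {I : Type uI} [Category.{wI} I] [MonoidalCategory I] [EnrichedOrdinaryCategory V I]
  [MonoidalEnriched V I]
variable {M : Type uM} [Bicategory.{wM, vM} M] [Bicategory.Strict M]
  [∀ A B : M, EnrichedOrdinaryCategory V (A ⟶ B)] [VCatCategory V M]
variable [StrictMonoidal I] {s : Side} {X O B : IObj V I M}

theorem Side.mulMap_one {u v : I} (f : u ⟶ v) (h : s.mul u (e[I]) = u) (h' : s.mul v (e[I]) = v) :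
    s.mulMap f (𝟙 (e[I])) ≫ eqToHom h' = eqToHom h ≫ f := by
  cases s
  · exact Copowering.one_tensorHom f
  · exact Copowering.tensorHom_one f

namespace Coin
variable (c : Coin s X O) (hB : IsTrivial (s.passive B)) (g : Equivariant O B)

/-- The restriction of `g` along `H i` in terms of the restriction along the unit. -/
def xi (i : I) : c.H.obj i ≫ g.hom ≅ (c.H.obj (e[I]) ≫ g.hom) ≫ (s.active B).obj i :=
  xiIso (c.trivial.obj_eq i) (hB.obj_eq i) (c.κ i (e[I]) i (s.mul_one i)) (g.ts s i)

theorem xi_natural {i j : I} (f : i ⟶ j) : CSq (c.xi hB g i) (c.xi hB g j) (c.H.map f ▷ g.hom)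
    ((c.H.obj (e[I]) ≫ g.hom) ◁ (s.active B).map f) :=
  xiIso_natural (c.trivial.map_eq f) (hB.map_eq f) (by
    have := c.isKap.natural (s.mul_one i) (s.mul_one j) f (𝟙 _) f (Side.mulMap_one _ _ _)
    simpa using this) (g.ts_natural s f)

theorem xi_kap {x i l : I} (h : s.mul x i = l) (h') :
    CSq (extL (c.trivial.obj_eq x) (c.κ x i l h) (c.xi hB g l) ((s.passive B).obj x))
      (extR (c.trivial.obj_eq x) (c.xi hB g i) ((s.active B).obj x)) (c.H.obj i ◁ (g.ts s x).hom)
      (eqToHom h') := by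
  subst h
  exact xiIso_kap (hB.obj_eq x) (s.active_mul O x i) (s.active_mul B x i)
    (c.isKap.mul (s.mul_one i) rfl (s.mul_one _)) (g.ts_mul s x i) _

theorem xi_sig {i u l : I} (h : s.mul i u = l) :
    CSq (whiskerLeftIso ((s.active X).obj u) (c.xi hB g i))
      (whiskerLeftIso ((s.passive X).obj u) (c.xi hB g l)) (cellPush (c.σ i u l h) g.hom).hom
      (actIso (hB.obj_eq u) (by rw [← h, s.active_mul])
        (pasteIso (c.trivial.obj_eq u) (c.oneTs u) (g.ts s u))).hom := by
  subst h
  exact xiIso_sig (s.active_mul O i u)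
    (c.comm (s.one_mul u) (s.mul_one i) rfl rfl)
    (c.isKap.mul (s.mul_one u) rfl (s.mul_one _)) (g.ts_mul s i u)

theorem vsquare_xi {g g' : Equivariant O B} {T : V} {t : T ⟶ (g.hom ⟶[V] g'.hom)}
    (ht : IsFam g g' t) (i : I) : VSquare (c.xi hB g i) (c.xi hB g' i) (famWhiskerLeft (c.H.obj i) t)
      (famWhiskerRight (famWhiskerLeft (c.H.obj (e[I])) t) ((s.active B).obj i)) :=
  VSquare.xiIso _ _ _ ((isFam_iff s g g' t).1 ht i)

/-- By `xi`, an equivariant family is determined on `H i` by its restriction to `H 1` whiskered with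
`act i`. Conversely these prescriptions fit together: they are `V`-natural because `act` is a
`V`-functor, they respect `σ` because `x` is equivariant, and the result is equivariant because `xi`
trivializes the action cells. -/
theorem exists_unique_fam (hV : ForgetFaithful.{uV, vV, uI, vM} V) (hB : IsTrivial (s.passive B))
    (g g' : Equivariant O B) (T : V)
    (x : T ⟶ ((c.H.obj (e[I]) ≫ g.hom) ⟶[V] (c.H.obj (e[I]) ≫ g'.hom)))
    (hx : ∀ u, VSquare (pasteIso (c.trivial.obj_eq u) (c.oneTs u) (g.ts s u))
      (pasteIso (c.trivial.obj_eq u) (c.oneTs u) (g'.ts s u))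
      (famWhiskerLeft ((s.active X).obj u) (famWhiskerRight x ((s.passive B).obj u)))
      (famWhiskerLeft ((s.passive X).obj u) (famWhiskerRight x ((s.active B).obj u)))) :
    ∃! t : T ⟶ (g.hom ⟶[V] g'.hom), IsFam g g' t ∧ famWhiskerLeft (c.H.obj (e[I])) t = x := by
  obtain ⟨vB⟩ := exists_vStr_active s B hB
  have hy : ∀ i, ∃ y : T ⟶ ((c.H.obj i ≫ g.hom) ⟶[V] (c.H.obj i ≫ g'.hom)),
      VSquare (c.xi hB g i) (c.xi hB g' i) y (famWhiskerRight x ((s.active B).obj i)) :=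
    fun i => ⟨_, VSquare.conj' _ _ _⟩
  choose y hy using hy
  -- The isomorphisms `xi` are natural in `i`, hence `V`-natural by `hV`; conjugating by them keeps
  -- the family `x ▷ act i` `V`-natural.
  have nat : ∀ (g : Equivariant O B) (i j : I), VSquare (c.xi hB g i) (c.xi hB g j)
      ((c.vs.funR g.hom).map i j) ((vB.funL (c.H.obj (e[I]) ≫ g.hom)).map i j) := fun g =>
    VStr.vsquare hV (c.vs.funR g.hom) (vB.funL _) (c.xi hB g) fun f => c.xi_natural hB g f
  obtain ⟨t, ht⟩ := c.full g.hom g'.hom T y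
    (VNat.conj (F := enrL (c.H.obj (e[I]) ≫ g.hom) vB.enr)
      (G := enrL (c.H.obj (e[I]) ≫ g'.hom) vB.enr) (F' := (c.vs.funR g.hom).enr)
      (G' := (c.vs.funR g'.hom).enr) (VNat.whiskerR_exchange vB.enr x)
      (fun i j => (nat g i j).symm) (fun i j => (nat g' i j).symm) fun i => (hy i).symm)
    (fun i u l h => by
      have h₁ := VSquare.actIso (hB.obj_eq u) (show (s.active B).obj l = _ by
        rw [← h, s.active_mul]) (hx u)
      have h₂ := c.xi_sig hB g h
      have h₃ := c.xi_sig hB g' h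
      refine (((hy i).whiskerLeft ((s.active X).obj u)).trans (h₁.trans
        ((hy l).whiskerLeft ((s.passive X).obj u)).symm)).congr h₂.conj_hom h₃.conj_hom)
  -- Equivariance is tested on every `H i`. There the action cells become equalities of 1-cells, and
  -- what remains is `x ▷ act (u·i) = x ▷ act i ▷ act u`.
  have hfam : IsFam g g' t := by
    refine (isFam_iff s g g' t).2 fun u => c.faithful.vsquare fun i => ?_
    have a := hy (s.mul u i)
    have b := hy i
    rw [← ht] at a b
    have e : ((c.H.obj (e[I]) ≫ g.hom) ≫ (s.active B).obj (s.mul u i)) ≫ (s.passive B).obj u =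
        ((c.H.obj (e[I]) ≫ g.hom) ≫ (s.active B).obj i) ≫ (s.active B).obj u := by
      rw [hB.obj_eq, s.active_mul]; simp only [Strict.comp_id, Strict.assoc]
    have e' : ((c.H.obj (e[I]) ≫ g'.hom) ≫ (s.active B).obj (s.mul u i)) ≫ (s.passive B).obj u =
        ((c.H.obj (e[I]) ≫ g'.hom) ≫ (s.active B).obj i) ≫ (s.active B).obj u := by
      rw [hB.obj_eq, s.active_mul]; simp only [Strict.comp_id, Strict.assoc]
    have h₁ := VSquare.extL (c.trivial.obj_eq u) (c.κ u i _ rfl) ((s.passive B).obj u) a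
    have h₂ := VSquare.extR (c.trivial.obj_eq u) ((s.active B).obj u) b
    have h₃ : FEq (famWhiskerRight (famWhiskerRight x ((s.active B).obj (s.mul u i)))
        ((s.passive B).obj u)) (famWhiskerRight (famWhiskerRight x ((s.active B).obj i))
        ((s.active B).obj u)) :=
      (FEq.right (FEq.rfl' _) (hB.obj_eq u)).trans <| (FEq.unitR _).trans <|
        (FEq.right (FEq.rfl' _) (s.active_mul B u i)).trans (FEq.assocR _ _ _).symm
    refine (h₁.trans ((h₃.vsquare e e').trans h₂.symm)).congr
      (CSq.conj_hom (x' := eqToIso e) (c.xi_kap hB g rfl e))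
      (CSq.conj_hom (x' := eqToIso e') (c.xi_kap hB g' rfl e'))
  refine ⟨t, ⟨hfam, ?_⟩, ?_⟩
  -- At the index `1` this only gives `t` restricted to `H 1` and whiskered with `act 1`; that
  -- 1-cell is an identity and is removed.
  · have h₁ := c.vsquare_xi hB hfam (e[I])
    rw [ht] at h₁ ⊢
    have h₂ := h₁.unique (hy _)
    exact ((FEq.unitR _).symm.trans ((FEq.right (FEq.rfl' _) (s.active_one B).symm).trans
      ((FEq.of_eq h₂).trans ((FEq.right (FEq.rfl' _) (s.active_one B)).trans (FEq.unitR _))))).eq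
  · rintro t' ⟨h₁, rfl⟩
    refine c.faithful fun i => ?_
    rw [ht]
    exact (c.vsquare_xi hB h₁ i).unique' (hy i)

-- This is `Coin.exists_unique_fam`, transported along the equality of `η.hom` with `H 1` and the
-- corresponding equality of action cells.
variable {c} in
theorem IsUnit.fully_faithful (hV : ForgetFaithful.{uV, vV, uI, vM} V) {η : Equivariant X O}
    (h : c.IsUnit η) (hB : IsTrivial (s.passive B)) (g g' : Equivariant O B) (T : V)
    (x : T ⟶ ((η.hom ≫ g.hom) ⟶[V] (η.hom ≫ g'.hom))) (hx : IsFam (comp η g) (comp η g') x) :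
    ∃! t : T ⟶ (g.hom ⟶[V] g'.hom), IsFam g g' t ∧ famWhiskerLeft η.hom t = x := by
  have hη : ∀ g : Equivariant O B, ∀ u, (comp η g).ts s u =
    pasteIso (c.trivial.obj_eq u) (η.ts s u) (g.ts s u) := fun g u => comp_ts s η g c.trivial u
  have hx' := (isFam_iff s (comp η g) (comp η g') x).1 hx
  have hx₁ : ∀ u, VSquare (pasteIso (c.trivial.obj_eq u) (η.ts s u) (g.ts s u))
      (pasteIso (c.trivial.obj_eq u) (η.ts s u) (g'.ts s u))
      (famWhiskerLeft ((s.active X).obj u) (famWhiskerRight x ((s.passive B).obj u)))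
      (famWhiskerLeft ((s.passive X).obj u) (famWhiskerRight x ((s.active B).obj u))) := fun u =>
    (hx' u).congr (congrArg Iso.hom (hη g u)) (congrArg Iso.hom (hη g' u))
  -- The 1-cell and its action cells are generalized, so that the equality with `H 1` can be
  -- substituted.
  have key : ∀ (f : X.carrier ⟶ O.carrier) (_ : f = c.H.obj (e[I]))
      (τ : ∀ u, (s.active X).obj u ≫ f ≫ (s.passive O).obj u ≅
        (s.passive X).obj u ≫ f ≫ (s.active O).obj u) (_ : ∀ u, CEq (τ u).hom (c.oneTs u).hom)
      (x : T ⟶ ((f ≫ g.hom) ⟶[V] (f ≫ g'.hom)))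
      (_ : ∀ u, VSquare (pasteIso (c.trivial.obj_eq u) (τ u) (g.ts s u))
        (pasteIso (c.trivial.obj_eq u) (τ u) (g'.ts s u))
        (famWhiskerLeft ((s.active X).obj u) (famWhiskerRight x ((s.passive B).obj u)))
        (famWhiskerLeft ((s.passive X).obj u) (famWhiskerRight x ((s.active B).obj u)))),
      ∃! t : T ⟶ (g.hom ⟶[V] g'.hom), IsFam g g' t ∧ famWhiskerLeft f t = x := by
    rintro _ rfl τ hτ x hx
    obtain rfl : τ = c.oneTs := funext fun u => Iso.ext (hτ u).eq
    exact c.exists_unique_fam hV hB g g' T x hx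
  exact key _ h.hom_eq _ h.ts_eq x hx₁

variable {c} in
/-- The unit of the coinvariants is local with respect to the actions on the other side. -/
theorem IsUnit.isLocal (hV : ForgetFaithful.{uV, vV, uI, vM} V) {η : Equivariant X O}
    (h : c.IsUnit η) (hB : IsTrivial (s.passive B)) : IsLocal η B where
  ess_surj := h.ess_surj hV hB
  fully_faithful := h.fully_faithful hV hB

end Coin
end LocalFull

open Bicategory

/-! ### Morphisms between actions with trivial active side -/

section PassRaw
open Bicategory
variable {M : Type uM} [Bicategory.{wM, vM} M] [Bicategory.Strict M]

attribute [local simp] leftUnitor_hom leftUnitor_inv rightUnitor_hom rightUnitor_inv associator_hom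
  associator_inv

variable {W W' E Z : M}

/-- The cell `f ≫ y' ≅ y ≫ f` obtained from an action cell whose other side is trivial. -/
def passIso {f : W ⟶ E} {x y : W ⟶ W} {x' y' : E ⟶ E} (hx : x = 𝟙 W) (hx' : x' = 𝟙 E)
    (t : x ≫ f ≫ y' ≅ y ≫ f ≫ x') : f ≫ y' ≅ y ≫ f :=
  eqToIso (by rw [hx, Strict.id_comp]) ≪≫ t ≪≫ eqToIso (by rw [hx', Strict.comp_id])

theorem passIso_natural {f : W ⟶ E} {x y x₁ y₁ : W ⟶ W} {x' y' x₁' y₁' : E ⟶ E} {hx : x = 𝟙 W}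
    {hx' : x' = 𝟙 E} {hx₁ : x₁ = 𝟙 W} {hx₁' : x₁' = 𝟙 E} {t : x ≫ f ≫ y' ≅ y ≫ f ≫ x'}
    {t₁ : x₁ ≫ f ≫ y₁' ≅ y₁ ≫ f ≫ x₁'} {ξ : x ⟶ x₁} {υ : y ⟶ y₁} {ξ' : x' ⟶ x₁'} {υ' : y' ⟶ y₁'}
    (hξ : ξ = eqToHom (hx.trans hx₁.symm)) (hξ' : ξ' = eqToHom (hx'.trans hx₁'.symm))
    (h : (ξ ▷ (f ≫ y')) ≫ (x₁ ◁ f ◁ υ') ≫ t₁.hom = t.hom ≫ (υ ▷ (f ≫ x')) ≫ (y₁ ◁ f ◁ ξ')) :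
    (f ◁ υ') ≫ (passIso hx₁ hx₁' t₁).hom = (passIso hx hx' t).hom ≫ (υ ▷ f) := by
  subst hx hx' hx₁ hx₁' hξ hξ'
  simp only [Category.assoc, eqToHom_trans, eqToHom_trans_assoc, eqToHom_refl, Category.id_comp,
    Category.comp_id, Bicategory.whiskerLeft_comp, Bicategory.comp_whiskerRight, whiskerLeft_eqToHom,
    Bicategory.whiskerLeft_id, Bicategory.id_whiskerRight, eqToHom_whiskerRight,
    Bicategory.comp_whiskerLeft, Bicategory.whiskerRight_comp, Bicategory.whisker_assoc,
    Bicategory.id_whiskerLeft, Bicategory.whiskerRight_id, leftUnitor_hom, leftUnitor_inv,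
    associator_hom, associator_inv, rightUnitor_hom, rightUnitor_inv] at h
  rw [eqToHom_comp_iff] at h
  simp [passIso, reassoc_of% h]

theorem passIso_one {f : W ⟶ E} {x y : W ⟶ W} {x' y' : E ⟶ E} {hx : x = 𝟙 W}
    {hx' : x' = 𝟙 E} {t : x ≫ f ≫ y' ≅ y ≫ f ≫ x'} {h} (ht : t.hom = eqToHom h) (h') :
    (passIso hx hx' t).hom = eqToHom h' := by
  simp [passIso, ht]

theorem passIso_mul {f : W ⟶ E} {xu xv xw yu yv yw : W ⟶ W} {xu' xv' xw' yu' yv' yw' : E ⟶ E}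
    {hu : xu = 𝟙 W} {hv : xv = 𝟙 W} {hw : xw = 𝟙 W} {hu' : xu' = 𝟙 E} {hv' : xv' = 𝟙 E}
    {hw' : xw' = 𝟙 E} {tu : xu ≫ f ≫ yu' ≅ yu ≫ f ≫ xu'} {tv : xv ≫ f ≫ yv' ≅ yv ≫ f ≫ xv'}
    {tw : xw ≫ f ≫ yw' ≅ yw ≫ f ≫ xw'} (hy : yw = yu ≫ yv) (hy' : yw' = yu' ≫ yv') {e₁ e₂ e₃}
    (ht : tw.hom = eqToHom e₁ ≫ (xv ◁ tu.hom ▷ yv') ≫ eqToHom e₂ ≫ (yu ◁ tv.hom ▷ xu') ≫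
      eqToHom e₃) :
    (passIso hw hw' tw).hom = eqToHom (by rw [hy', Strict.assoc]) ≫
      ((passIso hu hu' tu).hom ▷ yv') ≫ eqToHom (Strict.assoc _ _ _) ≫
      (yu ◁ (passIso hv hv' tv).hom) ≫ eqToHom (by rw [hy, Strict.assoc]) := by
  subst hu hv hw hu' hv' hw' hy hy'
  simp [passIso, ht]

theorem passIso_comp {w : W ⟶ W'} {l' : W' ⟶ E} {l : W ⟶ E} {g : w ≫ l' ≅ l} {x y : W ⟶ W}
    {x' y' : W' ⟶ W'} {p q : E ⟶ E} (hx : x = 𝟙 W) (hx' : x' = 𝟙 W') (hp : p = 𝟙 E)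
    {tw : x ≫ w ≫ y' ≅ y ≫ w ≫ x'} {tl' : x' ≫ l' ≫ q ≅ y' ≫ l' ≫ p} {tl : x ≫ l ≫ q ≅ y ≫ l ≫ p}
    (h : (x ◁ g.hom ▷ q) ≫ tl.hom =
      (Equivariant.pasteIso hx' tw.symm tl'.symm).symm.hom ≫ (y ◁ g.hom ▷ p)) :
    (g.hom ▷ q) ≫ (passIso hx hp tl).hom = eqToHom (Strict.assoc _ _ _) ≫
      (w ◁ (passIso hx' hp tl').hom) ≫ eqToHom (Strict.assoc _ _ _).symm ≫
      ((passIso hx hx' tw).hom ▷ l') ≫ eqToHom (Strict.assoc _ _ _) ≫ (y ◁ g.hom) := by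
  subst hx hx' hp
  simp only [Equivariant.pasteIso, Iso.trans_symm, Iso.symm_symm_eq, Iso.trans_hom, Iso.symm_hom, eqToIso.hom, eqToIso.inv, whiskerLeftIso_hom, whiskerRightIso_hom, whiskerLeftIso_inv, whiskerRightIso_inv, Iso.symm_inv, Category.assoc, eqToHom_trans, eqToHom_trans_assoc, eqToHom_refl, Category.id_comp,
    Category.comp_id, Bicategory.whiskerLeft_comp, Bicategory.comp_whiskerRight, whiskerLeft_eqToHom,
    Bicategory.whiskerLeft_id, Bicategory.id_whiskerRight, eqToHom_whiskerRight,
    Bicategory.comp_whiskerLeft, Bicategory.whiskerRight_comp, Bicategory.whisker_assoc,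
    Bicategory.id_whiskerLeft, Bicategory.whiskerRight_id, leftUnitor_hom, leftUnitor_inv,
    associator_hom, associator_inv, rightUnitor_hom, rightUnitor_inv] at h
  rw [eqToHom_comp_iff] at h
  simp only [eqToHom_trans_assoc] at h
  simp [passIso, reassoc_of% h]

/-- The cell `g ▷ k`, reassociated. -/
def gluePush {w : W ⟶ W'} {l' : W' ⟶ E} {l : W ⟶ E} (g : w ≫ l' ≅ l) (k : E ⟶ Z) :
    w ≫ l' ≫ k ≅ l ≫ k :=
  (α_ _ _ _).symm ≪≫ whiskerRightIso g k

theorem gluePush_comp {Z' : M} {w : W ⟶ W'} {l' : W' ⟶ E} {l : W ⟶ E} {g : w ≫ l' ≅ l} {k : E ⟶ Z}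
    {H' : W' ⟶ Z} {H : W ⟶ Z} {θ' : l' ≫ k ≅ H'} {θ : l ≫ k ≅ H} {d : w ≫ H' ≅ H}
    (hθ : (gluePush g k).hom ≫ θ.hom = (w ◁ θ'.hom) ≫ d.hom) (q : Z ⟶ Z') :
    (gluePush g (k ≫ q)).hom ≫ (gluePush θ q).hom =
      (w ◁ (gluePush θ' q).hom) ≫ (gluePush d q).hom := by
  have h := congrArg (· ▷ q) hθ
  simp [gluePush] at h
  rw [eqToHom_comp_iff] at h
  simp [gluePush, h]

/-- Compatibility with the gluing cells survives precomposition with an action. With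
`gluePush_comp`, the analogue for postcomposition, this lets the cells `σ` and `κ` descend to the
colimit. -/
theorem pushIso_glue {w : W ⟶ W'} {l' : W' ⟶ E} {l : W ⟶ E} {g : w ≫ l' ≅ l} {F : E ⟶ E}
    {a' : W' ⟶ W'} {a : W ⟶ W} {n' : l' ≫ F ≅ a' ≫ l'} {n : l ≫ F ≅ a ≫ l} {nw : w ≫ a' ≅ a ≫ w}
    (hn : (g.hom ▷ F) ≫ n.hom = eqToHom (Strict.assoc _ _ _) ≫ (w ◁ n'.hom) ≫
      eqToHom (Strict.assoc _ _ _).symm ≫ (nw.hom ▷ l') ≫ eqToHom (Strict.assoc _ _ _) ≫ (a ◁ g.hom))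
    {k : E ⟶ Z} {H' : W' ⟶ Z} {H : W ⟶ Z} {θ' : l' ≫ k ≅ H'} {θ : l ≫ k ≅ H} {d : w ≫ H' ≅ H}
    (hθ : (gluePush g k).hom ≫ θ.hom = (w ◁ θ'.hom) ≫ d.hom) :
    (gluePush g (F ≫ k)).hom ≫ (pushIso n θ).hom =
      (w ◁ (pushIso n' θ').hom) ≫ (pushIso nw d).hom := by
  have h₁ := congrArg (· ▷ k) hn
  have h₂ := congrArg (a ◁ ·) hθ
  have h₃ := whisker_exchange nw.hom θ'.hom
  simp [gluePush] at h₁ h₂ h₃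
  rw [eqToHom_comp_iff] at h₂ h₃
  simp at h₂ h₃
  simp [gluePush, pushIso, cellPush, reassoc_of% h₁, h₂, reassoc_of% h₃]

theorem pushIso_natural' {l : W ⟶ E} {F F' : E ⟶ E} {a a' : W ⟶ W} {k k' : E ⟶ Z} {h h' : W ⟶ Z}
    {n : l ≫ F ≅ a ≫ l} {n' : l ≫ F' ≅ a' ≫ l} {φ : l ≫ k ≅ h} {φ' : l ≫ k' ≅ h'} {f : F ⟶ F'}
    {α : a ⟶ a'} {δ : k ⟶ k'} {z : h ⟶ h'} (hn : (l ◁ f) ≫ n'.hom = n.hom ≫ (α ▷ l))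
    (hφ : (l ◁ δ) ≫ φ'.hom = φ.hom ≫ z) :
    CSq (pushIso n φ) (pushIso n' φ') (l ◁ ((f ▷ k) ≫ (F' ◁ δ))) ((α ▷ h) ≫ (a' ◁ z)) := by
  have h₁ := congrArg (· ▷ k) hn
  have h₂ := congrArg (a' ◁ ·) hφ
  have h₃ := whisker_exchange n'.hom δ
  have h₄ := whisker_exchange α φ.hom
  simp at h₁ h₂ h₃ h₄
  rw [eqToHom_comp_iff] at h₁ h₃
  simp only [← Category.assoc] at h₄ h₁ h₃
  simp only [Category.assoc, eqToHom_trans, eqToHom_trans_assoc] at h₁ h₃ h₄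
  simp [CSq, pushIso, cellPush, reassoc_of% h₄]
  rw [reassoc_of% h₃]
  simp [h₂, reassoc_of% h₁]

end PassRaw

/-! ### Weak colimits of sequences of equivariant morphisms -/

section Restr
open Bicategory Equivariant
variable {V : Type uV} [Category.{vV} V] [MonoidalCategory V] [SymmetricCategory V]
variable {I : Type uI} [Category.{wI} I] [MonoidalCategory I] [EnrichedOrdinaryCategory V I]
  [MonoidalEnriched V I]
variable {M : Type uM} [Bicategory.{wM, vM} M] [Bicategory.Strict M]
  [∀ A B : M, EnrichedOrdinaryCategory V (A ⟶ B)] [VCatCategory V M]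
variable {s : Side} {W W' X B E : IObj V I M}

/-- The cell `f ≫ act u ≅ act u ≫ f` for trivial active sides. -/
def actCell (hW : IsTrivial (s.active W)) (hE : IsTrivial (s.active E)) (f : Equivariant W E) (u : I) :
    f.hom ≫ (s.active E).obj u ≅ (s.active W).obj u ≫ f.hom :=
  eqToIso (by rw [hW.obj_eq, hE.obj_eq, Strict.comp_id, Strict.id_comp])

/-- The cell `f ≫ pas u ≅ pas u ≫ f` for trivial active sides. -/
def pasCell (hW : IsTrivial (s.active W)) (hE : IsTrivial (s.active E)) (f : Equivariant W E) (u : I) :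
    f.hom ≫ (s.passive E).obj u ≅ (s.passive W).obj u ≫ f.hom :=
  passIso (hW.obj_eq u) (hE.obj_eq u) (f.ts s u)

/-- `m'` is, up to the isomorphisms `θ`, the restriction of `m` along `f`. -/
structure Mid.Restr (hW : IsTrivial (s.active W)) (hE : IsTrivial (s.active E)) (f : Equivariant W E)
    (m : Mid s E B) (m' : Mid s W B) (θ : ∀ i, f.hom ≫ m.H.obj i ≅ m'.H.obj i) : Prop where
  natural {i j : I} (φ : i ⟶ j) : (f.hom ◁ m.H.map φ) ≫ (θ j).hom = (θ i).hom ≫ m'.H.map φ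
  sig (i u k : I) (h : s.mul i u = k) : CSq (pushIso (actCell hW hE f u) (θ i))
    (pushIso (pasCell hW hE f u) (θ k)) (f.hom ◁ (m.σ i u k h).hom) (m'.σ i u k h).hom
  kap (x i k : I) (h : s.mul x i = k) : CSq (gluePush (θ k) ((s.passive B).obj x))
    (gluePush (θ i) ((s.active B).obj x)) (f.hom ◁ (m.κ x i k h).hom) (m'.κ x i k h).hom

variable (s) in
/-- A weak colimit of a sequence of equivariant morphisms between actions with trivial `s.active`. -/
structure ColimSeq (E : IObj V I M) where
  W : ℕ → IObj V I M
  w (n : ℕ) : Equivariant (W n) (W (n + 1))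
  leg (n : ℕ) : Equivariant (W n) E
  glue (n : ℕ) : (w n).hom ≫ (leg (n + 1)).hom ≅ (leg n).hom
  isIso₂ (n : ℕ) : IsIso₂ (comp (w n) (leg (n + 1))) (leg n) (glue n)
  trivial (n : ℕ) : IsTrivial (s.active (W n))
  trivial' : IsTrivial (s.active E)
  universal : IsWeakSeqColimit V (f := fun n => (w n).hom) ⟨fun n => (leg n).hom, glue⟩

namespace ColimSeq
variable (L : ColimSeq s E) {Z : M}

/-- The restrictions of any family along the legs are compatible by exchange with the gluing cells,
so uniqueness in the weak colimit applies. -/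
theorem faithful : JointlyFaithful V fun n => (L.leg n).hom := by
  intro Z k k' T t t' h
  obtain ⟨u, -, hu⟩ := L.universal.fully_faithful k k' T (fun n => famWhiskerLeft (L.leg n).hom t)
    fun n => (VSquare.assocL _ _ t).symm.trans (VSquare.exchangeLeft (L.glue n) t)
  exact (hu t fun n => rfl).trans (hu t' fun n => (h n).symm).symm

theorem actCell_comp (n : ℕ) (u : I) :
    ((L.glue n).hom ▷ (s.active E).obj u) ≫ (actCell (L.trivial n) L.trivial' (L.leg n) u).hom =
      eqToHom (Strict.assoc _ _ _) ≫
      ((L.w n).hom ◁ (actCell (L.trivial (n + 1)) L.trivial' (L.leg (n + 1)) u).hom) ≫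
      eqToHom (Strict.assoc _ _ _).symm ≫
      ((actCell (L.trivial n) (L.trivial (n + 1)) (L.w n) u).hom ▷ (L.leg (n + 1)).hom) ≫
      eqToHom (Strict.assoc _ _ _) ≫ ((s.active (L.W n)).obj u ◁ (L.glue n).hom) := by
  have : ∀ {A B C : M} {w : A ⟶ B} {l' : B ⟶ C} {l : A ⟶ C} (g : w ≫ l' ≅ l) (p : C ⟶ C)
      (a' : B ⟶ B) (a : A ⟶ A) (_ : p = 𝟙 C) (_ : a' = 𝟙 B) (_ : a = 𝟙 A)
      (h₁ : l ≫ p = a ≫ l) (h₂ : (w ≫ l') ≫ p = w ≫ l' ≫ p) (h₃ : l' ≫ p = a' ≫ l')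
      (h₄ : w ≫ a' ≫ l' = (w ≫ a') ≫ l') (h₅ : w ≫ a' = a ≫ w) (h₆ : (a ≫ w) ≫ l' = a ≫ w ≫ l'),
      (g.hom ▷ p) ≫ eqToHom h₁ = eqToHom h₂ ≫ (w ◁ eqToHom h₃) ≫ eqToHom h₄ ≫ (eqToHom h₅ ▷ l') ≫
        eqToHom h₆ ≫ (a ◁ g.hom) := by
    intro A B C w l' l g p a' a hp ha' ha h₁ h₂ h₃ h₄ h₅ h₆
    subst hp ha' ha
    simp [leftUnitor_hom, leftUnitor_inv, rightUnitor_hom, rightUnitor_inv]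
  simp only [actCell, eqToIso.hom]
  exact this _ _ _ _ (L.trivial'.obj_eq u) ((L.trivial (n + 1)).obj_eq u) ((L.trivial n).obj_eq u)
    _ _ _ _ _ _

theorem pasCell_comp (n : ℕ) (u : I) :
    ((L.glue n).hom ▷ (s.passive E).obj u) ≫ (pasCell (L.trivial n) L.trivial' (L.leg n) u).hom =
      eqToHom (Strict.assoc _ _ _) ≫
      ((L.w n).hom ◁ (pasCell (L.trivial (n + 1)) L.trivial' (L.leg (n + 1)) u).hom) ≫
      eqToHom (Strict.assoc _ _ _).symm ≫
      ((pasCell (L.trivial n) (L.trivial (n + 1)) (L.w n) u).hom ▷ (L.leg (n + 1)).hom) ≫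
      eqToHom (Strict.assoc _ _ _) ≫ ((s.passive (L.W n)).obj u ◁ (L.glue n).hom) := by
  refine passIso_comp ((L.trivial n).obj_eq u) ((L.trivial (n + 1)).obj_eq u) (L.trivial'.obj_eq u) ?_
  have h := (isIso₂_iff s).1 (L.isIso₂ n) u
  have e := IsIso₂.comp_ts' s (L.w n) (L.leg (n + 1)) (L.trivial (n + 1)) u
  exact h.trans (congrArg (fun z => Iso.hom z ≫ _) e)

/-- The isomorphisms `a n` are compatible with the gluing isomorphisms `d n`. -/
def Compat {p : E.carrier ⟶ Z} {P : ∀ n, (L.W n).carrier ⟶ Z} (a : ∀ n, (L.leg n).hom ≫ p ≅ P n)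
    (d : ∀ n, (L.w n).hom ≫ P (n + 1) ≅ P n) : Prop :=
  ∀ n, (gluePush (L.glue n) p).hom ≫ (a n).hom = ((L.w n).hom ◁ (a (n + 1)).hom) ≫ (d n).hom

variable {L} in
/-- A compatible family of isomorphisms descends to the colimit. -/
theorem exists_iso {p q : E.carrier ⟶ Z} {P Q : ∀ n, (L.W n).carrier ⟶ Z}
    {a : ∀ n, (L.leg n).hom ≫ p ≅ P n} {b : ∀ n, (L.leg n).hom ≫ q ≅ Q n}
    {d : ∀ n, (L.w n).hom ≫ P (n + 1) ≅ P n} {d' : ∀ n, (L.w n).hom ≫ Q (n + 1) ≅ Q n}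
    (ha : L.Compat a d) (hb : L.Compat b d') (S : ∀ n, P n ≅ Q n)
    (hS : ∀ n, CSq (d n) (d' n) ((L.w n).hom ◁ (S (n + 1)).hom) (S n).hom) :
    ∃ ψ : p ≅ q, ∀ n, CSq (a n) (b n) ((L.leg n).hom ◁ ψ.hom) (S n).hom := by
  have key : ∀ {p q : E.carrier ⟶ Z} {P Q : ∀ n, (L.W n).carrier ⟶ Z}
      {a : ∀ n, (L.leg n).hom ≫ p ≅ P n} {b : ∀ n, (L.leg n).hom ≫ q ≅ Q n}
      {d : ∀ n, (L.w n).hom ≫ P (n + 1) ≅ P n} {d' : ∀ n, (L.w n).hom ≫ Q (n + 1) ≅ Q n}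
      (_ : L.Compat a d) (_ : L.Compat b d') (S : ∀ n, P n ≅ Q n)
      (_ : ∀ n, CSq (d n) (d' n) ((L.w n).hom ◁ (S (n + 1)).hom) (S n).hom),
      ∃ ψ : p ⟶ q, ∀ n, (L.leg n).hom ◁ ψ = (a n ≪≫ S n ≪≫ (b n).symm).hom := by
    intro p q P Q a b d d' ha hb S hS
    obtain ⟨t, ht, -⟩ := L.universal.fully_faithful p q _
      (fun n => eHomEquiv V (a n ≪≫ S n ≪≫ (b n).symm).hom) (fun n => by
        rw [famWhiskerLeft_eHomEquiv, VSquare.eHomEquiv_iff]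
        have h₁ : CSq (gluePush (L.glue n) p) (d n) ((L.w n).hom ◁ (a (n + 1)).hom) (a n).hom :=
          Eq.symm (ha n)
        have h₂ : CSq (gluePush (L.glue n) q) (d' n) ((L.w n).hom ◁ (b (n + 1)).hom) (b n).hom :=
          Eq.symm (hb n)
        -- Compatibility of the composite `a ≫ S ≫ b⁻¹` with the gluing cells is pasted from the
        -- compatibilities of its three factors.
        have h₃ := h₁.comp ((hS n).comp (CSq.inv (x := whiskerLeftIso _ (b (n + 1))) (x' := b n) h₂))
        change _ ≫ (gluePush (L.glue n) q).hom = (gluePush (L.glue n) p).hom ≫ _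
        simpa [CSq] using h₃)
    obtain ⟨ψ, rfl⟩ := (eHomEquiv V).surjective t
    exact ⟨ψ, fun n => (eHomEquiv V).injective ((famWhiskerLeft_eHomEquiv _ _).symm.trans (ht n))⟩
  obtain ⟨ψ, hψ⟩ := L.faithful.exists_iso (fun n => a n ≪≫ S n ≪≫ (b n).symm) (key ha hb S hS) (by
    obtain ⟨ψ, hψ⟩ := key hb ha (fun n => (S n).symm) fun n =>
      CSq.inv (x := whiskerLeftIso _ (S (n + 1))) (x' := S n) (hS n)
    exact ⟨ψ, fun n => (hψ n).trans (by simp)⟩)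
  refine ⟨ψ, fun n => ?_⟩
  rw [hψ]
  simp [CSq]

end ColimSeq
end Restr

open Bicategory
-- Gluing `V`-functors over a weak colimit
section GlueFunctor
open Bicategory Equivariant
variable {V : Type uV} [Category.{vV} V] [MonoidalCategory V] [SymmetricCategory V]
variable {I : Type uI} [Category.{wI} I] [MonoidalCategory I] [EnrichedOrdinaryCategory V I]
  [MonoidalEnriched V I]
variable {M : Type uM} [Bicategory.{wM, vM} M] [Bicategory.Strict M]
  [∀ A B : M, EnrichedOrdinaryCategory V (A ⟶ B)] [VCatCategory V M]
variable {s : Side} {X B E : IObj V I M} {L : ColimSeq s E} {Z : M}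

namespace ColimSeq

/-- A compatible sequence of `V`-functors `I → [W n, Z]` descends to the colimit. -/
theorem exists_functor (hV : ForgetFaithful.{uV, vV, uI, vM} V)
    {H : ∀ n, I ⥤ ((L.W n).carrier ⟶ Z)} (vs : ∀ n, VStr V (H n))
    (d : ∀ i n, (L.w n).hom ≫ (H (n + 1)).obj i ≅ (H n).obj i)
    (hd : ∀ n {i j : I} (φ : i ⟶ j),
      ((L.w n).hom ◁ (H (n + 1)).map φ) ≫ (d j n).hom = (d i n).hom ≫ (H n).map φ) :
    ∃ (K : I ⥤ (E.carrier ⟶ Z)) (_ : VStr V K) (θ : ∀ i n, (L.leg n).hom ≫ K.obj i ≅ (H n).obj i),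
      (∀ i, L.Compat (θ i) (d i)) ∧ ∀ n {i j : I} (φ : i ⟶ j),
        ((L.leg n).hom ◁ K.map φ) ≫ (θ j n).hom = (θ i n).hom ≫ (H n).map φ := by
  -- The objects are glued separately for every `i`.
  choose k θ hθ using fun i => L.universal.ess_surj ⟨fun n => (H n).obj i, d i⟩
  -- The action on hom objects is a family indexed by `i ⟶[V] j`, so the enriched full faithfulness
  -- of the colimit produces it; `hV` makes the transition isomorphisms `V`-natural.
  have key : ∀ i j, ∃ t : (i ⟶[V] j) ⟶ (k i ⟶[V] k j), ∀ n,
      VSquare (θ i n) (θ j n) (famWhiskerLeft (L.leg n).hom t) ((vs n).map i j) := by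
    intro i j
    obtain ⟨t, ht, -⟩ := L.universal.fully_faithful (k i) (k j) (i ⟶[V] j)
      (fun n => pre (θ i n).hom (post ((vs n).map i j) (θ j n).inv)) (fun n => by
        have h₁ := (VSquare.conj' (θ i (n + 1)) (θ j (n + 1)) ((vs (n + 1)).map i j)).whiskerLeft
          (L.w n).hom
        have h₂ := VStr.vsquare hV ((vs (n + 1)).funL (L.w n).hom) (vs n) (fun i => d i n) (hd n) i j
        refine VSquare.of_trans' ?_ (VSquare.conj' (θ i n) (θ j n) ((vs n).map i j))
        exact (h₁.trans h₂).congr (hθ i n).symm (hθ j n).symm)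
    exact ⟨t, fun n => (ht n).symm ▸ VSquare.conj' _ _ _⟩
  choose t ht using key
  -- The functor laws are tested on the legs, where `θ` conjugates them to those of `H n`.
  let G : EnrichedFunctor V I (E.carrier ⟶ Z) :=
    { obj := k
      map := t
      map_id := fun i => L.faithful fun n => by
        refine VSquare.unique' (σ := θ i n) (σ' := θ i n) (t' := eId V _) ?_ ?_
        · have := (ht i i n).comp_left (eId V i)
          rw [comp_famWhiskerLeft, (vs n).map_id] at this
          exact this
        · rw [← eHomEquiv_id, ← eHomEquiv_id, famWhiskerLeft_eHomEquiv, VSquare.eHomEquiv_iff]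
          simp
      map_comp := fun i j l => L.faithful fun n => by
        refine VSquare.unique' (σ := θ i n) (σ' := θ l n)
          (t' := fcomp ((vs n).map i j) ((vs n).map j l)) ?_ ?_
        · have := (ht i l n).comp_left (eComp V i j l)
          rw [comp_famWhiskerLeft, (vs n).map_comp] at this
          exact this
        · have := (ht i j n).fcomp (ht j l n)
          rw [← famWhiskerLeft_fcomp] at this
          exact this }
  refine ⟨underlying V G, VStr.ofEnr G, θ, hθ, fun n i j φ => ?_⟩
  exact VStr.natural ((VStr.ofEnr G).funL (L.leg n).hom) (vs n) (fun i => θ i n)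
    (fun i j => ht i j n) φ

end ColimSeq
end GlueFunctor

open Bicategory
-- Calculus of squares for gluing structure cells
section GlueRaw
open Bicategory
variable {M : Type uM} [Bicategory.{wM, vM} M] [Bicategory.Strict M]

attribute [local simp] leftUnitor_hom leftUnitor_inv rightUnitor_hom rightUnitor_inv associator_hom
  associator_inv

variable {W E Z Z' Z'' : M} {l : W ⟶ E}

theorem CSq.gluePush {k k' : E ⟶ Z} {h h' : W ⟶ Z} {θ : l ≫ k ≅ h} {θ' : l ≫ k' ≅ h'} {x : k ⟶ k'}
    {x' : h ⟶ h'} (H : CSq θ θ' (l ◁ x) x') (q : Z ⟶ Z') :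
    CSq (gluePush θ q) (gluePush θ' q) (l ◁ (x ▷ q)) (x' ▷ q) := by
  have h := congrArg (· ▷ q) H
  simp at h
  rw [eqToHom_comp_iff] at h
  simp [CSq, CoStab.gluePush, h]

theorem CSq.gluePush_exchange {k : E ⟶ Z} {h : W ⟶ Z} (θ : l ≫ k ≅ h) {q q' : Z ⟶ Z'} (β : q ⟶ q') :
    CSq (CoStab.gluePush θ q) (CoStab.gluePush θ q') (l ◁ (k ◁ β)) (h ◁ β) := by
  have h := (whisker_exchange θ.hom β).symm
  simp at h
  simp [CSq, CoStab.gluePush, h]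

theorem CSq.pushIso {F : E ⟶ E} {a : W ⟶ W} (n : l ≫ F ≅ a ≫ l) {k k' : E ⟶ Z} {h h' : W ⟶ Z}
    {θ : l ≫ k ≅ h} {θ' : l ≫ k' ≅ h'} {x : k ⟶ k'} {x' : h ⟶ h'} (H : CSq θ θ' (l ◁ x) x') :
    CSq (pushIso n θ) (pushIso n θ') (l ◁ (F ◁ x)) (a ◁ x') := by
  have h₁ := congrArg (a ◁ ·) H
  have h₂ := whisker_exchange n.hom x
  simp at h₁ h₂
  rw [eqToHom_comp_iff] at h₂
  simp [CSq, CoStab.pushIso, cellPush, reassoc_of% h₂, h₁]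

theorem CSq.gluePush_gluePush {k : E ⟶ Z} {h : W ⟶ Z} (θ : l ≫ k ≅ h) (q : Z ⟶ Z') (q' : Z' ⟶ Z'')
    (e e') : CSq (CoStab.gluePush (CoStab.gluePush θ q) q') (CoStab.gluePush θ (q ≫ q'))
      (l ◁ eqToHom e) (eqToHom e') := by
  simp [CSq, CoStab.gluePush]

theorem CSq.gluePush_pushIso {F : E ⟶ E} {a : W ⟶ W} (n : l ≫ F ≅ a ≫ l) {k : E ⟶ Z} {h : W ⟶ Z}
    (θ : l ≫ k ≅ h) (q : Z ⟶ Z') (e e') :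
    CSq (CoStab.gluePush (CoStab.pushIso n θ) q) (CoStab.pushIso n (CoStab.gluePush θ q))
      (l ◁ eqToHom e) (eqToHom e') := by
  simp [CSq, CoStab.gluePush, CoStab.pushIso, cellPush]

theorem CSq.gluePush_congr {k : E ⟶ Z} {h : W ⟶ Z} (θ : l ≫ k ≅ h) {q q' : Z ⟶ Z'} (hq : q = q')
    (e e') : CSq (CoStab.gluePush θ q) (CoStab.gluePush θ q') (l ◁ eqToHom e) (eqToHom e') := by
  subst hq
  simp [CSq]

theorem CSq.inv_eqToHom {k k' : E ⟶ Z} {h h' : W ⟶ Z} {θ : l ≫ k ≅ h} {θ' : l ≫ k' ≅ h'}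
    {e : k = k'} {e' : h = h'} (H : CSq θ θ' (l ◁ eqToHom e) (eqToHom e')) (e₁ e₁') :
    CSq θ' θ (l ◁ eqToHom e₁) (eqToHom e₁') := by
  subst e e'
  simp [CSq] at H ⊢
  exact H.symm

/-- The squares of the two factors are whiskered and pasted; in between, the order of the commuting
1-cells `bx` and `qy` is changed under the comparison `θk`. -/
theorem glue_kap_mul {ki kk kl : E ⟶ Z} {hi hk hl : W ⟶ Z} {θi : l ≫ ki ≅ hi} {θk : l ≫ kk ≅ hk}
    {θl : l ≫ kl ≅ hl} {qx qy qw bx b bw : Z ⟶ Z} {κx : kl ≫ qx ⟶ kk ≫ bx} {κy : kk ≫ qy ⟶ ki ≫ b}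
    {κx' : hl ≫ qx ⟶ hk ≫ bx} {κy' : hk ≫ qy ⟶ hi ≫ b} (hq : qw = qx ≫ qy) (hb : bw = b ≫ bx)
    (hc : bx ≫ qy = qy ≫ bx) (Hx : CSq (gluePush θl qx) (gluePush θk bx) (l ◁ κx) κx')
    (Hy : CSq (gluePush θk qy) (gluePush θi b) (l ◁ κy) κy') (e₁ e₂ e₃ e₄ e₅ e₆) :
    CSq (gluePush θl qw) (gluePush θi bw)
      (l ◁ (eqToHom e₁ ≫ (κx ▷ qy) ≫ eqToHom e₂ ≫ (κy ▷ bx) ≫ eqToHom e₃))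
      (eqToHom e₄ ≫ (κx' ▷ qy) ≫ eqToHom e₅ ≫ (κy' ▷ bx) ≫ eqToHom e₆) := by
  subst hq hb
  simp only [Bicategory.whiskerLeft_comp]
  refine CSq.comp ?_ ((Hx.gluePush qy).comp (CSq.comp ?_ ((Hy.gluePush bx).comp ?_)))
  · exact (CSq.gluePush_gluePush θl qx qy (Strict.assoc _ _ _) (Strict.assoc _ _ _)).inv_eqToHom _ _
  · have h₁ := CSq.gluePush_gluePush θk bx qy (Strict.assoc _ _ _) (Strict.assoc _ _ _)
    have h₂ := CSq.gluePush_congr θk hc (by rw [hc]) (by rw [hc])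
    have h₃ := (CSq.gluePush_gluePush θk qy bx (Strict.assoc _ _ _) (Strict.assoc _ _ _)).inv_eqToHom
      (Strict.assoc _ _ _).symm (Strict.assoc _ _ _).symm
    simpa only [whiskerLeft_eqToHom, eqToHom_trans] using h₁.comp (h₂.comp h₃)
  · exact CSq.gluePush_gluePush θi b bx _ _

/-- Both sides lie over the two sides of `h` in squares with the same comparison isomorphisms, and
such a square determines its restricted cell. -/
theorem glue_comm {F G : E ⟶ E} {a p : W ⟶ W} {n : l ≫ F ≅ a ≫ l} {m : l ≫ G ≅ p ≫ l}
    {ki kj kk kl : E ⟶ Z} {hi hj hk hl : W ⟶ Z} {θi : l ≫ ki ≅ hi} {θj : l ≫ kj ≅ hj}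
    {θk : l ≫ kk ≅ hk} {θl : l ≫ kl ≅ hl} {q b : Z ⟶ Z} {σj : F ≫ kj ⟶ G ≫ kl} {κk : kl ≫ q ⟶ kk ≫ b}
    {κi : kj ≫ q ⟶ ki ≫ b} {σi : F ≫ ki ⟶ G ≫ kk} {σj' : a ≫ hj ⟶ p ≫ hl} {κk' : hl ≫ q ⟶ hk ≫ b}
    {κi' : hj ≫ q ⟶ hi ≫ b} {σi' : a ≫ hi ⟶ p ≫ hk}
    (Hj : CSq (pushIso n θj) (pushIso m θl) (l ◁ σj) σj')
    (Hi : CSq (pushIso n θi) (pushIso m θk) (l ◁ σi) σi')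
    (Kk : CSq (gluePush θl q) (gluePush θk b) (l ◁ κk) κk')
    (Ki : CSq (gluePush θj q) (gluePush θi b) (l ◁ κi) κi')
    (h : (σj' ▷ q) ≫ eqToHom (Strict.assoc _ _ _) ≫ (p ◁ κk') =
      eqToHom (Strict.assoc _ _ _) ≫ (a ◁ κi') ≫ eqToHom (Strict.assoc _ _ _).symm ≫ (σi' ▷ b) ≫
        eqToHom (Strict.assoc _ _ _)) :
    l ◁ ((σj ▷ q) ≫ eqToHom (Strict.assoc _ _ _) ≫ (G ◁ κk)) =
      l ◁ (eqToHom (Strict.assoc _ _ _) ≫ (F ◁ κi) ≫ eqToHom (Strict.assoc _ _ _).symm ≫ (σi ▷ b) ≫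
        eqToHom (Strict.assoc _ _ _)) := by
  refine CSq.unique' (σ := gluePush (pushIso n θj) q) (σ' := pushIso m (gluePush θk b))
    (x' := (σj' ▷ q) ≫ eqToHom (Strict.assoc _ _ _) ≫ (p ◁ κk')) ?_ ?_
  · simp only [Bicategory.whiskerLeft_comp]
    exact (Hj.gluePush q).comp ((CSq.gluePush_pushIso m θl q _ _).comp (Kk.pushIso m))
  · rw [h]
    simp only [Bicategory.whiskerLeft_comp]
    exact (CSq.gluePush_pushIso n θj q _ _).comp ((Ki.pushIso n).comp
      (((CSq.gluePush_pushIso n θi b (Strict.assoc _ _ _) (Strict.assoc _ _ _)).inv_eqToHom _ _).comp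
        ((Hi.gluePush b).comp (CSq.gluePush_pushIso m θk b _ _))))

end GlueRaw

open Bicategory
-- Gluing families with structure cells
section Glue
open Bicategory Equivariant
variable {V : Type uV} [Category.{vV} V] [MonoidalCategory V] [SymmetricCategory V]
variable {I : Type uI} [Category.{wI} I] [MonoidalCategory I] [EnrichedOrdinaryCategory V I]
  [MonoidalEnriched V I]
variable {M : Type uM} [Bicategory.{wM, vM} M] [Bicategory.Strict M]
  [∀ A B : M, EnrichedOrdinaryCategory V (A ⟶ B)] [VCatCategory V M]
variable {s : Side} {W X B E : IObj V I M}

theorem actCell_natural (hW : IsTrivial (s.active W)) (hE : IsTrivial (s.active E))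
    (f : Equivariant W E) {u v : I} (ψ : u ⟶ v) :
    (f.hom ◁ (s.active E).map ψ) ≫ (actCell hW hE f v).hom =
      (actCell hW hE f u).hom ≫ ((s.active W).map ψ ▷ f.hom) := by
  simp [actCell, hW.map_eq ψ, hE.map_eq ψ, whiskerLeft_eqToHom, eqToHom_whiskerRight]

theorem actCell_one (hW : IsTrivial (s.active W)) (hE : IsTrivial (s.active E))
    (f : Equivariant W E) (u : I) : (actCell hW hE f u).hom =
      eqToHom (by rw [hW.obj_eq, hE.obj_eq, Strict.comp_id, Strict.id_comp]) := rfl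

theorem actCell_mul (hW : IsTrivial (s.active W)) (hE : IsTrivial (s.active E))
    (f : Equivariant W E) (u v : I) :
    (actCell hW hE f (s.mul u v)).hom = eqToHom (by rw [s.active_mul, Strict.assoc]) ≫
      ((actCell hW hE f v).hom ▷ (s.active E).obj u) ≫ eqToHom (Strict.assoc _ _ _) ≫
      ((s.active W).obj v ◁ (actCell hW hE f u).hom) ≫
      eqToHom (by rw [s.active_mul, Strict.assoc]) := by
  simp [actCell, whiskerLeft_eqToHom, eqToHom_whiskerRight]

theorem pasCell_natural (hW : IsTrivial (s.active W)) (hE : IsTrivial (s.active E))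
    (f : Equivariant W E) {u v : I} (ψ : u ⟶ v) :
    (f.hom ◁ (s.passive E).map ψ) ≫ (pasCell hW hE f v).hom =
      (pasCell hW hE f u).hom ≫ ((s.passive W).map ψ ▷ f.hom) :=
  passIso_natural (hW.map_eq ψ) (hE.map_eq ψ) (f.ts_natural s ψ)

theorem pasCell_one (hW : IsTrivial (s.active W)) (hE : IsTrivial (s.active E))
    (f : Equivariant W E) : (pasCell hW hE f (e[I])).hom = eqToHom (by
      rw [s.passive_one, s.passive_one, Strict.comp_id, Strict.id_comp]) :=
  passIso_one (f.ts_one (s := s)) _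

theorem pasCell_mul (hW : IsTrivial (s.active W)) (hE : IsTrivial (s.active E))
    (f : Equivariant W E) (u v : I) :
    (pasCell hW hE f (s.mul u v)).hom = eqToHom (by rw [s.passive_mul, Strict.assoc]) ≫
      ((pasCell hW hE f u).hom ▷ (s.passive E).obj v) ≫ eqToHom (Strict.assoc _ _ _) ≫
      ((s.passive W).obj u ◁ (pasCell hW hE f v).hom) ≫
      eqToHom (by rw [s.passive_mul, Strict.assoc]) :=
  passIso_mul (s.passive_mul W u v) (s.passive_mul E u v) (f.ts_mul s u v)

/-- The active 1-cells are identities and their cell is an equality, so after substitution nothing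
is left but the passive cell on both sides. -/
theorem actCell_pasCell (hW : IsTrivial (s.active W)) (hE : IsTrivial (s.active E))
    (f : Equivariant W E) (u v : I) :
    ((actCell hW hE f v).hom ▷ (s.passive E).obj u) ≫ eqToHom (Strict.assoc _ _ _) ≫
        ((s.active W).obj v ◁ (pasCell hW hE f u).hom) =
      eqToHom (by simp only [Strict.assoc, s.comm]) ≫
        ((pasCell hW hE f u).hom ▷ (s.active E).obj v) ≫ eqToHom (Strict.assoc _ _ _) ≫
        ((s.passive W).obj u ◁ (actCell hW hE f v).hom) ≫
        eqToHom (by simp only [← Strict.assoc, s.comm]) := by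
  have : ∀ {A C : M} {f : A ⟶ C} {x y : A ⟶ A} {x' y' : C ⟶ C} (t : f ≫ y' ≅ y ≫ f) (_ : x = 𝟙 A)
      (_ : x' = 𝟙 C) (h₁ : f ≫ x' = x ≫ f) (h₂ : (x ≫ f) ≫ y' = x ≫ f ≫ y')
      (h₃ : (f ≫ x') ≫ y' = (f ≫ y') ≫ x') (h₄ : (y ≫ f) ≫ x' = y ≫ f ≫ x')
      (h₅ : y ≫ x ≫ f = x ≫ y ≫ f),
      (eqToHom h₁ ▷ y') ≫ eqToHom h₂ ≫ (x ◁ t.hom) = eqToHom h₃ ≫ (t.hom ▷ x') ≫ eqToHom h₄ ≫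
        (y ◁ eqToHom h₁) ≫ eqToHom h₅ := by
    intro A C f x y x' y' t hx hx' h₁ h₂ h₃ h₄ h₅
    subst hx hx'
    simp [leftUnitor_hom, leftUnitor_inv, rightUnitor_hom, rightUnitor_inv]
  simp only [actCell, eqToIso.hom]
  exact this _ (hW.obj_eq v) (hE.obj_eq v) _ _ _ _ _

/-- Compatible `Mid`s on a sequence descend to the colimit. -/
theorem ColimSeq.exists_mid (hV : ForgetFaithful.{uV, vV, uI, vM} V) (L : ColimSeq s E)
    (m : ∀ n, Mid s (L.W n) B) (d : ∀ i n, (L.w n).hom ≫ (m (n + 1)).H.obj i ≅ (m n).H.obj i)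
    (hd : ∀ n, (m (n + 1)).Restr (L.trivial n) (L.trivial (n + 1)) (L.w n) (m n) fun i => d i n) :
    ∃ (m' : Mid s E B) (θ : ∀ i n, (L.leg n).hom ≫ m'.H.obj i ≅ (m n).H.obj i),
      (∀ i, L.Compat (θ i) (d i)) ∧
      ∀ n, m'.Restr (L.trivial n) L.trivial' (L.leg n) (m n) fun i => θ i n := by
  obtain ⟨K, vs, θ, hθ, nat⟩ := L.exists_functor hV (fun n => (m n).vs) d fun n => (hd n).natural
  -- The cells `σ` of the stages descend because they are compatible with the transition
  -- isomorphisms; the same is done below for `κ`.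
  have hσ : ∀ i u k (h : s.mul i u = k), ∃ σ : (s.active E).obj u ≫ K.obj i ≅
      (s.passive E).obj u ≫ K.obj k, ∀ n,
      CSq (pushIso (actCell (L.trivial n) L.trivial' (L.leg n) u) (θ i n))
        (pushIso (pasCell (L.trivial n) L.trivial' (L.leg n) u) (θ k n)) ((L.leg n).hom ◁ σ.hom)
        ((m n).σ i u k h).hom := by
    intro i u k h
    exact exists_iso
      (d := fun n => pushIso (actCell (L.trivial n) (L.trivial (n + 1)) (L.w n) u) (d i n))
      (d' := fun n => pushIso (pasCell (L.trivial n) (L.trivial (n + 1)) (L.w n) u) (d k n))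
      (fun n => pushIso_glue (L.actCell_comp n u) (hθ i n))
      (fun n => pushIso_glue (L.pasCell_comp n u) (hθ k n)) (fun n => (m n).σ i u k h)
      fun n => (hd n).sig i u k h
  have hκ : ∀ x i k (h : s.mul x i = k), ∃ κ : K.obj k ≫ (s.passive B).obj x ≅
      K.obj i ≫ (s.active B).obj x, ∀ n,
      CSq (gluePush (θ k n) ((s.passive B).obj x)) (gluePush (θ i n) ((s.active B).obj x))
        ((L.leg n).hom ◁ κ.hom) ((m n).κ x i k h).hom := by
    intro x i k h
    exact exists_iso
      (d := fun n => gluePush (d k n) ((s.passive B).obj x))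
      (d' := fun n => gluePush (d i n) ((s.active B).obj x))
      (fun n => gluePush_comp (hθ k n) _) (fun n => gluePush_comp (hθ i n) _)
      (fun n => (m n).κ x i k h) fun n => (hd n).kap x i k h
  choose σ hσ using hσ
  choose κ hκ using hκ
  refine ⟨⟨K, vs, σ, ⟨?_, ?_, ?_⟩, κ, ⟨?_, ?_, ?_⟩, ?_⟩, θ, hθ, fun n => ⟨nat n, fun i u k h => hσ i u k h n,
    fun x i k h => hκ x i k h n⟩⟩
  -- Each law of the glued cells is checked on the legs, where it reduces to the law at stage `n`.
  · intro i i' u u' k k' h h' φ ψ χ e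
    refine (Category.assoc _ _ _).symm.trans (L.faithful.cell fun n => ?_)
    refine (Bicategory.whiskerLeft_comp _ _ _).trans (Eq.trans ?_
      (Bicategory.whiskerLeft_comp _ _ _).symm)
    refine ((pushIso_natural' (actCell_natural _ _ _ ψ) (nat n φ)).comp (hσ _ _ _ h' n)).unique' ?_
    rw [Category.assoc, (m n).isSig.natural h h' φ ψ χ e]
    exact (hσ _ _ _ h n).comp (pushIso_natural' (pasCell_natural _ _ _ ψ) (nat n χ))
  · intro i h
    refine L.faithful.cell fun n => ?_
    refine (hσ i (e[I]) i h n).unique' ?_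
    rw [(m n).isSig.one]
    exact push_one (s.active_one E) (s.passive_one E) (s.active_one _) (s.passive_one _)
      (actCell_one _ _ _ _) (pasCell_one _ _ _) _ _
  · intro i u v k l h h' h''
    refine L.faithful.cell fun n => ?_
    refine (hσ i (s.mul u v) l h'' n).unique' ?_
    rw [(m n).isSig.mul h h' h'']
    exact push_mul (s.active_mul E u v) (s.passive_mul E u v) (s.active_mul _ u v)
      (s.passive_mul _ u v) (s.comm E v u) (s.comm _ v u) (actCell_mul _ _ _ u v)
      (pasCell_mul _ _ _ u v) (actCell_pasCell _ _ _ u v) (hσ i u k h n) (hσ k v l h' n) _ _ _ _ _ _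
  · intro x x' i i' k k' h h' ψ φ χ e
    refine (Category.assoc _ _ _).symm.trans (L.faithful.cell fun n => ?_)
    rw [Bicategory.whiskerLeft_comp, Bicategory.whiskerLeft_comp,
      Bicategory.whiskerLeft_comp, Bicategory.whiskerLeft_comp]
    have nat' : ∀ {i j} (φ : i ⟶ j), CSq (θ i n) (θ j n) ((L.leg n).hom ◁ K.map φ) ((m n).H.map φ) :=
      nat n
    refine (((nat' χ).gluePush _).comp (CSq.gluePush_exchange _ _) |>.comp (hκ _ _ _ h' n)).unique' ?_
    rw [Category.assoc, (m n).isKap.natural h h' ψ φ χ e]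
    exact (hκ _ _ _ h n).comp (((nat' φ).gluePush _).comp (CSq.gluePush_exchange _ _))
  · intro i h
    refine L.faithful.cell fun n => ?_
    refine (hκ (e[I]) i i h n).unique' ?_
    rw [(m n).isKap.one]
    exact CSq.gluePush_congr _ ((s.passive_one B).trans (s.active_one B).symm) _ _
  · intro x y i k l h h' h''
    refine L.faithful.cell fun n => ?_
    refine (hκ (s.mul x y) i l h'' n).unique' ?_
    rw [(m n).isKap.mul h h' h'']
    exact glue_kap_mul (s.passive_mul B x y) (s.active_mul B x y) (s.comm B x y)
      (hκ x k l h' n) (hκ y i k h n) _ _ _ _ _ _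
  · intro i u x k j l h hj hl h'
    refine L.faithful.cell fun n => ?_
    exact glue_comm (hσ j u l h' n) (hσ i u k h n) (hκ x k l hl n) (hκ x i j hj n)
      ((m n).comm h hj hl h')

end Glue

open Bicategory
-- Transition isomorphisms for composites through varying middle objects
section PairGlueRaw
open Bicategory
variable {M : Type uM} [Bicategory.{wM, vM} M] [Bicategory.Strict M]

attribute [local simp] leftUnitor_hom leftUnitor_inv rightUnitor_hom rightUnitor_inv associator_hom
  associator_inv

variable {W W' Y Y' Z : M} {w : W ⟶ W'} {α : W ⟶ Y} {α' : W' ⟶ Y'} {v : Y ⟶ Y'} {γ : Y ⟶ Z}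
  {γ' : Y' ⟶ Z}

/-- The composite `w ≫ α' ≫ a' ≫ γ' ≅ α ≫ v ≫ a' ≫ γ' ≅ α ≫ a ≫ v ≫ γ' ≅ α ≫ a ≫ γ`. -/
def pairGlue (p : w ≫ α' ≅ α ≫ v) {a' : Y' ⟶ Y'} {a : Y ⟶ Y} (n : v ≫ a' ≅ a ≫ v) (q : v ≫ γ' ≅ γ) :
    w ≫ α' ≫ a' ≫ γ' ≅ α ≫ a ≫ γ :=
  (α_ _ _ _).symm ≪≫ whiskerRightIso p (a' ≫ γ') ≪≫ α_ _ _ _ ≪≫ whiskerLeftIso α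
    ((α_ _ _ _).symm ≪≫ whiskerRightIso n γ' ≪≫ α_ _ _ _ ≪≫ whiskerLeftIso a q)

theorem pairGlue_natural (p : w ≫ α' ≅ α ≫ v) {a' b' : Y' ⟶ Y'} {a b : Y ⟶ Y} {n : v ≫ a' ≅ a ≫ v}
    {m : v ≫ b' ≅ b ≫ v} (q : v ≫ γ' ≅ γ) {f' : a' ⟶ b'} {f : a ⟶ b}
    (h : (v ◁ f') ≫ m.hom = n.hom ≫ (f ▷ v)) :
    (w ◁ (α' ◁ (f' ▷ γ'))) ≫ (pairGlue p m q).hom = (pairGlue p n q).hom ≫ (α ◁ (f ▷ γ)) := by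
  have h₁ := congrArg (fun z => α ◁ (z ▷ γ')) h
  have h₂ := whisker_exchange p.hom (f' ▷ γ')
  have h₃ := congrArg (α ◁ ·) (whisker_exchange f q.hom)
  simp at h₁ h₂ h₃
  rw [eqToHom_comp_iff] at h₁ h₂
  simp only [← Category.assoc] at h₂
  rw [comp_eqToHom_iff] at h₂
  simp only [Category.assoc, eqToHom_trans, eqToHom_trans_assoc] at h₂
  simp [pairGlue]
  rw [reassoc_of% h₂]
  simp [reassoc_of% h₁, h₃]

/-- Only the left half of `w ≫ α' ≫ a' ≫ γ'` is concerned: equivariance of `p` moves the action cell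
of `α'` to that of `α`, the cell of `v` produced thereby cancels against the one in `nk`, and the
rest is interchange. -/
theorem pairGlue_sig {p : w ≫ α' ≅ α ≫ v} {q : v ≫ γ' ≅ γ} {x y : W ⟶ W} {x' y' : W' ⟶ W'}
    {pu au ai ak : Y ⟶ Y} {pu' au' ai' ak' : Y' ⟶ Y'} (hx : x = 𝟙 W) (hx' : x' = 𝟙 W') (hpu : pu = 𝟙 Y)
    (hpu' : pu' = 𝟙 Y') {hk : ak = au ≫ ai} {hk' : ak' = au' ≫ ai'} {na : w ≫ x' ≅ x ≫ w} {ea}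
    (hna : na.hom = eqToHom ea) {tw : x ≫ w ≫ y' ≅ y ≫ w ≫ x'} {tα : x ≫ α ≫ pu ≅ y ≫ α ≫ au}
    {tα' : x' ≫ α' ≫ pu' ≅ y' ≫ α' ≫ au'} {tv : au ≫ v ≫ pu' ≅ pu ≫ v ≫ au'} {ni : v ≫ ai' ≅ ai ≫ v}
    {nk : v ≫ ak' ≅ ak ≫ v} {e₁ e₂ e₃}
    (hnk : nk.hom = eqToHom e₁ ≫ ((passIso hpu hpu' tv.symm).hom ▷ ai') ≫ eqToHom e₂ ≫
      (au ◁ ni.hom) ≫ eqToHom e₃)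
    (hp : (x ◁ p.hom ▷ pu') ≫ (Equivariant.pasteIso hpu tα tv).hom =
      (Equivariant.pasteIso hx' tw.symm tα'.symm).symm.hom ≫ (y ◁ p.hom ▷ au')) :
    CSq (pushIso na (pairGlue p ni q)) (pushIso (passIso hx hx' tw) (pairGlue p nk q))
      (w ◁ (pairSig (c := γ') hpu' hk' tα').hom) (pairSig (c := γ) hpu hk tα).hom := by
  subst hx hx' hpu hpu' hk hk'
  have h₁ := congrArg (fun z => z ▷ (ai' ≫ γ')) hp.symm
  have h₂ := whisker_exchange tα.hom (ni.hom ▷ γ' ≫ (α_ _ _ _).hom ≫ ai ◁ q.hom)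
  have hc : y ◁ α ◁ tv.hom ▷ ai' ▷ γ' ≫ y ◁ α ◁ tv.inv ▷ ai' ▷ γ' = 𝟙 _ := by
    simp only [← Bicategory.whiskerLeft_comp, ← Bicategory.comp_whiskerRight, Iso.hom_inv_id,
      Bicategory.whiskerLeft_id, Bicategory.id_whiskerRight]
  simp only [Equivariant.pasteIso, Iso.trans_symm, Iso.symm_symm_eq, Iso.trans_hom, Iso.symm_hom, eqToIso.hom, eqToIso.inv, whiskerLeftIso_hom, whiskerRightIso_hom, whiskerLeftIso_inv, whiskerRightIso_inv, Iso.symm_inv, Category.assoc, eqToHom_trans, eqToHom_trans_assoc, eqToHom_refl, Category.id_comp,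
    Category.comp_id, Bicategory.whiskerLeft_comp, Bicategory.comp_whiskerRight, whiskerLeft_eqToHom,
    Bicategory.whiskerLeft_id, Bicategory.id_whiskerRight, eqToHom_whiskerRight,
    Bicategory.comp_whiskerLeft, Bicategory.whiskerRight_comp, Bicategory.whisker_assoc,
    Bicategory.id_whiskerLeft, Bicategory.whiskerRight_id, leftUnitor_hom, leftUnitor_inv,
    associator_hom, associator_inv, rightUnitor_hom, rightUnitor_inv] at h₁ h₂ hc
  rw [eqToHom_comp_iff] at h₁ h₂
  simp only [← Category.assoc] at h₁ h₂
  rw [comp_eqToHom_iff] at h₁ h₂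
  simp only [Category.assoc, eqToHom_trans, eqToHom_trans_assoc] at h₁ h₂
  simp [CSq, pushIso, cellPush, pairGlue, pairSig, passIso, hna, hnk]
  rw [reassoc_of% h₁]
  simp only [Category.assoc, eqToHom_trans, eqToHom_trans_assoc, eqToHom_refl, Category.id_comp,
    reassoc_of% hc]
  rw [reassoc_of% h₂]
  simp

/-- Mirror image of `pairGlue_sig`: equivariance of `q` moves the action cell of `γ'` to that of
`γ`, and the cells of `v` cancel. -/
theorem pairGlue_kap {p : w ≫ α' ≅ α ≫ v} {q : v ≫ γ' ≅ γ} {c b : Z ⟶ Z} {px ax ai ak : Y ⟶ Y}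
    {px' ax' ai' ak' : Y' ⟶ Y'} (hpx : px = 𝟙 Y) (hpx' : px' = 𝟙 Y') {hk : ak = ai ≫ ax}
    {hk' : ak' = ai' ≫ ax'} {tγ : ax ≫ γ ≫ c ≅ px ≫ γ ≫ b} {tγ' : ax' ≫ γ' ≫ c ≅ px' ≫ γ' ≫ b}
    {tv : ax ≫ v ≫ px' ≅ px ≫ v ≫ ax'} {ni : v ≫ ai' ≅ ai ≫ v} {nk : v ≫ ak' ≅ ak ≫ v} {e₁ e₂ e₃}
    (hnk : nk.hom = eqToHom e₁ ≫ (ni.hom ▷ ax') ≫ eqToHom e₂ ≫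
      (ai ◁ (passIso hpx hpx' tv.symm).hom) ≫ eqToHom e₃)
    (hq : (ax ◁ q.hom ▷ c) ≫ tγ.hom =
      (Equivariant.pasteIso hpx' tv tγ').hom ≫ (px ◁ q.hom ▷ b)) :
    CSq (gluePush (pairGlue p nk q) c) (gluePush (pairGlue p ni q) b)
      (w ◁ (pairKap (a := α') hpx' hk' tγ').hom) (pairKap (a := α) hpx hk tγ).hom := by
  subst hpx hpx' hk hk'
  have h₁ := congrArg (fun z => α ◁ ai ◁ z) hq
  have h₂ := whisker_exchange (p.hom ▷ ai' ≫ (α_ _ _ _).hom ≫ α ◁ ni.hom) tγ'.hom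
  have hc : α ◁ ai ◁ tv.inv ▷ γ' ▷ c ≫ α ◁ ai ◁ tv.hom ▷ γ' ▷ c = 𝟙 _ := by
    simp only [← Bicategory.whiskerLeft_comp, ← Bicategory.comp_whiskerRight, Iso.inv_hom_id,
      Bicategory.whiskerLeft_id, Bicategory.id_whiskerRight]
  simp only [Equivariant.pasteIso, Iso.trans_symm, Iso.symm_symm_eq, Iso.trans_hom, Iso.symm_hom, eqToIso.hom, eqToIso.inv, whiskerLeftIso_hom, whiskerRightIso_hom, whiskerLeftIso_inv, whiskerRightIso_inv, Iso.symm_inv, Category.assoc, eqToHom_trans, eqToHom_trans_assoc, eqToHom_refl, Category.id_comp,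
    Category.comp_id, Bicategory.whiskerLeft_comp, Bicategory.comp_whiskerRight, whiskerLeft_eqToHom,
    Bicategory.whiskerLeft_id, Bicategory.id_whiskerRight, eqToHom_whiskerRight,
    Bicategory.comp_whiskerLeft, Bicategory.whiskerRight_comp, Bicategory.whisker_assoc,
    Bicategory.id_whiskerLeft, Bicategory.whiskerRight_id, leftUnitor_hom, leftUnitor_inv,
    associator_hom, associator_inv, rightUnitor_hom, rightUnitor_inv] at h₁ h₂ hc
  rw [eqToHom_comp_iff] at h₂
  simp only [← Category.assoc] at h₂
  rw [comp_eqToHom_iff] at h₂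
  simp only [Category.assoc, eqToHom_trans, eqToHom_trans_assoc] at h₁ h₂
  simp [CSq, gluePush, pairGlue, pairKap, passIso, hnk]
  rw [reassoc_of% h₂, reassoc_of% h₁]
  simp only [Category.assoc, eqToHom_trans, eqToHom_trans_assoc, eqToHom_refl, Category.id_comp,
    reassoc_of% hc]

end PairGlueRaw

open Bicategory
-- Compatibility of composite families along a sequence
section PairRestr
open Bicategory Equivariant
variable {V : Type uV} [Category.{vV} V] [MonoidalCategory V] [SymmetricCategory V]
variable {I : Type uI} [Category.{wI} I] [MonoidalCategory I] [EnrichedOrdinaryCategory V I]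
  [MonoidalEnriched V I]
variable {M : Type uM} [Bicategory.{wM, vM} M] [Bicategory.Strict M]
  [∀ A B : M, EnrichedOrdinaryCategory V (A ⟶ B)] [VCatCategory V M]
variable {s : Side} {W W' Y Y' B : IObj V I M}

/-- The cell `v ≫ act i ≅ act i ≫ v` for trivial passive sides. -/
def movCell (hY : IsTrivial (s.passive Y)) (hY' : IsTrivial (s.passive Y')) (v : Equivariant Y Y')
    (i : I) : v.hom ≫ (s.active Y').obj i ≅ (s.active Y).obj i ≫ v.hom :=
  passIso (hY.obj_eq i) (hY'.obj_eq i) (v.ts s i).symm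

theorem movCell_natural (hY : IsTrivial (s.passive Y)) (hY' : IsTrivial (s.passive Y'))
    (v : Equivariant Y Y') {i j : I} (φ : i ⟶ j) :
    (v.hom ◁ (s.active Y').map φ) ≫ (movCell hY hY' v j).hom =
      (movCell hY hY' v i).hom ≫ ((s.active Y).map φ ▷ v.hom) :=
  passIso_natural (hY.map_eq φ) (hY'.map_eq φ) (symm_nat (v.ts_natural s φ))

theorem movCell_mul (hY : IsTrivial (s.passive Y)) (hY' : IsTrivial (s.passive Y'))
    (v : Equivariant Y Y') {i u k : I} (h : s.mul i u = k) :
    (movCell hY hY' v k).hom = eqToHom (by rw [← h, s.active_mul, Strict.assoc]) ≫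
      ((movCell hY hY' v u).hom ▷ (s.active Y').obj i) ≫ eqToHom (Strict.assoc _ _ _) ≫
      ((s.active Y).obj u ◁ (movCell hY hY' v i).hom) ≫
      eqToHom (by rw [← h, s.active_mul, Strict.assoc]) := by
  subst h
  exact passIso_mul (s.active_mul Y i u) (s.active_mul Y' i u) (symm_mul _ _ _ (v.ts_mul s i u))

/-- A ladder between the factorizations `α ≫ γ` and `α' ≫ γ'` restricts one family to the other. The
rung `v` carries the action on `Y'` to that on `Y`, since both passive sides are trivial. -/
theorem Mid.ofPair_restr {w : Equivariant W W'} {α : Equivariant W Y} {α' : Equivariant W' Y'}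
    {v : Equivariant Y Y'} {γ : Equivariant Y B} {γ' : Equivariant Y' B}
    (hW : IsTrivial (s.active W)) (hW' : IsTrivial (s.active W')) (hY : IsTrivial (s.passive Y))
    (hY' : IsTrivial (s.passive Y')) {p : w.hom ≫ α'.hom ≅ α.hom ≫ v.hom}
    (hp : IsIso₂ (comp w α') (comp α v) p) {q : v.hom ≫ γ'.hom ≅ γ.hom}
    (hq : IsIso₂ (comp v γ') γ q) :
    (Mid.ofPair s α' γ' hY').Restr hW hW' w (Mid.ofPair s α γ hY)
      fun i => pairGlue p (movCell hY hY' v i) q where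
  natural φ := pairGlue_natural p q (movCell_natural hY hY' v φ)
  sig i u k h := by
    refine pairGlue_sig (hW.obj_eq u) (hW'.obj_eq u) (hY.obj_eq u) (hY'.obj_eq u)
      (actCell_one hW hW' w u) (tv := v.ts s u)
      (hk := by rw [← h, s.active_mul]) (hk' := by rw [← h, s.active_mul]) (movCell_mul hY hY' v h) ?_
    have := (isIso₂_iff s).1 hp u
    refine (congrArg (_ ≫ Iso.hom ·) (comp_ts s α v hY u).symm).trans (this.trans ?_)
    exact congrArg (Iso.hom · ≫ _) (IsIso₂.comp_ts' s w α' hW' u)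
  kap x i k h := by
    refine pairGlue_kap (hY.obj_eq x) (hY'.obj_eq x) (tv := v.ts s x)
      (hk := by rw [← h, s.active_mul]) (hk' := by rw [← h, s.active_mul]) (movCell_mul hY hY' v h) ?_
    refine ((isIso₂_iff s).1 hq x).trans ?_
    exact congrArg (Iso.hom · ≫ _) (comp_ts s v γ' hY' x)

end PairRestr

open Bicategory
-- Action cells of glued families at the unit object
section UnitRaw
open Bicategory
variable {M : Type uM} [Bicategory.{wM, vM} M] [Bicategory.Strict M]

attribute [local simp] leftUnitor_hom leftUnitor_inv rightUnitor_hom rightUnitor_inv associator_hom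
  associator_inv

variable {W W' Y Y' E Z : M}

theorem paste_left {l : W ⟶ E} {x y : W ⟶ W} {x' y' : E ⟶ E} {q b : Z ⟶ Z} {f f' : E ⟶ Z} {i : f ⟶ f'}
    (hx' : x' = 𝟙 E) {tl : x ≫ l ≫ y' ≅ y ≫ l ≫ x'} {T : x' ≫ f ≫ q ≅ y' ≫ f ≫ b}
    {S : x' ≫ f' ≫ q ≅ y' ≫ f' ≫ b} (h : (x' ◁ i ▷ q) ≫ S.hom = T.hom ≫ (y' ◁ i ▷ b)) :
    (x ◁ (l ◁ i) ▷ q) ≫ (Equivariant.pasteIso hx' tl.symm S.symm).symm.hom =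
      (Equivariant.pasteIso hx' tl.symm T.symm).symm.hom ≫ (y ◁ (l ◁ i) ▷ b) := by
  subst hx'
  have h₁ := congrArg (fun z => x ◁ l ◁ z) h
  have h₂ := whisker_exchange tl.hom (i ▷ b)
  simp at h₁ h₂
  rw [eqToHom_comp_iff] at h₁ h₂
  simp only [← Category.assoc] at h₂
  rw [comp_eqToHom_iff] at h₂
  simp only [Category.assoc, eqToHom_trans, eqToHom_trans_assoc] at h₁ h₂
  simp [Equivariant.pasteIso, reassoc_of% h₁, reassoc_of% h₂]

/-- The square for `σ` followed by the square for `κ`; the action cell of `l` enters through the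
comparison in the first and is interchanged with `κ'`. -/
theorem oneIso_restr {l : W ⟶ E} {x y : W ⟶ W} {x' y' : E ⟶ E} {q b : Z ⟶ Z} {h hu : E ⟶ Z}
    {k ku : W ⟶ Z} {θ : l ≫ h ≅ k} {θu : l ≫ hu ≅ ku} {σ' : x' ≫ h ≅ y' ≫ hu} {κ' : hu ≫ q ≅ h ≫ b}
    {σ : x ≫ k ≅ y ≫ ku} {κ : ku ≫ q ≅ k ≫ b} (hx : x = 𝟙 W) (hx' : x' = 𝟙 E) {na : l ≫ x' ≅ x ≫ l}
    {ea} (hna : na.hom = eqToHom ea) {tl : x ≫ l ≫ y' ≅ y ≫ l ≫ x'}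
    (hσ : CSq (pushIso na θ) (pushIso (passIso hx hx' tl) θu) (l ◁ σ'.hom) σ.hom)
    (hκ : CSq (gluePush θu q) (gluePush θ b) (l ◁ κ'.hom) κ.hom) :
    (x ◁ θ.hom ▷ q) ≫ (oneIso σ κ).hom =
      (Equivariant.pasteIso hx' tl.symm (oneIso σ' κ').symm).symm.hom ≫ (y ◁ θ.hom ▷ b) := by
  subst hx hx'
  have h₁ := congrArg (· ▷ q) hσ
  have h₂ := congrArg (y ◁ ·) hκ
  have h₃ := whisker_exchange tl.hom κ'.hom
  simp [pushIso, cellPush, gluePush, passIso, hna] at h₁ h₂ h₃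
  replace h₁ := h₁.symm
  rw [eqToHom_comp_iff] at h₁ h₃
  simp only [← Category.assoc] at h₃
  rw [comp_eqToHom_iff] at h₃
  simp only [Category.assoc, eqToHom_trans, eqToHom_trans_assoc] at h₁ h₂ h₃
  simp [Equivariant.pasteIso, oneIso]
  rw [reassoc_of% h₃]
  simp only [Category.assoc, eqToHom_trans, eqToHom_trans_assoc, eqToHom_refl, Category.id_comp]
  rw [h₂, reassoc_of% h₁]
  simp

theorem oneIso_pair' {α : W ⟶ Y} {γ : Y ⟶ Z} {x y : W ⟶ W} {q b : Z ⟶ Z} {pu a₁ au : Y ⟶ Y}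
    (hpu : pu = 𝟙 Y) (ha₁ : a₁ = 𝟙 Y) {hk : au = au ≫ a₁} {hk' : au = a₁ ≫ au}
    {tα : x ≫ α ≫ pu ≅ y ≫ α ≫ au} {tγ : au ≫ γ ≫ q ≅ pu ≫ γ ≫ b} (e : α ≫ a₁ ≫ γ = α ≫ γ) :
    (x ◁ eqToHom e ▷ q) ≫ (Equivariant.pasteIso hpu tα tγ).hom =
      (oneIso (pairSig hpu hk tα) (pairKap hpu hk' tγ)).hom ≫ (y ◁ eqToHom e ▷ b) := by
  subst hpu ha₁
  simp only [Category.assoc, eqToHom_trans, eqToHom_trans_assoc, eqToHom_refl, Category.id_comp,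
    Category.comp_id, Bicategory.whiskerLeft_comp, Bicategory.comp_whiskerRight, whiskerLeft_eqToHom,
    Bicategory.whiskerLeft_id, Bicategory.id_whiskerRight, eqToHom_whiskerRight,
    Bicategory.comp_whiskerLeft, Bicategory.whiskerRight_comp, Bicategory.whisker_assoc,
    Bicategory.id_whiskerLeft, Bicategory.whiskerRight_id, leftUnitor_hom, leftUnitor_inv,
    associator_hom, associator_inv, rightUnitor_hom, rightUnitor_inv, Iso.trans_hom, Iso.symm_hom,
    eqToIso.hom, whiskerLeftIso_hom, whiskerRightIso_hom, oneIso, pairSig, pairKap,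
    Equivariant.pasteIso]

/-- The composite `w ≫ α' ≫ γ' ≅ α ≫ v ≫ γ' ≅ α ≫ γ`. -/
def pairIso {w : W ⟶ W'} {α : W ⟶ Y} {α' : W' ⟶ Y'} {v : Y ⟶ Y'} {γ : Y ⟶ Z} {γ' : Y' ⟶ Z}
    (p : w ≫ α' ≅ α ≫ v) (q : v ≫ γ' ≅ γ) : w ≫ α' ≫ γ' ≅ α ≫ γ :=
  (α_ _ _ _).symm ≪≫ whiskerRightIso p γ' ≪≫ α_ _ _ _ ≪≫ whiskerLeftIso α q

theorem pairGlue_one {w : W ⟶ W'} {α : W ⟶ Y} {α' : W' ⟶ Y'} {v : Y ⟶ Y'} {γ : Y ⟶ Z} {γ' : Y' ⟶ Z}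
    {p : w ≫ α' ≅ α ≫ v} {q : v ≫ γ' ≅ γ} {a' : Y' ⟶ Y'} {a : Y ⟶ Y} (ha : a = 𝟙 Y) (ha' : a' = 𝟙 Y')
    {n : v ≫ a' ≅ a ≫ v} {e} (hn : n.hom = eqToHom e) (e₁ : α' ≫ a' ≫ γ' = α' ≫ γ')
    (e₂ : α ≫ a ≫ γ = α ≫ γ) :
    (w ◁ eqToHom e₁) ≫ (pairIso p q).hom = (pairGlue p n q).hom ≫ eqToHom e₂ := by
  subst ha ha'
  simp only [Category.assoc, eqToHom_trans, eqToHom_trans_assoc, eqToHom_refl, Category.id_comp,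
    Category.comp_id, Bicategory.whiskerLeft_comp, Bicategory.comp_whiskerRight, whiskerLeft_eqToHom,
    Bicategory.whiskerLeft_id, Bicategory.id_whiskerRight, eqToHom_whiskerRight,
    Bicategory.comp_whiskerLeft, Bicategory.whiskerRight_comp, Bicategory.whisker_assoc,
    Bicategory.id_whiskerLeft, Bicategory.whiskerRight_id, leftUnitor_hom, leftUnitor_inv,
    associator_hom, associator_inv, rightUnitor_hom, rightUnitor_inv, Iso.trans_hom, Iso.symm_hom,
    eqToIso.hom, whiskerLeftIso_hom, whiskerRightIso_hom, pairIso, pairGlue, hn]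

/-- Prefixing a 2-cell on `E` preserves compatibility with the gluing cells, by interchange. -/
theorem gluePush_unit {w : W ⟶ W'} {l' : W' ⟶ E} {l : W ⟶ E} {g : w ≫ l' ≅ l} {k k' : E ⟶ Z}
    (i : k ≅ k') {H' H'' : W' ⟶ Z} {H H₁ : W ⟶ Z} {θ' : l' ≫ k' ≅ H'} {θ : l ≫ k' ≅ H}
    {d : w ≫ H' ≅ H} {d₁ : w ≫ H'' ≅ H₁} (hθ : (gluePush g k').hom ≫ θ.hom = (w ◁ θ'.hom) ≫ d.hom)
    {e' : H' = H''} {e : H = H₁} (hd : (w ◁ eqToHom e') ≫ d₁.hom = d.hom ≫ eqToHom e) :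
    (gluePush g k).hom ≫ (whiskerLeftIso l i ≪≫ θ ≪≫ eqToIso e).hom =
      (w ◁ (whiskerLeftIso l' i ≪≫ θ' ≪≫ eqToIso e').hom) ≫ d₁.hom := by
  subst e e'
  simp only [eqToHom_refl, Bicategory.whiskerLeft_id, Category.id_comp, Category.comp_id] at hd
  rw [hd]
  have h := whisker_exchange g.hom i.hom
  simp [gluePush] at h hθ
  rw [eqToHom_comp_iff] at hθ h
  simp [gluePush]
  rw [← reassoc_of% h, hθ]
  simp

end UnitRaw

open Bicategory
-- Extending glued composites along the unit of the coinvariants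
section PairExtension
open Bicategory Equivariant
variable {V : Type uV} [Category.{vV} V] [MonoidalCategory V] [SymmetricCategory V]
variable {I : Type uI} [Category.{wI} I] [MonoidalCategory I] [EnrichedOrdinaryCategory V I]
  [MonoidalEnriched V I]
variable {M : Type uM} [Bicategory.{wM, vM} M] [Bicategory.Strict M]
  [∀ A B : M, EnrichedOrdinaryCategory V (A ⟶ B)] [VCatCategory V M]
variable [StrictMonoidal I] {s : Side} {W X B E O : IObj V I M}

theorem movCell_one {Y Y' : IObj V I M} (hY : IsTrivial (s.passive Y))
    (hY' : IsTrivial (s.passive Y')) (v : Equivariant Y Y') : (movCell hY hY' v (e[I])).hom =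
      eqToHom (by rw [s.active_one, s.active_one, Strict.comp_id, Strict.id_comp]) :=
  passIso_one (inv_eq_eqToHom (v.ts_one (s := s))) _

theorem Mid.Restr.oneTs {hW : IsTrivial (s.active W)} {hE : IsTrivial (s.active E)}
    {f : Equivariant W E} {m : Mid s E B} {m' : Mid s W B} {θ : ∀ i, f.hom ≫ m.H.obj i ≅ m'.H.obj i}
    (h : m.Restr hW hE f m' θ) (u : I) :
    ((s.active W).obj u ◁ (θ (e[I])).hom ▷ (s.passive B).obj u) ≫ (m'.oneTs u).hom =
      (pasteIso (hE.obj_eq u) (f.ts s u).symm (m.oneTs u).symm).symm.hom ≫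
        ((s.passive W).obj u ◁ (θ (e[I])).hom ▷ (s.active B).obj u) :=
  oneIso_restr (hW.obj_eq u) (hE.obj_eq u) (actCell_one hW hE f u) (h.sig _ u u (s.one_mul u))
    (h.kap u _ u (s.mul_one u))

/-- At the unit object `act` is an identity, so the family takes the value `α ≫ γ`, and `σ` followed
by `κ` is the pasting that defines composition. -/
theorem Mid.ofPair_oneTs {Y : IObj V I M} (hY : IsTrivial (s.passive Y)) (α : Equivariant W Y)
    (γ : Equivariant Y B) (e : (Mid.ofPair s α γ hY).H.obj (e[I]) = α.hom ≫ γ.hom) (u : I) :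
    ((s.active W).obj u ◁ eqToHom e ▷ (s.passive B).obj u) ≫ ((comp α γ).ts s u).hom =
      ((Mid.ofPair s α γ hY).oneTs u).hom ≫
        ((s.passive W).obj u ◁ eqToHom e ▷ (s.active B).obj u) := by
  refine (congrArg (_ ≫ Iso.hom ·) (comp_ts s α γ hY u)).trans ?_
  exact oneIso_pair' (hY.obj_eq u) (s.active_one Y) (hk := by rw [s.active_one, Strict.comp_id])
    (hk' := by rw [s.active_one, Strict.id_comp]) e

/-- Compatible composites `α n ≫ γ n : W n → Y n → B` through objects `Y n` with trivial passive
side extend along the unit of the coinvariants of the colimit. -/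
theorem ColimSeq.exists_pair_extension (hV : ForgetFaithful.{uV, vV, uI, vM} V) (L : ColimSeq s E)
    {c : Coin s E O} {η : Equivariant E O} (hc : c.IsUnit η) {Y : ℕ → IObj V I M}
    (hY : ∀ n, IsTrivial (s.passive (Y n))) {α : ∀ n, Equivariant (L.W n) (Y n)}
    {γ : ∀ n, Equivariant (Y n) B} {v : ∀ n, Equivariant (Y n) (Y (n + 1))}
    {p : ∀ n, (L.w n).hom ≫ (α (n + 1)).hom ≅ (α n).hom ≫ (v n).hom}
    (hp : ∀ n, IsIso₂ (comp (L.w n) (α (n + 1))) (comp (α n) (v n)) (p n))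
    {q : ∀ n, (v n).hom ≫ (γ (n + 1)).hom ≅ (γ n).hom}
    (hq : ∀ n, IsIso₂ (comp (v n) (γ (n + 1))) (γ n) (q n)) :
    ∃ (k : Equivariant O B) (ω : ∀ n, (L.leg n).hom ≫ η.hom ≫ k.hom ≅ (α n).hom ≫ (γ n).hom),
      (∀ n, IsIso₂ (comp (L.leg n) (comp η k)) (comp (α n) (γ n)) (ω n)) ∧
      L.Compat ω fun n => pairIso (p n) (q n) := by
  -- Whole families are glued, not only their values at `1`: an extension to the coinvariants needs
  -- the values at all `i` with their cells.
  obtain ⟨m, θ, hθ, hm⟩ := L.exists_mid hV (fun n => Mid.ofPair s (α n) (γ n) (hY n))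
    (fun i n => pairGlue (p n) (movCell (hY n) (hY (n + 1)) (v n) i) (q n))
    fun n => Mid.ofPair_restr (L.trivial n) (L.trivial (n + 1)) (hY n) (hY (n + 1)) (hp n) (hq n)
  obtain ⟨k, i, hi⟩ := hc.exists_extension hV m
  have e : ∀ n, (Mid.ofPair s (α n) (γ n) (hY n)).H.obj (e[I]) = (α n).hom ≫ (γ n).hom := by
    intro n
    change (α n).hom ≫ (s.active (Y n)).obj (e[I]) ≫ (γ n).hom = _
    rw [s.active_one, Strict.id_comp]
  refine ⟨k, fun n => whiskerLeftIso (L.leg n).hom i ≪≫ θ (e[I]) n ≪≫ eqToIso (e n),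
    fun n => (isIso₂_iff s).2 fun u => ?_, fun n => ?_⟩
  · rw [IsIso₂.comp_ts' s (L.leg n) (comp η k) L.trivial' u]
    exact cell_trans (paste_left (L.trivial'.obj_eq u) (hi u))
      (cell_trans ((hm n).oneTs u) (Mid.ofPair_oneTs (hY n) (α n) (γ n) (e n) u))
  · exact gluePush_unit i (hθ (e[I]) n) (pairGlue_one (s.active_one (Y n)) (s.active_one (Y (n + 1)))
      (movCell_one (hY n) (hY (n + 1)) (v n)) (e (n + 1)) (e n))

end PairExtension

open Bicategory
-- Testing equivariance on the legs
section Legs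
open Bicategory Equivariant
variable {V : Type uV} [Category.{vV} V] [MonoidalCategory V] [SymmetricCategory V]
variable {I : Type uI} [Category.{wI} I] [MonoidalCategory I] [EnrichedOrdinaryCategory V I]
  [MonoidalEnriched V I]
variable {M : Type uM} [Bicategory.{wM, vM} M] [Bicategory.Strict M]
  [∀ A B : M, EnrichedOrdinaryCategory V (A ⟶ B)] [VCatCategory V M]
variable {s : Side} {B E : IObj V I M}

/-- Families of 2-cells are equivariant if they are so on a jointly faithful family of equivariant
morphisms between actions that are trivial on the same side. -/
theorem IsFam.of_jointlyFaithful {J : Type*} {W : J → IObj V I M} {e : ∀ j, Equivariant (W j) E}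
    (he : JointlyFaithful V fun j => (e j).hom) (hW : ∀ j, IsTrivial (s.passive (W j)))
    (hE : IsTrivial (s.passive E)) {g g' : Equivariant E B} {T : V} {t : T ⟶ (g.hom ⟶[V] g'.hom)}
    (ht : ∀ j, IsFam (comp (e j) g) (comp (e j) g') (famWhiskerLeft (e j).hom t)) : IsFam g g' t := by
  refine (isFam_iff s _ _ _).2 fun u => he.vsquare fun j => ?_
  have raw : ∀ {A C D : M} {r : A ⟶ A} {f : A ⟶ C} {x y : C ⟶ D} (i : x ≅ y) (_ : r = 𝟙 A)
      (h : f ≫ x = (r ≫ f) ≫ x) (h' : (r ≫ f) ≫ y = f ≫ y),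
      (eqToIso h ≪≫ whiskerLeftIso (r ≫ f) i ≪≫ eqToIso h').hom = (whiskerLeftIso f i).hom := by
    intro A C D r f x y i hr h h'
    subst hr
    simp [leftUnitor_hom, leftUnitor_inv, associator_hom, associator_inv]
  have hr : (s.passive (W j)).obj u ≫ (e j).hom = (e j).hom := by
    rw [(hW j).obj_eq, Strict.id_comp]
  -- The square for `comp (e j) g` is the pasting from `IsFam.comp_left`. Its pieces other than the
  -- one for `g` commute in any case; cancelling them leaves the square for `g` whiskered with `pas
  -- u ≫ e j`, and `pas u` is an identity on `W j`.
  have h := ((isFam_iff s _ _ _).1 (ht j) u).congr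
    (σ₁ := pasteIso (hE.obj_eq u) ((e j).ts s u) (g.ts s u))
    (σ₁' := pasteIso (hE.obj_eq u) ((e j).ts s u) (g'.ts s u))
    (congrArg Iso.hom (comp_ts s (e j) g hE u)) (congrArg Iso.hom (comp_ts s (e j) g' hE u))
  have h₁ := VSquare.of_trans h (FEq.vsquare (t' := famWhiskerLeft (_ ≫ (e j).hom ≫ (s.passive E).obj u)
      (famWhiskerRight t _)) (((FEq.assocM _ _ _).left rfl).trans <| (FEq.assocL _ _ _).symm.trans <|
      FEq.left (by rw [hE.obj_eq, Strict.comp_id]) (FEq.rfl' _)) _ _)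
  have h₂ := VSquare.of_trans h₁ (VSquare.exchangeLeft ((e j).ts s u) _)
  have h₃ := VSquare.of_trans h₂ (FEq.vsquare (t' := famWhiskerLeft (_ ≫ (e j).hom)
    (famWhiskerLeft _ (famWhiskerRight t _)))
    (((FEq.left (Strict.assoc _ _ _).symm (FEq.rfl' _))).trans (FEq.assocL _ _ _)) _ _)
  have h₄ := VSquare.of_trans' h₃ (FEq.vsquare (t := famWhiskerLeft (_ ≫ (e j).hom)
    (famWhiskerLeft ((s.passive E).obj u) (famWhiskerRight t ((s.active B).obj u))))
    ((FEq.left rfl (FEq.left (hE.obj_eq u) (FEq.rfl' _))).trans <|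
      (FEq.left rfl (FEq.unitL _)).trans <| (FEq.assocL _ _ _).trans
        (FEq.left rfl (FEq.assocM _ _ _).symm)) _ _)
  exact ((((FEq.rfl' _).left hr.symm).vsquare (by rw [hr]) (by rw [hr])).trans
    (h₄.trans (((FEq.rfl' _).left hr).vsquare (by rw [hr]) (by rw [hr])))).congr
    (raw _ ((hW j).obj_eq u) _ _) (raw _ ((hW j).obj_eq u) _ _)

variable (L : ColimSeq s E)

/-- The objects of the sequence have trivial `s.active`, which is the passive action for the other
side; equivariance may be expressed with either side. -/
theorem ColimSeq.isFam {g g' : Equivariant E B} {T : V} {t : T ⟶ (g.hom ⟶[V] g'.hom)}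
    (ht : ∀ n, IsFam (comp (L.leg n) g) (comp (L.leg n) g') (famWhiskerLeft (L.leg n).hom t)) :
    IsFam g g' t := by
  have hW := L.trivial
  have hE := L.trivial'
  cases s
  · exact IsFam.of_jointlyFaithful (s := .r) L.faithful hW hE ht
  · exact IsFam.of_jointlyFaithful (s := .l) L.faithful hW hE ht

end Legs

open Bicategory
-- The first leg is local if the sequence is
section LegLocal
open Bicategory Equivariant
variable {V : Type uV} [Category.{vV} V] [MonoidalCategory V] [SymmetricCategory V]
variable {I : Type uI} [Category.{wI} I] [MonoidalCategory I] [EnrichedOrdinaryCategory V I]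
  [MonoidalEnriched V I]
variable {M : Type uM} [Bicategory.{wM, vM} M] [Bicategory.Strict M]
  [∀ A B : M, EnrichedOrdinaryCategory V (A ⟶ B)] [VCatCategory V M]
variable {s : Side} {B E O : IObj V I M}

namespace ColimSeq
variable (L : ColimSeq s E)

theorem isIso₂_gluePush (g : Equivariant E B) (n : ℕ) :
    IsIso₂ (comp (L.w n) (comp (L.leg (n + 1)) g)) (comp (L.leg n) g)
      (gluePush (L.glue n) g.hom) := by
  have h := (IsIso₂.assoc (L.w n) (L.leg (n + 1)) g).symm.trans ((L.isIso₂ n).comp_right g)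
  refine (congrArg (fun z => IsIso₂ _ _ z) (Iso.ext ?_)).mp h
  simp only [gluePush, Iso.trans_hom, Iso.symm_hom, eqToIso.inv, associator_inv]
  rfl

theorem vsquare_gluePush {g g' : Equivariant E B} {T : V} (t : T ⟶ (g.hom ⟶[V] g'.hom)) (n : ℕ) :
    VSquare (gluePush (L.glue n) g.hom) (gluePush (L.glue n) g'.hom)
      (famWhiskerLeft (L.w n).hom (famWhiskerLeft (L.leg (n + 1)).hom t))
      (famWhiskerLeft (L.leg n).hom t) :=
  (VSquare.assocL _ _ t).symm.trans (VSquare.exchangeLeft (L.glue n) t)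

/-- The gluing cell identifies a family on leg `n` with one on `w n` followed by leg `n + 1`, to
which the locality of `w n` applies. -/
theorem existsUnique_step {n : ℕ} (hw : IsLocal (L.w n) B) {g g' : Equivariant E B} {T : V}
    {x : T ⟶ (((L.leg n).hom ≫ g.hom) ⟶[V] ((L.leg n).hom ≫ g'.hom))}
    (hx : IsFam (comp (L.leg n) g) (comp (L.leg n) g') x) :
    ∃! y : T ⟶ (((L.leg (n + 1)).hom ≫ g.hom) ⟶[V] ((L.leg (n + 1)).hom ≫ g'.hom)),
      IsFam (comp (L.leg (n + 1)) g) (comp (L.leg (n + 1)) g') y ∧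
      VSquare (gluePush (L.glue n) g.hom) (gluePush (L.glue n) g'.hom)
        (famWhiskerLeft (L.w n).hom y) x := by
  have h := VSquare.conj' (gluePush (L.glue n) g.hom) (gluePush (L.glue n) g'.hom) x
  obtain ⟨y, ⟨hy, e⟩, u⟩ := hw.fully_faithful _ _ T _
    (hx.conj (L.isIso₂_gluePush g n).symm (L.isIso₂_gluePush g' n).symm h.symm)
  exact ⟨y, ⟨hy, e.symm ▸ h⟩, fun y' hy' => u y' ⟨hy'.1, hy'.2.unique' h⟩⟩

/-- A family on the first leg spreads uniquely over all legs by `existsUnique_step`. The compatible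
families glue by the weak colimit, and equivariance of the result is tested on the legs. -/
theorem leg_fully_faithful (hw : ∀ n, IsLocal (L.w n) B) {g g' : Equivariant E B} {T : V}
    {x : T ⟶ (((L.leg 0).hom ≫ g.hom) ⟶[V] ((L.leg 0).hom ≫ g'.hom))}
    (hx : IsFam (comp (L.leg 0) g) (comp (L.leg 0) g') x) :
    ∃! t : T ⟶ (g.hom ⟶[V] g'.hom), IsFam g g' t ∧ famWhiskerLeft (L.leg 0).hom t = x := by
  let F : ℕ → Type _ := fun n =>
    { x : T ⟶ (((L.leg n).hom ≫ g.hom) ⟶[V] ((L.leg n).hom ≫ g'.hom)) //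
      IsFam (comp (L.leg n) g) (comp (L.leg n) g') x }
  -- Equivariance is carried along in the recursion, as the next step depends on it.
  let y : ∀ n, F n := fun n => Nat.rec (motive := F) ⟨x, hx⟩ (fun n z =>
    ⟨(L.existsUnique_step (hw n) z.2).choose, (L.existsUnique_step (hw n) z.2).choose_spec.1.1⟩) n
  have hy : ∀ n, VSquare (gluePush (L.glue n) g.hom) (gluePush (L.glue n) g'.hom)
      (famWhiskerLeft (L.w n).hom (y (n + 1)).1) (y n).1 := fun n =>
    (L.existsUnique_step (hw n) (y n).2).choose_spec.1.2
  obtain ⟨t, ht, -⟩ := L.universal.fully_faithful g.hom g'.hom T (fun n => (y n).1) hy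
  refine ⟨t, ⟨L.isFam fun n => ?_, ht 0⟩, fun t' ht' => L.faithful fun n => ?_⟩
  · have := (y n).2
    rw [← ht n] at this
    exact this
  · rw [ht n]
    induction n with
    | zero => exact ht'.2
    | succ n ih =>
      refine (L.existsUnique_step (hw n) (y n).2).unique ⟨ht'.1.comp_left _, ?_⟩ ⟨(y (n + 1)).2, hy n⟩
      have := L.vsquare_gluePush t' n
      rw [ih] at this
      exact this

/-- The extensions of `f` to all stages must be glued to an equivariant morphism on `E`. Instead of
gluing action cells directly, the families `fs n ≫ act i` are extended to the coinvariants of `E`,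
and the extension is restricted along `η`. -/
theorem leg_ess_surj [StrictMonoidal I] (hV : ForgetFaithful.{uV, vV, uI, vM} V) {c : Coin s E O}
    {η : Equivariant E O} (hc : c.IsUnit η) (hB : IsTrivial (s.passive B))
    (hw : ∀ n, IsLocal (L.w n) B) (f : Equivariant (L.W 0) B) :
    ∃ (g : Equivariant E B) (i : (L.leg 0).hom ≫ g.hom ≅ f.hom), IsIso₂ (comp (L.leg 0) g) f i := by
  choose F j hj using fun n => (hw n).ess_surj
  let fs : ∀ n, Equivariant (L.W n) B := fun n =>
    Nat.rec (motive := fun n => Equivariant (L.W n) B) f F n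
  have hid := IsIso₂.id_comp (Equivariant.id B)
  -- The middle object is `B` at every stage, with identities as rungs and second factors; this is
  -- where `B` must have trivial passive side.
  obtain ⟨k, ω, hω, -⟩ := L.exists_pair_extension hV hc (fun _ => hB) (α := fs)
    (γ := fun _ => Equivariant.id B) (v := fun _ => Equivariant.id B)
    (fun n => (hj n (fs n)).trans (IsIso₂.comp_id (fs n)).symm) (fun _ => hid)
  exact ⟨comp η k, _, (hω 0).trans (IsIso₂.comp_id f)⟩

/-- The first structure morphism of the colimit is local if the morphisms of the sequence are. -/
theorem isLocal_leg [StrictMonoidal I] (hV : ForgetFaithful.{uV, vV, uI, vM} V) {c : Coin s E O}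
    {η : Equivariant E O} (hc : c.IsUnit η) (hB : IsTrivial (s.passive B))
    (hw : ∀ n, IsLocal (L.w n) B) : IsLocal (L.leg 0) B :=
  ⟨L.leg_ess_surj hV hc hB hw, fun _ _ _ _ hs => L.leg_fully_faithful hw hs⟩

end ColimSeq
end LegLocal

open Bicategory
-- Stability of the colimit
section Stable
open Bicategory Equivariant
variable {V : Type uV} [Category.{vV} V] [MonoidalCategory V] [SymmetricCategory V]
variable {I : Type uI} [Category.{wI} I] [MonoidalCategory I] [EnrichedOrdinaryCategory V I]
  [MonoidalEnriched V I]
variable {M : Type uM} [Bicategory.{wM, vM} M] [Bicategory.Strict M]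
  [∀ A B : M, EnrichedOrdinaryCategory V (A ⟶ B)] [VCatCategory V M]
variable {s : Side} {W W' W'' Y Y' B E O : IObj V I M}

attribute [local simp] leftUnitor_hom leftUnitor_inv rightUnitor_hom rightUnitor_inv associator_hom
  associator_inv

theorem IsIso₂.assoc_of_eq {w : Equivariant W W'} {a : Equivariant W Y} {z : Equivariant Y W'}
    (hw : w = comp a z) (f : Equivariant W' B) {e} :
    IsIso₂ (comp w f) (comp a (comp z f)) (eqToIso e) := by
  subst hw
  exact IsIso₂.assoc a z f

/-- The isomorphisms from `a ≫ z ≫ l'` to `l` respect the two kinds of transition cells, so that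
they may be glued: up to strict associativity both composites are the gluing cell `g'` followed by
`g`. -/
theorem pairIso_glue {A A' A'' C C' D : M} {w : A ⟶ A'} {w' : A' ⟶ A''} {a : A ⟶ C} {z : C ⟶ A'}
    {a' : A' ⟶ C'} {z' : C' ⟶ A''} {l : A ⟶ D} {l' : A' ⟶ D} {l'' : A'' ⟶ D} {g : w ≫ l' ≅ l}
    {g' : w' ≫ l'' ≅ l'} (hw : w = a ≫ z) (hw' : w' = a' ≫ z') (e₁ : w ≫ a' = a ≫ z ≫ a')
    (e₂ : (z ≫ a') ≫ z' ≫ l'' = z ≫ a' ≫ z' ≫ l'') (e₃ : a' ≫ z' ≫ l'' = w' ≫ l'')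
    (e₄ : a ≫ z ≫ l' = w ≫ l') :
    CSq (pairIso (eqToIso e₁) (eqToIso e₂ ≪≫ whiskerLeftIso z (eqToIso e₃ ≪≫ g'))) g
      (w ◁ (eqToIso e₃ ≪≫ g').hom) (eqToIso e₄ ≪≫ g).hom := by
  subst hw hw'
  simp [CSq, pairIso]

/-- If each morphism of the sequence factors through an action with trivial passive side, then the unit
of the coinvariants of the colimit is an equivalence. -/
theorem ColimSeq.equivalent [StrictMonoidal I] (hV : ForgetFaithful.{uV, vV, uI, vM} V)
    (L : ColimSeq s E) {c : Coin s E O} {η : Equivariant E O} (hc : c.IsUnit η) {Y : ℕ → IObj V I M}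
    (hY : ∀ n, IsTrivial (s.passive (Y n))) (a : ∀ n, Equivariant (L.W n) (Y n))
    (z : ∀ n, Equivariant (Y n) (L.W (n + 1))) (hw : ∀ n, L.w n = comp (a n) (z n)) :
    Equivalent E O := by
  have hom : ∀ n, (L.w n).hom = (a n).hom ≫ (z n).hom := fun n => congrArg Equivariant.hom (hw n)
  have e₁ : ∀ n, (L.w n).hom ≫ (a (n + 1)).hom = (a n).hom ≫ (z n).hom ≫ (a (n + 1)).hom := fun n => by
    rw [hom, Strict.assoc]
  have e₂ : ∀ n, ((z n).hom ≫ (a (n + 1)).hom) ≫ (z (n + 1)).hom ≫ (L.leg (n + 2)).hom =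
      (z n).hom ≫ (a (n + 1)).hom ≫ (z (n + 1)).hom ≫ (L.leg (n + 2)).hom := fun n =>
    Strict.assoc _ _ _
  have e₃ : ∀ n, (a n).hom ≫ (z n).hom ≫ (L.leg (n + 1)).hom =
      (L.w n).hom ≫ (L.leg (n + 1)).hom := fun n => by
    rw [hom, Strict.assoc]
  have hS : ∀ n, IsIso₂ (comp (a n) (comp (z n) (L.leg (n + 1)))) (L.leg n)
      (eqToIso (e₃ n) ≪≫ L.glue n) := fun n =>
    (IsIso₂.assoc_of_eq (hw n) (L.leg (n + 1)) (e := (e₃ n).symm)).symm.trans (L.isIso₂ n)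
  -- The leg at `n` is factored as `a n : W n → Y n` followed by `z n` and the leg at `n + 1`; the
  -- ladder between consecutive factorizations has the rungs `z n ≫ a (n + 1)`.
  obtain ⟨k, ω, hω, hc'⟩ := L.exists_pair_extension hV hc hY (α := a)
    (γ := fun n => comp (z n) (L.leg (n + 1))) (v := fun n => comp (z n) (a (n + 1)))
    (p := fun n => eqToIso (e₁ n)) (fun n => IsIso₂.assoc_of_eq (hw n) (a (n + 1)))
    (q := fun n => eqToIso (e₂ n) ≪≫ whiskerLeftIso (z n).hom
      (eqToIso (e₃ (n + 1)) ≪≫ L.glue (n + 1)))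
    (fun n => (IsIso₂.assoc _ _ _).trans ((hS (n + 1)).comp_left (z n)))
  have hb : L.Compat (p := 𝟙 E.carrier) (fun n => eqToIso (Strict.comp_id (L.leg n).hom)) L.glue :=
    fun n => by simp [gluePush]
  -- On each leg `η ≫ k` is isomorphic to the leg itself; gluing these isomorphisms gives `η ≫ k ≅
  -- 𝟙`.
  obtain ⟨ψ, hψ⟩ := ColimSeq.exists_iso hc' hb (fun n => eqToIso (e₃ n) ≪≫ L.glue n) fun n =>
    pairIso_glue (hom n) (hom (n + 1)) (e₁ n) (e₂ n) (e₃ (n + 1)) (e₃ n)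
  have hψ' : IsIso₂ (comp η k) (Equivariant.id E) ψ := by
    refine L.isFam fun n => ?_
    have h := ((hω n).trans (hS n)).trans (IsIso₂.comp_id (L.leg n)).symm
    have e : whiskerLeftIso (L.leg n).hom ψ =
        (ω n ≪≫ eqToIso (e₃ n) ≪≫ L.glue n) ≪≫ (eqToIso (Strict.comp_id (L.leg n).hom)).symm := by
      ext
      rw [Iso.trans_hom, Iso.symm_hom, Iso.eq_comp_inv]
      exact hψ n
    rw [famWhiskerLeft_eHomEquiv]
    exact (congrArg (IsIso₂ (comp (L.leg n) (comp η k)) (comp (L.leg n) (Equivariant.id E))) e).mpr h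
  -- For the other composite, `η ≫ (k ≫ η) ≅ η ≅ η ≫ 𝟙`, and `O` has trivial passive side, so the
  -- locality of `η` lifts this to `k ≫ η ≅ 𝟙`.
  obtain ⟨χ, hχ, -⟩ := (hc.isLocal hV c.trivial).exists_iso
    ((((IsIso₂.assoc η k η).symm.trans (hψ'.comp_right η)).trans (IsIso₂.id_comp η)).trans
      (IsIso₂.comp_id η).symm)
  exact ⟨η, k, hψ'.nonempty_iso, hχ.nonempty_iso⟩

end Stable

open Bicategory
-- The costabilization
section Costabilization
open Bicategory Equivariant
variable {V : Type uV} [Category.{vV} V] [MonoidalCategory V] [SymmetricCategory V]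
variable {I : Type uI} [Category.{wI} I] [MonoidalCategory I] [StrictMonoidal I]
  [EnrichedOrdinaryCategory V I] [MonoidalEnriched V I]
variable {M : Type uM} [Bicategory.{wM, vM} M] [Bicategory.Strict M]
  [∀ A B : M, EnrichedOrdinaryCategory V (A ⟶ B)] [VCatCategory V M]
variable {P : Copowering V I M} {X Y B : IObj V I M}

theorem Equivariant.Equivalent.symm (h : Equivalent X Y) : Equivalent Y X :=
  let ⟨f, g, hf, hg⟩ := h
  ⟨g, f, hg, hf⟩

theorem CoInv.isLocal_unit (hV : ForgetFaithful.{uV, vV, uI, vM} V) {s : Side} (c : CoInv P s X)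
    (hB : IsTrivial (s.passive B)) : IsLocal c.unit B :=
  (c.isUnit hV).isLocal hV hB

/-- A morphism that is local with respect to the actions with trivial `s.passive` is local with
respect to the stable ones. -/
theorem Equivariant.IsLocal.of_isStable {η : Equivariant X Y} (s : Side)
    (h : ∀ B : IObj V I M, IsTrivial (s.passive B) → IsLocal η B) (hB : IsStable B) :
    IsLocal η B := by
  -- A stable object either has the required trivial side itself or is equivalent to an object that
  -- has it.
  cases s
  · rcases hB with ⟨-, B', hB', e⟩ | ⟨hB, -⟩
    · exact (h B' hB').of_equivalent e
    · exact h B hB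
  · rcases hB with ⟨hB, -⟩ | ⟨-, B', hB', e⟩
    · exact h B hB
    · exact (h B' hB').of_equivalent e

namespace CoInvInfty
variable {coInv : ∀ (s : Side) (X : IObj V I M), CoInv P s X} {A : IObj V I M}

/-- The sequence of iterated coinvariants. -/
noncomputable def colimSeq (C : CoInvInfty coInv A) : ColimSeq .r C.obj where
  W := coInvSeq coInv A
  w := coInvMap coInv A
  leg := C.leg
  glue n := isoCell (C.glue n)
  isIso₂ n := IsIso₂.of_iso (C.glue n)
  trivial n := by
    cases n with
    | zero => exact (coInv .l A).trivial
    | succ n => exact (coInv .l _).trivial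
  trivial' := C.trivial
  universal := C.universal

/-- The partner of the opposite kind is `coInv_r` of the colimit itself. By construction the
morphisms of the sequence factor through the left actions `coInv_r (coInv^n A)`. -/
theorem isStable (hV : ForgetFaithful.{uV, vV, uI, vM} V) (C : CoInvInfty coInv A) :
    IsStable C.obj :=
  Or.inr ⟨C.trivial, _, (coInv .r C.obj).trivial,
    C.colimSeq.equivalent hV ((coInv .r C.obj).isUnit hV)
      (fun n => (coInv .r (coInvSeq coInv A n)).trivial) (fun n => (coInv .r (coInvSeq coInv A n)).ηr)
      (fun n => (coInv .l (coInv .r (coInvSeq coInv A n)).obj).ηl) fun _ => rfl⟩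

/-- Units of both kinds are local with respect to stable objects, hence so are the morphisms of the
sequence, the first leg, and its composite with `η_l`. -/
theorem isLocal (hV : ForgetFaithful.{uV, vV, uI, vM} V) (C : CoInvInfty coInv A)
    (hB : IsStable B) : IsLocal C.η B := by
  have hl : ∀ (X B : IObj V I M), IsStable B → IsLocal (coInv .l X).ηl B := fun X B hB =>
    IsLocal.of_isStable .l (fun B hB => (coInv .l X).isLocal_unit hV hB) hB
  have hr : ∀ (X B : IObj V I M), IsStable B → IsLocal (coInv .r X).ηr B := fun X B hB =>
    IsLocal.of_isStable .r (fun B hB => (coInv .r X).isLocal_unit hV hB) hB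
  have hw : ∀ B, IsStable B → ∀ n, IsLocal (C.colimSeq.w n) B := fun B hB n =>
    (hr _ B hB).comp (hl _ B hB)
  -- Gluing along the legs works for left actions only; a stable right action is replaced below by
  -- an equivalent left action, which is again stable.
  have leg : ∀ B, IsStable B → IsTrivial B.R → IsLocal (C.leg 0) B := fun B hB hR =>
    C.colimSeq.isLocal_leg hV ((coInv .r C.obj).isUnit hV) hR (hw B hB)
  refine (hl A B hB).comp ?_
  rcases hB with ⟨hR, h⟩ | ⟨hL, B', hR, e⟩
  · exact leg B (Or.inl ⟨hR, h⟩) hR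
  · exact (leg B' (Or.inl ⟨hR, _, hL, Equivalent.symm e⟩) hR).of_equivalent e

end CoInvInfty
end Costabilization
end CoStab

theorem mainTheorem3
    {V : Type uV} [Category.{vV} V] [MonoidalCategory V] [SymmetricCategory V]
    {I : Type uI} [Category.{wI} I] [MonoidalCategory I] [CoStab.StrictMonoidal I]
    [EnrichedOrdinaryCategory V I] [CoStab.MonoidalEnriched V I]
    {M : Type uM} [Bicategory.{wM, vM} M] [Bicategory.Strict M]
    [∀ A B : M, EnrichedOrdinaryCategory V (A ⟶ B)] [CoStab.VCatCategory V M]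
    (hV : CoStab.ForgetFaithful.{uV, vV, uI, vM} V)
    (P : CoStab.Copowering V I M)
    (coInv : ∀ (s : CoStab.Side) (X : CoStab.IObj V I M), CoStab.CoInv P s X)
    (A : CoStab.IObj V I M) (C : CoStab.CoInvInfty coInv A) :
    CoStab.IsCostabilization A C.obj C.η where
  stable := C.isStable hV
  ess_surj _ hB f :=
    let ⟨g, _, hi⟩ := (C.isLocal hV hB).ess_surj f
    ⟨g, hi.nonempty_iso⟩
  fully_faithful _ hB := (C.isLocal hV hB).fully_faithful
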